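/- Let $n\ge 2$. A dominant weight of $SU(n)$ is given by its Dynkin labels $\lambda=(\lambda_1,\dots,\lambda_{n-1})\in\mathbb Z_{\ge0}^{n-1}$; let $V_\lambda$ be the irreducible representation of $SU(n)$ with highest weight $\lambda$, $\chi_\lambda$ its character, $N_{\lambda\mu}^{\nu}$ the multiplicity of $V_\nu$ in $V_\lambda\otimes V_\mu$, and $\rho=(1,\dots,1)$. For $T=\mathrm{diag}(e^{i t_1},\dots,e^{i t_n})$ with $\sum_j t_j=0$ and distinct eigenvalues put $u_j=t_j-t_{j+1}$ and $$D_n=\sum_{p\in\mathbb Z^{n-1}}(-1)^{(n-1)\sum_j jp_j}\prod_{1\le i<i'\le n}\frac1{\sum_{k=i}^{i'-1}(u_k+2\pi p_k)},\qquad \widehat D_n=\sum_{p\in\mathbb Z^{n-1}}\prod_{1\le i<i'\le n}\frac1{\sum_{k=i}^{i'-1}(u_k+2\pi p_k)},$$ $$\varpi_n=\prod_{1\le i<i'\le n}2\sin\Big(\tfrac12\sum_{k=i}^{i'-1}u_k\Big),\qquad R_n(T)=D_n\varpi_n,\qquad \widehat R_n(T)=\widehat D_n\varpi_n,$$ where sums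 over $p\in\mathbb Z^{n-1}$ are limits of the sums over $[-N,N]^{n-1}$ as $N\to\infty$. There are unique finite expansions with real coefficients, valid for all such $T$, $R_n(T)=\sum_\kappa r_\kappa\chi_\kappa(T)$ and $\widehat R_n(T)=\sum_\kappa\hat r_\kappa\chi_\kappa(T)$. With $c^{(\nu)}_{\nu'}=\sum_\kappa N_{\kappa\nu}^{\nu'}r_\kappa$, and, for $\nu$ with all labels $\ge1$, $\hat c^{(\nu)}_{\nu'}=\sum_\kappa N_{\kappa\,\nu-\rho}^{\nu'}\hat r_\kappa$, one has $$\sum_\kappa r_\kappa\dim V_\kappa=1,\qquad \sum_\kappa\hat r_\kappa\dim V_\kappa=1;$$ for all dominant $\lambda,\mu$, $$\sum_{\nu,\nu'}N_{\lambda\mu}^{\nu'}\,c^{(\nu)}_{\nu'}\dim V_\nu=\dim V_\lambda\dim V_\mu;$$ and for all $\lambda,\mu$ with all Dynkin labels $\ge 1$, $$\sum_{\nu,\nu'}N_{\lambda-\rho\,\mu-\rho}^{\nu'}\,\hat c^{(\nu)}_{\nu'}\dim V_{\nu-\rho}=\dim V_{\lambda-\rho}\dim V_{\mu-\rho},$$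 the last sum being over the $\nu$ with all labels $\ge1$ and all dominant $\nu'$. As a consequence: for real vectors $\alpha,\beta,\gamma\in\mathbb R^n$ let $$\mathcal J_n(\alpha,\beta;\gamma)=\frac{i^{-n(n-1)/2}}{2^{n-1}\,n!\,\pi^{n-1}}\int_{\mathbb R^{n-1}}\frac{d^{n-1}u}{\prod_{i<i'}(u_i+\cdots+u_{i'-1})}\sum_{P,P',P''\in S_n}\varepsilon_P\varepsilon_{P'}\varepsilon_{P''}\prod_{j=1}^{n-1}e^{iu_jA_j(P,P',P'')},$$ $$A_j(P,P',P'')=\sum_{k=1}^j(\alpha_{P(k)}+\beta_{P'(k)}-\gamma_{P''(k)})-\frac jn\sum_{k=1}^n(\alpha_k+\beta_k-\gamma_k),$$ the integral being the limit of the integrals over $[-L,L]^{n-1}$ as $L\to\infty$. Let $\widetilde{\mathbf H}_{\alpha\beta}$ be the convex hull of the vectors $\gamma_1\ge\dots\ge\gamma_n$ that are the ordered spectrum of some $A+B$, where $A$ and $B$ are Hermitian with spectra $\alpha$ and $\beta$. Let $\Delta(x)=\prod_{i<j}(x_i-x_j)$. Then for all $\alpha,\beta\in\mathbb Z^n$ with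 strictly decreasing components, $$\int_{\widetilde{\mathbf H}_{\alpha\beta}}d\gamma_1\cdots d\gamma_{n-1}\,\mathcal J_n(\alpha,\beta;\gamma)\frac{\Delta(\gamma)}{\Delta(\alpha)\Delta(\beta)}=\sum_{\gamma\in\widetilde{\mathbf H}_{\alpha\beta}\cap\mathbb Z^n}\mathcal J_n(\alpha,\beta;\gamma)\frac{\Delta(\gamma)}{\Delta(\alpha)\Delta(\beta)}=\frac1{\prod_{p=1}^{n-1}p!},$$ where $\widetilde{\mathbf H}_{\alpha\beta}$ is parametrized by $\gamma_1,\dots,\gamma_{n-1}$, with $\gamma_n$ fixed by $\sum_k\gamma_k=\sum_k(\alpha_k+\beta_k)$. -/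

import Mathlib

open scoped BigOperators Topology
open Filter

noncomputable section

namespace HornLR

/-! ### Weights of `SU(n)` -/

/-- Dominant integral weights of `SU(n)`, given by their `n - 1` Dynkin labels.
The entry with index `k` is the label of the `(k+1)`-st fundamental weight. -/
abbrev Weight (n : ℕ) : Type := Fin (n - 1) → ℕ

/-- The weight lies off the walls of the dominant chamber, i.e. `κ - ρ` is dominant. -/
def OffWalls {n : ℕ} (κ : Weight n) : Prop := ∀ k, 1 ≤ κ k

/-- The weight `κ - ρ`, where all the Dynkin labels of `ρ` are `1`; it is used only for weights
off the walls, where the subtraction does not truncate. -/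
def subRho {n : ℕ} (κ : Weight n) : Weight n := fun k => κ k - 1

/-! ### Irreducible representations of `SU(n)`

`V_κ` is realized inside the space of functions on `SU(n)`, on which the group acts by right
translations: it is generated by the function `g ↦ ∏ₖ (k-th leading principal minor of g) ^ κₖ`.
That function is invariant under right translation by upper triangular unipotent matrices, and a
diagonal `x` multiplies it by `∏ₖ (x₁ ⋯ xₖ) ^ κₖ`: it is a highest weight vector of weight `κ`. -/

/-- The group `SU(n)`. -/
abbrev SU (n : ℕ) : Type := Matrix.specialUnitaryGroup (Fin n) ℂ

/-- The representation of a group on its complex functions by right translation: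
`(x • f) g = f (g * x)`. -/
def rightRegular (G : Type) [Group G] : Representation ℂ G (G → ℂ) where
  toFun x := LinearMap.funLeft ℂ ℂ (fun g => g * x)
  map_one' := by
    ext f g
    simp [LinearMap.funLeft_apply]
  map_mul' x y := by
    refine LinearMap.ext fun f => funext fun g => ?_
    simp [LinearMap.funLeft_apply, mul_assoc]

/-- The leading principal minor of size `k + 1`. -/
def leadingMinor {n : ℕ} (k : Fin (n - 1)) (A : Matrix (Fin n) (Fin n) ℂ) : ℂ :=
  (A.submatrix (Fin.castLE (show (k : ℕ) + 1 ≤ n by have := k.2; omega))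
    (Fin.castLE (show (k : ℕ) + 1 ≤ n by have := k.2; omega))).det

/-- The highest weight vector of weight `κ` among the functions on `SU(n)`. -/
def highestWeightVector {n : ℕ} (κ : Weight n) : SU n → ℂ :=
  fun g => ∏ k, leadingMinor k (g : Matrix (Fin n) (Fin n) ℂ) ^ κ k

/-- The space of the irreducible representation `V_κ` of `SU(n)`: the span of the translates of
the highest weight vector. -/
def irrepSpace {n : ℕ} (κ : Weight n) : Submodule ℂ (SU n → ℂ) :=
  Submodule.span ℂ (Set.range fun x : SU n => rightRegular (SU n) x (highestWeightVector κ))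

theorem irrepSpace_le_comap {n : ℕ} (κ : Weight n) (x : SU n) :
    irrepSpace κ ≤ (irrepSpace κ).comap (rightRegular (SU n) x) := by
  refine Submodule.span_le.mpr ?_
  rintro _ ⟨y, rfl⟩
  refine Submodule.subset_span ⟨x * y, ?_⟩
  simp only [map_mul]
  rfl

/-- The irreducible representation `V_κ` of `SU(n)` with highest weight `κ`. -/
def irrep {n : ℕ} (κ : Weight n) : Representation ℂ (SU n) (irrepSpace κ) :=
  (rightRegular (SU n)).subrepresentation (irrepSpace κ) (irrepSpace_le_comap κ)

/-- `dim V_κ`. -/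
def dimV {n : ℕ} (κ : Weight n) : ℕ := Module.finrank ℂ (irrepSpace κ)

/-- The character `χ_κ` of `V_κ`. -/
def chi {n : ℕ} (κ : Weight n) (g : SU n) : ℂ := (irrep κ).character g

/-- The Littlewood-Richardson coefficient `N_{κ μ}^ν`: the multiplicity of `V_ν` in
`V_κ ⊗ V_μ`, that is, the dimension of the space of intertwiners `V_ν → V_κ ⊗ V_μ`. -/
def lrCoeff {n : ℕ} (κ μ ν : Weight n) : ℕ :=
  Module.finrank ℂ (Representation.IntertwiningMap (irrep ν) ((irrep κ).tprod (irrep μ)))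

/-! ### The functions `R_n` and `R̂_n` -/

/-- `u_i + u_{i+1} + ⋯ + u_{i'-1}`. -/
def blockSum {n : ℕ} {M : Type} [AddCommMonoid M] (u : Fin (n - 1) → M) (i i' : Fin n) : M :=
  ∑ k : Fin (n - 1) with i.val ≤ k.val ∧ k.val < i'.val, u k

/-- `∏_{i < i'} (u_i + ⋯ + u_{i'-1})`, the Vandermonde product in terms of successive
differences. -/
def vanderTilde {n : ℕ} (u : Fin (n - 1) → ℝ) : ℝ :=
  ∏ q : Fin n × Fin n with q.1 < q.2, blockSum u q.1 q.2

/-- `ϖ_n = ∏_{i < i'} 2 sin ((u_i + ⋯ + u_{i'-1}) / 2)`. -/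
def varpi {n : ℕ} (u : Fin (n - 1) → ℝ) : ℝ :=
  ∏ q : Fin n × Fin n with q.1 < q.2, 2 * Real.sin (blockSum u q.1 q.2 / 2)

/-- `D_n = ∑_p (-1) ^ (∑_j j p_j (n-1)) ∏_{i < i'} 1 / (u_i + ⋯ + 2π (p_i + ⋯ + p_{i'-1}))`, the
sum over all `p ∈ ℤ^{n-1}` being the limit of the sums over the boxes `[-N, N]^{n-1}`. It
converges absolutely for `n ≥ 3`; for `n = 2` this limit is the principal value. -/
def Dser {n : ℕ} (u : Fin (n - 1) → ℝ) : ℝ :=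
  limUnder atTop fun N : ℕ =>
    ∑ p ∈ Fintype.piFinset fun _ : Fin (n - 1) => Finset.Icc (-(N : ℤ)) (N : ℤ),
      (-1 : ℝ) ^ (∑ j : Fin (n - 1), ((j : ℤ) + 1) * p j * ((n : ℤ) - 1)) *
        (vanderTilde fun j => u j + p j * (2 * Real.pi))⁻¹

/-- `D̂_n`: the same sum without the signs. -/
def DserHat {n : ℕ} (u : Fin (n - 1) → ℝ) : ℝ :=
  limUnder atTop fun N : ℕ =>
    ∑ p ∈ Fintype.piFinset fun _ : Fin (n - 1) => Finset.Icc (-(N : ℤ)) (N : ℤ),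
      (vanderTilde fun j => u j + p j * (2 * Real.pi))⁻¹

/-- `R_n = D_n ϖ_n`, as a function of `u` off the poles of `D_n`. -/
def Rfun {n : ℕ} (u : Fin (n - 1) → ℝ) : ℝ := Dser u * varpi u

/-- `R̂_n = D̂_n ϖ_n`, as a function of `u` off the poles of `D̂_n`. -/
def RfunHat {n : ℕ} (u : Fin (n - 1) → ℝ) : ℝ := DserHat u * varpi u

/-- The successive differences `u_j = t_j - t_{j+1}`. -/
def diffs {n : ℕ} (t : Fin n → ℝ) : Fin (n - 1) → ℝ := fun j =>
  t ⟨j, by have := j.2; omega⟩ - t ⟨j + 1, by have := j.2; omega⟩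

/-- `F(T) = ∑_κ r_κ χ_κ(T)` for all `T = diag (e^{i t_1}, …, e^{i t_n})` in `SU(n)`,
`∑ t_j = 0`, with distinct eigenvalues (off the poles of `D_n`, `D̂_n`). -/
def IsCharacterExpansion {n : ℕ} (F : (Fin (n - 1) → ℝ) → ℝ) (r : Weight n →₀ ℝ) : Prop :=
  ∀ (t : Fin n → ℝ) (T : SU n), ∑ j, t j = 0 →
    (T : Matrix (Fin n) (Fin n) ℂ) =
      Matrix.diagonal (fun j => Complex.exp (Complex.I * (t j : ℂ))) →
    Function.Injective (fun j => Complex.exp (Complex.I * (t j : ℂ))) →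
    (F (diffs t) : ℂ) = r.sum fun κ a => (a : ℂ) * chi κ T

/-- `c_{ν'}^{(ν)} = ∑_κ N_{κ ν}^{ν'} r_κ`. -/
def cCoeff {n : ℕ} (r : Weight n →₀ ℝ) (ν ν' : Weight n) : ℝ :=
  r.sum fun κ a => (lrCoeff κ ν ν' : ℝ) * a

/-- `ĉ_{ν'}^{(ν)} = ∑_κ N_{κ, ν-ρ}^{ν'} r̂_κ`. -/
def cCoeffHat {n : ℕ} (r : Weight n →₀ ℝ) (ν ν' : Weight n) : ℝ :=
  r.sum fun κ a => (lrCoeff κ (subRho ν) ν' : ℝ) * a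

/-! ### The function `J_n` and the Horn polytope -/

/-- The Vandermonde product `Δ(x) = ∏_{i < j} (x_i - x_j)`. -/
def vander {n : ℕ} (x : Fin n → ℝ) : ℝ :=
  ∏ q : Fin n × Fin n with q.1 < q.2, (x q.1 - x q.2)

/-- `A_j(P, P', P'') = ∑_{k ≤ j} (α_{P k} + β_{P' k} - γ_{P'' k})
  - (j / n) ∑_k (α_k + β_k - γ_k)`. -/
def phase {n : ℕ} (α β γ : Fin n → ℝ) (P P' P'' : Equiv.Perm (Fin n)) (j : Fin (n - 1)) : ℝ :=
  ∑ k : Fin n with k.val ≤ j.val, (α (P k) + β (P' k) - γ (P'' k)) -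
    ((j : ℝ) + 1) / n * ∑ k, (α k + β k - γ k)

/-- The integrand `(∑_{P,P',P''} ε_P ε_{P'} ε_{P''} ∏_j e^{i u_j A_j(P,P',P'')}) / Δ̃(u)`. -/
def kernelIntegrand {n : ℕ} (α β γ : Fin n → ℝ) (u : Fin (n - 1) → ℝ) : ℂ :=
  (∑ P : Equiv.Perm (Fin n), ∑ P' : Equiv.Perm (Fin n), ∑ P'' : Equiv.Perm (Fin n),
    ((Equiv.Perm.sign P : ℤ) : ℂ) * ((Equiv.Perm.sign P' : ℤ) : ℂ) *
      ((Equiv.Perm.sign P'' : ℤ) : ℂ) *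
      ∏ j, Complex.exp (Complex.I * ((u j * phase α β γ P P' P'' j : ℝ) : ℂ))) /
    (vanderTilde u : ℂ)

/-- `J_n(α, β; γ)`. The integral over `ℝ^{n-1}` is the limit of the integrals over the cubes
`[-L, L]^{n-1}`: it converges absolutely for `n ≥ 3`, conditionally for `n = 2`. -/
def J {n : ℕ} (α β γ : Fin n → ℝ) : ℂ :=
  (Complex.I ^ (n * (n - 1) / 2))⁻¹ /
      (2 ^ (n - 1) * (n.factorial : ℂ) * (Real.pi : ℂ) ^ (n - 1)) *
    limUnder atTop fun L : ℝ =>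
      ∫ u in Set.Icc (fun _ : Fin (n - 1) => -L) (fun _ => L), kernelIntegrand α β γ u

/-- The orbit `{u* diag(α) u : u ∈ U(n)}`. -/
def orbit {n : ℕ} (α : Fin n → ℝ) : Set (Matrix (Fin n) (Fin n) ℂ) :=
  {A | ∃ u ∈ Matrix.unitaryGroup (Fin n) ℂ,
    A = star u * Matrix.diagonal (fun i => (α i : ℂ)) * u}

/-- The Horn polytope: the convex hull of the ordered spectra `γ_1 ≥ ⋯ ≥ γ_n` of the sums
`A + B` with `A` in the orbit of `α` and `B` in the orbit of `β`. -/
def hornPolytope {n : ℕ} (α β : Fin n → ℝ) : Set (Fin n → ℝ) :=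
  convexHull ℝ {γ | Antitone γ ∧ ∃ A ∈ orbit α, ∃ B ∈ orbit β, A + B ∈ orbit γ}

/-- The vector `γ` with first coordinates `g_1, …, g_{n-1}` and
`∑ γ_k = ∑ (α_k + β_k)`. -/
def complete {n : ℕ} (α β : Fin n → ℝ) (g : Fin (n - 1) → ℝ) : Fin n → ℝ := fun i =>
  if h : (i : ℕ) < n - 1 then g ⟨i, h⟩ else ∑ k, (α k + β k) - ∑ j, g j

/-- The points of the Horn polytope, described by their first `n - 1` coordinates. -/
def hornRegion {n : ℕ} (α β : Fin n → ℝ) : Set (Fin (n - 1) → ℝ) :=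
  {g | complete α β g ∈ hornPolytope α β}

/-- An integral vector seen as a real one. -/
def castVec {ι : Type} (m : ι → ℤ) : ι → ℝ := fun i => (m i : ℝ)

/-- `J_n(α, β; γ) Δ(γ) / (Δ(α) Δ(β))`, with `γ` given by its first `n - 1` coordinates. -/
def density {n : ℕ} (α β : Fin n → ℝ) (g : Fin (n - 1) → ℝ) : ℂ :=
  J α β (complete α β g) *
    ((vander (complete α β g) / (vander α * vander β) : ℝ) : ℂ)

end HornLR

end

noncomputable section

namespace HornLR

section

open scoped Topology Matrix ComplexOrder Real
open Filter MeasureTheory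
open Finset (sum_congr mul_sum sum_mul sum_add_distrib sum_sub_distrib mem_univ mem_filter prod_congr
  sum_const sum_filter sum_comm prod_mul_distrib smul_sum card_univ sum_eq_single)
open Matrix (diagonal mem_specialUnitaryGroup_iff mem_unitaryGroup_iff mem_unitaryGroup_iff')
open Function (Injective)
open Complex (I exp normSq)
open AddMonoidAlgebra (coeff_smul coeff_sum)
open Equiv (Perm)
open Real (sinc)


variable {n : ℕ}

/-! Everything is governed by one compactly supported function `B`, the Fourier transform of a
product of cardinal sines over the positive roots. Translating `u` by `2πp` changes each sine of
`ϖ_n` by a sign, so multiplying the series by `ϖ_n` gives a lattice sum of translates of that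
product (`varpi_mul_inv`). The signs put into `D_n` cancel those of the sines; in `D̂_n` the signs
of the sines survive, as the character `e^{2πi ρ·p}`. By Poisson summation `R_n` and `R̂_n` are
finite sums `∑ B(x) e^{i x·t}` over the root lattice and over its translate by `ρ`
(`IsSplineKernel.Rfun_eq`, `IsSplineKernel.RfunHat_eq`). These are symmetric, have real coefficients
and exponents in the weight lattice, hence are combinations of irreducible characters in exactly one
way. At the identity all terms of the lattice sum but `p = 0` vanish, so the value there is 1.
`IsSplineKernel` collects what is needed of `B`. For `n ≥ 3` it is a box spline, the density of a
sum of roots with independent uniform coefficients, and everything converges absolutely. For `n = 2`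
it is the indicator of an interval, and the cotangent series and the Dirichlet integral replace
Poisson summation.

The link with representations is the Weyl character formula, proved for the model by minors
(`monoSum_mul_alt_rho`). That model is spanned by translates of one highest weight vector, so the
Casimir operator is a scalar on it. The trace of the Casimir operator times a torus element says
that `χ a_ρ`, with `a_ρ` the alternant of `ρ`, is an eigenfunction of the Laplacian with eigenvalue
`|λ + ρ|²`, and dominance of `λ` leaves a single orbit of exponents. Averaging over the group turns
multiplicities into coefficients of `χ_κ χ_μ a_ρ` (`lrCoeff_eq`). Hence `c` is the matrix of
multiplication by `R_n`, its transpose is multiplication by the conjugate of `R_n`, and evaluation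
at the identity shows that the transpose fixes the vector of dimensions. This is
`sum_lrCoeff_mul_cCoeff`; the hatted rule is the same statement after a shift by `ρ`.

The integrand of `J_n` is `a_α a_β` times the conjugate of `a_γ`, over a Vandermonde product.
Dividing by `a_ρ` gives `J_n(γ) = ∑ g(x) B(γ - x)`, where `g(x)` are the coefficients of `χ_κ χ_μ
a_ρ` (`IsSplineKernel.J_eq`). At integral `γ` the convolution is a coefficient of `χ_κ χ_μ R̂_n
a_ρ`, so the sum over ordered integral `γ` of the density is again an evaluation at the identity
(`finsum_chamber`).

The sum over ordered vectors is a sum over the Horn polytope because `J_n` vanishes at ordered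
vectors outside it (`mem_hornPolytope_of_J_ne_zero`). Indeed `J_n` is homogeneous, and where it does
not vanish, large multiples of `γ` stay within bounded distance of constituents of tensor products.
A constituent yields Hermitian matrices with the three highest weights as spectra: an intertwiner
gives a covariant function of two matrices, and at a maximum of its modulus on `SU(n) × SU(n)` the
moment map vanishes (`exists_diagonal_eq`). Rescaling and compactness give the claim for `γ`.

For the integral, homogeneity identifies the Riemann sum of mesh `1/M` with the lattice sum for
`Mα`, `Mβ`, which does not depend on `M` (`tsum_density`). The density is continuous when `B` is,
that is for `n ≥ 3`; the case `n = 2` is computed directly (`integral_density_two`). -/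

/-! ### Traceless vectors -/

/-- The vector with coordinate sum zero whose successive differences are `u`. -/
def lift : (Fin (n - 1) → ℝ) →ₗ[ℝ] (Fin n → ℝ) where
  toFun u i := (∑ j : Fin (n - 1) with i.val ≤ j.val, u j) -
    (∑ j : Fin (n - 1), ((j : ℝ) + 1) * u j) / n
  map_add' u v := by
    ext i
    simp only [Pi.add_apply, mul_add, sum_add_distrib]
    ring
  map_smul' c u := by
    ext i
    simp only [Pi.smul_apply, smul_eq_mul, RingHom.id_apply, mul_left_comm _ c, ← mul_sum]
    ring

theorem lift_apply (u : Fin (n - 1) → ℝ) (i : Fin n) :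
    lift u i = (∑ j : Fin (n - 1) with i.val ≤ j.val, u j) -
      (∑ j : Fin (n - 1), ((j : ℝ) + 1) * u j) / n := rfl

theorem sum_lift (u : Fin (n - 1) → ℝ) : ∑ i, lift u i = 0 := by
  rcases Nat.eq_zero_or_pos n with rfl | hn
  · simp
  simp only [lift_apply, sum_sub_distrib, sum_const, card_univ, Fintype.card_fin, nsmul_eq_mul]
  rw [mul_div_cancel₀ _ (by positivity)]
  simp only [sum_filter]
  rw [sum_comm, ← sum_sub_distrib]
  refine Finset.sum_eq_zero fun j _ => ?_
  rw [← sum_filter, sum_const, sub_eq_zero, nsmul_eq_mul]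
  have : (Finset.univ.filter fun i : Fin n => i.val ≤ j.val).card = j.val + 1 := by
    have h : (Finset.univ.filter fun i : Fin n => i.val ≤ j.val) =
        Finset.Iic ⟨j.val, by omega⟩ := by
      ext i; simp [Fin.le_def]
    rw [h, Fin.card_Iic]
  rw [this]; push_cast; ring

theorem lift_sub_lift (u : Fin (n - 1) → ℝ) {i j : Fin n} (h : i ≤ j) :
    lift u i - lift u j = blockSum u i j := by
  simp only [lift_apply, blockSum, sum_filter]
  rw [sub_sub_sub_cancel_right, ← sum_sub_distrib]
  refine sum_congr rfl fun k _ => ?_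
  have h' : i.val ≤ j.val := h
  split_ifs <;> first | omega | simp

theorem diffs_lift (u : Fin (n - 1) → ℝ) : diffs (lift u) = u := by
  funext j
  have hj := j.2
  rw [diffs, lift_sub_lift u (by simp [Fin.le_def]), blockSum]
  have : (Finset.univ.filter fun k : Fin (n - 1) => j.val ≤ k.val ∧ k.val < j.val + 1) = {j} := by
    ext k; simp [Fin.ext_iff]; omega
  simp only [this, Finset.sum_singleton]

theorem lift_injective : Injective (lift (n := n)) := Function.LeftInverse.injective diffs_lift

theorem eq_of_diffs_eq {s t : Fin n → ℝ} (h : diffs s = diffs t)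
    (hs : ∑ i, s i = ∑ i, t i) : s = t := by
  rcases Nat.eq_zero_or_pos n with rfl | hn
  · exact Subsingleton.elim _ _
  have key : ∀ k (hk : k < n), s ⟨k, hk⟩ - t ⟨k, hk⟩ = s ⟨0, hn⟩ - t ⟨0, hn⟩ := by
    intro k
    induction k with
    | zero => intro _; rfl
    | succ k ih =>
      intro hk
      have h1 := congrFun h ⟨k, by omega⟩
      simp only [diffs] at h1
      have h2 := ih (by omega)
      linarith
  have hsum : ∑ i, (s i - t i) = n * (s ⟨0, hn⟩ - t ⟨0, hn⟩) := by
    rw [sum_congr rfl fun i _ => key i.1 i.2]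
    simp only [sum_const, card_univ, Fintype.card_fin, nsmul_eq_mul]
  rw [sum_sub_distrib, hs, sub_self, eq_comm, mul_eq_zero] at hsum
  have h0 : s ⟨0, hn⟩ - t ⟨0, hn⟩ = 0 := hsum.resolve_left (by positivity)
  funext i
  have := key i.1 i.2
  simp only [Fin.eta] at this
  linarith

theorem lift_diffs {t : Fin n → ℝ} (ht : ∑ i, t i = 0) : lift (diffs t) = t :=
  eq_of_diffs_eq (diffs_lift _) (by rw [sum_lift, ht])

theorem lift_diffs_apply (x : Fin n → ℝ) : lift (diffs x) = fun i => x i - (∑ k, x k) / n := by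
  refine eq_of_diffs_eq (by rw [diffs_lift]; funext j; simp [diffs]) ?_
  rw [sum_lift, sum_sub_distrib]
  rcases Nat.eq_zero_or_pos n with rfl | hn
  · simp
  · simp [mul_div_cancel₀ _ (show (n : ℝ) ≠ 0 by positivity)]

theorem blockSum_diffs (t : Fin n → ℝ) {i j : Fin n} (h : i ≤ j) : blockSum (diffs t) i j = t i - t j := by
  rw [← lift_sub_lift _ h, lift_diffs_apply]
  exact sub_sub_sub_cancel_right ..

/-! ### Trigonometric polynomials -/

/-- Formal trigonometric polynomials in `n` angles, with real exponent vectors. -/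
abbrev TrigPoly (n : ℕ) : Type := AddMonoidAlgebra ℂ (Fin n → ℝ)

/-- The monomial with exponent vector `x`. -/
abbrev mono (x : Fin n → ℝ) : TrigPoly n := AddMonoidAlgebra.single x 1

/-- The character `x ↦ exp (i t · x)`. -/
def expHom (t : Fin n → ℝ) : Multiplicative (Fin n → ℝ) →* ℂ where
  toFun x := exp (I * ((∑ k, t k * x.toAdd k : ℝ) : ℂ))
  map_one' := by simp
  map_mul' x y := by
    rw [← Complex.exp_add, ← mul_add, ← Complex.ofReal_add, ← sum_add_distrib]
    simp [mul_add]

/-- Evaluation of a trigonometric polynomial at the angles `t`. -/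
def ev (t : Fin n → ℝ) : TrigPoly n →ₐ[ℂ] ℂ := AddMonoidAlgebra.lift ℂ ℂ (Fin n → ℝ) (expHom t)

theorem ev_mono (t x : Fin n → ℝ) : ev t (mono x) = exp (I * ((∑ k, t k * x k : ℝ) : ℂ)) := by
  simp [ev, mono, expHom]

theorem ev_eq_sum (t : Fin n → ℝ) (f : TrigPoly n) :
    ev t f = f.coeff.sum fun x c => c * exp (I * ((∑ k, t k * x k : ℝ) : ℂ)) := by
  simp [ev, AddMonoidAlgebra.lift_apply, expHom]

theorem eq_sum_mono (f : TrigPoly n) : f = f.coeff.sum fun x c => c • mono x := by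
  conv_lhs => rw [← AddMonoidAlgebra.sum_coeff_single f]
  simp [mono]

theorem continuous_ev (f : TrigPoly n) : Continuous fun t => ev t f := by
  simp only [ev_eq_sum, Finsupp.sum]
  fun_prop

/-- The action of permutations of the angles. -/
def act (w : Perm (Fin n)) : TrigPoly n →ₐ[ℂ] TrigPoly n :=
  AddMonoidAlgebra.mapDomainAlgHom ℂ ℂ
    ({ toFun := fun x => x ∘ w, map_zero' := rfl, map_add' := fun _ _ => rfl } :
      (Fin n → ℝ) →+ (Fin n → ℝ))

/-- The involution inverting all monomials. -/
def inv : TrigPoly n →ₐ[ℂ] TrigPoly n :=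
  AddMonoidAlgebra.mapDomainAlgHom ℂ ℂ (-AddMonoidHom.id (Fin n → ℝ))

theorem act_mono (w : Perm (Fin n)) (x : Fin n → ℝ) : act w (mono x) = mono (x ∘ w) := by
  simp [act, mono]

theorem inv_mono (x : Fin n → ℝ) : inv (mono x) = mono (-x) := by simp [inv, mono]

@[elab_as_elim]
theorem trigPoly_induction {p : TrigPoly n → Prop} (f : TrigPoly n)
    (hm : ∀ x, p (mono x)) (ha : ∀ f g, p f → p g → p (f + g)) (hs : ∀ (c : ℂ) f, p f → p (c • f)) :
    p f := by
  rw [eq_sum_mono f, Finsupp.sum]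
  refine Finset.sum_induction _ p ha ?_ fun x _ => hs _ _ (hm x)
  simpa using hs 0 _ (hm 0)

theorem coeff_mono (x y : Fin n → ℝ) : (mono x).coeff y = if x = y then 1 else 0 := by
  classical
  simp [mono, Finsupp.single_apply]

theorem coeff_mul_mono (f : TrigPoly n) (x y : Fin n → ℝ) :
    (f * mono x).coeff y = f.coeff (y - x) := by
  rw [mono, AddMonoidAlgebra.coeff_mul_single_eq_coeff_mul (m₂ := y - x), mul_one]
  intro z _
  exact ⟨fun h => by rw [← h, add_sub_cancel_right], fun h => by rw [h, sub_add_cancel]⟩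

theorem coeff_act (w : Perm (Fin n)) (f : TrigPoly n) (x : Fin n → ℝ) :
    (act w f).coeff (x ∘ w) = f.coeff x := by
  induction f using trigPoly_induction with
  | hm y =>
    rw [act_mono, coeff_mono, coeff_mono]
    refine if_congr ?_ rfl rfl
    exact ⟨fun h => by simpa [Function.comp_assoc] using congrArg (· ∘ w.symm) h,
      fun h => by rw [h]⟩
  | ha f g hf hg => simp [hf, hg]
  | hs c f hf => simp [hf]

theorem coeff_inv (f : TrigPoly n) (x : Fin n → ℝ) : (inv f).coeff x = f.coeff (-x) := by
  induction f using trigPoly_induction with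
  | hm y => rw [inv_mono, coeff_mono, coeff_mono]; simp [neg_eq_iff_eq_neg]
  | ha f g hf hg => simp [hf, hg]
  | hs c f hf => simp [hf]

theorem inv_inv (f : TrigPoly n) : inv (inv f) = f := by
  refine AddMonoidAlgebra.ext ?_
  ext x
  simp [coeff_inv]

theorem act_inv (w : Perm (Fin n)) (f : TrigPoly n) : act w (inv f) = inv (act w f) := by
  induction f using trigPoly_induction with
  | hm x => simp only [inv_mono, act_mono]; rfl
  | ha f g hf hg => simp [hf, hg]
  | hs c f hf => simp [hf]

theorem ev_act (w : Perm (Fin n)) (f : TrigPoly n) (t : Fin n → ℝ) :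
    ev t (act w f) = ev (t ∘ w.symm) f := by
  induction f using trigPoly_induction with
  | hm x =>
    rw [act_mono, ev_mono, ev_mono]
    congr 3
    rw [← Equiv.sum_comp w.symm]
    simp
  | ha f g hf hg => simp [hf, hg]
  | hs c f hf => simp [hf]

theorem ev_inv (f : TrigPoly n) (t : Fin n → ℝ) : ev t (inv f) = ev (-t) f := by
  induction f using trigPoly_induction with
  | hm x => rw [inv_mono, ev_mono, ev_mono]; simp
  | ha f g hf hg => simp [hf, hg]
  | hs c f hf => simp [hf]

/-! ### Alternants -/

/-- Symmetric trigonometric polynomials. -/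
def IsSymm (f : TrigPoly n) : Prop := ∀ w, act w f = f

/-- Antisymmetric trigonometric polynomials. -/
def IsAlt (f : TrigPoly n) : Prop := ∀ w, act w f = ((Equiv.Perm.sign w : ℤ) : ℂ) • f

/-- The alternant `∑_w sgn(w) e^{x ∘ w}`. -/
def alt (x : Fin n → ℝ) : TrigPoly n :=
  ∑ w : Perm (Fin n), ((Equiv.Perm.sign w : ℤ) : ℂ) • mono (x ∘ w)

theorem IsSymm.mul {f g : TrigPoly n} (hf : IsSymm f) (hg : IsSymm g) :
    IsSymm (f * g) := fun w => by rw [map_mul, hf, hg]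

theorem IsSymm.mul_isAlt {f g : TrigPoly n} (hf : IsSymm f) (hg : IsAlt g) :
    IsAlt (f * g) := fun w => by rw [map_mul, hf, hg, mul_smul_comm]

theorem IsSymm.inv {f : TrigPoly n} (hf : IsSymm f) : IsSymm (inv f) := fun w => by rw [act_inv, hf]

theorem sign_sq (w : Perm (Fin n)) :
    ((Equiv.Perm.sign w : ℤ) : ℂ) * ((Equiv.Perm.sign w : ℤ) : ℂ) = 1 := by
  rcases Int.units_eq_one_or (Equiv.Perm.sign w) with h | h <;> simp [h]

theorem isAlt_alt (x : Fin n → ℝ) : IsAlt (alt x) := by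
  intro v
  simp only [alt, map_sum, map_smul, act_mono, smul_sum, smul_smul]
  rw [← Equiv.sum_comp (Equiv.mulRight v⁻¹)]
  refine sum_congr rfl fun w _ => ?_
  simp only [Equiv.coe_mulRight, Equiv.Perm.sign_mul, Equiv.Perm.sign_inv, Units.val_mul,
    Int.cast_mul]
  congr 1
  · ring
  · congr 1
    funext i
    simp

theorem IsAlt.coeff_comp {f : TrigPoly n} (hf : IsAlt f) (w : Perm (Fin n))
    (x : Fin n → ℝ) : f.coeff (x ∘ w) = ((Equiv.Perm.sign w : ℤ) : ℂ) * f.coeff x := by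
  have h := coeff_act w f x
  rw [hf w] at h
  simp only [coeff_smul, Finsupp.smul_apply, smul_eq_mul] at h
  rw [← h, ← mul_assoc, sign_sq, one_mul]

theorem IsAlt.coeff_eq_zero {f : TrigPoly n} (hf : IsAlt f) {x : Fin n → ℝ}
    (hx : ¬ Injective x) : f.coeff x = 0 := by
  simp only [Injective, not_forall] at hx
  obtain ⟨i, j, hij, hne⟩ := hx
  have h := hf.coeff_comp (Equiv.swap i j) x
  have hs : x ∘ Equiv.swap i j = x := by
    funext k
    simp only [Function.comp]
    rcases eq_or_ne k i with rfl | hki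
    · simp [hij]
    rcases eq_or_ne k j with rfl | hkj
    · simp [hij]
    rw [Equiv.swap_apply_of_ne_of_ne hki hkj]
  rw [hs, Equiv.Perm.sign_swap hne] at h
  have h2 : f.coeff x = -f.coeff x := by simpa using h
  linear_combination h2 / 2

theorem exists_strictAnti_comp {x : Fin n → ℝ} (hx : Injective x) :
    ∃ w : Perm (Fin n), StrictAnti (x ∘ w) := by
  have h := Tuple.monotone_sort (fun i => -x i)
  refine ⟨Tuple.sort fun i => -x i, fun i j hij => lt_of_le_of_ne ?_ ?_⟩
  · simpa using h hij.le
  · intro h2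
    exact hij.ne' ((Tuple.sort fun i => -x i).injective (hx h2))

theorem perm_eq_of_strictAnti {x : Fin n → ℝ} {w : Perm (Fin n)}
    (hx : StrictAnti x) (hw : StrictAnti (x ∘ w)) : w = 1 := by
  have hm : StrictMono w := fun i j hij => hx.lt_iff_gt.mp (hw hij)
  ext i
  have := StrictMono.range_inj hm (strictMono_id (α := Fin n))
  rw [w.range_eq_univ, Set.range_id] at this
  rw [this.mp rfl]; rfl

theorem coeff_alt_self {x y : Fin n → ℝ} (hx : StrictAnti x) (hy : StrictAnti y) :
    (alt x).coeff y = if x = y then 1 else 0 := by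
  rw [alt, coeff_sum, Finsupp.finsetSum_apply]
  simp only [coeff_smul, Finsupp.smul_apply, coeff_mono, smul_eq_mul]
  rw [sum_eq_single 1]
  · simp
  · intro w _ hw
    rw [if_neg, mul_zero]
    intro h
    exact hw (perm_eq_of_strictAnti hx (h ▸ hy))
  · simp

/-- Every exponent with distinct coordinates is a permutation of a strictly decreasing one, and
exponents with a repeated coordinate have coefficient zero. -/
theorem IsAlt.ext {f g : TrigPoly n} (hf : IsAlt f) (hg : IsAlt g)
    (h : ∀ x, StrictAnti x → f.coeff x = g.coeff x) : f = g := by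
  refine AddMonoidAlgebra.ext ?_
  ext x
  by_cases hx : Injective x
  · obtain ⟨w, hw⟩ := exists_strictAnti_comp hx
    have h1 := h _ hw
    rw [hf.coeff_comp, hg.coeff_comp] at h1
    refine mul_left_cancel₀ (left_ne_zero_of_mul_eq_one (sign_sq w)) h1
  · rw [hf.coeff_eq_zero hx, hg.coeff_eq_zero hx]

/-- Pairing with an alternant extracts a coefficient. -/
theorem IsAlt.coeff_zero_mul_inv_alt {f : TrigPoly n} (hf : IsAlt f) (x : Fin n → ℝ) :
    (f * inv (alt x)).coeff 0 = (n.factorial : ℂ) * f.coeff x := by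
  simp only [alt, map_sum, map_smul, inv_mono, mul_sum, mul_smul_comm,
    coeff_sum, Finsupp.finsetSum_apply, coeff_smul,
    Finsupp.smul_apply, coeff_mul_mono, zero_sub, neg_neg, hf.coeff_comp, smul_eq_mul]
  simp only [← mul_assoc, sign_sq, one_mul, sum_const, card_univ,
    Fintype.card_perm, Fintype.card_fin, nsmul_eq_mul]

theorem ev_alt (t x : Fin n → ℝ) : ev t (alt x) =
    (Matrix.of fun k l => exp (I * ((t l * x k : ℝ) : ℂ))).det := by
  rw [Matrix.det_apply']
  simp only [alt, map_sum, map_smul, ev_mono, smul_eq_mul, Matrix.of_apply, ← Complex.exp_sum]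
  refine sum_congr rfl fun w _ => ?_
  simp only [Function.comp, Complex.ofReal_sum, mul_sum]

/-- The determinant of `exp (i t_l x_k)` is symmetric in `t` and `x`. This exchange makes the value
of any alternant at a multiple of `ρ` a value of the Weyl denominator. -/
theorem ev_alt_comm (t x : Fin n → ℝ) : ev t (alt x) = ev x (alt t) := by
  rw [ev_alt, ev_alt, ← Matrix.det_transpose]
  congr 1
  ext k l
  simp [mul_comm]

/-- Half the sum of the positive roots. -/
def rho : Fin n → ℝ := lift 1

theorem rho_apply (i : Fin n) : rho i = ((n : ℝ) - 1) / 2 - i := by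
  have h : (rho : Fin n → ℝ) = fun i : Fin n => ((n : ℝ) - 1) / 2 - i := by
    refine eq_of_diffs_eq ?_ ?_
    · rw [rho, diffs_lift]
      funext j
      simp [diffs]
    · rw [rho, sum_lift, sum_sub_distrib]
      simp only [sum_const, card_univ, Fintype.card_fin, nsmul_eq_mul]
      have h2 := Finset.sum_range_id_mul_two n
      rw [Fin.sum_univ_eq_sum_range (fun i => (i : ℝ)) n]
      rcases Nat.eq_zero_or_pos n with rfl | hn
      · simp
      have h3 : (∑ i ∈ Finset.range n, (i : ℝ)) * 2 = n * ((n : ℝ) - 1) := by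
        have := congrArg (Nat.cast (R := ℝ)) h2
        push_cast [Nat.cast_sub hn] at this
        exact this
      linarith
  rw [h]

theorem card_Ioi_add_card_Iio (k : Fin n) : (Finset.Ioi k).card + (Finset.Iio k).card = n - 1 := by
  rw [Fin.card_Ioi, Fin.card_Iio]; omega

/-- A product over ordered pairs as an iterated product. -/
theorem prod_pairs {M : Type*} [CommMonoid M] (f : Fin n → Fin n → M) :
    ∏ q : Fin n × Fin n with q.1 < q.2, f q.1 q.2 = ∏ i, ∏ j ∈ Finset.Ioi i, f i j := by
  rw [Finset.prod_filter, Fintype.prod_prod_type]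
  refine prod_congr rfl fun i _ => ?_
  rw [← Finset.prod_filter]
  congr 1
  ext j; simp

theorem sum_pairs {M : Type*} [AddCommMonoid M] (f : Fin n → Fin n → M) :
    ∑ q : Fin n × Fin n with q.1 < q.2, f q.1 q.2 = ∑ i, ∑ j ∈ Finset.Ioi i, f i j := by
  rw [sum_filter, Fintype.sum_prod_type]
  refine sum_congr rfl fun i _ => ?_
  rw [← sum_filter]
  congr 1
  ext j; simp

theorem sum_pairs_add (t : Fin n → ℂ) :
    ∑ q : Fin n × Fin n with q.1 < q.2, (t q.1 + t q.2) = ((n : ℂ) - 1) * ∑ k, t k := by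
  rcases Nat.eq_zero_or_pos n with rfl | hn
  · simp
  rw [sum_add_distrib, sum_pairs (fun i _ => t i)]
  have h2 : ∑ q : Fin n × Fin n with q.1 < q.2, t q.2 = ∑ j, ∑ i ∈ Finset.Iio j, t j := by
    rw [sum_filter, Fintype.sum_prod_type_right]
    refine sum_congr rfl fun i _ => ?_
    rw [← sum_filter]
    congr 1
    ext j; simp
  rw [h2, ← sum_add_distrib, mul_sum]
  refine sum_congr rfl fun k _ => ?_
  simp only [sum_const, nsmul_eq_mul]
  rw [← add_mul, ← Nat.cast_add, card_Ioi_add_card_Iio, Nat.cast_sub hn, Nat.cast_one]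

/-- After the exchange of `t` and `ρ`, row `k` is `e^{i(n-1)t_k/2}` times the powers of `e^{-i
t_k}`, so the determinant is a Vandermonde determinant. The prefactors distribute over the pairs and
make each difference `e^{-i t_j} - e^{-i t_i}` a sine. -/
theorem ev_alt_rho (t : Fin n → ℝ) : ev t (alt rho) = ∏ q : Fin n × Fin n with q.1 < q.2,
      (2 * I * ((Real.sin ((t q.1 - t q.2) / 2) : ℝ) : ℂ)) := by
  rw [ev_alt_comm, ev_alt]
  have h1 : (Matrix.of fun k l : Fin n => exp (I * ((rho l * t k : ℝ) : ℂ))) =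
      Matrix.of fun k l => exp (((n : ℂ) - 1) * (I * t k / 2)) *
        Matrix.vandermonde (fun k => exp (-(I * t k))) k l := by
    ext k l
    simp only [Matrix.of_apply, Matrix.vandermonde_apply]
    rw [← Complex.exp_nat_mul, ← Complex.exp_add, rho_apply]
    push_cast
    congr 1
    ring
  rw [h1, Matrix.det_mul_column, Matrix.det_vandermonde,
    ← prod_pairs (fun i j => exp (-(I * t j)) - exp (-(I * t i))),
    ← Complex.exp_sum, ← mul_sum, ← sum_pairs_add, Complex.exp_sum,
    ← prod_mul_distrib]
  refine prod_congr rfl fun q _ => ?_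
  rw [mul_sub, ← Complex.exp_add, ← Complex.exp_add, Complex.ofReal_sin, Complex.sin]
  push_cast
  rw [show (2 : ℂ) * I * ((exp (-(((t q.1 : ℂ) - t q.2) / 2) * I) -
    exp (((t q.1 : ℂ) - t q.2) / 2 * I)) * I / 2) =
    (I * I) * (exp (-(((t q.1 : ℂ) - t q.2) / 2) * I) -
    exp (((t q.1 : ℂ) - t q.2) / 2 * I)) by ring, Complex.I_mul_I]
  rw [neg_one_mul, neg_sub]
  congr 2 <;> ring

/-! ### Separation of trigonometric polynomials -/

/-- The exponents of `f` lie in `A`. -/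
def SuppIn (A : Set (Fin n → ℝ)) (f : TrigPoly n) : Prop := ∀ x, f.coeff x ≠ 0 → x ∈ A

theorem SuppIn.mono {A B : Set (Fin n → ℝ)} {f : TrigPoly n} (hf : SuppIn A f)
    (h : A ⊆ B) : SuppIn B f := fun x hx => h (hf x hx)

theorem SuppIn.mul {A B C : Set (Fin n → ℝ)} {f g : TrigPoly n} (hf : SuppIn A f)
    (hg : SuppIn B g) (h : ∀ a ∈ A, ∀ b ∈ B, a + b ∈ C) : SuppIn C (f * g) := by
  classical
  intro x hx
  have hx' : x ∈ (f * g).coeff.support := Finsupp.mem_support_iff.mpr hx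
  have := AddMonoidAlgebra.support_coeff_mul_subset f g hx'
  obtain ⟨a, ha, b, hb, rfl⟩ := Finset.mem_add.mp this
  exact h a (hf a (Finsupp.mem_support_iff.mp ha)) b (hg b (Finsupp.mem_support_iff.mp hb))

theorem SuppIn.add {A : Set (Fin n → ℝ)} {f g : TrigPoly n} (hf : SuppIn A f)
    (hg : SuppIn A g) : SuppIn A (f + g) := by
  intro x hx
  by_contra hxA
  have h1 : f.coeff x = 0 := by_contra fun h => hxA (hf x h)
  have h2 : g.coeff x = 0 := by_contra fun h => hxA (hg x h)
  simp [h1, h2] at hx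

theorem SuppIn.smul {A : Set (Fin n → ℝ)} {f : TrigPoly n} (hf : SuppIn A f) (c : ℂ) :
    SuppIn A (c • f) := by
  intro x hx
  refine hf x fun h => hx ?_
  simp [h]

theorem SuppIn.zero (A : Set (Fin n → ℝ)) : SuppIn A (0 : TrigPoly n) := by
  intro x hx; simp at hx

theorem SuppIn.sum {A : Set (Fin n → ℝ)} {ι : Type*} (s : Finset ι) (f : ι → TrigPoly n)
    (h : ∀ i ∈ s, SuppIn A (f i)) : SuppIn A (∑ i ∈ s, f i) :=
  Finset.sum_induction _ _ (fun _ _ => SuppIn.add) (SuppIn.zero A) h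

theorem suppIn_mono {A : Set (Fin n → ℝ)} {x : Fin n → ℝ} (hx : x ∈ A) : SuppIn A (mono x) := by
  intro y hy
  rw [coeff_mono] at hy
  have : x = y := by by_contra h; simp [h] at hy
  exact this ▸ hx

theorem SuppIn.inv {A B : Set (Fin n → ℝ)} {f : TrigPoly n} (hf : SuppIn A f)
    (h : ∀ a ∈ A, -a ∈ B) : SuppIn B (inv f) := by
  intro x hx
  rw [coeff_inv] at hx
  simpa using h _ (hf _ hx)

theorem suppIn_alt {A : Set (Fin n → ℝ)} {x : Fin n → ℝ}
    (h : ∀ w : Perm (Fin n), x ∘ w ∈ A) : SuppIn A (alt x) :=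
  SuppIn.sum _ _ fun w _ => (suppIn_mono (h w)).smul _

/-- Vectors with coordinate sum zero. -/
def traceless (n : ℕ) : AddSubgroup (Fin n → ℝ) where
  carrier := {x | ∑ i, x i = 0}
  zero_mem' := by simp
  add_mem' := by
    intro a b ha hb
    simp only [Set.mem_ofPred_eq, Pi.add_apply, sum_add_distrib] at *
    rw [ha, hb, add_zero]
  neg_mem' := by
    intro a ha
    simp only [Set.mem_ofPred_eq, Pi.neg_apply, Finset.sum_neg_distrib] at *
    rw [ha, neg_zero]

theorem mem_traceless {x : Fin n → ℝ} : x ∈ traceless n ↔ ∑ i, x i = 0 := Iff.rfl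

/-- The exponents of `f` differ by traceless vectors, so distinct exponents restrict to distinct
characters of the group of traceless angles, and characters are linearly independent. -/
theorem eq_zero_of_ev {A : Set (Fin n → ℝ)} {f : TrigPoly n} (hf : SuppIn A f)
    (hA : ∀ x ∈ A, ∀ y ∈ A, x - y ∈ traceless n) (h : ∀ t ∈ traceless n, ev t f = 0) : f = 0 := by
  classical
  let χ : f.coeff.support → (Multiplicative (traceless n) →* ℂ) := fun x =>
    { toFun := fun t => exp (I * ((∑ k, (t.toAdd : Fin n → ℝ) k * x.1 k : ℝ) : ℂ))
      map_one' := by simp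
      map_mul' := by
        intro s t
        rw [← Complex.exp_add, ← mul_add, ← Complex.ofReal_add, ← sum_add_distrib]
        simp [add_mul] }
  have hχ : Injective χ := by
    intro x y hxy
    by_contra hne
    have hd : x.1 - y.1 ≠ 0 := sub_ne_zero.mpr fun h => hne (Subtype.ext h)
    have hx := hf _ (Finsupp.mem_support_iff.mp x.2)
    have hy := hf _ (Finsupp.mem_support_iff.mp y.2)
    set d := x.1 - y.1 with hdd
    have hpos : 0 < ∑ k, d k * d k := by
      obtain ⟨k, hk⟩ := Function.ne_iff.mp hd
      exact Finset.sum_pos' (fun _ _ => mul_self_nonneg _) ⟨k, mem_univ _, mul_self_pos.mpr hk⟩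
    -- At the angles `c • d` the two characters differ by the factor `e^{iπ} = -1`.
    set c : ℝ := π / ∑ k, d k * d k
    have hs : c • d ∈ traceless n := by
      rw [mem_traceless]
      simp only [Pi.smul_apply, smul_eq_mul, ← mul_sum]
      rw [mem_traceless.mp (hA _ hx _ hy), mul_zero]
    have h1 := DFunLike.congr_fun hxy (Multiplicative.ofAdd (⟨c • d, hs⟩ : traceless n))
    simp only [χ, MonoidHom.coe_mk, OneHom.coe_mk, toAdd_ofAdd] at h1
    rw [Complex.exp_eq_exp_iff_exists_int] at h1
    obtain ⟨m, hm⟩ := h1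
    have h2 : (((∑ k, (c • d) k * x.1 k) - ∑ k, (c • d) k * y.1 k : ℝ) : ℂ) =
        ((m * (2 * π) : ℝ) : ℂ) := by
      have hI := Complex.I_ne_zero
      refine mul_left_cancel₀ hI ?_
      push_cast
      push_cast at hm
      linear_combination hm
    have h3 := Complex.ofReal_injective h2
    rw [← sum_sub_distrib] at h3
    have h4 : ∑ k, ((c • d) k * x.1 k - (c • d) k * y.1 k) = π := by
      have : ∀ k, (c • d) k * x.1 k - (c • d) k * y.1 k = c * (d k * d k) := by
        intro k
        simp only [Pi.smul_apply, smul_eq_mul, hdd, Pi.sub_apply]; ring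
      rw [sum_congr rfl fun k _ => this k, ← mul_sum]
      exact div_mul_cancel₀ _ hpos.ne'
    rw [h4] at h3
    have h5 : (1 : ℝ) = ((m * 2 : ℤ) : ℝ) := by
      have := Real.pi_pos
      push_cast
      refine mul_right_cancel₀ this.ne' ?_
      linarith
    have : (1 : ℤ) = m * 2 := by exact_mod_cast h5
    omega
  have hli := (linearIndependent_monoidHom (Multiplicative (traceless n)) ℂ).comp χ hχ
  rw [Fintype.linearIndependent_iff] at hli
  have h0 := hli (fun x => f.coeff x.1) (by
    funext t
    have h1 := h _ t.toAdd.2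
    rw [ev_eq_sum, Finsupp.sum, ← Finset.sum_coe_sort] at h1
    simpa [χ] using h1)
  refine AddMonoidAlgebra.ext ?_
  ext x
  by_contra hx
  exact hx (h0 ⟨x, Finsupp.mem_support_iff.mpr hx⟩)

theorem strictAnti_rho : StrictAnti (rho : Fin n → ℝ) := by
  intro i j hij
  rw [rho_apply, rho_apply]
  have : (i.val : ℝ) < j.val := by exact_mod_cast hij
  linarith

theorem alt_ne_zero {x : Fin n → ℝ} (hx : StrictAnti x) : alt x ≠ 0 := by
  intro h
  have := coeff_alt_self hx hx
  rw [h] at this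
  simp at this

theorem comp_mem_traceless {x : Fin n → ℝ} (hx : x ∈ traceless n)
    (w : Perm (Fin n)) : x ∘ w ∈ traceless n := by
  rw [mem_traceless] at *
  rw [← hx, ← Equiv.sum_comp w x]; rfl

theorem lift_mem_traceless (u : Fin (n - 1) → ℝ) : lift u ∈ traceless n := sum_lift u

theorem ev_alt_rho_eq_zero {t : Fin n → ℝ} (h : ¬ Injective fun j => exp (I * (t j : ℂ))) :
    ev t (alt rho) = 0 := by
  simp only [Injective, not_forall] at h
  obtain ⟨i, j, hij, hne⟩ := h
  wlog hlt : i < j generalizing i j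
  · exact this j i hij.symm (Ne.symm hne) (lt_of_le_of_ne (not_lt.mp hlt) (Ne.symm hne))
  rw [ev_alt_rho]
  refine Finset.prod_eq_zero (i := (i, j)) (by simpa using hlt) ?_
  rw [Complex.exp_eq_exp_iff_exists_int] at hij
  obtain ⟨m, hm⟩ := hij
  have h2 : (t i : ℂ) = t j + m * (2 * π) := by
    refine mul_left_cancel₀ Complex.I_ne_zero ?_
    linear_combination hm
  have h3 : t i = t j + m * (2 * π) := by exact_mod_cast h2
  have h4 : (t i - t j) / 2 = m * π := by rw [h3]; ring
  simp only [h4, Real.sin_int_mul_pi]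
  simp

/-- The product with the Weyl denominator vanishes at all angles, since the denominator vanishes at
the singular ones, and the algebra of trigonometric polynomials is a domain. -/
theorem eq_zero_of_ev_regular {A : Set (Fin n → ℝ)} {f : TrigPoly n} (hf : SuppIn A f)
    (hA : ∀ x ∈ A, ∀ y ∈ A, x - y ∈ traceless n) (h : ∀ t ∈ traceless n, Injective (fun j => exp (I * (t j : ℂ))) →
      ev t f = 0) : f = 0 := by
  have h1 : f * alt rho = 0 := by
    refine eq_zero_of_ev (A := {x | ∃ a ∈ A, x - a ∈ traceless n})
      (hf.mul (suppIn_alt (A := traceless n) (comp_mem_traceless (lift_mem_traceless _)))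
        fun a ha b hb => ⟨a, ha, by rwa [add_sub_cancel_left]⟩) ?_ ?_
    · rintro x ⟨a, ha, hxa⟩ y ⟨b, hb, hyb⟩
      have := add_mem (sub_mem hxa hyb) (hA a ha b hb)
      rwa [show x - a - (y - b) + (a - b) = x - y by abel] at this
    intro t ht
    rw [map_mul]
    by_cases hreg : Injective (fun j => exp (I * (t j : ℂ)))
    · rw [h t ht hreg, zero_mul]
    · rw [ev_alt_rho_eq_zero hreg, mul_zero]
  exact (mul_eq_zero.mp h1).resolve_right (alt_ne_zero strictAnti_rho)

/-! ### Expansion into alternants -/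

/-- The weight lattice, realized by vectors with coordinate sum zero. -/
def weightLattice (n : ℕ) : AddSubgroup (Fin n → ℝ) where
  carrier := {x | ∃ a : Fin (n - 1) → ℤ, x = lift (castVec a)}
  zero_mem' := ⟨0, by rw [← map_zero lift]; congr 1; funext; simp [castVec]⟩
  add_mem' := by
    rintro _ _ ⟨a, rfl⟩ ⟨b, rfl⟩
    exact ⟨a + b, by rw [← map_add]; congr 1; funext; simp [castVec]⟩
  neg_mem' := by
    rintro _ ⟨a, rfl⟩
    exact ⟨-a, by rw [← map_neg]; congr 1; funext; simp [castVec]⟩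

theorem weightLattice_le_traceless (n : ℕ) : weightLattice n ≤ traceless n := by
  rintro _ ⟨a, rfl⟩
  exact lift_mem_traceless _

/-- The vector of the weight `κ`. -/
def wt (κ : Weight n) : Fin n → ℝ := lift fun k => (κ k : ℝ)

theorem wt_mem (κ : Weight n) : wt κ ∈ weightLattice n := ⟨fun k => κ k, by rw [wt]; congr 1⟩

theorem rho_mem : rho ∈ weightLattice n := ⟨1, by rw [rho]; congr 1; funext; simp [castVec]⟩

theorem mem_weightLattice_iff {x : Fin n → ℝ} : x ∈ weightLattice n ↔
    x ∈ traceless n ∧ ∀ i j, ∃ m : ℤ, x i - x j = m := by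
  constructor
  · rintro ⟨a, rfl⟩
    refine ⟨lift_mem_traceless _, fun i j => ?_⟩
    wlog h : i ≤ j generalizing i j
    · obtain ⟨m, hm⟩ := this j i (not_le.mp h).le
      exact ⟨-m, by push_cast; linarith⟩
    rw [lift_sub_lift _ h, blockSum]
    exact ⟨_, (Int.cast_sum _ _).symm⟩
  · rintro ⟨h1, h2⟩
    choose m hm using h2
    refine ⟨fun j => m ⟨j, by have := j.2; omega⟩ ⟨j + 1, by have := j.2; omega⟩, ?_⟩
    rw [← lift_diffs h1]
    congr 1
    funext j
    simp only [castVec, diffs, hm]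

theorem comp_mem_weightLattice {x : Fin n → ℝ} (hx : x ∈ weightLattice n)
    (w : Perm (Fin n)) : x ∘ w ∈ weightLattice n := by
  rw [mem_weightLattice_iff] at *
  exact ⟨comp_mem_traceless hx.1 w, fun i j => hx.2 _ _⟩

/-- The strictly dominant weight `κ + ρ`. -/
def shifted (κ : Weight n) : Fin n → ℝ := wt κ + rho

theorem diffs_shifted (κ : Weight n) : diffs (shifted κ) = fun k => (κ k : ℝ) + 1 := by
  rw [shifted, wt, rho, ← map_add, diffs_lift]; rfl

theorem shifted_mem (κ : Weight n) : shifted κ ∈ weightLattice n := add_mem (wt_mem κ) rho_mem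

theorem shifted_zero : shifted (0 : Weight n) = rho := by
  rw [shifted, wt, add_eq_right, ← map_zero lift]; congr 1; funext; simp

theorem shifted_injective : Injective (shifted (n := n)) := by
  intro κ κ' h
  have := congrArg diffs h
  rw [diffs_shifted, diffs_shifted] at this
  funext k
  have := congrFun this k
  simpa using this

theorem strictAnti_of_diffs_pos {x : Fin n → ℝ} (h : ∀ k, 0 < diffs x k) : StrictAnti x := by
  rcases n with _ | n
  · intro i; exact i.elim0
  · refine Fin.strictAnti_iff_succ_lt.mpr fun i => ?_
    exact sub_pos.mp (h i)

theorem strictAnti_shifted (κ : Weight n) : StrictAnti (shifted κ) :=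
  strictAnti_of_diffs_pos fun k => by rw [diffs_shifted]; positivity

theorem exists_eq_shifted {x : Fin n → ℝ} (hx : x ∈ weightLattice n)
    (h : StrictAnti x) : ∃ κ, x = shifted κ := by
  have ⟨a, ha⟩ := hx
  have hd : diffs x = castVec a := by rw [ha, diffs_lift]
  have hpos : ∀ k, 1 ≤ a k := by
    intro k
    have h1 : 0 < diffs x k := sub_pos.mpr (h (by simp [Fin.lt_def]))
    rw [hd, castVec] at h1
    exact_mod_cast h1
  refine ⟨fun k => (a k - 1).toNat, eq_of_diffs_eq ?_ ?_⟩
  · rw [hd, diffs_shifted]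
    funext k
    have := hpos k
    have h2 : (((a k - 1).toNat : ℤ) : ℝ) = ((a k - 1 : ℤ) : ℝ) := by
      rw [Int.toNat_of_nonneg (by omega)]
    simp only [castVec]
    push_cast at h2
    linarith
  · rw [weightLattice_le_traceless n hx, weightLattice_le_traceless n (shifted_mem _)]

/-- The coefficients of an antisymmetric trigonometric polynomial at strictly dominant weights. -/
def altCoeffs (g : TrigPoly n) : Weight n →₀ ℂ :=
  g.coeff.comapDomain shifted shifted_injective.injOn

theorem altCoeffs_apply (g : TrigPoly n) (κ : Weight n) : altCoeffs g κ = g.coeff (shifted κ) := rfl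

theorem coeff_finsuppSum {ι : Type*} (c : ι →₀ ℂ) (f : ι → TrigPoly n) (x : Fin n → ℝ) :
    (c.sum fun κ a => a • f κ).coeff x = c.sum fun κ a => a * (f κ).coeff x := by
  simp [Finsupp.sum, coeff_sum, Finsupp.finsetSum_apply]

theorem IsAlt.sum {ι : Type*} (c : ι →₀ ℂ) (f : ι → TrigPoly n) (h : ∀ i, IsAlt (f i)) :
    IsAlt (c.sum fun κ a => a • f κ) := by
  intro w
  simp only [Finsupp.sum, map_sum, map_smul, smul_sum]
  refine sum_congr rfl fun i _ => ?_
  rw [h i w, smul_comm]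

theorem coeff_sum_alt (c : Weight n →₀ ℂ) (κ : Weight n) :
    (c.sum fun κ a => a • alt (shifted κ)).coeff (shifted κ) = c κ := by
  rw [coeff_finsuppSum, Finsupp.sum]
  simp only [coeff_alt_self (strictAnti_shifted _) (strictAnti_shifted κ)]
  rw [sum_eq_single κ]
  · simp
  · intro κ' _ hne
    rw [if_neg (fun h => hne (shifted_injective h)), mul_zero]
  · intro h
    simpa using h

theorem IsAlt.eq_sum {g : TrigPoly n} (hg : IsAlt g) (hs : SuppIn (weightLattice n) g) :
    g = (altCoeffs g).sum fun κ c => c • alt (shifted κ) := by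
  refine hg.ext (IsAlt.sum _ _ fun _ => isAlt_alt _) fun x hx => ?_
  by_cases hxw : x ∈ weightLattice n
  · obtain ⟨κ, rfl⟩ := exists_eq_shifted hxw hx
    rw [coeff_sum_alt, altCoeffs_apply]
  · rw [by_contra fun h => hxw (hs x h), coeff_finsuppSum, Finsupp.sum, Finset.sum_eq_zero]
    intro κ _
    rw [coeff_alt_self (strictAnti_shifted κ) hx, if_neg, mul_zero]
    rintro rfl
    exact hxw (shifted_mem κ)

/-! ### Schur functions -/

/-- A family of trigonometric polynomials satisfying the Weyl character formula. -/
def IsSchurFamily (ch : Weight n → TrigPoly n) : Prop := ∀ κ, ch κ * alt rho = alt (shifted κ)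

namespace IsSchurFamily

variable {ch : Weight n → TrigPoly n}

theorem isSymm (h : IsSchurFamily ch) (κ : Weight n) : IsSymm (ch κ) := by
  intro w
  have h1 := congrArg (act w) (h κ)
  rw [map_mul, isAlt_alt, isAlt_alt, ← h κ, mul_smul_comm] at h1
  have h2 := congrArg (((Equiv.Perm.sign w : ℤ) : ℂ) • ·) h1
  simp only [smul_smul, sign_sq, one_smul] at h2
  exact mul_right_cancel₀ (alt_ne_zero strictAnti_rho) h2

theorem eq_sum (h : IsSchurFamily ch) {f : TrigPoly n} (hf : IsSymm f)
    (hs : SuppIn (weightLattice n) f) :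
    f = (altCoeffs (f * alt rho)).sum fun κ c => c • ch κ := by
  refine mul_right_cancel₀ (alt_ne_zero (strictAnti_rho (n := n))) ?_
  conv_lhs => rw [IsAlt.eq_sum (hf.mul_isAlt (isAlt_alt rho)) (hs.mul (suppIn_alt
    (A := weightLattice n) (comp_mem_weightLattice rho_mem)) fun a ha b hb => add_mem ha hb)]
  simp only [Finsupp.sum, sum_mul, smul_mul_assoc, h _]

/-- Both sides, times `n!`, are the constant term of `f a_ρ` times the conjugate of `χ_ν a_ρ`: the
multiplicity of `V_ν` in `f` is that of the trivial representation in `f ⊗ V_ν*`. -/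
theorem coeff_inv_mul (h : IsSchurFamily ch) {f : TrigPoly n} (hf : IsSymm f) (ν : Weight n) :
    (f * inv (ch ν) * alt rho).coeff rho = (f * alt rho).coeff (shifted ν) := by
  have hn : (n.factorial : ℂ) ≠ 0 := by exact_mod_cast n.factorial_ne_zero
  refine mul_left_cancel₀ hn ?_
  rw [← IsAlt.coeff_zero_mul_inv_alt ((hf.mul (h.isSymm ν).inv).mul_isAlt (isAlt_alt rho)),
    ← IsAlt.coeff_zero_mul_inv_alt (hf.mul_isAlt (isAlt_alt rho)), ← h ν, map_mul]
  have h1 : f * inv (ch ν) * alt rho * inv (alt rho) =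
      f * alt rho * (inv (ch ν) * inv (alt rho)) := by ring
  rw [h1]

/-- Times `n!`, the two sides are constant terms of products that `inv` exchanges, and `inv` keeps
the constant term. In other words, the transpose of multiplication by `f` is multiplication by `inv
f`. -/
theorem coeff_swap (h : IsSchurFamily ch) {f : TrigPoly n} (hf : IsSymm f) (μ ν : Weight n) :
    (f * ch μ * alt rho).coeff (shifted ν) = (inv f * ch ν * alt rho).coeff (shifted μ) := by
  have hn : (n.factorial : ℂ) ≠ 0 := by exact_mod_cast n.factorial_ne_zero
  refine mul_left_cancel₀ hn ?_
  rw [← IsAlt.coeff_zero_mul_inv_alt ((hf.mul (h.isSymm μ)).mul_isAlt (isAlt_alt rho)),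
    ← IsAlt.coeff_zero_mul_inv_alt ((hf.inv.mul (h.isSymm ν)).mul_isAlt (isAlt_alt rho))]
  have h1 : inv (f * ch μ * alt rho * inv (alt (shifted ν))) =
      inv f * ch ν * alt rho * inv (alt (shifted μ)) := by
    rw [← h ν, ← h μ, map_mul, inv_inv]
    simp only [map_mul]
    ring
  rw [← h1, coeff_inv, neg_zero]

end IsSchurFamily

/-! ### Values at the identity -/

theorem ev_mul_rho_alt (ε : ℝ) (x : Fin n → ℝ) : ev (ε • rho) (alt x) =
    ∏ q : Fin n × Fin n with q.1 < q.2,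
      (2 * I * ((Real.sin (ε * (x q.1 - x q.2) / 2) : ℝ) : ℂ)) := by
  have h : ev (ε • rho) (alt x) = ev (ε • x) (alt rho) := by
    rw [ev_alt_comm, ev_alt, ev_alt]
    congr 1
    ext k l
    simp only [Matrix.of_apply, Pi.smul_apply, smul_eq_mul]
    congr 3
    ring
  rw [h, ev_alt_rho]
  simp only [Pi.smul_apply, smul_eq_mul, mul_sub]

theorem tendsto_sin_mul_div (a b : ℝ) (hb : b ≠ 0) :
    Tendsto (fun ε : ℝ => Real.sin (ε * a / 2) / Real.sin (ε * b / 2)) (𝓝[≠] 0) (𝓝 (a / b)) := by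
  have key : ∀ c : ℝ, Tendsto (fun ε : ℝ => Real.sin (ε * c / 2) / ε) (𝓝[≠] 0) (𝓝 (c / 2)) := by
    intro c
    have hd : HasDerivAt (fun ε : ℝ => Real.sin (ε * c / 2)) (c / 2) 0 := by
      have h1 : HasDerivAt (fun ε : ℝ => ε * c / 2) (c / 2) 0 := by
        simpa using ((hasDerivAt_id (0 : ℝ)).mul_const c).div_const 2
      simpa using h1.sin
    refine (hasDerivAt_iff_tendsto_slope_zero.mp hd).congr fun ε => ?_
    simp [div_eq_inv_mul]
  refine (((key a).div (key b) (by simpa using hb)).congr' ?_).trans (by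
    rw [div_div_div_cancel_right₀ two_ne_zero])
  filter_upwards [self_mem_nhdsWithin] with ε hε
  exact div_div_div_cancel_right₀ hε _ _

theorem tendsto_ev_alt_div (x : Fin n → ℝ) :
    Tendsto (fun ε : ℝ => ev (n := n) (ε • rho) (alt x) / ev (n := n) (ε • rho) (alt rho)) (𝓝[≠] 0)
      (𝓝 ((vander x / vander (rho : Fin n → ℝ) : ℝ) : ℂ)) := by
  simp only [ev_mul_rho_alt, ← Finset.prod_div_distrib, vander]
  rw [Complex.ofReal_prod]
  refine tendsto_finsetProd _ fun q hq => ?_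
  have hne : (rho q.1 : ℝ) - rho q.2 ≠ 0 := (sub_pos.mpr (strictAnti_rho (mem_filter.mp hq).2)).ne'
  have h := (Complex.continuous_ofReal.tendsto _).comp
    (tendsto_sin_mul_div (x q.1 - x q.2) (rho q.1 - rho q.2) hne)
  refine h.congr fun ε => ?_
  simp only [Function.comp, Complex.ofReal_div]
  rw [mul_div_mul_left _ _ (by simp)]

theorem vander_rho (hn : 1 ≤ n) : vander (rho : Fin n → ℝ) = (Nat.superFactorial (n - 1) : ℝ) := by
  obtain ⟨m, rfl⟩ : ∃ m, n = m + 1 := ⟨n - 1, by omega⟩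
  rw [Nat.add_sub_cancel, ← Matrix.det_vandermonde_id_eq_superFactorial, Matrix.det_vandermonde,
    ← prod_pairs (fun i j : Fin (m + 1) => ((j : ℕ) : ℝ) - ((i : ℕ) : ℝ)), vander]
  refine prod_congr rfl fun q _ => ?_
  rw [rho_apply, rho_apply]; ring

theorem vander_pos {x : Fin n → ℝ} (hx : StrictAnti x) : 0 < vander x :=
  Finset.prod_pos fun _ hq => sub_pos.mpr (hx (mem_filter.mp hq).2)

theorem ev_alt_rho_ne_zero :
    ∀ᶠ ε : ℝ in 𝓝[≠] 0, ev (n := n) (ε • (rho : Fin n → ℝ)) (alt rho) ≠ 0 := by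
  have h := tendsto_ev_alt_div (rho : Fin n → ℝ)
  rw [div_self (vander_pos strictAnti_rho).ne'] at h
  filter_upwards [h.eventually_ne (by simp : ((1 : ℝ) : ℂ) ≠ 0)] with ε hε h0
  rw [h0] at hε
  simp at hε

/-- Weyl's dimension formula. The denominator vanishes at the identity, so the value is a limit
along `ε ρ`, where both alternants are products of sines. -/
theorem ev_zero_of_mul_alt {f : TrigPoly n} {x : Fin n → ℝ} (h : f * alt rho = alt x) :
    ev 0 f = ((vander x / vander (rho : Fin n → ℝ) : ℝ) : ℂ) := by
  have h1 : Tendsto (fun ε : ℝ => ev (ε • (rho : Fin n → ℝ)) f) (𝓝[≠] 0) (𝓝 (ev 0 f)) := by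
    have h2 : Continuous fun ε : ℝ => ev (ε • (rho : Fin n → ℝ)) f :=
      (continuous_ev f).comp (by fun_prop)
    simpa using (h2.tendsto 0).mono_left nhdsWithin_le_nhds
  refine tendsto_nhds_unique h1 ((tendsto_ev_alt_div x).congr' ?_)
  filter_upwards [ev_alt_rho_ne_zero (n := n)] with ε hε
  rw [← h, map_mul, mul_div_cancel_right₀ _ hε]

/-! ### Polynomial functions on matrices -/

/-- Polynomials in the entries of an `n × n` matrix. -/
abbrev MPoly (n : ℕ) : Type := MvPolynomial (Fin n × Fin n) ℂ

/-- Evaluation at a matrix. -/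
def evalM (g : Matrix (Fin n) (Fin n) ℂ) : MPoly n →ₐ[ℂ] ℂ := MvPolynomial.aeval fun q => g q.1 q.2

/-- Right translation `f ↦ f (· * x)`. -/
def rtrans (x : Matrix (Fin n) (Fin n) ℂ) : MPoly n →ₐ[ℂ] MPoly n :=
  MvPolynomial.aeval fun q => ∑ l, x l q.2 • MvPolynomial.X (q.1, l)

theorem evalM_X (g : Matrix (Fin n) (Fin n) ℂ) (q : Fin n × Fin n) :
    evalM g (MvPolynomial.X q) = g q.1 q.2 := by simp [evalM]

theorem rtrans_X (x : Matrix (Fin n) (Fin n) ℂ) (q : Fin n × Fin n) :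
    rtrans x (MvPolynomial.X q) = ∑ l, x l q.2 • MvPolynomial.X (q.1, l) := by simp [rtrans]

theorem evalM_rtrans (g x : Matrix (Fin n) (Fin n) ℂ) (f : MPoly n) :
    evalM g (rtrans x f) = evalM (g * x) f := by
  have : (evalM g).comp (rtrans x) = evalM (g * x) := by
    refine MvPolynomial.algHom_ext fun q => ?_
    simp only [AlgHom.comp_apply, rtrans_X, map_sum, map_smul, evalM_X, Matrix.mul_apply,
      smul_eq_mul, mul_comm]
  exact DFunLike.congr_fun this f

theorem mpoly_ext {f g : MPoly n} (h : ∀ x, evalM x f = evalM x g) : f = g := by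
  refine MvPolynomial.funext fun v => ?_
  have key : ∀ p : MPoly n, MvPolynomial.eval v p = evalM (Matrix.of fun i j => v (i, j)) p :=
    fun p => (DFunLike.congr_fun (MvPolynomial.coe_aeval_eq_eval v) p).symm
  rw [key, key, h]

theorem rtrans_mul (x y : Matrix (Fin n) (Fin n) ℂ) (f : MPoly n) :
    rtrans (x * y) f = rtrans x (rtrans y f) :=
  mpoly_ext fun g => by simp only [evalM_rtrans, mul_assoc]

theorem rtrans_one (f : MPoly n) : rtrans 1 f = f :=
  mpoly_ext fun g => by simp only [evalM_rtrans, mul_one]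

theorem evalM_smul {f : MPoly n} {d : ℕ} (hf : f.IsHomogeneous d) (c : ℂ)
    (g : Matrix (Fin n) (Fin n) ℂ) : evalM (c • g) f = c ^ d * evalM g f := by
  simp only [evalM, MvPolynomial.aeval_def, MvPolynomial.eval₂_eq', mul_sum,
    Matrix.smul_apply, smul_eq_mul, mul_pow, prod_mul_distrib]
  refine sum_congr rfl fun e he => ?_
  have h1 := hf (MvPolynomial.mem_support_iff.mp he)
  rw [Finset.prod_pow_eq_pow_sum]
  have h2 : ∑ i, e i = d := by
    rw [← h1, Finsupp.weight_apply, Finsupp.sum_fintype _ _ (by simp)]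
    simp
  rw [h2]; ring

/-! ### Zariski density of `SU(n)` -/

/-- A unitary matrix is a scalar, an `n`-th root of its determinant, times an element of `SU(n)`,
and a homogeneous polynomial sees the scalar only as a factor. -/
theorem evalM_eq_zero_of_unitary (hn : n ≠ 0) {f : MPoly n} {d : ℕ}
    (hf : f.IsHomogeneous d) (h : ∀ x : SU n, evalM x.1 f = 0) {U : Matrix (Fin n) (Fin n) ℂ}
    (hU : U ∈ Matrix.unitaryGroup (Fin n) ℂ) : evalM U f = 0 := by
  obtain ⟨c, hc⟩ := IsAlgClosed.exists_pow_nat_eq U.det (Nat.pos_of_ne_zero hn)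
  have hdet : ‖U.det‖ = 1 := by
    have h1 := Matrix.det_of_mem_unitary hU
    exact CStarRing.norm_of_mem_unitary h1
  have hcn : ‖c‖ = 1 := by
    have h2 : ‖c‖ ^ n = 1 := by rw [← norm_pow, hc, hdet]
    exact (pow_eq_one_iff_of_nonneg (norm_nonneg _) hn).mp h2
  have hc0 : c ≠ 0 := norm_ne_zero_iff.mp (by rw [hcn]; exact one_ne_zero)
  have hcc : c⁻¹ * star c⁻¹ = 1 := by
    rw [Complex.star_def, Complex.mul_conj, Complex.normSq_eq_norm_sq, norm_inv, hcn]; simp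
  have hS : c⁻¹ • U ∈ Matrix.specialUnitaryGroup (Fin n) ℂ := by
    rw [mem_specialUnitaryGroup_iff]
    constructor
    · rw [mem_unitaryGroup_iff] at hU ⊢
      rw [star_smul, Matrix.smul_mul, Matrix.mul_smul, smul_smul, hU, hcc, one_smul]
    · rw [Matrix.det_smul, Fintype.card_fin, inv_pow, hc, inv_mul_cancel₀]
      exact norm_ne_zero_iff.mp (by rw [hdet]; exact one_ne_zero)
  have h1 : U = c • (c⁻¹ • U) := by rw [smul_smul, mul_inv_cancel₀ hc0, one_smul]
  rw [h1, evalM_smul hf, h ⟨_, hS⟩, mul_zero]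

theorem cayley_mem {X : Matrix (Fin n) (Fin n) ℂ} (hX : star X = -X)
    (hdet : IsUnit (1 + X).det) : (1 - X) * (1 + X)⁻¹ ∈ Matrix.unitaryGroup (Fin n) ℂ := by
  have h1 : star (1 + X) = 1 - X := by rw [star_add, hX, star_one, sub_eq_add_neg]
  have h2 : star (1 - X) = 1 + X := by rw [star_sub, hX, star_one, sub_neg_eq_add]
  have hu : IsUnit (1 - X).det := by
    rw [← h1, Matrix.star_eq_conjTranspose, Matrix.det_conjTranspose]
    exact hdet.star
  rw [mem_unitaryGroup_iff', star_mul, h2, Matrix.star_eq_conjTranspose,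
    Matrix.conjTranspose_nonsing_inv, ← Matrix.star_eq_conjTranspose, h1]
  have hcomm : (1 + X) * (1 - X) = (1 - X) * (1 + X) := by noncomm_ring
  rw [mul_assoc, ← mul_assoc (1 + X), hcomm, mul_assoc, ← mul_assoc,
    Matrix.nonsing_inv_mul _ hu, one_mul, Matrix.mul_nonsing_inv _ hdet]

/-- The polynomial `z ↦ f ((1 - X) adj (1 + X))` for `X = A + z B`. -/
theorem exists_polynomial_cayley (f : MPoly n) (A B : Matrix (Fin n) (Fin n) ℂ) :
    ∃ p : Polynomial ℂ, ∀ z : ℂ, p.eval z =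
      evalM ((1 - (A + z • B)) * (1 + (A + z • B)).adjugate) f := by
  let X : Matrix (Fin n) (Fin n) (Polynomial ℂ) :=
    A.map Polynomial.C + (Polynomial.X : Polynomial ℂ) • B.map Polynomial.C
  refine ⟨MvPolynomial.aeval (fun q => ((1 - X) * (1 + X).adjugate) q.1 q.2) f, fun z => ?_⟩
  have hX : (Polynomial.evalRingHom z).mapMatrix X = A + z • B := by
    ext i j
    simp [X, mul_comm z]
  have h1 : (Polynomial.evalRingHom z).mapMatrix ((1 - X) * (1 + X).adjugate) =
      (1 - (A + z • B)) * (1 + (A + z • B)).adjugate := by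
    rw [map_mul, RingHom.map_adjugate, map_sub, map_add _ 1 X, map_one, hX]
  rw [← h1, ← Polynomial.coe_evalRingHom, evalM]
  generalize (1 - X) * (1 + X).adjugate = Y
  simp only [MvPolynomial.aeval_def, MvPolynomial.eval₂_eq', map_sum, map_mul, map_prod, map_pow,
    RingHom.mapMatrix_apply, Matrix.map_apply]
  simp

/-- For skew-Hermitian `X` the number `⟨y, X y⟩` is imaginary, so `1 + X` is invertible and the
Cayley transform of `X` is unitary. The adjugate in place of the inverse keeps the expression
polynomial in `X`; homogeneity absorbs the determinant. -/
theorem evalM_cayley_skew {f : MPoly n} {d : ℕ} (hf : f.IsHomogeneous d)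
    (h : ∀ U ∈ Matrix.unitaryGroup (Fin n) ℂ, evalM U f = 0) {X : Matrix (Fin n) (Fin n) ℂ}
    (hX : star X = -X) : evalM ((1 - X) * (1 + X).adjugate) f = 0 := by
  have hpos : IsUnit (1 + X).det := by
    rw [← Matrix.isUnit_iff_isUnit_det]
    refine Matrix.mulVec_injective_iff_isUnit.mp fun v w hvw => ?_
    rw [← sub_eq_zero] at hvw ⊢
    rw [← Matrix.mulVec_sub] at hvw
    set y := v - w
    have h1 : star y ⬝ᵥ ((1 + X) *ᵥ y) = 0 := by rw [hvw, dotProduct_zero]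
    rw [Matrix.add_mulVec, Matrix.one_mulVec, dotProduct_add] at h1
    have h2 : star (star y ⬝ᵥ (X *ᵥ y)) = -(star y ⬝ᵥ (X *ᵥ y)) := by
      conv_lhs => rw [Matrix.star_dotProduct, star_star, Matrix.star_mulVec,
        ← Matrix.star_eq_conjTranspose, hX, Matrix.vecMul_neg, dotProduct_comm]
      rw [dotProduct_neg, dotProduct_comm, ← Matrix.dotProduct_mulVec]
    have h3 : star (star y ⬝ᵥ y) = star y ⬝ᵥ y := by
      conv_lhs => rw [Matrix.star_dotProduct, star_star]
    have h4 : star y ⬝ᵥ y = 0 := by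
      have h5 := congrArg star h1
      rw [star_add, h2, h3, star_zero] at h5
      linear_combination (h1 + h5) / 2
    exact dotProduct_star_self_eq_zero.mp h4
  have h1 : (1 - X) * (1 + X).adjugate = (1 + X).det • ((1 - X) * (1 + X)⁻¹) := by
    rw [Matrix.inv_def, Matrix.mul_smul, smul_smul, Ring.mul_inverse_cancel _ hpos, one_smul]
  rw [h1, evalM_smul hf, h _ (cayley_mem hX hpos), mul_zero]

/-- A homogeneous polynomial vanishing on `SU(n)` is zero. -/
theorem eq_zero_of_evalM_SU (hn : n ≠ 0) {f : MPoly n} {d : ℕ}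
    (hf : f.IsHomogeneous d) (h : ∀ x : SU n, evalM x.1 f = 0) : f = 0 := by
  have hU := fun U hU => evalM_eq_zero_of_unitary (U := U) hn hf h hU
  have hall : ∀ X : Matrix (Fin n) (Fin n) ℂ, evalM ((1 - X) * (1 + X).adjugate) f = 0 := by
    intro X
    -- Both `A` and `B` are skew-Hermitian and `X = A - i B`. The polynomial `z ↦ f(…)` at `A + z B`
    -- vanishes for real `z`, hence also at `z = -i`.
    set A := (2⁻¹ : ℂ) • (X - star X)
    set B := (2⁻¹ * I : ℂ) • (X + star X)
    obtain ⟨p, hp⟩ := exists_polynomial_cayley f A B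
    have hp0 : p = 0 := by
      refine Polynomial.eq_zero_of_infinite_isRoot p ?_
      refine (Set.infinite_range_of_injective Complex.ofReal_injective).mono ?_
      rintro _ ⟨r, rfl⟩
      change p.eval _ = 0
      rw [hp]
      refine evalM_cayley_skew hf hU ?_
      simp only [A, B, star_add, star_smul, star_sub, star_star, star_mul']
      ext i j
      simp
      ring
    have h1 := hp (-I)
    rw [hp0, Polynomial.eval_zero] at h1
    have h2 : A + (-I) • B = X := by
      ext i j
      simp only [A, B, Matrix.add_apply, Matrix.smul_apply, Matrix.sub_apply, smul_eq_mul]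
      linear_combination (-(2⁻¹ : ℂ) * (X i j + star X i j)) * Complex.I_mul_I
    rw [h2] at h1
    exact h1.symm
  -- The factor `det (1 + g)` disposes of the matrices without a Cayley transform.
  let D : MPoly n := (1 + Matrix.mvPolynomialX (Fin n) (Fin n) ℂ).det
  have hD : ∀ g, evalM g D = (1 + g).det := by
    intro g
    have : (evalM g).toRingHom.mapMatrix (1 + Matrix.mvPolynomialX (Fin n) (Fin n) ℂ) = 1 + g := by
      rw [map_add, map_one]
      congr 1
      ext i j
      simp [evalM_X]
    rw [← this, ← RingHom.map_det]; rfl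
  have hD0 : D ≠ 0 := by
    intro h0
    have := hD 0
    rw [h0] at this
    simp at this
  have hfD : f * D = 0 := by
    refine mpoly_ext fun g => ?_
    rw [map_mul, hD, map_zero]
    by_cases hg : (1 + g).det = 0
    · rw [hg, mul_zero]
    have hu : IsUnit (1 + g).det := isUnit_iff_ne_zero.mpr hg
    set Y := (1 + g)⁻¹
    have hY1 : (1 + g) * Y = 1 := Matrix.mul_nonsing_inv _ hu
    have hY2 : Y * (1 + g) = 1 := Matrix.nonsing_inv_mul _ hu
    have hX1 : 1 + (1 - g) * Y = (2 : ℂ) • Y := by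
      have h2 : 1 + g + (1 - g) = (2 : ℂ) • (1 : Matrix (Fin n) (Fin n) ℂ) := by rw [two_smul]; abel
      calc 1 + (1 - g) * Y = (1 + g + (1 - g)) * Y := by rw [add_mul (1 + g), hY1]
        _ = _ := by rw [h2, Matrix.smul_mul, one_mul]
    have hX2 : 1 - (1 - g) * Y = g * ((2 : ℂ) • Y) := by
      have h2 : 1 + g - (1 - g) = (2 : ℂ) • g := by rw [two_smul]; abel
      calc 1 - (1 - g) * Y = (1 + g - (1 - g)) * Y := by rw [sub_mul (1 + g), hY1]
        _ = _ := by rw [h2, Matrix.smul_mul, Matrix.mul_smul]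
    -- The Cayley transform is an involution: at its value `(1 - g) Y` the expression `(1 - X) adj
    -- (1 + X)` is the multiple `det (2 Y) g` of `g`.
    have h1 := hall ((1 - g) * Y)
    rw [hX2, hX1, mul_assoc, Matrix.mul_adjugate, Matrix.mul_smul, mul_one, evalM_smul hf] at h1
    have hdY : ((2 : ℂ) • Y).det ≠ 0 := by
      rw [Matrix.det_smul]
      refine mul_ne_zero (pow_ne_zero _ two_ne_zero) fun h0 => ?_
      have := congrArg Matrix.det hY1
      rw [Matrix.det_mul, h0, mul_zero, Matrix.det_one] at this
      exact zero_ne_one this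
    rw [(mul_eq_zero.mp h1).resolve_left (pow_ne_zero _ hdY), zero_mul]
  exact (mul_eq_zero.mp hfD).resolve_right hD0

/-! ### Products of minors on the first rows -/

/-- The minor on the first `k + 1` rows and the columns `φ`. -/
def minorAt (k : Fin n) (φ : Fin (k + 1) → Fin n) : MPoly n :=
  (Matrix.of fun a b : Fin (k + 1) =>
    (MvPolynomial.X (Fin.castLE (Nat.succ_le_of_lt k.2) a, φ b) : MPoly n)).det

/-- Choices of columns for the factors of a product of minors with multiplicities `l`. -/
abbrev Cols (l : Fin n → ℕ) : Type := (k : Fin n) → Fin (l k) → Fin (k + 1) → Fin n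

/-- The product of the minors with columns `φ`. -/
def prodMinor {l : Fin n → ℕ} (φ : Cols l) : MPoly n := ∏ k, ∏ r, minorAt k (φ k r)

/-- The columns of the leading minors. -/
def leadCols (l : Fin n → ℕ) : Cols l := fun k _ => Fin.castLE (Nat.succ_le_of_lt k.2)

/-- The highest weight vector. -/
def hwv (l : Fin n → ℕ) : MPoly n := prodMinor (leadCols l)

/-- The total weight of the columns `φ`, if the column `j` has weight `c j`. -/
def colsWeight {l : Fin n → ℕ} {M : Type*} [AddCommMonoid M] (c : Fin n → M)
    (φ : Cols l) : M := ∑ k, ∑ r, ∑ b, c (φ k r b)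

theorem isWeightedHomogeneous_minorAt {M : Type*} [AddCommMonoid M] (c : Fin n → M)
    (k : Fin n) (φ : Fin (k + 1) → Fin n) :
    MvPolynomial.IsWeightedHomogeneous (fun q : Fin n × Fin n => c q.2) (minorAt k φ)
      (∑ b, c (φ b)) := by
  rw [minorAt, Matrix.det_apply]
  refine MvPolynomial.IsWeightedHomogeneous.sum _ _ _ fun σ _ => ?_
  rw [Units.smul_def, zsmul_eq_mul, ← map_intCast (MvPolynomial.C : ℂ →+* MPoly n)]
  have := (MvPolynomial.isWeightedHomogeneous_C (fun q : Fin n × Fin n => c q.2)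
    (((Equiv.Perm.sign σ : ℤ) : ℂ))).mul (MvPolynomial.IsWeightedHomogeneous.prod Finset.univ
      (fun i => (MvPolynomial.X (Fin.castLE (Nat.succ_le_of_lt k.2) (σ i), φ i) : MPoly n))
      (fun i => c (φ i)) fun i _ => MvPolynomial.isWeightedHomogeneous_X ℂ _ _)
  simpa using this

theorem isWeightedHomogeneous_prodMinor {l : Fin n → ℕ} {M : Type*} [AddCommMonoid M]
    (c : Fin n → M) (φ : Cols l) :
    MvPolynomial.IsWeightedHomogeneous (fun q : Fin n × Fin n => c q.2) (prodMinor φ)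
      (colsWeight c φ) :=
  MvPolynomial.IsWeightedHomogeneous.prod _ _ _ fun k _ =>
    MvPolynomial.IsWeightedHomogeneous.prod _ _ _ fun _ _ => isWeightedHomogeneous_minorAt c k _

/-- The degree of the products of minors. -/
def labelDeg (l : Fin n → ℕ) : ℕ := ∑ k, l k * (k + 1)

theorem colsWeight_one {l : Fin n → ℕ} (φ : Cols l) : colsWeight (fun _ => 1) φ = labelDeg l := by
  simp [colsWeight, labelDeg]

theorem isHomogeneous_prodMinor {l : Fin n → ℕ} (φ : Cols l) :
    (prodMinor φ).IsHomogeneous (labelDeg l) := by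
  have := isWeightedHomogeneous_prodMinor (fun _ => 1) φ
  rwa [colsWeight_one] at this

/-- The columns of the translated minor are combinations of the columns of the generic matrix.
Multilinearity expands over all maps `ψ`; those that are not injective contribute zero minors. -/
theorem rtrans_minorAt (x : Matrix (Fin n) (Fin n) ℂ) (k : Fin n) (φ : Fin (k + 1) → Fin n) :
    rtrans x (minorAt k φ) = ∑ ψ : Fin (k + 1) → Fin n, (∏ b, x (ψ b) (φ b)) • minorAt k ψ := by
  have h1 : rtrans x (minorAt k φ) = (Matrix.detRowAlternating (fun b : Fin (k + 1) =>
      ∑ j : Fin n, (MvPolynomial.C (x j (φ b)) : MPoly n) • fun a : Fin (k + 1) =>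
        (MvPolynomial.X (Fin.castLE (Nat.succ_le_of_lt k.2) a, j) : MPoly n))) := by
    rw [minorAt, AlgHom.map_det, ← Matrix.det_transpose]
    change Matrix.det _ = Matrix.det _
    congr 1
    ext1 b a
    simp only [Matrix.transpose_apply, AlgHom.mapMatrix_apply, Matrix.map_apply, Matrix.of_apply,
      rtrans_X, Finset.sum_apply, Pi.smul_apply, MvPolynomial.smul_eq_C_mul, smul_eq_mul]
  rw [h1, ← AlternatingMap.coe_multilinearMap, MultilinearMap.map_sum]
  refine sum_congr rfl fun ψ _ => ?_
  rw [MultilinearMap.map_smul_univ, ← map_prod, smul_eq_mul, ← MvPolynomial.smul_eq_C_mul,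
    minorAt, ← Matrix.det_transpose]
  rfl

theorem rtrans_prodMinor {l : Fin n → ℕ} (x : Matrix (Fin n) (Fin n) ℂ) (φ : Cols l) :
    rtrans x (prodMinor φ) =
      ∑ ψ : Cols l, (∏ k, ∏ r, ∏ b, x (ψ k r b) (φ k r b)) • prodMinor ψ := by
  simp only [prodMinor, map_prod, rtrans_minorAt, Finset.prod_univ_sum, Fintype.piFinset_univ]
  refine sum_congr rfl fun ψ _ => ?_
  simp only [MvPolynomial.smul_eq_C_mul, prod_mul_distrib, map_prod]

theorem evalM_minorAt (g : Matrix (Fin n) (Fin n) ℂ) (k : Fin n) (φ : Fin (k + 1) → Fin n) :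
    evalM g (minorAt k φ) = (g.submatrix (Fin.castLE (Nat.succ_le_of_lt k.2)) φ).det := by
  rw [minorAt, AlgHom.map_det]
  congr 1
  ext a b
  simp [evalM_X]

/-- The partition with multiplicities `l`. -/
def part (l : Fin n → ℕ) (j : Fin n) : ℕ := ∑ k ∈ Finset.Ici j, l k

theorem castLE_le (k j : Fin n) :
    (∃ a : Fin (k + 1), Fin.castLE (Nat.succ_le_of_lt k.2) a = j) ↔ j ≤ k := by
  constructor
  · rintro ⟨a, rfl⟩
    have := a.2
    simp only [Fin.le_def, Fin.val_castLE]
    omega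
  · intro h
    exact ⟨⟨j, by rw [Fin.le_def] at h; omega⟩, rfl⟩

theorem sum_castLE {M : Type*} [AddCommMonoid M] (k : Fin n) (f : Fin n → M) :
    ∑ a : Fin (k + 1), f (Fin.castLE (Nat.succ_le_of_lt k.2) a) = ∑ j ∈ Finset.Iic k, f j := by
  refine Finset.sum_bij (fun a _ => Fin.castLE (Nat.succ_le_of_lt k.2) a) ?_ ?_ ?_ ?_
  · intro a _
    exact Finset.mem_Iic.mpr ((castLE_le k _).mp ⟨a, rfl⟩)
  · intro a _ b _ h
    exact Fin.castLE_injective _ h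
  · intro j hj
    obtain ⟨a, ha⟩ := (castLE_le k j).mpr (Finset.mem_Iic.mp hj)
    exact ⟨a, mem_univ _, ha⟩
  · intro a _; rfl

theorem prod_castLE {M : Type*} [CommMonoid M] (k : Fin n) (f : Fin n → M) :
    ∏ a : Fin (k + 1), f (Fin.castLE (Nat.succ_le_of_lt k.2) a) = ∏ j ∈ Finset.Iic k, f j :=
  sum_castLE (M := Additive M) k f

theorem prod_part (l : Fin n → ℕ) {M : Type*} [CommMonoid M] (z : Fin n → M) :
    ∏ k, (∏ j ∈ Finset.Iic k, z j) ^ l k = ∏ j, z j ^ part l j := by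
  simp only [part, ← Finset.prod_pow_eq_pow_sum, ← Finset.prod_pow]
  refine Finset.prod_comm' fun k j => ?_
  simp

theorem sum_part (l : Fin n → ℕ) {M : Type*} [AddCommMonoid M] (z : Fin n → M) :
    ∑ k, l k • (∑ j ∈ Finset.Iic k, z j) = ∑ j, part l j • z j :=
  prod_part l (M := Multiplicative M) z

theorem submatrix_lower_mul {b : Matrix (Fin n) (Fin n) ℂ} (hb : ∀ i j, i < j → b i j = 0)
    (g : Matrix (Fin n) (Fin n) ℂ) (k : Fin n) (φ : Fin (k + 1) → Fin n) :
    (b * g).submatrix (Fin.castLE (Nat.succ_le_of_lt k.2)) φ =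
      b.submatrix (Fin.castLE (Nat.succ_le_of_lt k.2)) (Fin.castLE (Nat.succ_le_of_lt k.2)) *
        g.submatrix (Fin.castLE (Nat.succ_le_of_lt k.2)) φ := by
  ext a c
  simp only [Matrix.submatrix_apply, Matrix.mul_apply]
  rw [sum_castLE k (fun j => b (Fin.castLE _ a) j * g j (φ c))]
  refine (Finset.sum_subset (Finset.subset_univ _) fun j _ hj => ?_).symm
  rw [hb _ _ (lt_of_le_of_lt ((castLE_le k _).mp ⟨a, rfl⟩) (by simpa using hj)), zero_mul]

theorem det_submatrix_lower {b : Matrix (Fin n) (Fin n) ℂ}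
    (hb : ∀ i j, i < j → b i j = 0) (k : Fin n) :
    (b.submatrix (Fin.castLE (Nat.succ_le_of_lt k.2)) (Fin.castLE (Nat.succ_le_of_lt k.2))).det =
      ∏ j ∈ Finset.Iic k, b j j := by
  rw [Matrix.det_of_isLowerTriangular, ← prod_castLE]
  · rfl
  · intro i j hij
    exact hb _ _ hij

/-- Products of minors on the first rows are covariant under lower triangular matrices. -/
theorem evalM_lower_mul {l : Fin n → ℕ} {b : Matrix (Fin n) (Fin n) ℂ}
    (hb : ∀ i j, i < j → b i j = 0) (g : Matrix (Fin n) (Fin n) ℂ) (φ : Cols l) :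
    evalM (b * g) (prodMinor φ) = (∏ j, b j j ^ part l j) * evalM g (prodMinor φ) := by
  simp only [prodMinor, map_prod, evalM_minorAt, submatrix_lower_mul hb, Matrix.det_mul,
    det_submatrix_lower hb, prod_mul_distrib, Finset.prod_const, card_univ,
    Fintype.card_fin, prod_part]

/-- Leading minors are unchanged by transposition, which turns the upper triangular case into the
lower triangular one. -/
theorem evalM_mul_upper {l : Fin n → ℕ} {b : Matrix (Fin n) (Fin n) ℂ}
    (hb : ∀ i j, j < i → b i j = 0) (g : Matrix (Fin n) (Fin n) ℂ) :
    evalM (g * b) (hwv l) = (∏ j, b j j ^ part l j) * evalM g (hwv l) := by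
  have key : ∀ (A : Matrix (Fin n) (Fin n) ℂ), evalM A (hwv l) = evalM Aᵀ (hwv l) := by
    intro A
    simp only [hwv, prodMinor, map_prod, evalM_minorAt, leadCols]
    refine prod_congr rfl fun k _ => prod_congr rfl fun r _ => ?_
    rw [← Matrix.det_transpose]
    rfl
  rw [key, Matrix.transpose_mul, hwv, evalM_lower_mul (b := bᵀ) (fun i j h => hb j i h), ← hwv, ← key]
  rfl

theorem rtrans_upper_hwv {l : Fin n → ℕ} {b : Matrix (Fin n) (Fin n) ℂ}
    (hb : ∀ i j, j < i → b i j = 0) : rtrans b (hwv l) = (∏ j, b j j ^ part l j) • hwv l :=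
  mpoly_ext fun g => by rw [evalM_rtrans, evalM_mul_upper hb, map_smul, smul_eq_mul]

theorem hwv_ne_zero (l : Fin n → ℕ) : hwv l ≠ 0 := by
  intro h
  have h1 : evalM (1 : Matrix (Fin n) (Fin n) ℂ) (hwv l) = 1 := by
    simp only [hwv, prodMinor, map_prod, evalM_minorAt, leadCols]
    refine Finset.prod_eq_one fun k _ => Finset.prod_eq_one fun r _ => ?_
    rw [Matrix.submatrix_one _ (Fin.castLE_injective _), Matrix.det_one]
  rw [h, map_zero] at h1
  exact zero_ne_one h1

/-! ### The polynomial model of the irreducible representations -/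

/-- The span of the products of minors. -/
def minorSpace (l : Fin n → ℕ) : Submodule ℂ (MPoly n) :=
  Submodule.span ℂ (Set.range (prodMinor (l := l)))

/-- The span of the `SU(n)`-translates of the highest weight vector. -/
def polyRep (l : Fin n → ℕ) : Submodule ℂ (MPoly n) :=
  Submodule.span ℂ (Set.range fun x : SU n => rtrans x.1 (hwv l))

theorem minorSpace_rtrans {l : Fin n → ℕ} (x : Matrix (Fin n) (Fin n) ℂ) {f : MPoly n}
    (hf : f ∈ minorSpace l) : rtrans x f ∈ minorSpace l := by
  have : minorSpace l ≤ (minorSpace l).comap (rtrans x).toLinearMap := by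
    refine Submodule.span_le.mpr ?_
    rintro _ ⟨φ, rfl⟩
    change rtrans x (prodMinor φ) ∈ minorSpace l
    rw [rtrans_prodMinor]
    exact Submodule.sum_mem _ fun ψ _ => Submodule.smul_mem _ _ (Submodule.subset_span ⟨ψ, rfl⟩)
  exact this hf

theorem polyRep_le (l : Fin n → ℕ) : polyRep l ≤ minorSpace l := by
  refine Submodule.span_le.mpr ?_
  rintro _ ⟨x, rfl⟩
  exact minorSpace_rtrans _ (Submodule.subset_span ⟨_, rfl⟩)

instance (l : Fin n → ℕ) : FiniteDimensional ℂ (minorSpace l) :=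
  FiniteDimensional.span_of_finite ℂ (Set.finite_range _)

instance (l : Fin n → ℕ) : FiniteDimensional ℂ (polyRep l) :=
  Submodule.finiteDimensional_of_le (polyRep_le l)

theorem minorSpace_isHomogeneous {l : Fin n → ℕ} {f : MPoly n} (hf : f ∈ minorSpace l) :
    f.IsHomogeneous (labelDeg l) := by
  have : minorSpace l ≤ MvPolynomial.homogeneousSubmodule _ _ (labelDeg l) := by
    refine Submodule.span_le.mpr ?_
    rintro _ ⟨φ, rfl⟩
    exact isHomogeneous_prodMinor φ
  exact this hf

theorem exists_eq_sum {l : Fin n → ℕ} {f : MPoly n} (hf : f ∈ minorSpace l) :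
    ∃ a : Cols l → ℂ, f = ∑ φ, a φ • prodMinor φ := by
  obtain ⟨a, ha⟩ := (Submodule.mem_span_range_iff_exists_fun ℂ).mp hf
  exact ⟨a, ha.symm⟩

/-- Translations act on `minorSpace l` by homogeneous polynomials in the matrix entries. -/
theorem rtrans_eq_sum {l : Fin n → ℕ} {f : MPoly n} (hf : f ∈ minorSpace l) :
    ∃ q : Cols l → MPoly n, (∀ ψ, (q ψ).IsHomogeneous (labelDeg l)) ∧
      ∀ x, rtrans x f = ∑ ψ, evalM x (q ψ) • prodMinor ψ := by
  obtain ⟨a, rfl⟩ := exists_eq_sum hf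
  refine ⟨fun ψ => ∑ φ, a φ • ∏ k, ∏ r, ∏ b, MvPolynomial.X (ψ k r b, φ k r b), fun ψ => ?_,
    fun x => ?_⟩
  · refine Submodule.sum_mem (MvPolynomial.homogeneousSubmodule _ _ _) fun φ _ =>
      Submodule.smul_mem _ _ ?_
    rw [MvPolynomial.mem_homogeneousSubmodule]
    have := MvPolynomial.IsHomogeneous.prod Finset.univ
      (fun k => ∏ r : Fin (l k), ∏ b, (MvPolynomial.X (ψ k r b, φ k r b) : MPoly n)) _
      fun k _ => MvPolynomial.IsHomogeneous.prod Finset.univ _ _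
      fun r _ => MvPolynomial.IsHomogeneous.prod Finset.univ _ _
      fun b _ => MvPolynomial.isHomogeneous_X ℂ _
    simpa [labelDeg] using this
  · simp only [map_sum, map_smul, rtrans_prodMinor, smul_sum, smul_smul, map_prod, evalM_X,
      smul_eq_mul, Finset.sum_smul]
    rw [sum_comm]

theorem exists_dual_ne_zero {V : Type*} [AddCommGroup V] [Module ℂ V] {W : Submodule ℂ V} {v : V}
    (hv : v ∉ W) : ∃ f : V →ₗ[ℂ] ℂ, f v ≠ 0 ∧ ∀ w ∈ W, f w = 0 := by
  obtain ⟨f, h1, h2⟩ := Submodule.exists_le_ker_of_notMem hv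
  exact ⟨f, h1, fun w hw => h2 hw⟩

theorem polyRep_rtrans_SU {l : Fin n → ℕ} (x : SU n) {f : MPoly n}
    (hf : f ∈ polyRep l) : rtrans x.1 f ∈ polyRep l := by
  induction hf using Submodule.span_induction with
  | mem f hf =>
    obtain ⟨y, rfl⟩ := hf
    have h1 : rtrans x.1 (rtrans y.1 (hwv l)) = rtrans (x * y).1 (hwv l) := by
      rw [← rtrans_mul, Submonoid.coe_mul]
    simp only [h1]
    exact Submodule.subset_span (Set.mem_range_self (x * y))
  | zero => rw [map_zero]; exact Submodule.zero_mem _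
  | add f g _ _ hf hg => rw [map_add]; exact Submodule.add_mem _ hf hg
  | smul c f _ hf => rw [map_smul]; exact Submodule.smul_mem _ _ hf

theorem isHomogeneous_sum_smul {d : ℕ} {ι : Type*} [Fintype ι] (c : ι → ℂ) {q : ι → MPoly n}
    (hq : ∀ i, (q i).IsHomogeneous d) : (∑ i, c i • q i).IsHomogeneous d := by
  refine MvPolynomial.IsHomogeneous.sum _ _ _ fun i _ => ?_
  rw [MvPolynomial.smul_eq_C_mul]
  simpa using (MvPolynomial.isHomogeneous_C (Fin n × Fin n) (c i)).mul (hq i)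

/-- `polyRep l` is stable under all translations. -/
theorem polyRep_rtrans (hn : n ≠ 0) {l : Fin n → ℕ} (x : Matrix (Fin n) (Fin n) ℂ)
    {f : MPoly n} (hf : f ∈ polyRep l) : rtrans x f ∈ polyRep l := by
  by_contra hx
  obtain ⟨L, h1, h2⟩ := exists_dual_ne_zero hx
  obtain ⟨q, hq, hxq⟩ := rtrans_eq_sum (polyRep_le l hf)
  have hL : ∀ y, L (rtrans y f) = evalM y (∑ ψ, L (prodMinor ψ) • q ψ) := by
    intro y
    rw [hxq, map_sum, map_sum]
    simp only [map_smul, smul_eq_mul, mul_comm]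
  -- For a functional `L` that vanishes on `polyRep l`, the matrix coefficient `y ↦ L (rtrans y f)`
  -- is a homogeneous polynomial in `y` vanishing on `SU(n)`, hence everywhere.
  have hq0 : ∑ ψ, L (prodMinor ψ) • q ψ = 0 :=
    eq_zero_of_evalM_SU hn (isHomogeneous_sum_smul _ hq) fun y => by
      rw [← hL, h2 _ (polyRep_rtrans_SU y hf)]
  rw [hL, hq0, map_zero] at h1
  exact h1 rfl

/-- Right translation on `polyRep l`. -/
def rtransOn (hn : n ≠ 0) (l : Fin n → ℕ) (x : Matrix (Fin n) (Fin n) ℂ) :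
    polyRep l →ₗ[ℂ] polyRep l :=
  (rtrans x).toLinearMap.restrict fun _ hf => polyRep_rtrans hn x hf

theorem coe_rtransOn (hn : n ≠ 0) (l : Fin n → ℕ) (x : Matrix (Fin n) (Fin n) ℂ)
    (f : polyRep l) : (rtransOn hn l x f : MPoly n) = rtrans x f.1 := rfl

/-- The Dynkin labels of `l`. -/
def dynkin (l : Fin n → ℕ) : Weight n := fun k => l ⟨k, by have := k.2; omega⟩

/-- Restriction of a polynomial to `SU(n)`. -/
def resSU (n : ℕ) : MPoly n →ₗ[ℂ] (SU n → ℂ) where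
  toFun f g := evalM g.1 f
  map_add' f g := by ext; simp
  map_smul' c f := by ext; simp

theorem resSU_rtrans (x : SU n) (f : MPoly n) :
    resSU n (rtrans x.1 f) = rightRegular (SU n) x (resSU n f) := by
  funext g
  exact evalM_rtrans _ _ _

theorem resSU_hwv (l : Fin n → ℕ) : resSU n (hwv l) = highestWeightVector (dynkin l) := by
  funext g
  change evalM g.1 (hwv l) = _
  rcases n with _ | m
  · simp [hwv, prodMinor, highestWeightVector]
  simp only [hwv, prodMinor, map_prod, map_pow, evalM_minorAt, leadCols, Finset.prod_const,
    card_univ, Fintype.card_fin, highestWeightVector]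
  rw [Fin.prod_univ_castSucc]
  -- The last leading minor is the determinant, which is 1 on `SU(n)`; so the last entry of `l`
  -- leaves no trace in the restriction.
  have h1 : ((g.1.submatrix (Fin.castLE (Nat.succ_le_of_lt (Fin.last m).2))
      (Fin.castLE (Nat.succ_le_of_lt (Fin.last m).2))).det) = 1 := by
    have := (mem_specialUnitaryGroup_iff.mp g.2).2
    rw [← this]
    rfl
  rw [h1, one_pow, mul_one]
  rfl

theorem map_polyRep (l : Fin n → ℕ) : (polyRep l).map (resSU n) = irrepSpace (dynkin l) := by
  rw [polyRep, Submodule.map_span, irrepSpace]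
  congr 1
  rw [← Set.range_comp]
  congr 1
  funext x
  simp only [Function.comp, resSU_rtrans, resSU_hwv]

theorem resSU_injOn (hn : n ≠ 0) (l : Fin n → ℕ) {f : MPoly n} (hf : f ∈ minorSpace l)
    (h : resSU n f = 0) : f = 0 :=
  eq_zero_of_evalM_SU hn (minorSpace_isHomogeneous hf) fun x => congrFun h x

/-- The polynomial model is isomorphic to the irreducible representation. -/
def polyRepEquiv (hn : n ≠ 0) (l : Fin n → ℕ) : polyRep l ≃ₗ[ℂ] irrepSpace (dynkin l) :=
  (LinearEquiv.ofInjective ((resSU n).domRestrict (polyRep l)) (by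
    rw [← LinearMap.ker_eq_bot, LinearMap.ker_eq_bot']
    intro f hf
    exact Subtype.ext (resSU_injOn hn l (polyRep_le l f.2) hf))).trans
  (LinearEquiv.ofEq _ _ (by rw [← map_polyRep, LinearMap.range_domRestrict]))

theorem coe_polyRepEquiv (hn : n ≠ 0) (l : Fin n → ℕ) (f : polyRep l) :
    (polyRepEquiv hn l f : SU n → ℂ) = resSU n f.1 := rfl

theorem polyRepEquiv_rtransOn (hn : n ≠ 0) (l : Fin n → ℕ) (x : SU n) (f : polyRep l) :
    polyRepEquiv hn l (rtransOn hn l x.1 f) = irrep (dynkin l) x (polyRepEquiv hn l f) :=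
  Subtype.ext (by
    rw [coe_polyRepEquiv, coe_rtransOn, resSU_rtrans, ← coe_polyRepEquiv hn l f]
    rfl)

theorem chi_dynkin (hn : n ≠ 0) (l : Fin n → ℕ) (x : SU n) :
    chi (dynkin l) x = LinearMap.trace ℂ _ (rtransOn hn l x.1) := by
  rw [chi, Representation.character, ← LinearMap.trace_conj' (rtransOn hn l x.1)
    (polyRepEquiv hn l)]
  congr 1
  ext1 f
  rw [LinearEquiv.conj_apply_apply, polyRepEquiv_rtransOn, LinearEquiv.apply_symm_apply]

/-! ### The infinitesimal action -/

/-- The derivation `∑_k X_{k i} ∂_{k j}`. -/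
def der (i j : Fin n) : Derivation ℂ (MPoly n) (MPoly n) :=
  MvPolynomial.mkDerivation ℂ fun q => if q.2 = j then MvPolynomial.X (q.1, i) else 0

theorem der_X (i j : Fin n) (q : Fin n × Fin n) :
    der i j (MvPolynomial.X q) = if q.2 = j then MvPolynomial.X (q.1, i) else 0 := by
  simp [der]

/-- Translation by `1 + s E_{ij}` with a formal parameter `s`. -/
def transCurve (i j : Fin n) : MPoly n →ₐ[ℂ] Polynomial (MPoly n) :=
  MvPolynomial.aeval fun q => Polynomial.C (MvPolynomial.X q) +
    Polynomial.X * Polynomial.C (der i j (MvPolynomial.X q))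

theorem transCurve_X (i j : Fin n) (q : Fin n × Fin n) :
    transCurve i j (MvPolynomial.X q) = Polynomial.C (MvPolynomial.X q) +
      Polynomial.X * Polynomial.C (der i j (MvPolynomial.X q)) := by simp [transCurve]

theorem transCurve_C (i j : Fin n) (c : ℂ) :
    transCurve i j (MvPolynomial.C c) = Polynomial.C (MvPolynomial.C c) := by
  rw [← MvPolynomial.algebraMap_eq, AlgHom.commutes]
  rfl

theorem transCurve_coeff (i j : Fin n) (f : MPoly n) :
    (transCurve i j f).coeff 0 = f ∧ (transCurve i j f).coeff 1 = der i j f := by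
  induction f using MvPolynomial.induction_on with
  | C c =>
    rw [transCurve_C, Polynomial.coeff_C_zero, Polynomial.coeff_C_succ]
    simp [der]
  | add f g hf hg => simp [hf, hg]
  | mul_X f q hf =>
    rw [map_mul, transCurve_X, mul_add, ← mul_assoc]
    constructor
    · simp [hf.1, mul_assoc]
    · rw [Derivation.leibniz]
      simp only [Polynomial.coeff_add, Polynomial.coeff_mul_C, hf.2, Polynomial.coeff_mul_X, hf.1,
        smul_eq_mul]
      ring

theorem eval_transCurve (i j : Fin n) (s : ℂ) (f : MPoly n) :
    (transCurve i j f).eval (MvPolynomial.C s) = rtrans (1 + s • Matrix.single i j 1) f := by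
  induction f using MvPolynomial.induction_on with
  | C c =>
    rw [transCurve_C, Polynomial.eval_C, ← MvPolynomial.algebraMap_eq, AlgHom.commutes]
  | add f g hf hg => simp [hf, hg]
  | mul_X f q hf =>
    rw [map_mul, map_mul, Polynomial.eval_mul, hf, transCurve_X, rtrans_X, der_X]
    congr 1
    simp only [Matrix.add_apply, Matrix.smul_apply, add_smul, sum_add_distrib,
      Matrix.one_apply, Matrix.single_apply, smul_eq_mul, mul_ite, mul_one, mul_zero, ite_smul,
      one_smul, zero_smul]
    by_cases h : q.2 = j
    · subst h
      simp [MvPolynomial.smul_eq_C_mul]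
      ring
    · simp [h, Ne.symm h]

/-- Polynomials in `s` that agree at all complex `s` are equal, so a derivation can be read off as a
linear coefficient, with no differentiation. -/
theorem der_eq_of_eval {i j : Fin n} {f : MPoly n} {p : Polynomial (MPoly n)}
    (h : ∀ s : ℂ, rtrans (1 + s • Matrix.single i j 1) f = p.eval (MvPolynomial.C s)) :
    der i j f = p.coeff 1 := by
  have : transCurve i j f = p := by
    refine Polynomial.eq_of_infinite_eval_eq _ _ ?_
    refine (Set.infinite_range_of_injective (MvPolynomial.C_injective (Fin n × Fin n) ℂ)).mono ?_
    rintro _ ⟨s, rfl⟩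
    change _ = _
    rw [eval_transCurve, h]
  rw [← this, (transCurve_coeff i j f).2]

/-- A functional that vanishes on `W`, applied to the translates by `1 + s E_{ij}`, gives a
polynomial in `s` that vanishes identically; its linear coefficient is the value at `der i j f`. -/
theorem der_mem {W : Submodule ℂ (MPoly n)} (hW : ∀ x, ∀ f ∈ W, rtrans x f ∈ W)
    (i j : Fin n) {f : MPoly n} (hf : f ∈ W) : der i j f ∈ W := by
  by_contra hx
  obtain ⟨L, h1, h2⟩ := exists_dual_ne_zero hx
  refine h1 ?_
  -- The summand 2 puts the index 1 into the range even when the degree is 0.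
  let p : Polynomial ℂ := ∑ k ∈ Finset.range ((transCurve i j f).natDegree + 2),
    Polynomial.monomial k (L ((transCurve i j f).coeff k))
  have hp : p = 0 := by
    refine Polynomial.funext fun s => ?_
    have h3 := h2 _ (hW (1 + s • Matrix.single i j 1) f hf)
    rw [← eval_transCurve, Polynomial.eval_eq_sum_range' (n := (transCurve i j f).natDegree + 2)
      (by omega), map_sum] at h3
    rw [Polynomial.eval_zero, ← h3, Polynomial.eval_finsetSum]
    refine sum_congr rfl fun k _ => ?_
    rw [Polynomial.eval_monomial, ← map_pow, mul_comm _ (MvPolynomial.C _),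
      ← MvPolynomial.smul_eq_C_mul, map_smul, smul_eq_mul, mul_comm]
  have h4 := congrArg (fun q => Polynomial.coeff q 1) hp
  simp only [p, Polynomial.finsetSum_coeff, Polynomial.coeff_monomial, Polynomial.coeff_zero] at h4
  rw [Finset.sum_ite_eq', if_pos (by simp)] at h4
  rw [← (transCurve_coeff i j f).2, h4]

/-- `f` is a weight vector of weight `m`. -/
def IsWeightVector (m : Fin n → ℕ) (f : MPoly n) : Prop :=
  ∀ z : Fin n → ℂ, rtrans (diagonal z) f = (∏ j, z j ^ m j) • f

theorem IsWeightVector.der {m : Fin n → ℕ} {f : MPoly n} (hf : IsWeightVector m f)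
    (i : Fin n) : der i i f = (m i : ℂ) • f := by
  have h1 : ∀ s : ℂ, rtrans (1 + s • Matrix.single i i 1) f =
      ((1 + Polynomial.X) ^ m i * Polynomial.C f : Polynomial (MPoly n)).eval
        (MvPolynomial.C s) := by
    intro s
    have h2 : (1 + s • Matrix.single i i 1 : Matrix (Fin n) (Fin n) ℂ) =
        diagonal (Function.update 1 i (1 + s)) := by
      ext a b
      simp only [Matrix.add_apply, Matrix.one_apply, Matrix.smul_apply, Matrix.single_apply,
        Matrix.diagonal_apply, Function.update_apply, Pi.one_apply, smul_eq_mul]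
      by_cases hab : a = b
      · subst hab
        by_cases ha : a = i
        · simp [ha]
        · simp [ha, Ne.symm ha]
      · rw [if_neg hab, if_neg hab, if_neg, mul_zero, add_zero]
        rintro ⟨rfl, rfl⟩
        exact hab rfl
    rw [h2, hf, Finset.prod_eq_single i]
    · simp [MvPolynomial.smul_eq_C_mul]
    · intro b _ hb
      simp [Function.update_of_ne hb]
    · simp
  rw [der_eq_of_eval h1, Polynomial.coeff_mul_C, add_comm, Polynomial.coeff_X_add_one_pow,
    Nat.choose_one_right, MvPolynomial.smul_eq_C_mul]
  simp

/-- For `i < j` the matrix `1 + s E_{ij}` is upper unipotent and fixes the highest weight vector. -/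
theorem der_hwv_of_lt {i j : Fin n} (h : i < j) (l : Fin n → ℕ) : der i j (hwv l) = 0 := by
  have h1 : ∀ s : ℂ, rtrans (1 + s • Matrix.single i j 1) (hwv l) =
      (Polynomial.C (hwv l) : Polynomial (MPoly n)).eval (MvPolynomial.C s) := by
    intro s
    rw [rtrans_upper_hwv, Polynomial.eval_C]
    · rw [Finset.prod_eq_one, one_smul]
      intro k _
      rw [Matrix.add_apply, Matrix.smul_apply, Matrix.single_apply, if_neg]
      · simp
      · rintro ⟨rfl, rfl⟩; exact lt_irrefl _ h
    · intro a b hab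
      rw [Matrix.add_apply, Matrix.smul_apply, Matrix.single_apply, if_neg, Matrix.one_apply_ne]
      · simp
      · exact hab.ne'
      · rintro ⟨rfl, rfl⟩; exact lt_asymm h hab
  rw [der_eq_of_eval h1, Polynomial.coeff_C_succ]

theorem isWeightVector_hwv (l : Fin n → ℕ) : IsWeightVector (part l) (hwv l) := by
  intro z
  rw [rtrans_upper_hwv fun i j h => Matrix.diagonal_apply_ne _ h.ne']
  simp

theorem der_comm {i j : Fin n} (f : MPoly n) (h : i ≠ j) :
    der i j (der j i f) - der j i (der i j f) = der i i f - der j j f := by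
  have h1 : ⁅der i j, der j i⁆ = der i i - der j j := by
    refine MvPolynomial.derivation_ext fun q => ?_
    rw [Derivation.commutator_apply, Derivation.sub_apply]
    simp only [der_X]
    by_cases h1 : q.2 = i
    · have h2 : q.2 ≠ j := fun h2 => h (h1 ▸ h2)
      simp [h1, der_X, h]
    · by_cases h2 : q.2 = j
      · simp [h2, der_X, Ne.symm h]
      · simp [h1, h2]
  have := DFunLike.congr_fun h1 f
  rwa [Derivation.commutator_apply, Derivation.sub_apply] at this

theorem rtrans_diagonal_X (z : Fin n → ℂ) (q : Fin n × Fin n) :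
    rtrans (diagonal z) (MvPolynomial.X q) = z q.2 • MvPolynomial.X q := by
  rw [rtrans_X, sum_eq_single q.2]
  · simp
  · intro b _ hb
    rw [Matrix.diagonal_apply_ne _ hb, zero_smul]
  · simp

/-- Conjugation by `diag z` multiplies `E_{ij}` by `z_i / z_j`; multiplied out, the relation needs
no `z_j` to be invertible. -/
theorem rtrans_der (z : Fin n → ℂ) (i j : Fin n) (f : MPoly n) :
    z j • rtrans (diagonal z) (der i j f) = z i • der i j (rtrans (diagonal z) f) := by
  induction f using MvPolynomial.induction_on with
  | C c =>
    rw [← MvPolynomial.algebraMap_eq, AlgHom.commutes, Derivation.map_algebraMap]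
    simp
  | add f g hf hg => simp only [map_add, smul_add, hf, hg]
  | mul_X f q hf =>
    simp only [Derivation.leibniz, map_mul, map_add, smul_add, smul_eq_mul, rtrans_diagonal_X,
      Derivation.map_smul, der_X]
    congr 1
    · split_ifs with h
      · rw [rtrans_diagonal_X, h]
        simp only [mul_smul_comm, smul_comm (z i)]
      · simp
    · rw [← mul_smul_comm, hf, mul_smul_comm]

/-- The quadratic Casimir operator. -/
def casimir : MPoly n →ₗ[ℂ] MPoly n :=
  ∑ i : Fin n, ∑ j : Fin n, (der i j).toLinearMap ∘ₗ (der j i).toLinearMap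

theorem casimir_apply (f : MPoly n) : casimir f = ∑ i, ∑ j, der i j (der j i f) := by simp [casimir]

/-- The coefficients `y_{qi} x_{jp}` are those of `x⁻¹ E_{ij} x` in the elementary matrices
`E_{qp}`. -/
theorem der_rtrans {x y : Matrix (Fin n) (Fin n) ℂ} (hxy : x * y = 1) (i j : Fin n)
    (f : MPoly n) : der i j (rtrans x f) = ∑ q, ∑ p, (y q i * x j p) • rtrans x (der q p f) := by
  induction f using MvPolynomial.induction_on with
  | C c =>
    rw [← MvPolynomial.algebraMap_eq, AlgHom.commutes, Derivation.map_algebraMap]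
    simp
  | add f g hf hg => simp only [map_add, smul_add, hf, hg, sum_add_distrib]
  | mul_X f r hf =>
    rw [map_mul, Derivation.leibniz, hf]
    simp only [Derivation.leibniz, map_mul, map_add, smul_add, smul_eq_mul,
      sum_add_distrib, ← mul_smul_comm, ← mul_sum]
    congr 2
    rw [rtrans_X]
    simp only [map_sum, Derivation.map_smul, der_X, smul_ite, smul_zero, apply_ite (rtrans x),
      map_zero, rtrans_X, smul_sum, Finset.sum_ite_eq, Finset.sum_ite_eq', mem_univ,
      if_true, smul_smul]
    rw [sum_comm]
    have h1 : ∀ l, ∑ q, y q i * x j r.2 * x l q = (x * y) l i * x j r.2 := by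
      intro l
      rw [Matrix.mul_apply, sum_mul]
      exact sum_congr rfl fun q _ => by ring
    simp only [← Finset.sum_smul, h1, hxy, Matrix.one_apply]
    simp

/-- The tensor `∑ E_{ij} ⊗ E_{ji}` is invariant under conjugation: after expansion, the sums over
`i` and `j` contract to entries of `y x = 1`. -/
theorem casimir_rtrans {x y : Matrix (Fin n) (Fin n) ℂ} (hxy : x * y = 1) (f : MPoly n) :
    casimir (rtrans x f) = rtrans x (casimir f) := by
  have hyx : y * x = 1 := mul_eq_one_comm.mp hxy
  have h1 : ∀ i j, der i j (der j i (rtrans x f)) = ∑ r : (Fin n × Fin n) × Fin n × Fin n,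
      ((y r.1.1 j * x j r.2.2) * (y r.2.1 i * x i r.1.2)) •
        rtrans x (der r.2.1 r.2.2 (der r.1.1 r.1.2 f)) := by
    intro i j
    simp only [der_rtrans hxy, map_sum, Derivation.map_smul, Fintype.sum_prod_type,
      smul_sum, smul_smul]
    refine sum_congr rfl fun _ _ => sum_congr rfl fun _ _ =>
      sum_congr rfl fun _ _ => sum_congr rfl fun _ _ => ?_
    congr 1
    ring
  simp only [casimir_apply, h1]
  simp only [sum_comm (t := (Finset.univ : Finset ((Fin n × Fin n) × Fin n × Fin n)))]
  have h2 : ∀ r : (Fin n × Fin n) × Fin n × Fin n,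
      (∑ i, ∑ j, ((y r.1.1 j * x j r.2.2) * (y r.2.1 i * x i r.1.2)) •
        rtrans x (der r.2.1 r.2.2 (der r.1.1 r.1.2 f))) =
      ((y * x) r.1.1 r.2.2 * (y * x) r.2.1 r.1.2) •
        rtrans x (der r.2.1 r.2.2 (der r.1.1 r.1.2 f)) := by
    intro r
    simp only [← Finset.sum_smul, Matrix.mul_apply, Finset.sum_mul_sum]
    rw [sum_comm]
  simp only [h2, hyx, Matrix.one_apply, Fintype.sum_prod_type, ite_mul, mul_ite, one_mul, zero_mul,
    mul_zero, ite_smul, zero_smul, one_smul, map_sum]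
  rw [sum_comm]
  simp

/-- The eigenvalue of the Casimir operator. -/
def casimirValue (l : Fin n → ℕ) : ℂ :=
  ∑ i, (part l i : ℂ) ^ 2 + ∑ q : Fin n × Fin n with q.1 < q.2, ((part l q.1 : ℂ) - part l q.2)

theorem sum_sum_eq_diag_add_pairs {M : Type*} [AddCommMonoid M] (f : Fin n → Fin n → M) :
    ∑ i, ∑ j, f i j = ∑ i, f i i + ∑ q : Fin n × Fin n with q.1 < q.2, (f q.1 q.2 + f q.2 q.1) := by
  rw [sum_add_distrib, sum_pairs f]
  have h2 : ∑ q : Fin n × Fin n with q.1 < q.2, f q.2 q.1 = ∑ i, ∑ j ∈ Finset.Iio i, f i j := by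
    rw [sum_filter, Fintype.sum_prod_type_right]
    refine sum_congr rfl fun i _ => ?_
    rw [← sum_filter]
    congr 1
    ext j; simp
  rw [h2, ← sum_add_distrib, ← sum_add_distrib]
  refine sum_congr rfl fun i _ => ?_
  rw [← Finset.sum_erase_add _ _ (mem_univ i), add_comm, ← Finset.sum_union]
  · congr 1
    refine sum_congr ?_ fun _ _ => rfl
    ext j
    simp only [Finset.mem_erase, mem_univ, and_true, Finset.mem_union, Finset.mem_Ioi,
      Finset.mem_Iio]
    exact ⟨fun h => (lt_or_gt_of_ne h).symm, fun h => h.elim ne_of_gt ne_of_lt⟩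
  · rw [Finset.disjoint_left]
    intro j h1 h2
    exact lt_asymm (Finset.mem_Ioi.mp h1) (Finset.mem_Iio.mp h2)

/-- In each off-diagonal pair, the order that applies the raising operator first contributes
nothing, and the other order is then the commutator `E_{ii} - E_{jj}`, which acts by the difference
of two parts. -/
theorem casimir_hwv (l : Fin n → ℕ) : casimir (hwv l) = casimirValue l • hwv l := by
  rw [casimir_apply, sum_sum_eq_diag_add_pairs (fun i j => der i j (der j i (hwv l))),
    casimirValue, add_smul, Finset.sum_smul, Finset.sum_smul]
  congr 1
  · refine sum_congr rfl fun i _ => ?_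
    rw [(isWeightVector_hwv l).der, Derivation.map_smul, (isWeightVector_hwv l).der, smul_smul, sq]
  · refine sum_congr rfl fun q hq => ?_
    have hlt := (mem_filter.mp hq).2
    have h1 := der_comm (hwv l) hlt.ne
    rw [der_hwv_of_lt hlt, map_zero, sub_zero, (isWeightVector_hwv l).der,
      (isWeightVector_hwv l).der, ← sub_smul] at h1
    rw [h1, der_hwv_of_lt hlt, map_zero, add_zero]

/-- The Casimir operator commutes with translations, and the space is spanned by translates of one
eigenvector; irreducibility plays no role. -/
theorem casimir_polyRep {l : Fin n → ℕ} {f : MPoly n} (hf : f ∈ polyRep l) :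
    casimir f = casimirValue l • f := by
  have : polyRep l ≤ LinearMap.eqLocus casimir (casimirValue l • LinearMap.id) := by
    refine Submodule.span_le.mpr ?_
    rintro _ ⟨x, rfl⟩
    change casimir (rtrans x.1 (hwv l)) = casimirValue l • rtrans x.1 (hwv l)
    have hx : x.1 * star x.1 = 1 := mem_unitaryGroup_iff.mp (mem_specialUnitaryGroup_iff.mp x.2).1
    rw [casimir_rtrans hx, casimir_hwv, map_smul]
  exact this hf

/-! ### Weights -/

/-- The weight of the columns `φ`: the number of occurrences of each index. -/
def wtOf {l : Fin n → ℕ} (φ : Cols l) : Fin n → ℕ := colsWeight (fun j => Pi.single j 1) φ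

theorem colsWeight_eq {l : Fin n → ℕ} {M : Type*} [AddCommMonoid M] (c : Fin n → M)
    (φ : Cols l) : colsWeight c φ = ∑ j, wtOf φ j • c j := by
  simp only [wtOf, colsWeight, Finset.sum_apply, Finset.sum_smul]
  rw [sum_comm (s := (Finset.univ : Finset (Fin n)))]
  refine sum_congr rfl fun k _ => ?_
  rw [sum_comm (s := (Finset.univ : Finset (Fin n)))]
  refine sum_congr rfl fun r _ => ?_
  rw [sum_comm (s := (Finset.univ : Finset (Fin n)))]
  refine sum_congr rfl fun b _ => ?_
  rw [sum_eq_single (φ k r b)]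
  · simp
  · intro j _ hj
    rw [Pi.single_eq_of_ne hj, zero_smul]
  · simp

theorem sum_wtOf {l : Fin n → ℕ} (φ : Cols l) : ∑ j, wtOf φ j = labelDeg l := by
  rw [← colsWeight_one φ, colsWeight_eq]
  simp

theorem isWeightVector_prodMinor {l : Fin n → ℕ} (φ : Cols l) :
    IsWeightVector (wtOf φ) (prodMinor φ) := by
  intro z
  rw [rtrans_prodMinor, sum_eq_single φ]
  · congr 1
    simp only [Matrix.diagonal_apply_eq]
    exact (colsWeight_eq (M := Additive ℂ) z φ)
  · intro ψ _ hψ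
    have : ∃ k r b, ψ k r b ≠ φ k r b := by
      by_contra h
      push Not at h
      exact hψ (funext fun k => funext fun r => funext fun b => h k r b)
    obtain ⟨k, r, b, h⟩ := this
    rw [Finset.prod_eq_zero (mem_univ k), zero_smul]
    refine Finset.prod_eq_zero (mem_univ r) (Finset.prod_eq_zero (mem_univ b) ?_)
    exact Matrix.diagonal_apply_ne _ h
  · simp

/-- The span of the products of minors of weight `m`. -/
def wtSpace (l m : Fin n → ℕ) : Submodule ℂ (MPoly n) :=
  Submodule.span ℂ (prodMinor '' {φ : Cols l | wtOf φ = m})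

theorem wtSpace_isWeightVector {l m : Fin n → ℕ} {f : MPoly n} (hf : f ∈ wtSpace l m) :
    IsWeightVector m f := by
  intro z
  induction hf using Submodule.span_induction with
  | mem f hf =>
    obtain ⟨φ, rfl, rfl⟩ := hf
    exact isWeightVector_prodMinor φ z
  | zero => simp
  | add f g _ _ hf hg => rw [map_add, hf, hg, smul_add]
  | smul c f _ hf => rw [map_smul, hf, smul_comm]

theorem exists_of_mem_wtSpace {l m : Fin n → ℕ} {f : MPoly n} (hf : f ∈ wtSpace l m)
    (h0 : f ≠ 0) : ∃ φ : Cols l, wtOf φ = m ∧ prodMinor φ ≠ 0 := by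
  by_contra! h
  refine h0 ?_
  have : wtSpace l m ≤ ⊥ := by
    refine Submodule.span_le.mpr ?_
    rintro _ ⟨φ, hφ, rfl⟩
    exact h φ hφ
  exact (Submodule.mem_bot ℂ).mp (this hf)

theorem mvPolynomial_sum_eq_zero {ι : Type*} (s : Finset ι) (m : ι → Fin n → ℕ) (c : ι → ℂ)
    (h : ∀ z : Fin n → ℂ, ∑ i ∈ s, (∏ j, z j ^ m i j) * c i = 0) (m₀ : Fin n → ℕ) :
    ∑ i ∈ s with m i = m₀, c i = 0 := by
  classical
  let p : MvPolynomial (Fin n) ℂ :=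
    ∑ i ∈ s, MvPolynomial.monomial (Finsupp.equivFunOnFinite.symm (m i)) (c i)
  have hp : p = 0 := by
    refine MvPolynomial.funext fun z => ?_
    simp only [p, map_sum, MvPolynomial.eval_monomial, map_zero]
    rw [← h z]
    refine sum_congr rfl fun i _ => ?_
    rw [mul_comm, Finsupp.prod_fintype _ _ (by simp)]
    rfl
  have h1 := congrArg (MvPolynomial.coeff (Finsupp.equivFunOnFinite.symm m₀)) hp
  simp only [p, MvPolynomial.coeff_sum, MvPolynomial.coeff_monomial, MvPolynomial.coeff_zero,
    EmbeddingLike.apply_eq_iff_eq] at h1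
  rw [sum_filter]
  exact h1

/-- A functional vanishing on `polyRep l`, applied to the torus translates of `f`, is a polynomial
in `z` that vanishes identically, and its coefficients are the values at the weight components. -/
theorem polyRep_weight_component (hn : n ≠ 0) {l : Fin n → ℕ} {a : Cols l → ℂ}
    (hf : ∑ φ, a φ • prodMinor φ ∈ polyRep l) (m : Fin n → ℕ) :
    ∑ φ with wtOf φ = m, a φ • prodMinor φ ∈ polyRep l := by
  by_contra hx
  obtain ⟨L, h1, h2⟩ := exists_dual_ne_zero hx
  refine h1 ?_
  rw [map_sum]
  refine mvPolynomial_sum_eq_zero Finset.univ wtOf (fun φ : Cols l => L (a φ • prodMinor φ))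
    (fun z => ?_) m
  rw [← h2 _ (polyRep_rtrans hn (diagonal z) hf), map_sum, map_sum]
  refine sum_congr rfl fun φ _ => ?_
  rw [map_smul (rtrans _), isWeightVector_prodMinor, smul_comm, map_smul L (∏ j, z j ^ wtOf φ j), smul_eq_mul]

/-- A basis of `polyRep l` consisting of weight vectors. -/
theorem exists_weight_basis (hn : n ≠ 0) (l : Fin n → ℕ) :
    ∃ (d : ℕ) (b : Module.Basis (Fin d) ℂ (polyRep l)) (m : Fin d → Fin n → ℕ),
      ∀ i, (b i).1 ∈ wtSpace l (m i) := by
  classical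
  let S : Set (polyRep l) := {f | ∃ m, f.1 ∈ wtSpace l m}
  have hS : ⊤ ≤ Submodule.span ℂ S := by
    rintro ⟨f, hf⟩ -
    obtain ⟨a, rfl⟩ := exists_eq_sum (polyRep_le l hf)
    have h1 : (⟨∑ φ, a φ • prodMinor φ, hf⟩ : polyRep l) = ∑ m ∈ Finset.univ.image (wtOf (l := l)),
        ⟨∑ φ with wtOf φ = m, a φ • prodMinor φ, polyRep_weight_component hn hf m⟩ := by
      refine Subtype.ext ?_
      rw [AddSubmonoidClass.coe_finsetSum]
      exact (Finset.sum_fiberwise_of_maps_to (fun φ _ => Finset.mem_image_of_mem _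
        (mem_univ φ)) _).symm
    rw [h1]
    refine Submodule.sum_mem _ fun m _ => Submodule.subset_span ⟨m, ?_⟩
    exact Submodule.sum_mem _ fun φ hφ => Submodule.smul_mem _ _ (Submodule.subset_span
      ⟨φ, (mem_filter.mp hφ).2, rfl⟩)
  let b := Module.Basis.ofSpan hS
  have : Fintype ((linearIndepOn_empty ℂ id).extend (Set.empty_subset S)) :=
    FiniteDimensional.fintypeBasisIndex b
  let e := Fintype.equivFin ((linearIndepOn_empty ℂ id).extend (Set.empty_subset S))
  have hb : ∀ i, ∃ m, ((b.reindex e) i).1 ∈ wtSpace l m := by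
    intro i
    rw [Module.Basis.reindex_apply]
    exact Module.Basis.ofSpan_subset hS ⟨_, rfl⟩
  choose m hm using hb
  exact ⟨_, b.reindex e, m, hm⟩

/-! ### Dominance of the highest weight -/

theorem minorAt_ne_zero {k : Fin n} {φ : Fin (k + 1) → Fin n} (h : minorAt k φ ≠ 0) :
    Injective φ := by
  intro a b hab
  by_contra hne
  refine h (Matrix.det_zero_of_column_eq hne fun i => ?_)
  simp only [Matrix.of_apply, hab]

theorem prodMinor_ne_zero {l : Fin n → ℕ} {φ : Cols l} (h : prodMinor φ ≠ 0)
    (k : Fin n) (r : Fin (l k)) : Injective (φ k r) :=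
  minorAt_ne_zero fun h0 => h (Finset.prod_eq_zero (mem_univ k)
    (Finset.prod_eq_zero (mem_univ r) h0))

/-- After subtraction of `c k` from all terms, those inside `Iic k` are nonnegative and those
outside are nonpositive. -/
theorem sum_le_sum_Iic {c : Fin n → ℝ} (hc : Antitone c) (k : Fin n) (s : Finset (Fin n))
    (hs : s.card = k + 1) : ∑ j ∈ s, c j ≤ ∑ j ∈ Finset.Iic k, c j := by
  have hcard : s.card = (Finset.Iic k).card := by rw [hs, Fin.card_Iic]
  have h1 : ∑ j ∈ s, (c j - c k) ≤ ∑ j ∈ Finset.Iic k, (c j - c k) := by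
    rw [← Finset.sum_inter_add_sum_sdiff s (Finset.Iic k)]
    have h2 : ∑ j ∈ s \ Finset.Iic k, (c j - c k) ≤ 0 := Finset.sum_nonpos fun j hj => by
      have : k < j := by simpa using (Finset.mem_sdiff.mp hj).2
      linarith [hc this.le]
    have h3 : ∑ j ∈ s ∩ Finset.Iic k, (c j - c k) ≤ ∑ j ∈ Finset.Iic k, (c j - c k) :=
      Finset.sum_le_sum_of_subset_of_nonneg Finset.inter_subset_right fun j hj _ => by
        linarith [hc (Finset.mem_Iic.mp hj)]
    linarith
  rw [sum_sub_distrib, sum_sub_distrib, sum_const, sum_const, hcard] at h1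
  linarith

theorem eq_Iic_of_sum_eq {c : Fin n → ℝ} (hc : StrictAnti c) {k : Fin n}
    {s : Finset (Fin n)} (hs : s.card = k + 1) (h : ∑ j ∈ s, c j = ∑ j ∈ Finset.Iic k, c j) :
    s = Finset.Iic k := by
  have hcard : s.card = (Finset.Iic k).card := by rw [hs, Fin.card_Iic]
  refine Finset.eq_of_subset_of_card_le (fun j hj => ?_) hcard.ge
  by_contra hjk
  have h1 : ∑ j ∈ s, (c j - c k) < ∑ j ∈ Finset.Iic k, (c j - c k) := by
    rw [← Finset.sum_inter_add_sum_sdiff s (Finset.Iic k)]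
    have hj' : j ∈ s \ Finset.Iic k := Finset.mem_sdiff.mpr ⟨hj, hjk⟩
    have h2 : ∑ j ∈ s \ Finset.Iic k, (c j - c k) < 0 :=
      Finset.sum_neg (fun j hj => by
        have : k < j := by simpa using (Finset.mem_sdiff.mp hj).2
        linarith [hc this]) ⟨j, hj'⟩
    have h3 : ∑ j ∈ s ∩ Finset.Iic k, (c j - c k) ≤ ∑ j ∈ Finset.Iic k, (c j - c k) :=
      Finset.sum_le_sum_of_subset_of_nonneg Finset.inter_subset_right fun j hj _ => by
        linarith [hc.antitone (Finset.mem_Iic.mp hj)]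
    linarith
  rw [sum_sub_distrib, sum_sub_distrib, sum_const, sum_const, hcard, h] at h1
  exact lt_irrefl _ h1

theorem sum_comp_le {c : Fin n → ℝ} (hc : Antitone c) {k : Fin n}
    {φ : Fin (k + 1) → Fin n} (hφ : Injective φ) :
    ∑ b, c (φ b) ≤ ∑ j ∈ Finset.Iic k, c j := by
  have := sum_le_sum_Iic hc k (Finset.univ.map ⟨φ, hφ⟩) (by simp)
  rwa [Finset.sum_map] at this

theorem sum_wtOf_mul {l : Fin n → ℕ} (c : Fin n → ℝ) (φ : Cols l) :
    ∑ j, (wtOf φ j : ℝ) * c j = ∑ k, ∑ r, ∑ b, c (φ k r b) := by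
  have := colsWeight_eq c φ
  simp only [nsmul_eq_mul] at this
  rw [← this, colsWeight]

theorem sum_part_mul (l : Fin n → ℕ) (c : Fin n → ℝ) :
    ∑ j, (part l j : ℝ) * c j = ∑ k, ∑ _r : Fin (l k), ∑ j ∈ Finset.Iic k, c j := by
  have := sum_part l c
  simp only [nsmul_eq_mul] at this
  rw [← this]
  simp

/-- Nonzero minors have distinct columns, and `k + 1` distinct columns have at most the total weight
of the first `k + 1`. -/
theorem wtOf_le {l : Fin n → ℕ} {c : Fin n → ℝ} (hc : Antitone c) {φ : Cols l}
    (hφ : prodMinor φ ≠ 0) : ∑ j, (wtOf φ j : ℝ) * c j ≤ ∑ j, (part l j : ℝ) * c j := by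
  rw [sum_wtOf_mul, sum_part_mul]
  exact Finset.sum_le_sum fun k _ => Finset.sum_le_sum fun r _ =>
    sum_comp_le hc (prodMinor_ne_zero hφ k r)

theorem minorAt_of_image {k : Fin n} {φ : Fin (k + 1) → Fin n}
    (hφ : Injective φ) (h : Finset.univ.map ⟨φ, hφ⟩ = Finset.Iic k) :
    ∃ c : ℂ, minorAt k φ = c • minorAt k (Fin.castLE (Nat.succ_le_of_lt k.2)) := by
  have h1 : ∀ b, ∃ a : Fin (k + 1), Fin.castLE (Nat.succ_le_of_lt k.2) a = φ b := by
    intro b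
    rw [castLE_le, ← Finset.mem_Iic, ← h]
    exact Finset.mem_map.mpr ⟨b, mem_univ _, rfl⟩
  choose σ hσ using h1
  have hinj : Injective σ := fun a b hab => hφ (by rw [← hσ, ← hσ, hab])
  let τ : Perm (Fin (k + 1)) := Equiv.ofBijective σ (Finite.injective_iff_bijective.mp hinj)
  refine ⟨((Equiv.Perm.sign τ : ℤ) : ℂ), ?_⟩
  have h2 : minorAt k φ = (Matrix.submatrix (Matrix.of fun a b : Fin (k + 1) =>
    (MvPolynomial.X (Fin.castLE (Nat.succ_le_of_lt k.2) a, Fin.castLE (Nat.succ_le_of_lt k.2) b)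
      : MPoly n)) id τ).det := by
    rw [minorAt]
    congr 1
    ext1 a b
    simp only [Matrix.of_apply, Matrix.submatrix_apply, id, ← hσ]
    rfl
  rw [h2, Matrix.det_permute', minorAt, MvPolynomial.smul_eq_C_mul, map_intCast]

/-- Equality against a strictly decreasing `c` forces every set of columns to be an initial segment,
so every factor is a leading minor up to sign. Hence the highest weight space is one-dimensional. -/
theorem prodMinor_of_wtOf_eq {l : Fin n → ℕ} {c : Fin n → ℝ} (hc : StrictAnti c)
    {φ : Cols l} (hφ : prodMinor φ ≠ 0)
    (h : ∑ j, (wtOf φ j : ℝ) * c j = ∑ j, (part l j : ℝ) * c j) :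
    wtOf φ = part l ∧ ∃ a : ℂ, prodMinor φ = a • hwv l := by
  have hinj := prodMinor_ne_zero hφ
  rw [sum_wtOf_mul, sum_part_mul] at h
  have h1 := (Finset.sum_eq_sum_iff_of_le fun k _ => Finset.sum_le_sum fun r _ =>
    sum_comp_le hc.antitone (hinj k r)).mp h
  have h2 : ∀ k r, Finset.univ.map ⟨φ k r, hinj k r⟩ = Finset.Iic k := by
    intro k r
    have := (Finset.sum_eq_sum_iff_of_le fun r _ =>
      sum_comp_le hc.antitone (hinj k r)).mp (h1 k (mem_univ k)) r (mem_univ r)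
    refine eq_Iic_of_sum_eq hc (by simp) ?_
    rw [Finset.sum_map]
    exact this
  constructor
  · funext j
    have h3 : (wtOf φ j : ℝ) = part l j := by
      have h4 := sum_wtOf_mul (Pi.single j 1) φ
      have h5 := sum_part_mul l (Pi.single j 1)
      have h6 : ∀ k r, ∑ b, (Pi.single j 1 : Fin n → ℝ) (φ k r b) =
          ∑ i ∈ Finset.Iic k, (Pi.single j 1 : Fin n → ℝ) i := by
        intro k r
        rw [← h2 k r, Finset.sum_map]
        rfl
      simp only [h6] at h4
      rw [← h5] at h4
      simpa [Pi.single_apply] using h4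
    exact_mod_cast h3
  · choose a ha using fun k r => minorAt_of_image (hinj k r) (h2 k r)
    refine ⟨∏ k, ∏ r, a k r, ?_⟩
    simp only [prodMinor, hwv, ha, leadCols, MvPolynomial.smul_eq_C_mul, prod_mul_distrib, map_prod]

/-! ### Traces -/

theorem trace_of_apply_basis {V : Type*} [AddCommGroup V] [Module ℂ V] {d : ℕ}
    (b : Module.Basis (Fin d) ℂ V) {A : V →ₗ[ℂ] V} {c : Fin d → ℂ} (h : ∀ i, A (b i) = c i • b i) :
    LinearMap.trace ℂ V A = ∑ i, c i := by
  rw [LinearMap.trace_eq_matrix_trace ℂ b, Matrix.trace]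
  refine sum_congr rfl fun i _ => ?_
  simp [LinearMap.toMatrix_apply, h]

theorem trace_sub_mul {V : Type*} [AddCommGroup V] [Module ℂ V] (A B X : Module.End ℂ V) :
    LinearMap.trace ℂ V ((A - B) * X) =
      LinearMap.trace ℂ V (A * X) - LinearMap.trace ℂ V (B * X) := by
  rw [← map_sub]
  exact congrArg _ (sub_mul A B X)

theorem rtransOn_mul (hn : n ≠ 0) (l : Fin n → ℕ) (x y : Matrix (Fin n) (Fin n) ℂ) :
    rtransOn hn l (x * y) = rtransOn hn l x * rtransOn hn l y := by
  refine LinearMap.ext fun f => Subtype.ext ?_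
  rw [coe_rtransOn, rtrans_mul]
  rfl

theorem trace_rtransOn_perm (hn : n ≠ 0) (l : Fin n → ℕ) (z : Fin n → ℂ) (w : Perm (Fin n)) :
    LinearMap.trace ℂ _ (rtransOn hn l (diagonal (z ∘ w))) =
      LinearMap.trace ℂ _ (rtransOn hn l (diagonal z)) := by
  have h1 : diagonal (z ∘ w) = ((1 : Matrix (Fin n) (Fin n) ℂ).submatrix w id) *
      (diagonal z * (1 : Matrix (Fin n) (Fin n) ℂ).submatrix id w) := by
    ext i j
    simp only [Matrix.mul_apply, Matrix.submatrix_apply, Matrix.one_apply, Matrix.diagonal_apply,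
      id, ite_mul, mul_ite, one_mul, zero_mul, mul_one, mul_zero, Finset.sum_ite_eq', mem_univ, if_true, Function.comp, w.injective.eq_iff]
    split_ifs with h
    · rw [h]
    · rfl
  have h2 : (1 : Matrix (Fin n) (Fin n) ℂ).submatrix id w *
      (1 : Matrix (Fin n) (Fin n) ℂ).submatrix w id = 1 := by
    rw [Matrix.submatrix_mul_equiv, mul_one, Matrix.submatrix_id_id]
  rw [h1, rtransOn_mul, LinearMap.trace_mul_comm, ← rtransOn_mul, mul_assoc, h2, mul_one]

/-- The derivation `der i j` on `polyRep l`. -/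
def derOn (hn : n ≠ 0) (l : Fin n → ℕ) (i j : Fin n) : Module.End ℂ (polyRep l) :=
  (der i j).toLinearMap.restrict fun _ hf => der_mem (fun x _ hf => polyRep_rtrans hn x hf) i j hf

theorem coe_derOn (hn : n ≠ 0) (l : Fin n → ℕ) (i j : Fin n) (f : polyRep l) :
    (derOn hn l i j f : MPoly n) = der i j f.1 := rfl

theorem derOn_comm (hn : n ≠ 0) (l : Fin n → ℕ) {i j : Fin n} (h : i ≠ j) :
    derOn hn l i j * derOn hn l j i - derOn hn l j i * derOn hn l i j =
      derOn hn l i i - derOn hn l j j :=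
  LinearMap.ext fun f => Subtype.ext (der_comm f.1 h)

theorem rtransOn_derOn (hn : n ≠ 0) (l : Fin n → ℕ) (z : Fin n → ℂ) (i j : Fin n) :
    z j • (rtransOn hn l (diagonal z) * derOn hn l i j) =
      z i • (derOn hn l i j * rtransOn hn l (diagonal z)) :=
  LinearMap.ext fun f => Subtype.ext (rtrans_der z i j f.1)

theorem sum_derOn (hn : n ≠ 0) (l : Fin n → ℕ) :
    ∑ i, ∑ j, derOn hn l i j * derOn hn l j i = casimirValue l • 1 := by
  refine LinearMap.ext fun f => Subtype.ext ?_
  have h := casimir_polyRep f.2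
  rw [casimir_apply] at h
  simp only [LinearMap.sum_apply, Module.End.mul_apply, AddSubmonoidClass.coe_finsetSum, coe_derOn]
  exact h

/-- Cyclicity of the trace and torus covariance give `z_j tr(E_{ij} E_{ji} X) = z_i tr(E_{ji} E_{ij}
X)`. With the commutation relation this determines the symmetrized trace, where `z_i ≠ z_j`, from
the diagonal operators, whose traces are derivatives of the character. -/
theorem trace_derOn (hn : n ≠ 0) (l : Fin n → ℕ) (z : Fin n → ℂ) {i j : Fin n}
    (h : i ≠ j) : ∃ p : ℂ, LinearMap.trace ℂ _
        ((derOn hn l i j * derOn hn l j i + derOn hn l j i * derOn hn l i j) *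
          rtransOn hn l (diagonal z)) = p ∧
      (z i - z j) * p = (z i + z j) * LinearMap.trace ℂ _
        ((derOn hn l i i - derOn hn l j j) * rtransOn hn l (diagonal z)) := by
  set X := rtransOn hn l (diagonal z)
  refine ⟨_, rfl, ?_⟩
  have h1 : z j * LinearMap.trace ℂ _ (derOn hn l i j * derOn hn l j i * X) =
      z i * LinearMap.trace ℂ _ (derOn hn l j i * derOn hn l i j * X) := by
    have h2 := congrArg (fun A => LinearMap.trace ℂ _ (derOn hn l j i * A))
      (rtransOn_derOn hn l z i j)
    simp only [mul_smul_comm, map_smul, smul_eq_mul] at h2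
    rw [mul_assoc, LinearMap.trace_mul_comm, mul_assoc, mul_assoc]
    exact h2
  rw [← derOn_comm hn l h, add_mul, trace_sub_mul, map_add]
  linear_combination -2 * h1

/-! ### The character on the torus and the Casimir identity. -/

/-- The sum of the monomials with exponents `m i`. -/
def monoSum {d : ℕ} (m : Fin d → Fin n → ℕ) : TrigPoly n := ∑ i, mono fun j => (m i j : ℝ)

/-- The point of the torus with angles `t`. -/
def expi (t : Fin n → ℝ) (j : Fin n) : ℂ := exp (I * (t j : ℂ))

theorem prod_expi_pow (t : Fin n → ℝ) (m : Fin n → ℕ) :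
    ∏ j, expi t j ^ m j = ev t (mono fun j => (m j : ℝ)) := by
  rw [ev_mono]
  simp only [expi, ← Complex.exp_nat_mul, ← Complex.exp_sum]
  congr 1
  push_cast
  rw [mul_sum]
  exact sum_congr rfl fun j _ => by ring

/-- The derivation multiplying `e^x` by `x_k`. -/
def theta (k : Fin n) : Derivation ℂ (TrigPoly n) (TrigPoly n) :=
  Derivation.mk' ((AddMonoidAlgebra.coeffLinearEquiv ℂ).symm.toLinearMap ∘ₗ
    Finsupp.lsum ℂ (fun x : Fin n → ℝ => (x k : ℂ) • Finsupp.lsingle x) ∘ₗ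
    (AddMonoidAlgebra.coeffLinearEquiv ℂ).toLinearMap) (by
  intro f g
  set D := (AddMonoidAlgebra.coeffLinearEquiv ℂ).symm.toLinearMap ∘ₗ
    Finsupp.lsum ℂ (fun x : Fin n → ℝ => (x k : ℂ) • Finsupp.lsingle x) ∘ₗ
    (AddMonoidAlgebra.coeffLinearEquiv (S := ℂ) ℂ).toLinearMap with hD
  have hDm : ∀ x : Fin n → ℝ, D (mono x) = (x k : ℂ) • mono x := by
    intro x
    refine AddMonoidAlgebra.ext ?_
    simp [hD]
  induction f using trigPoly_induction with
  | hm x =>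
    induction g using trigPoly_induction with
    | hm y =>
      have h1 : (mono x * mono y : TrigPoly n) = mono (x + y) := by
        simp [mono, AddMonoidAlgebra.single_mul_single]
      rw [h1, hDm, hDm, hDm, smul_eq_mul, smul_eq_mul, mul_smul_comm, mul_smul_comm, h1,
        mul_comm (mono y), h1, ← add_smul]
      simp [add_comm]
    | ha f g hf hg => simp only [mul_add, map_add, hf, hg, smul_add, add_smul]; abel
    | hs c f hf => rw [mul_smul_comm, map_smul, hf, map_smul, smul_add, smul_comm c, smul_assoc c]
  | ha f₁ f₂ hf hg => simp only [add_mul, map_add, hf, hg, smul_add, add_smul]; abel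
  | hs c f hf => rw [smul_mul_assoc, map_smul, hf, map_smul, smul_add, smul_comm c g, smul_assoc c])

theorem theta_mono (k : Fin n) (x : Fin n → ℝ) : theta k (mono x) = (x k : ℂ) • mono x := by
  refine AddMonoidAlgebra.ext ?_
  simp [theta]

theorem coeff_theta (k : Fin n) (f : TrigPoly n) (x : Fin n → ℝ) :
    (theta k f).coeff x = x k * f.coeff x := by
  induction f using trigPoly_induction with
  | hm y =>
    rw [theta_mono, coeff_smul, Finsupp.smul_apply, coeff_mono, smul_eq_mul]
    split_ifs with h
    · rw [h]
    · simp
  | ha f g hf hg => simp [hf, hg, mul_add]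
  | hs c f hf =>
    rw [Derivation.map_smul]
    simp only [coeff_smul, Finsupp.smul_apply, hf, smul_eq_mul]
    ring

variable {hn : n ≠ 0} {l : Fin n → ℕ} {d : ℕ} {b : Module.Basis (Fin d) ℂ (polyRep l)}
  {m : Fin d → Fin n → ℕ}

theorem trace_rtransOn_diagonal (hb : ∀ i, (b i).1 ∈ wtSpace l (m i)) (t : Fin n → ℝ) :
    LinearMap.trace ℂ _ (rtransOn hn l (diagonal (expi t))) = ev t (monoSum m) := by
  rw [trace_of_apply_basis b (c := fun i => ∏ j, expi t j ^ m i j), monoSum, map_sum]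
  · exact sum_congr rfl fun i _ => prod_expi_pow t (m i)
  · intro i
    exact Subtype.ext (wtSpace_isWeightVector (hb i) (expi t))

theorem trace_derOn_rtransOn_diagonal (hb : ∀ i, (b i).1 ∈ wtSpace l (m i)) (t : Fin n → ℝ)
    (k : Fin n) :
    LinearMap.trace ℂ _ (derOn hn l k k * rtransOn hn l (diagonal (expi t))) =
      ev t (theta k (monoSum m)) := by
  rw [trace_of_apply_basis b (c := fun i => (m i k : ℂ) * ∏ j, expi t j ^ m i j), monoSum,
    map_sum, map_sum]
  · refine sum_congr rfl fun i _ => ?_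
    rw [prod_expi_pow, theta_mono, map_smul, smul_eq_mul, Complex.ofReal_natCast]
  · intro i
    have h := wtSpace_isWeightVector (hb i)
    refine Subtype.ext ?_
    rw [Module.End.mul_apply, coe_derOn, coe_rtransOn, h, Derivation.map_smul, h.der, smul_smul,
      mul_comm]
    rfl

theorem trace_derOn_sq_rtransOn_diagonal (hb : ∀ i, (b i).1 ∈ wtSpace l (m i)) (t : Fin n → ℝ)
    (k : Fin n) :
    LinearMap.trace ℂ _ (derOn hn l k k * derOn hn l k k * rtransOn hn l (diagonal (expi t))) =
      ev t (theta k (theta k (monoSum m))) := by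
  rw [trace_of_apply_basis b (c := fun i => (m i k : ℂ) * ((m i k : ℂ) * ∏ j, expi t j ^ m i j)),
    monoSum, map_sum, map_sum, map_sum]
  · refine sum_congr rfl fun i _ => ?_
    rw [prod_expi_pow, theta_mono, Derivation.map_smul, theta_mono, map_smul, map_smul,
      smul_eq_mul, smul_eq_mul, Complex.ofReal_natCast]
  · intro i
    have h := wtSpace_isWeightVector (hb i)
    refine Subtype.ext ?_
    rw [Module.End.mul_apply, Module.End.mul_apply, coe_derOn, coe_derOn, coe_rtransOn, h,
      Derivation.map_smul, h.der, Derivation.map_smul, Derivation.map_smul, h.der, smul_smul,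
      smul_smul, mul_comm (∏ j, _), mul_assoc]
    rw [mul_comm _ (m i k : ℂ)]
    rfl

/-- The Casimir identity for the character. -/
theorem casimir_monoSum (hn : n ≠ 0) (hb : ∀ i, (b i).1 ∈ wtSpace l (m i)) (t : Fin n → ℝ) :
    ∃ p : Fin n → Fin n → ℂ, (∀ i j, i ≠ j → (expi t i - expi t j) * p i j = (expi t i + expi t j) *
        (ev t (theta i (monoSum m)) - ev t (theta j (monoSum m)))) ∧
      ∑ k, ev t (theta k (theta k (monoSum m))) +
        ∑ q : Fin n × Fin n with q.1 < q.2, p q.1 q.2 = casimirValue l * ev t (monoSum m) := by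
  set X := rtransOn hn l (diagonal (expi t)) with hX
  refine ⟨fun i j => LinearMap.trace ℂ _
    ((derOn hn l i j * derOn hn l j i + derOn hn l j i * derOn hn l i j) * X), ?_, ?_⟩
  · intro i j hij
    obtain ⟨p, h1, h2⟩ := trace_derOn hn l (expi t) hij
    rw [← trace_derOn_rtransOn_diagonal (hn := hn) hb, ← trace_derOn_rtransOn_diagonal (hn := hn) hb,
      ← trace_sub_mul, ← h2, ← h1]
  · have h := congrArg (fun A => LinearMap.trace ℂ _ (A * X)) (sum_derOn hn l)
    simp only [sum_sum_eq_diag_add_pairs (fun i j => derOn hn l i j * derOn hn l j i), add_mul,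
      sum_mul, map_add, map_sum, smul_mul_assoc, one_mul, map_smul, smul_eq_mul] at h
    rw [hX, trace_rtransOn_diagonal hb, ← hX] at h
    rw [← h]
    congr 1
    · refine sum_congr rfl fun k _ => ?_
      rw [hX, trace_derOn_sq_rtransOn_diagonal hb]
    · refine sum_congr rfl fun q _ => ?_
      beta_reduce
      rw [add_mul, map_add]

/-! ### The Weyl denominator -/

/-- Half the root `ε_i - ε_j`. -/
def halfRoot (i j : Fin n) : Fin n → ℝ := Pi.single i (1 / 2) - Pi.single j (1 / 2)

theorem halfRoot_mem (i j : Fin n) : halfRoot i j ∈ traceless n := by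
  rw [mem_traceless]
  simp [halfRoot]

theorem sum_mul_halfRoot (t : Fin n → ℝ) (i j : Fin n) :
    ∑ k, t k * halfRoot i j k = (t i - t j) / 2 := by
  simp only [halfRoot, Pi.sub_apply, mul_sub, sum_sub_distrib, Pi.single_apply, mul_ite,
    mul_zero, Finset.sum_ite_eq', mem_univ, if_true]
  ring

/-- `e^{α/2} - e^{-α/2}` for the root `α = ε_i - ε_j`. -/
def rootDiff (i j : Fin n) : TrigPoly n := mono (halfRoot i j) - mono (-halfRoot i j)

/-- `e^{α/2} + e^{-α/2}` for the root `α = ε_i - ε_j`. -/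
def rootSum (i j : Fin n) : TrigPoly n := mono (halfRoot i j) + mono (-halfRoot i j)

theorem theta_rootDiff (k i j : Fin n) :
    theta k (rootDiff i j) = (halfRoot i j k : ℂ) • rootSum i j := by
  rw [rootDiff, map_sub, theta_mono, theta_mono, rootSum, smul_add, Pi.neg_apply,
    Complex.ofReal_neg, neg_smul, sub_neg_eq_add]

theorem ev_mono_halfRoot (t : Fin n → ℝ) (i j : Fin n) :
    ev t (mono (halfRoot i j)) = exp (I * ((t i : ℂ) - t j) / 2) ∧
    ev t (mono (-halfRoot i j)) = exp (-(I * ((t i : ℂ) - t j) / 2)) := by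
  constructor
  · rw [ev_mono, sum_mul_halfRoot]
    congr 1
    push_cast
    ring
  · rw [ev_mono]
    simp only [Pi.neg_apply, mul_neg, Finset.sum_neg_distrib, sum_mul_halfRoot]
    congr 1
    push_cast
    ring

theorem expi_eq (t : Fin n → ℝ) (i j : Fin n) :
    expi t i = exp (I * ((t i : ℂ) + t j) / 2) * ev t (mono (halfRoot i j)) ∧
    expi t j = exp (I * ((t i : ℂ) + t j) / 2) * ev t (mono (-halfRoot i j)) := by
  rw [(ev_mono_halfRoot t i j).1, (ev_mono_halfRoot t i j).2, ← Complex.exp_add, ← Complex.exp_add,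
    expi, expi]
  constructor <;> congr 1 <;> ring

theorem expi_sub (t : Fin n → ℝ) (i j : Fin n) : expi t i - expi t j =
    exp (I * ((t i : ℂ) + t j) / 2) * ev t (rootDiff i j) := by
  rw [(expi_eq t i j).1, (expi_eq t i j).2, rootDiff, map_sub, mul_sub]

theorem expi_add (t : Fin n → ℝ) (i j : Fin n) : expi t i + expi t j =
    exp (I * ((t i : ℂ) + t j) / 2) * ev t (rootSum i j) := by
  rw [(expi_eq t i j).1, (expi_eq t i j).2, rootSum, map_add]
  ring

theorem suppIn_rootDiff (i j : Fin n) : SuppIn (traceless n : Set (Fin n → ℝ)) (rootDiff i j) := by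
  have h := (suppIn_mono (A := (traceless n : Set (Fin n → ℝ))) (halfRoot_mem i j)).add
    ((suppIn_mono (A := (traceless n : Set (Fin n → ℝ))) (neg_mem (halfRoot_mem i j))).smul (-1))
  rwa [neg_one_smul, ← sub_eq_add_neg] at h

theorem alt_rho_eq_prod :
    alt (rho : Fin n → ℝ) = ∏ q : Fin n × Fin n with q.1 < q.2, rootDiff q.1 q.2 := by
  rw [← sub_eq_zero]
  refine eq_zero_of_ev (A := (traceless n : Set (Fin n → ℝ))) ?_ (fun x hx y hy => sub_mem hx hy) ?_
  · rw [sub_eq_add_neg, ← neg_one_smul ℂ]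
    refine SuppIn.add (suppIn_alt (comp_mem_traceless (lift_mem_traceless _))) (SuppIn.smul ?_ _)
    refine Finset.prod_induction _ (SuppIn (traceless n : Set (Fin n → ℝ)))
      (fun f g hf hg => hf.mul hg fun a ha b hb => add_mem ha hb) ?_ fun q _ => suppIn_rootDiff _ _
    rw [AddMonoidAlgebra.one_def]
    exact suppIn_mono (zero_mem _)
  · intro t _
    rw [map_sub, map_prod, ev_alt_rho, sub_eq_zero]
    refine prod_congr rfl fun q _ => ?_
    rw [rootDiff, map_sub, (ev_mono_halfRoot t _ _).1, (ev_mono_halfRoot t _ _).2,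
      Complex.ofReal_sin, Complex.sin]
    push_cast
    rw [show (2 : ℂ) * I * ((exp (-(((t q.1 : ℂ) - t q.2) / 2) * I) -
      exp (((t q.1 : ℂ) - t q.2) / 2 * I)) * I / 2) =
      (I * I) * (exp (-(((t q.1 : ℂ) - t q.2) / 2) * I) -
      exp (((t q.1 : ℂ) - t q.2) / 2 * I)) by ring, Complex.I_mul_I, neg_one_mul,
      neg_sub]
    congr 2 <;> ring

theorem ev_theta_prod {ι : Type*} (t : Fin n → ℝ) (k : Fin n) (s : Finset ι)
    (f : ι → TrigPoly n) (h : ∀ i ∈ s, ev t (f i) ≠ 0) :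
    ev t (theta k (∏ i ∈ s, f i)) =
      ev t (∏ i ∈ s, f i) * ∑ i ∈ s, ev t (theta k (f i)) / ev t (f i) := by
  classical
  induction s using Finset.induction_on with
  | empty => simp
  | insert i s hi ih =>
    have hi0 := h i (Finset.mem_insert_self i s)
    rw [Finset.prod_insert hi, Finset.sum_insert hi, Derivation.leibniz, map_add, smul_eq_mul,
      smul_eq_mul, map_mul, map_mul, ih fun j hj => h j (Finset.mem_insert_of_mem hj), map_mul]
    field_simp
    ring

/-- The logarithmic derivative of the product formula; no factor vanishes at regular angles. -/
theorem ev_theta_alt_rho {t : Fin n → ℝ} (ht : Injective (expi t)) (k : Fin n) :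
    ev t (theta k (alt rho)) = ev t (alt rho) * ∑ q : Fin n × Fin n with q.1 < q.2,
        (halfRoot q.1 q.2 k : ℂ) * ((expi t q.1 + expi t q.2) / (expi t q.1 - expi t q.2)) := by
  rw [alt_rho_eq_prod, ev_theta_prod]
  · congr 1
    refine sum_congr rfl fun q _ => ?_
    rw [theta_rootDiff, map_smul, smul_eq_mul, expi_add, expi_sub,
      mul_div_mul_left _ _ (Complex.exp_ne_zero _), mul_div_assoc]
  · intro q hq h0
    have h1 := expi_sub t q.1 q.2
    rw [h0, mul_zero, sub_eq_zero] at h1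
    exact (mem_filter.mp hq).2.ne (ht h1)

theorem sum_theta_theta_mono (x : Fin n → ℝ) :
    ∑ k, theta k (theta k (mono x)) = ((∑ k, x k ^ 2 : ℝ) : ℂ) • mono x := by
  push_cast
  rw [Finset.sum_smul]
  refine sum_congr rfl fun k _ => ?_
  rw [theta_mono, Derivation.map_smul, theta_mono, smul_smul, sq]

theorem sum_theta_theta_alt (x : Fin n → ℝ) :
    ∑ k, theta k (theta k (alt x)) = ((∑ k, x k ^ 2 : ℝ) : ℂ) • alt x := by
  simp only [alt, map_sum, Derivation.map_smul]
  rw [sum_comm, smul_sum]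
  refine sum_congr rfl fun w _ => ?_
  have h : ∑ k, (x ∘ w) k ^ 2 = ∑ k, x k ^ 2 := Equiv.sum_comp w fun k => x k ^ 2
  rw [← smul_sum, sum_theta_theta_mono, smul_comm, h]

theorem sum_pairs_sub (x : Fin n → ℝ) :
    ∑ q : Fin n × Fin n with q.1 < q.2, (x q.1 - x q.2) = 2 * ∑ k, rho k * x k := by
  rw [sum_sub_distrib, sum_pairs (fun i _ => x i)]
  have h2 : ∑ q : Fin n × Fin n with q.1 < q.2, x q.2 = ∑ j, ∑ i ∈ Finset.Iio j, x j := by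
    rw [sum_filter, Fintype.sum_prod_type_right]
    refine sum_congr rfl fun i _ => ?_
    rw [← sum_filter]
    congr 1
    ext j; simp
  rw [h2, ← sum_sub_distrib, mul_sum]
  refine sum_congr rfl fun k _ => ?_
  have hk := k.2
  have h3 : ((n - 1 - k.val : ℕ) : ℝ) = n - 1 - k := by
    rw [Nat.cast_sub (show k.val ≤ n - 1 by omega), Nat.cast_sub (show 1 ≤ n by omega),
      Nat.cast_one]
  simp only [sum_const, nsmul_eq_mul, Fin.card_Ioi, Fin.card_Iio, rho_apply, h3]
  ring

/-- The shifted partition. -/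
def partRho (l : Fin n → ℕ) (j : Fin n) : ℝ := part l j + rho j

theorem part_antitone (l : Fin n → ℕ) : Antitone (part l) := fun _ _ hij =>
  Finset.sum_le_sum_of_subset (Finset.Ici_subset_Ici.mpr hij)

theorem strictAnti_partRho (l : Fin n → ℕ) : StrictAnti (partRho l) := fun i j hij => by
  have h1 : (part l j : ℝ) ≤ part l i := by exact_mod_cast part_antitone l hij.le
  have h2 := strictAnti_rho hij
  rw [partRho, partRho]
  linarith

theorem casimirValue_add (l : Fin n → ℕ) :
    casimirValue l + ((∑ k : Fin n, rho k ^ 2 : ℝ) : ℂ) = ((∑ k, partRho l k ^ 2 : ℝ) : ℂ) := by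
  have h := sum_pairs_sub fun k => (part l k : ℝ)
  rw [casimirValue]
  have h1 : (∑ q : Fin n × Fin n with q.1 < q.2, ((part l q.1 : ℂ) - part l q.2)) =
      ((∑ q : Fin n × Fin n with q.1 < q.2, ((part l q.1 : ℝ) - part l q.2) : ℝ) : ℂ) := by
    push_cast; rfl
  rw [h1, h]
  push_cast
  simp only [partRho]
  push_cast
  rw [mul_sum, ← sum_add_distrib, ← sum_add_distrib]
  exact sum_congr rfl fun k _ => by ring

/-! ### The Weyl character formula -/

theorem suppIn_monoSum {d : ℕ} {m : Fin d → Fin n → ℕ} {N : ℕ} (h : ∀ i, ∑ j, m i j = N) :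
    SuppIn {x : Fin n → ℝ | ∑ j, x j = N} (monoSum m) :=
  SuppIn.sum _ _ fun i _ => suppIn_mono (by
    rw [Set.mem_ofPred_eq, ← h i]
    push_cast
    rfl)

theorem sub_mem_of_sum_eq {N : ℝ} {x y : Fin n → ℝ} (hx : x ∈ {x : Fin n → ℝ | ∑ j, x j = N})
    (hy : y ∈ {x : Fin n → ℝ | ∑ j, x j = N}) : x - y ∈ traceless n := by
  rw [Set.mem_ofPred_eq] at hx hy
  rw [mem_traceless]
  simp [hx, hy]

section

variable {l : Fin n → ℕ} {d : ℕ} {b : Module.Basis (Fin d) ℂ (polyRep l)} {m : Fin d → Fin n → ℕ}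

/-- By the product rule the Laplacian of `χ a_ρ` is `(Δχ) a_ρ + 2 ∇χ·∇a_ρ + χ Δa_ρ`. The last term
is `|ρ|² χ a_ρ`, and the middle one is `a_ρ` times the off-diagonal part of the trace of the Casimir
operator, since `∇a_ρ / a_ρ` carries the same quotients `(z_i + z_j)/(z_i - z_j)`. The eigenvalue is
then the Casimir value plus `|ρ|²`, which is `|λ + ρ|²`. -/
theorem sum_theta_theta_monoSum_mul (hn : n ≠ 0) (hb : ∀ i, (b i).1 ∈ wtSpace l (m i))
    {t : Fin n → ℝ} (ht : Injective (expi t)) :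
    ev t (∑ k, theta k (theta k (monoSum m * alt rho))) =
      ((∑ k, partRho l k ^ 2 : ℝ) : ℂ) * ev t (monoSum m * alt rho) := by
  obtain ⟨p, h1, h2⟩ := casimir_monoSum hn hb t
  have h3 : ∀ k, ev t (theta k (theta k (monoSum m * alt rho))) =
      ev t (theta k (theta k (monoSum m))) * ev t (alt rho) +
      2 * (ev t (theta k (monoSum m)) * ev t (theta k (alt rho))) +
      ev t (monoSum m) * ev t (theta k (theta k (alt rho))) := by
    intro k
    simp only [Derivation.leibniz, map_add, smul_eq_mul, map_mul]
    ring
  rw [map_sum, sum_congr rfl fun k _ => h3 k, sum_add_distrib,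
    sum_add_distrib, ← sum_mul, ← mul_sum, ← mul_sum, ← map_sum,
    ← map_sum, sum_theta_theta_alt, map_smul, smul_eq_mul, map_sum]
  have h4 : 2 * ∑ k, ev t (theta k (monoSum m)) * ev t (theta k (alt rho)) =
      ev t (alt rho) * ∑ q : Fin n × Fin n with q.1 < q.2, p q.1 q.2 := by
    simp only [ev_theta_alt_rho ht, mul_sum]
    rw [sum_comm]
    refine sum_congr rfl fun q hq => ?_
    have hne := (mem_filter.mp hq).2.ne
    have h5 := h1 q.1 q.2 hne
    have h6 : expi t q.1 - expi t q.2 ≠ 0 := sub_ne_zero.mpr fun h => hne (ht h)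
    have h7 : p q.1 q.2 = (expi t q.1 + expi t q.2) / (expi t q.1 - expi t q.2) *
        (ev t (theta q.1 (monoSum m)) - ev t (theta q.2 (monoSum m))) := by
      rw [div_mul_eq_mul_div, eq_div_iff h6, ← h5, mul_comm]
    have h8 : ∑ k, ev t (theta k (monoSum m)) * (halfRoot q.1 q.2 k : ℂ) =
        (ev t (theta q.1 (monoSum m)) - ev t (theta q.2 (monoSum m))) / 2 := by
      simp only [halfRoot, Pi.sub_apply, Complex.ofReal_sub, mul_sub, sum_sub_distrib,
        Pi.single_apply]
      simp only [apply_ite Complex.ofReal, Complex.ofReal_zero, mul_ite, mul_zero,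
        Finset.sum_ite_eq', mem_univ, if_true]
      push_cast
      ring
    rw [h7]
    rw [← sub_eq_zero]
    trans 2 * ev t (alt rho) * ((expi t q.1 + expi t q.2) / (expi t q.1 - expi t q.2)) *
      (∑ k, ev t (theta k (monoSum m)) * (halfRoot q.1 q.2 k : ℂ)) -
      ev t (alt rho) * ((expi t q.1 + expi t q.2) / (expi t q.1 - expi t q.2) *
        (ev t (theta q.1 (monoSum m)) - ev t (theta q.2 (monoSum m))))
    · rw [mul_sum]
      congr 1
      exact sum_congr rfl fun k _ => by ring
    · rw [h8]
      ring
  rw [h4, ← casimirValue_add, map_mul]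
  linear_combination (ev t) (alt rho) * h2

/-- The Laplacian multiplies the coefficient at `x` by `|x|²`, so all exponents of an eigenfunction
lie on one sphere. The eigenvalue equation is known only at regular angles, which suffice. -/
theorem coeff_monoSum_mul_eq_zero (hn : n ≠ 0) (hb : ∀ i, (b i).1 ∈ wtSpace l (m i))
    {N : ℕ} (hN : ∀ i, ∑ j, m i j = N) {x : Fin n → ℝ}
    (hx : (monoSum m * alt rho).coeff x ≠ 0) : ∑ k, x k ^ 2 = ∑ k, partRho l k ^ 2 := by
  have h1 : SuppIn {x : Fin n → ℝ | ∑ j, x j = N} (monoSum m * alt rho) :=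
    (suppIn_monoSum hN).mul (suppIn_alt (A := traceless n)
      (comp_mem_traceless (lift_mem_traceless _))) fun a ha b hb => by
        rw [Set.mem_ofPred_eq] at *
        simp only [Pi.add_apply, sum_add_distrib, ha, mem_traceless.mp hb, add_zero]
  set F := ∑ k, theta k (theta k (monoSum m * alt rho)) -
    ((∑ k, partRho l k ^ 2 : ℝ) : ℂ) • (monoSum m * alt rho) with hF
  have hcF : ∀ y, F.coeff y = ((∑ k, y k ^ 2 - ∑ k, partRho l k ^ 2 : ℝ) : ℂ) *
      (monoSum m * alt rho).coeff y := by
    intro y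
    rw [hF, AddMonoidAlgebra.coeff_sub, coeff_sum, Finsupp.sub_apply,
      Finsupp.finsetSum_apply, coeff_smul, Finsupp.smul_apply]
    simp only [coeff_theta, smul_eq_mul]
    push_cast
    rw [sub_mul]
    congr 1
    rw [sum_mul]
    exact sum_congr rfl fun k _ => by ring
  have hF0 : F = 0 := by
    refine eq_zero_of_ev_regular (A := {x : Fin n → ℝ | ∑ j, x j = N}) (fun y hy => ?_)
      (fun x hx y hy => sub_mem_of_sum_eq hx hy) fun t _ ht => ?_
    · rw [hcF] at hy
      exact h1 y (right_ne_zero_of_mul hy)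
    · rw [hF, map_sub, sum_theta_theta_monoSum_mul hn hb ht, map_smul, smul_eq_mul, sub_self]
  have h2 := hcF x
  rw [hF0] at h2
  have h3 := (mul_eq_zero.mp h2.symm).resolve_right hx
  exact sub_eq_zero.mp (by exact_mod_cast h3)

theorem isSymm_monoSum (hn : n ≠ 0) (hb : ∀ i, (b i).1 ∈ wtSpace l (m i))
    {N : ℕ} (hN : ∀ i, ∑ j, m i j = N) : IsSymm (monoSum m) := by
  intro w
  rw [← sub_eq_zero]
  refine eq_zero_of_ev (A := {x : Fin n → ℝ | ∑ j, x j = N}) ?_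
    (fun x hx y hy => sub_mem_of_sum_eq hx hy) fun t _ => ?_
  · rw [sub_eq_add_neg, ← neg_one_smul ℂ]
    refine SuppIn.add ?_ ((suppIn_monoSum hN).smul _)
    intro x hx
    have h1 := coeff_act w (monoSum m) (x ∘ w.symm)
    rw [Function.comp_assoc, Equiv.symm_comp_self, Function.comp_id] at h1
    rw [h1] at hx
    have h2 := suppIn_monoSum hN _ hx
    rw [Set.mem_ofPred_eq] at *
    rw [← h2]
    exact (Equiv.sum_comp w.symm x).symm
  · rw [map_sub, ev_act, ← trace_rtransOn_diagonal (hn := hn) hb,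
      ← trace_rtransOn_diagonal (hn := hn) hb, sub_eq_zero]
    exact trace_rtransOn_perm hn l (expi t) w.symm

end

theorem hwv_mem (l : Fin n → ℕ) : hwv l ∈ polyRep l := Submodule.subset_span ⟨1, rtrans_one _⟩

theorem exists_of_coeff_alt_ne_zero {x y : Fin n → ℝ} (h : (alt x).coeff y ≠ 0) :
    ∃ w : Perm (Fin n), y = x ∘ w :=
  suppIn_alt (A := {y | ∃ w : Perm (Fin n), y = x ∘ w}) (fun w => ⟨w, rfl⟩) y h

theorem sum_mul_comp_le {x y : Fin n → ℝ} (hx : Antitone x) (hy : Antitone y)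
    (w : Perm (Fin n)) : ∑ j, y (w j) * x j ≤ ∑ j, y j * x j :=
  (hy.monovary hx).sum_comp_perm_mul_le_sum_mul

section

variable {l : Fin n → ℕ} {d : ℕ} {b : Module.Basis (Fin d) ℂ (polyRep l)} {m : Fin d → Fin n → ℕ}

theorem weight_le (hb : ∀ i, (b i).1 ∈ wtSpace l (m i)) {c : Fin n → ℝ} (hc : Antitone c)
    (i : Fin d) : ∑ j, (m i j : ℝ) * c j ≤ ∑ j, (part l j : ℝ) * c j := by
  obtain ⟨φ, h1, h2⟩ := exists_of_mem_wtSpace (hb i) fun h => b.ne_zero i (Subtype.ext h)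
  rw [← h1]
  exact wtOf_le hc h2

theorem weight_eq (hb : ∀ i, (b i).1 ∈ wtSpace l (m i)) {c : Fin n → ℝ} (hc : StrictAnti c)
    (i : Fin d) (h : ∑ j, (m i j : ℝ) * c j = ∑ j, (part l j : ℝ) * c j) : m i = part l := by
  obtain ⟨φ, h1, h2⟩ := exists_of_mem_wtSpace (hb i) fun h => b.ne_zero i (Subtype.ext h)
  rw [← h1] at h ⊢
  exact (prodMinor_of_wtOf_eq hc h2 h).1

theorem wtSpace_part_le (l : Fin n → ℕ) {f : MPoly n} (hf : f ∈ wtSpace l (part l)) :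
    ∃ a : ℂ, f = a • hwv l := by
  have : wtSpace l (part l) ≤ Submodule.span ℂ {hwv l} := by
    refine Submodule.span_le.mpr ?_
    rintro _ ⟨φ, hφ, rfl⟩
    by_cases h : prodMinor φ = 0
    · rw [h]; exact Submodule.zero_mem _
    obtain ⟨-, a, ha⟩ := prodMinor_of_wtOf_eq (c := rho) strictAnti_rho h (by
      rw [show wtOf φ = part l from hφ])
    rw [ha]
    exact Submodule.smul_mem _ _ (Submodule.mem_span_singleton_self _)
  obtain ⟨a, ha⟩ := Submodule.mem_span_singleton.mp (this hf)
  exact ⟨a, ha.symm⟩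

theorem weight_part_unique (hb : ∀ i, (b i).1 ∈ wtSpace l (m i)) {i j : Fin d}
    (hi : m i = part l) (hj : m j = part l) : i = j := by
  by_contra hne
  obtain ⟨a, ha⟩ := wtSpace_part_le l (hi ▸ hb i)
  obtain ⟨c, hc⟩ := wtSpace_part_le l (hj ▸ hb j)
  have ha0 : a ≠ 0 := fun h => b.ne_zero i (Subtype.ext (by rw [ha, h, zero_smul]; rfl))
  have h1 : a • b j = c • b i := Subtype.ext (by
    change a • (b j).1 = c • (b i).1
    rw [ha, hc, smul_comm])
  have h2 := congrArg (fun v => b.repr v j) h1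
  simp only [map_smul, Module.Basis.repr_self, Finsupp.smul_apply, smul_eq_mul,
    Finsupp.single_eq_same, Finsupp.single_eq_of_ne (Ne.symm hne)] at h2
  simp [ha0] at h2

theorem coeff_monoSum_mul (x : Fin n → ℝ) : (monoSum m * alt rho).coeff x =
    ∑ i, (alt rho).coeff (x - fun j => (m i j : ℝ)) := by
  rw [mul_comm, monoSum, mul_sum, coeff_sum, Finsupp.finsetSum_apply]
  simp only [coeff_mul_mono]

/-- An exponent is `x = m + ρ ∘ w` with `m` a weight. For decreasing `x`, dominance and
rearrangement give `|x|² = ⟨m, x⟩ + ⟨ρ ∘ w, x⟩ ≤ ⟨λ + ρ, x⟩`. As `|x| = |λ + ρ|`, it follows that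
`|x - (λ + ρ)|² ≤ 0`. -/
theorem eq_partRho_of_coeff_ne_zero (hn : n ≠ 0) (hb : ∀ i, (b i).1 ∈ wtSpace l (m i))
    {N : ℕ} (hN : ∀ i, ∑ j, m i j = N) {x : Fin n → ℝ} (hxa : StrictAnti x)
    (hx : (monoSum m * alt rho).coeff x ≠ 0) : x = partRho l := by
  have h1 := coeff_monoSum_mul_eq_zero hn hb hN hx
  rw [coeff_monoSum_mul] at hx
  obtain ⟨i, -, hi⟩ := Finset.exists_ne_zero_of_sum_ne_zero hx
  obtain ⟨w, hw⟩ := exists_of_coeff_alt_ne_zero hi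
  have h2 := weight_le hb hxa.antitone i
  have h3 := sum_mul_comp_le hxa.antitone (strictAnti_rho (n := n)).antitone w
  have h4 : ∑ j, x j ^ 2 = ∑ j, (m i j : ℝ) * x j + ∑ j, rho (w j) * x j := by
    rw [← sum_add_distrib]
    refine sum_congr rfl fun j _ => ?_
    have := congrFun hw j
    simp only [Pi.sub_apply, Function.comp] at this
    rw [← this]
    ring
  have h5 : ∑ j, partRho l j * x j = ∑ j, (part l j : ℝ) * x j + ∑ j, rho j * x j := by
    rw [← sum_add_distrib]
    exact sum_congr rfl fun j _ => by rw [partRho]; ring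
  have h6 : ∑ j, (x j - partRho l j) ^ 2 =
      ∑ j, x j ^ 2 - 2 * ∑ j, partRho l j * x j + ∑ j, partRho l j ^ 2 := by
    rw [mul_sum, ← sum_sub_distrib, ← sum_add_distrib]
    exact sum_congr rfl fun j _ => by ring
  have h7 : ∑ j, (x j - partRho l j) ^ 2 = 0 :=
    le_antisymm (by linarith) (Finset.sum_nonneg fun j _ => sq_nonneg _)
  funext j
  have := (Finset.sum_eq_zero_iff_of_nonneg fun j _ => sq_nonneg _).mp h7 j (mem_univ j)
  exact sub_eq_zero.mp (pow_eq_zero_iff two_ne_zero |>.mp this)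

/-- A contribution to the coefficient at `λ + ρ` makes the inequalities of dominance and
rearrangement equalities, and equality in dominance against a strictly decreasing vector forces `m =
λ`. -/
theorem coeff_monoSum_mul_partRho (hb : ∀ i, (b i).1 ∈ wtSpace l (m i)) :
    (monoSum m * alt rho).coeff (partRho l) = ∑ i, if m i = part l then 1 else 0 := by
  rw [coeff_monoSum_mul]
  refine sum_congr rfl fun i _ => ?_
  have hs := strictAnti_partRho l
  split_ifs with h
  · have h1 : (partRho l - fun j => (m i j : ℝ)) = rho := by
      funext j
      simp [partRho, h]
    rw [h1, coeff_alt_self strictAnti_rho strictAnti_rho, if_pos rfl]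
  · by_contra hne
    obtain ⟨w, hw⟩ := exists_of_coeff_alt_ne_zero hne
    refine h (weight_eq hb hs i (le_antisymm (weight_le hb hs.antitone i) ?_))
    have h3 := sum_mul_comp_le hs.antitone (strictAnti_rho (n := n)).antitone w
    have h4 : ∑ j, (m i j : ℝ) * partRho l j + ∑ j, rho (w j) * partRho l j =
        ∑ j, (part l j : ℝ) * partRho l j + ∑ j, rho j * partRho l j := by
      rw [← sum_add_distrib, ← sum_add_distrib]
      refine sum_congr rfl fun j _ => ?_
      have := congrFun hw j
      simp only [Pi.sub_apply, Function.comp] at this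
      rw [← this, ← add_mul, ← add_mul]
      simp only [partRho]
      ring
    linarith

/-- The Weyl character formula for `polyRep l`. -/
theorem monoSum_mul_alt_rho (hn : n ≠ 0) (hb : ∀ i, (b i).1 ∈ wtSpace l (m i))
    {N : ℕ} (hN : ∀ i, ∑ j, m i j = N) : monoSum m * alt rho = alt (partRho l) := by
  classical
  have hs := strictAnti_partRho l
  have halt := (isSymm_monoSum hn hb hN).mul_isAlt (isAlt_alt rho)
  -- Without the highest weight the antisymmetric product would vanish, hence also the character.
  -- Its value at the identity is the dimension, and the space contains the nonzero highest weight
  -- vector.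
  have h0 : ∃ i, m i = part l := by
    by_contra! h
    have h1 : monoSum m * alt rho = 0 := by
      have hz : IsAlt (0 : TrigPoly n) := fun w => by simp
      refine halt.ext hz fun x hx => ?_
      by_contra hne
      have h2 : (monoSum m * alt rho).coeff x ≠ 0 := by simpa using hne
      have := eq_partRho_of_coeff_ne_zero hn hb hN hx h2
      rw [this, coeff_monoSum_mul_partRho hb] at h2
      exact h2 (Finset.sum_eq_zero fun i _ => if_neg (h i))
    have h2 := (mul_eq_zero.mp h1).resolve_right (alt_ne_zero strictAnti_rho)
    have h3 := congrArg (ev 0) h2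
    rw [monoSum, map_sum] at h3
    simp only [ev_mono] at h3
    simp at h3
    subst h3
    have h4 : (⟨hwv l, hwv_mem l⟩ : polyRep l) = 0 := by
      rw [← b.sum_repr ⟨hwv l, hwv_mem l⟩]
      simp
    exact hwv_ne_zero l (congrArg Subtype.val h4)
  obtain ⟨i, hi⟩ := h0
  refine halt.ext (isAlt_alt _) fun x hx => ?_
  rw [coeff_alt_self hs hx]
  split_ifs with h
  · rw [← h, coeff_monoSum_mul_partRho hb, sum_eq_single i, if_pos hi]
    · intro j _ hj
      exact if_neg fun h => hj (weight_part_unique hb h hi)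
    · simp
  · by_contra hne
    exact h (eq_partRho_of_coeff_ne_zero hn hb hN hx hne).symm

end

/-- The labels with a given last entry. -/
def fullLabels (κ : Weight n) (c : ℕ) (k : Fin n) : ℕ := if h : (k : ℕ) < n - 1 then κ ⟨k, h⟩ else c

theorem dynkin_fullLabels (κ : Weight n) (c : ℕ) : dynkin (fullLabels κ c) = κ := by
  funext k
  simp [dynkin, fullLabels]

theorem diffs_part (l : Fin n → ℕ) :
    diffs (fun j => (part l j : ℝ)) = fun k => (dynkin l k : ℝ) := by
  funext k
  have hk := k.2
  simp only [diffs, dynkin, part]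
  have h : Finset.Ici (⟨k, by omega⟩ : Fin n) =
      insert ⟨k, by omega⟩ (Finset.Ici (⟨k + 1, by omega⟩ : Fin n)) := by
    ext j
    simp only [Finset.mem_Ici, Finset.mem_insert, Fin.le_def, Fin.ext_iff]
    omega
  rw [h, Finset.sum_insert (by simp [Fin.le_def])]
  push_cast
  ring

theorem partRho_sub (hn : n ≠ 0) (l : Fin n → ℕ) :
    partRho l = shifted (dynkin l) + fun _ => (labelDeg l : ℝ) / n := by
  refine eq_of_diffs_eq ?_ ?_
  · have h1 := diffs_part l
    have h2 := diffs_shifted (dynkin l)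
    have h3 := diffs_lift (n := n) 1
    funext k
    have e1 := congrFun h1 k
    have e2 := congrFun h2 k
    have e3 := congrFun h3 k
    simp only [diffs, partRho, Pi.add_apply, rho, Pi.one_apply] at *
    linarith
  · have h1 := weightLattice_le_traceless n (shifted_mem (dynkin l))
    have h2 : ∑ j, rho j = 0 := sum_lift (n := n) 1
    have h3 : ∑ j, (part l j : ℝ) = labelDeg l := by
      have := sum_wtOf (leadCols l)
      have h4 := sum_part_mul l 1
      have h5 := sum_wtOf_mul (l := l) 1 (leadCols l)
      simp only [Pi.one_apply, mul_one] at h4 h5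
      rw [h4]
      simp [labelDeg, mul_add]
    simp only [partRho, Pi.add_apply, sum_add_distrib, h2, h3, mem_traceless.mp h1,
      sum_const, card_univ, Fintype.card_fin, nsmul_eq_mul]
    have : (n : ℝ) ≠ 0 := by exact_mod_cast hn
    field_simp
    ring

theorem alt_mul_mono_const (x : Fin n → ℝ) (c : ℝ) :
    alt x * mono (fun _ => c) = alt (x + fun _ => c) := by
  simp only [alt, sum_mul, smul_mul_assoc]
  refine sum_congr rfl fun w _ => ?_
  congr 1
  simp only [mono, AddMonoidAlgebra.single_mul_single, mul_one]
  rfl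

/-- The irreducible characters of `SU(n)` as trigonometric polynomials. -/
theorem exists_schurFamily (hn : n ≠ 0) : ∃ ch : Weight n → TrigPoly n,
    IsSchurFamily ch ∧ (∀ κ, SuppIn (weightLattice n) (ch κ)) ∧
      ∀ κ (t : Fin n → ℝ) (T : SU n), ∑ j, t j = 0 →
        (T : Matrix (Fin n) (Fin n) ℂ) = diagonal (expi t) → chi κ T = ev t (ch κ) := by
  choose d b m hb using fun κ : Weight n => exists_weight_basis hn (fullLabels κ 0)
  have hN : ∀ κ i, ∑ j, m κ i j = labelDeg (fullLabels κ 0) := by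
    intro κ i
    obtain ⟨φ, h1, h2⟩ := exists_of_mem_wtSpace (hb κ i) fun h => (b κ).ne_zero i (Subtype.ext h)
    rw [← h1, sum_wtOf]
  -- The constant shift of the exponents makes their coordinate sum zero; it does not change values
  -- at traceless angles.
  refine ⟨fun κ => monoSum (m κ) * mono fun _ => -((labelDeg (fullLabels κ 0) : ℝ) / n),
    fun κ => ?_, fun κ => ?_, fun κ t T ht hT => ?_⟩
  · rw [mul_right_comm, monoSum_mul_alt_rho hn (hb κ) (hN κ), alt_mul_mono_const,
      partRho_sub hn, dynkin_fullLabels]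
    congr 1
    funext j
    simp
  · refine (SuppIn.sum Finset.univ (A := {x | ∃ i, x = fun j => (m κ i j : ℝ)}) _
      fun i _ => suppIn_mono ⟨i, rfl⟩).mul (suppIn_mono (Set.mem_singleton _)) ?_
    rintro _ ⟨i, rfl⟩ _ rfl
    refine mem_weightLattice_iff.mpr ⟨?_, fun j k => ⟨(m κ i j : ℤ) - m κ i k, ?_⟩⟩
    · rw [mem_traceless]
      have h1 : (∑ j, (m κ i j : ℝ)) = labelDeg (fullLabels κ 0) := by exact_mod_cast hN κ i
      simp only [Pi.add_apply, sum_add_distrib, h1, sum_const, card_univ,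
        Fintype.card_fin, nsmul_eq_mul]
      have : (n : ℝ) ≠ 0 := by exact_mod_cast hn
      field_simp
      ring
    · push_cast
      simp
  · have h1 := chi_dynkin hn (fullLabels κ 0) T
    rw [dynkin_fullLabels, hT, trace_rtransOn_diagonal (hb κ)] at h1
    rw [h1, map_mul, ev_mono]
    simp only [mul_neg, Finset.sum_neg_distrib, ← sum_mul, ht]
    simp

/-! ### Averaging over compact groups -/

/-- Haar measure, stated as a functional on continuous functions so that the choice of a Borel
structure stays inside the proof. -/
theorem exists_mean (G : Type) [Group G] [TopologicalSpace G] [IsTopologicalGroup G]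
    [CompactSpace G] : ∃ I : C(G, ℂ) →ₗ[ℂ] ℂ, I 1 = 1 ∧
      ∀ (h : G) (f : C(G, ℂ)), I (f.comp ⟨fun g => h * g, by fun_prop⟩) = I f := by
  let _ : MeasurableSpace G := borel G
  have : BorelSpace G := ⟨rfl⟩
  let μ : Measure G := Measure.haarMeasure ⊤
  have hμ : μ Set.univ = 1 := Measure.haarMeasure_self
  have : IsProbabilityMeasure μ := ⟨hμ⟩
  have hint : ∀ f : C(G, ℂ), Integrable f μ := fun f =>
    f.continuous.integrable_of_hasCompactSupport (HasCompactSupport.of_compactSpace _)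
  refine ⟨⟨⟨fun f => ∫ g, f g ∂μ, fun f g => ?_⟩, fun c f => ?_⟩, ?_, fun h f => ?_⟩
  · exact integral_add (hint f) (hint g)
  · exact integral_const_mul c _
  · change ∫ _, (1 : ℂ) ∂μ = 1
    simp
  · exact integral_mul_left_eq_self (fun g => f g) h

/-- Continuity of all matrix coefficients. -/
def ContRep {G : Type} [Group G] [TopologicalSpace G] {V : Type*} [AddCommGroup V] [Module ℂ V]
    (r : Representation ℂ G V) : Prop := ∀ (v : V) (L : V →ₗ[ℂ] ℂ), Continuous fun g => L (r g v)

section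

variable {G : Type} [Group G] [TopologicalSpace G] {V W : Type*} [AddCommGroup V] [Module ℂ V]
  [AddCommGroup W] [Module ℂ W]
  {r : Representation ℂ G V} {s : Representation ℂ G W}

theorem linearMap_eq_sum {ι : Type*} [Fintype ι] (b : Module.Basis ι ℂ V) (L : V →ₗ[ℂ] W) (v : V) :
    L v = ∑ i, b.coord i v • L (b i) := by
  conv_lhs => rw [← b.sum_repr v]
  simp only [map_sum, map_smul, Module.Basis.coord_apply]

theorem ContRep.tprod [FiniteDimensional ℂ V] [FiniteDimensional ℂ W] (hr : ContRep r) (hs : ContRep s) : ContRep (r.tprod s) := by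
  intro v L
  induction v using TensorProduct.induction_on with
  | zero => simp only [map_zero]; exact continuous_const
  | add v w hv hw => simp only [map_add]; exact hv.add hw
  | tmul v w =>
    let b := Module.finBasis ℂ V
    let c := Module.finBasis ℂ W
    have h : ∀ g, L ((r.tprod s) g (v ⊗ₜ w)) =
        ∑ i, ∑ j, b.coord i (r g v) * (c.coord j (s g w) * L (b i ⊗ₜ c j)) := by
      intro g
      rw [Representation.tprod_apply, TensorProduct.map_tmul]
      change (L ∘ₗ (TensorProduct.mk ℂ V W).flip (s g w)) (r g v) = _
      rw [linearMap_eq_sum b (L ∘ₗ (TensorProduct.mk ℂ V W).flip (s g w)) (r g v)]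
      refine sum_congr rfl fun i _ => ?_
      change _ • (L ∘ₗ TensorProduct.mk ℂ V W (b i)) (s g w) = _
      rw [linearMap_eq_sum c (L ∘ₗ TensorProduct.mk ℂ V W (b i)) (s g w), smul_eq_mul, mul_sum]
      rfl
    simp only [h]
    exact continuous_finsetSum _ fun i _ => continuous_finsetSum _ fun j _ =>
      (hr v _).mul ((hs w _).mul continuous_const)

theorem ContRep.linHom [IsTopologicalGroup G] [FiniteDimensional ℂ V] [FiniteDimensional ℂ W]
    (hr : ContRep r) (hs : ContRep s) :
    ContRep (Representation.linHom r s) := by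
  let b := Module.finBasis ℂ V
  let c := Module.finBasis ℂ W
  intro A L
  have hL : ∃ K : Fin (Module.finrank ℂ V) → Fin (Module.finrank ℂ W) → ℂ, ∀ B : V →ₗ[ℂ] W,
      L B = ∑ i, ∑ j, c.coord j (B (b i)) * K i j := by
    refine ⟨fun i j => L ((b.coord i).smulRight (c j)), fun B => ?_⟩
    have hB : B = ∑ i, ∑ j, c.coord j (B (b i)) • (b.coord i).smulRight (c j) := by
      refine b.ext fun k => ?_
      conv_lhs => rw [← c.sum_repr (B (b k))]
      simp only [LinearMap.sum_apply, LinearMap.smul_apply, LinearMap.smulRight_apply,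
        Module.Basis.coord_apply, Module.Basis.repr_self]
      rw [sum_eq_single k]
      · simp
      · intro i _ hi
        simp [Finsupp.single_eq_of_ne hi]
      · simp
    conv_lhs => rw [hB]
    simp only [map_sum, map_smul, smul_eq_mul]
  obtain ⟨K, hK⟩ := hL
  simp only [hK]
  refine continuous_finsetSum _ fun i _ => continuous_finsetSum _ fun j _ =>
    Continuous.mul ?_ continuous_const
  have h : ∀ g, c.coord j (Representation.linHom r s g A (b i)) =
      ∑ k, b.coord k (r g⁻¹ (b i)) * c.coord j (s g (A (b k))) := by
    intro g
    rw [Representation.linHom_apply]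
    change (c.coord j ∘ₗ s g ∘ₗ A) (r g⁻¹ (b i)) = _
    rw [linearMap_eq_sum b]
    rfl
  simp only [h]
  exact continuous_finsetSum _ fun k _ => (((hr (b i) (b.coord k)).comp continuous_inv)).mul
    (hs (A (b k)) _)

theorem ContRep.continuous_character [FiniteDimensional ℂ V] (hr : ContRep r) : Continuous r.character := by
  have h : ∀ g, r.character g = ∑ i, (Module.finBasis ℂ V).coord i (r g (Module.finBasis ℂ V i)) := by
    intro g
    rw [Representation.character, LinearMap.trace_eq_matrix_trace ℂ (Module.finBasis ℂ V),
      Matrix.trace]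
    simp [LinearMap.toMatrix_apply]
  rw [funext h]
  exact continuous_finsetSum _ fun i _ => hr _ _

/-- The dimension of the invariants is the mean of the character. -/
theorem ContRep.finrank_invariants [IsTopologicalGroup G] [FiniteDimensional ℂ V]
    (hr : ContRep r) {I : C(G, ℂ) →ₗ[ℂ] ℂ}
    (h1 : I 1 = 1)
    (hI : ∀ (h : G) (f : C(G, ℂ)), I (f.comp ⟨fun g => h * g, by fun_prop⟩) = I f) :
    (Module.finrank ℂ r.invariants : ℂ) = I ⟨r.character, hr.continuous_character⟩ := by
  let b := Module.finBasis ℂ V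
  -- `P` averages the orbit of `v`, coordinate by coordinate. It is a projection onto the
  -- invariants, so its trace is their dimension.
  let P : V →ₗ[ℂ] V :=
    { toFun := fun v => ∑ i, I ⟨_, hr v (b.coord i)⟩ • b i
      map_add' := fun v w => by
        rw [← sum_add_distrib]
        refine sum_congr rfl fun i _ => ?_
        rw [← add_smul, ← map_add]
        congr 2
        ext g
        simp
      map_smul' := fun a v => by
        rw [RingHom.id_apply, smul_sum]
        refine sum_congr rfl fun i _ => ?_
        rw [smul_smul, ← smul_eq_mul, ← map_smul I]
        congr 2
        ext g
        simp }
  have hPv : ∀ v, P v = ∑ i, I ⟨_, hr v (b.coord i)⟩ • b i := fun v => rfl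
  have hL : ∀ v (L : V →ₗ[ℂ] ℂ), L (P v) = I ⟨_, hr v L⟩ := by
    intro v L
    rw [hPv, map_sum]
    simp only [map_smul, smul_eq_mul]
    have : (⟨_, hr v L⟩ : C(G, ℂ)) = ∑ i, L (b i) • ⟨_, hr v (b.coord i)⟩ := by
      ext g
      simp only [ContinuousMap.coe_mk, ContinuousMap.coe_sum, Finset.sum_apply,
        ContinuousMap.coe_smul, Pi.smul_apply]
      rw [linearMap_eq_sum b L]
      exact sum_congr rfl fun i _ => mul_comm _ _
    rw [this, map_sum]
    exact sum_congr rfl fun i _ => by rw [map_smul, smul_eq_mul, mul_comm]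
  have hproj : LinearMap.IsProj r.invariants P := by
    constructor
    · intro v h
      refine b.ext_elem fun i => ?_
      have e1 := hL v (b.coord i ∘ₗ r h)
      have e2 := hL v (b.coord i)
      change b.coord i (r h (P v)) = b.coord i (P v)
      rw [e2, ← hI h]
      refine e1.trans ?_
      congr 1
      ext g
      simp [map_mul]
    · intro v hv
      refine b.ext_elem fun i => ?_
      change b.coord i (P v) = b.coord i v
      rw [hL]
      have : (⟨_, hr v (b.coord i)⟩ : C(G, ℂ)) = (b.coord i v) • 1 := by
        ext g
        simp [hv g]
      rw [this, map_smul, h1, smul_eq_mul, mul_one]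
  rw [← hproj.trace, LinearMap.trace_eq_matrix_trace ℂ b, Matrix.trace]
  have : (⟨r.character, hr.continuous_character⟩ : C(G, ℂ)) = ∑ i, ⟨_, hr (b i) (b.coord i)⟩ := by
    ext g
    simp only [ContinuousMap.coe_mk, ContinuousMap.coe_sum, Finset.sum_apply]
    rw [Representation.character, LinearMap.trace_eq_matrix_trace ℂ b, Matrix.trace]
    simp [LinearMap.toMatrix_apply]
  rw [this, map_sum]
  refine sum_congr rfl fun i _ => ?_
  rw [← hL (b i) (b.coord i)]
  simp [LinearMap.toMatrix_apply]

end

/-! ### Topology of `SU(n)` -/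

instance : IsTopologicalGroup (SU n) where
  continuous_inv := by
    refine Continuous.subtype_mk ?_ _
    exact continuous_star.comp continuous_subtype_val

instance : CompactSpace (SU n) := by
  have h1 : IsCompact (X := Matrix (Fin n) (Fin n) ℂ) (Set.univ.pi fun _ : Fin n =>
      Set.univ.pi fun _ : Fin n => Metric.closedBall (0 : ℂ) 1) :=
    isCompact_univ_pi fun _ => isCompact_univ_pi fun _ => isCompact_closedBall _ _
  refine isCompact_iff_compactSpace.mp (h1.of_isClosed_subset
    (t := (Matrix.specialUnitaryGroup (Fin n) ℂ : Set (Matrix (Fin n) (Fin n) ℂ))) ?_ ?_)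
  · have h2 : (Matrix.specialUnitaryGroup (Fin n) ℂ : Set (Matrix (Fin n) (Fin n) ℂ)) =
        {A | A * star A = 1} ∩ {A | A.det = 1} := by
      ext A
      rw [SetLike.mem_coe, mem_specialUnitaryGroup_iff, mem_unitaryGroup_iff]
      rfl
    rw [h2]
    exact (isClosed_eq (continuous_id.mul continuous_star) continuous_const).inter
      (isClosed_eq (Continuous.matrix_det continuous_id) continuous_const)
  · intro A hA i _ j _
    rw [mem_closedBall_zero_iff]
    exact entry_norm_bound_of_unitary (mem_specialUnitaryGroup_iff.mp hA).1 i j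

/-! ### Diagonalization of unitary matrices -/

/-- The unit circle is infinite, and the characteristic polynomial of `-A` has finitely many roots.
-/
theorem exists_unit_isUnit_det (A : Matrix (Fin n) (Fin n) ℂ) :
    ∃ d : ℂ, d * star d = 1 ∧ IsUnit (d • 1 + A).det := by
  by_contra! h
  have hinf : (Metric.sphere (0 : ℂ) 1).Infinite := by
    refine IsPreconnected.infinite_of_nontrivial ?_ ?_
    · exact isPreconnected_sphere (by rw [Complex.rank_real_complex]; norm_num) _ _
    · exact ⟨1, by simp, -1, by simp, by norm_num⟩
  refine (Matrix.charpoly_monic (-A)).ne_zero (Polynomial.eq_zero_of_infinite_isRoot _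
    (hinf.mono fun d hd => ?_))
  have h1 : ‖d‖ = 1 := by simpa using hd
  have h2 := h d (by rw [Complex.star_def, Complex.mul_conj, Complex.normSq_eq_norm_sq, h1]; simp)
  rw [isUnit_iff_ne_zero, not_not] at h2
  change Polynomial.eval _ _ = _
  rw [Matrix.eval_charpoly, ← h2, sub_neg_eq_add]
  congr 2
  ext i j
  simp [Matrix.diagonal_apply, Matrix.one_apply]

/-- With `d` of modulus one and `-d` not an eigenvalue, `X = (d - g)(d + g)⁻¹` is skew-Hermitian, so
`i X` can be diagonalized by the spectral theorem. In that eigenbasis the off-diagonal entries of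
`g` satisfy `(λ_i + i) G_{ij} = 0` with `λ_i` real, so they vanish. -/
theorem exists_diagonalization {g : Matrix (Fin n) (Fin n) ℂ} (hg : g ∈ Matrix.unitaryGroup (Fin n) ℂ) :
    ∃ U ∈ Matrix.unitaryGroup (Fin n) ℂ, ∃ t : Fin n → ℝ, g = U * diagonal (expi t) * star U := by
  obtain ⟨d, hd, hu⟩ := exists_unit_isUnit_det g
  have hg2 := mem_unitaryGroup_iff'.mp hg
  set P := d • 1 + g with hP
  set X := (d • 1 - g) * P⁻¹ with hX
  have hXm : X * P = d • 1 - g := by rw [hX, mul_assoc, Matrix.nonsing_inv_mul _ hu, mul_one]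
  have hU : IsUnit P := (Matrix.isUnit_iff_isUnit_det _).mpr hu
  have hstar : star X = -X := by
    refine hU.star.mul_left_cancel (hU.mul_right_cancel ?_)
    rw [← star_mul, hXm, mul_assoc, neg_mul, hXm, hP]
    simp only [star_add, star_sub, star_smul, star_one, mul_add, add_mul, sub_mul, mul_sub, mul_neg,
      Matrix.smul_mul, Matrix.mul_smul, smul_smul, one_mul, mul_one, hg2, hd, one_smul]
    abel
  have hH : (I • X).IsHermitian := by
    change star (I • X) = _
    rw [star_smul, hstar, Complex.star_def, Complex.conj_I, smul_neg, neg_smul, neg_neg]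
  have hspec := hH.spectral_theorem
  set φ := Unitary.conjStarAlgAut ℂ (Matrix (Fin n) (Fin n) ℂ) hH.eigenvectorUnitary
  obtain ⟨G, hG⟩ := EquivLike.surjective φ g
  have hGd : diagonal (fun i => G i i) = G := by
    ext i j
    rcases eq_or_ne i j with rfl | hij
    · rw [Matrix.diagonal_apply_eq]
    · have h1 : diagonal (RCLike.ofReal ∘ hH.eigenvalues) * (d • 1 + G) = I • (d • 1 - G) := by
        refine EquivLike.injective φ ?_
        simp only [map_mul, map_add, map_sub, map_smul, map_one, hG, ← hspec, ← hP, Matrix.smul_mul, hXm]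
      have h2 := congrFun (congrFun h1 i) j
      rw [Matrix.diagonal_mul] at h2
      simp only [Matrix.add_apply, Matrix.sub_apply, Matrix.smul_apply, Matrix.one_apply_ne hij,
        smul_eq_mul, Function.comp_apply] at h2
      have h3 : ((hH.eigenvalues i : ℂ) + I) * G i j = 0 := by linear_combination h2
      rw [Matrix.diagonal_apply_ne _ hij, (mul_eq_zero.mp h3).resolve_left fun h => by
        simpa using congrArg Complex.im h]
  have hGn : ∀ i, ‖G i i‖ = 1 := fun i => by
    have h1 : G * star G = 1 := EquivLike.injective φ (by
      rw [map_mul, map_star, map_one, hG, mem_unitaryGroup_iff.mp hg])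
    have h2 := congrFun (congrFun h1 i) i
    rw [← hGd, Matrix.star_eq_conjTranspose, Matrix.diagonal_conjTranspose,
      Matrix.diagonal_mul_diagonal, Matrix.diagonal_apply_eq, Matrix.one_apply_eq, Pi.star_apply,
      Complex.star_def, Complex.mul_conj, Complex.normSq_eq_norm_sq] at h2
    exact (pow_eq_one_iff_of_nonneg (norm_nonneg _) two_ne_zero).mp (by exact_mod_cast h2)
  choose t ht using fun i => (Complex.norm_eq_one_iff _).mp (hGn i)
  refine ⟨_, hH.eigenvectorUnitary.2, t, ?_⟩
  have h4 : expi t = fun i => G i i := funext fun i => by rw [← ht, expi, mul_comm]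
  rw [h4, hGd, ← hG]
  exact Unitary.conjStarAlgAut_apply ..

/-- The diagonal torus of `SU(n)`. -/
def torus (t : Fin n → ℝ) (ht : ∑ j, t j = 0) : SU n :=
  ⟨diagonal (expi t), by
    rw [mem_specialUnitaryGroup_iff, mem_unitaryGroup_iff]
    constructor
    · rw [Matrix.star_eq_conjTranspose, Matrix.diagonal_conjTranspose, Matrix.diagonal_mul_diagonal,
        ← Matrix.diagonal_one]
      congr 1
      funext i
      simp only [Pi.star_apply, expi, Complex.star_def, Complex.mul_conj, Complex.normSq_eq_norm_sq]
      rw [mul_comm, Complex.norm_exp_ofReal_mul_I]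
      simp
    · rw [Matrix.det_diagonal]
      simp only [expi]
      rw [← Complex.exp_sum, ← mul_sum, ← Complex.ofReal_sum, ht]
      simp⟩

theorem coe_torus (t : Fin n → ℝ) (ht : ∑ j, t j = 0) :
    (torus t ht : Matrix (Fin n) (Fin n) ℂ) = diagonal (expi t) := rfl

theorem exists_conj_torus (hn : n ≠ 0) (g : SU n) :
    ∃ U ∈ Matrix.unitaryGroup (Fin n) ℂ, ∃ (t : Fin n → ℝ) (ht : ∑ j, t j = 0),
      g.1 = U * (torus t ht).1 * star U := by
  obtain ⟨hg, hdet⟩ := mem_specialUnitaryGroup_iff.mp g.2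
  obtain ⟨U, hU, t, ht⟩ := exists_diagonalization hg
  have h1 : (diagonal (expi t)).det = 1 := by
    rw [← hdet, ht, Matrix.det_mul_right_comm, mem_unitaryGroup_iff.mp hU, one_mul]
  rw [Matrix.det_diagonal] at h1
  simp only [expi] at h1
  rw [← Complex.exp_sum, ← mul_sum, ← Complex.ofReal_sum, Complex.exp_eq_one_iff] at h1
  obtain ⟨k, hk⟩ := h1
  have hk' : ∑ j, t j = k * (2 * π) := by
    have h2 : ((∑ j, t j : ℝ) : ℂ) = ((k * (2 * π) : ℝ) : ℂ) := by
      refine mul_left_cancel₀ Complex.I_ne_zero ?_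
      rw [hk]
      push_cast
      ring
    exact Complex.ofReal_injective h2
  let i₀ : Fin n := ⟨0, Nat.pos_of_ne_zero hn⟩
  -- The angles add up to a multiple of `2π`, which is removed from one of them.
  let s : Fin n → ℝ := t - Pi.single i₀ (k * (2 * π))
  have hs : ∑ j, s j = 0 := by simp [s, hk']
  have hst : expi s = expi t := by
    funext j
    simp only [expi, s, Pi.sub_apply]
    rcases eq_or_ne j i₀ with rfl | hj
    · rw [Pi.single_eq_same, Complex.exp_eq_exp_iff_exists_int]
      exact ⟨-k, by push_cast; ring⟩
    · rw [Pi.single_eq_of_ne hj, sub_zero]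
  exact ⟨U, hU, s, hs, by rw [coe_torus, hst, ← ht]⟩

/-! ### Multiplicities -/

theorem finrank_intertwiningMap {G : Type} [Group G] [TopologicalSpace G] [IsTopologicalGroup G]
    {V W U : Type*} [AddCommGroup V] [Module ℂ V] [FiniteDimensional ℂ V]
    [AddCommGroup W] [Module ℂ W] [FiniteDimensional ℂ W]
    [AddCommGroup U] [Module ℂ U] [FiniteDimensional ℂ U] {r : Representation ℂ G V}
    {s : Representation ℂ G W} {t : Representation ℂ G U} (hr : ContRep r) (hs : ContRep s)
    (ht : ContRep t) {I : C(G, ℂ) →ₗ[ℂ] ℂ} (h1 : I 1 = 1)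
    (hI : ∀ (h : G) (f : C(G, ℂ)), I (f.comp ⟨fun g => h * g, by fun_prop⟩) = I f) :
    (Module.finrank ℂ (Representation.IntertwiningMap r (s.tprod t)) : ℂ) =
      I ⟨fun g => r.character g⁻¹ * (s.character g * t.character g),
        (hr.continuous_character.comp continuous_inv).mul
          (hs.continuous_character.mul ht.continuous_character)⟩ := by
  rw [← (Representation.invariantsEquivIntertwiningMap r (W := TensorProduct ℂ W U)
    (s.tprod t)).finrank_eq, (hr.linHom (hs.tprod ht)).finrank_invariants h1 hI]
  congr 1
  ext g
  rw [ContinuousMap.coe_mk, ContinuousMap.coe_mk, Representation.char_linHom,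
    Representation.char_tensor]
  rfl

theorem finiteDimensional_irrepSpace (hn : n ≠ 0) (κ : Weight n) :
    FiniteDimensional ℂ (irrepSpace κ) := by
  rw [← dynkin_fullLabels κ 0]
  exact Module.Finite.equiv (polyRepEquiv hn (fullLabels κ 0))

theorem continuous_evalM (f : MPoly n) : Continuous fun g : SU n => evalM g.1 f := by
  induction f using MvPolynomial.induction_on with
  | C c =>
    simp only [← MvPolynomial.algebraMap_eq, AlgHom.commutes]
    exact continuous_const
  | add f g hf hg => simp only [map_add]; exact hf.add hg
  | mul_X f q hf =>
    simp only [map_mul, evalM_X]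
    exact hf.mul ((continuous_apply_apply q.1 q.2).comp continuous_subtype_val)

theorem contRep_irrep_dynkin (hn : n ≠ 0) (l : Fin n → ℕ) : ContRep (irrep (dynkin l)) := by
  intro v L
  obtain ⟨f, rfl⟩ := (polyRepEquiv hn l).surjective v
  obtain ⟨K, hK⟩ := LinearMap.exists_extend (L ∘ₗ (polyRepEquiv hn l).toLinearMap)
  obtain ⟨q, -, hq⟩ := rtrans_eq_sum (polyRep_le l f.2)
  have h : ∀ g : SU n, L (irrep (dynkin l) g (polyRepEquiv hn l f)) =
      ∑ ψ, evalM g.1 (q ψ) * K (prodMinor ψ) := by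
    intro g
    rw [← polyRepEquiv_rtransOn]
    refine (LinearMap.congr_fun hK (rtransOn hn l g.1 f)).symm.trans ?_
    change K (rtrans g.1 f.1) = _
    rw [hq, map_sum]
    simp only [map_smul, smul_eq_mul]
  simp only [h]
  exact continuous_finsetSum _ fun ψ _ => (continuous_evalM _).mul continuous_const

theorem contRep_irrep (hn : n ≠ 0) (κ : Weight n) : ContRep (irrep κ) := by
  rw [← dynkin_fullLabels κ 0]
  exact contRep_irrep_dynkin hn _

/-- An invariant vector is a polynomial that is constant on `SU(n)`. Left translation by the torus
multiplies it by the highest weight, which is a nontrivial character unless the Dynkin labels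
vanish. So the constant is zero, and so is the polynomial. -/
theorem invariants_irrep_dynkin (hn : n ≠ 0) {l : Fin n → ℕ} (hl : dynkin l ≠ 0) :
    (irrep (dynkin l)).invariants = ⊥ := by
  refine (Submodule.eq_bot_iff _).mpr fun v hv => ?_
  obtain ⟨p, rfl⟩ := (polyRepEquiv hn l).surjective v
  have hinv : ∀ x : SU n, evalM x.1 p.1 = evalM 1 p.1 := by
    intro x
    have h1 := congrArg (fun f : irrepSpace (dynkin l) => f.1 1) (hv x)
    have h2 : evalM ((1 : SU n) * x).1 p.1 = evalM (1 : SU n).1 p.1 := h1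
    rwa [one_mul] at h2
  have hcov : ∀ (t : Fin n → ℝ), ∑ j, t j = 0 →
      evalM 1 p.1 = ev t (mono fun j => (part l j : ℝ)) * evalM 1 p.1 := by
    intro t ht
    obtain ⟨a, ha⟩ := exists_eq_sum (polyRep_le l p.2)
    have h1 := hinv (torus t ht)
    rw [coe_torus] at h1
    conv_lhs => rw [← h1]
    rw [← prod_expi_pow, ha, map_sum, map_sum, mul_sum]
    refine sum_congr rfl fun φ _ => ?_
    have h2 := evalM_lower_mul (b := diagonal (expi t))
      (fun i j hij => Matrix.diagonal_apply_ne _ hij.ne) 1 φ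
    rw [mul_one] at h2
    rw [map_smul, map_smul, h2, smul_eq_mul, smul_eq_mul]
    simp only [Matrix.diagonal_apply_eq]
    ring
  have h0 : evalM 1 p.1 = 0 := by
    by_contra hne
    -- Both monomials take the value 1 at all traceless angles and have the same coordinate sum, so
    -- the exponents agree: the partition is constant and its successive differences vanish.
    have h1 : (mono fun j => (part l j : ℝ)) - mono (fun _ => (∑ j, (part l j : ℝ)) / n) =
        (0 : TrigPoly n) := by
      have hn' : (n : ℝ) ≠ 0 := by exact_mod_cast hn
      refine eq_zero_of_ev (A := {x | ∑ j, x j = ∑ j, (part l j : ℝ)}) ?_ ?_ ?_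
      · rw [sub_eq_add_neg, ← neg_one_smul ℂ]
        refine SuppIn.add (suppIn_mono (Set.mem_ofPred_eq ▸ rfl)) (SuppIn.smul (suppIn_mono ?_) _)
        simp only [Set.mem_ofPred_eq, sum_const, card_univ, Fintype.card_fin, nsmul_eq_mul]
        field_simp
      · intro x hx y hy
        rw [Set.mem_ofPred_eq] at hx hy
        rw [mem_traceless]
        simp [hx, hy]
      · intro t ht
        have h2 : ev t (mono fun j => (part l j : ℝ)) = 1 :=
          mul_right_cancel₀ hne (by rw [one_mul]; exact (hcov t ht).symm)
        rw [map_sub, h2, ev_mono]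
        simp only [← sum_mul]
        rw [mem_traceless.mp ht]
        simp
    rw [sub_eq_zero] at h1
    have h2 := congrArg (fun f => f.coeff fun j => (part l j : ℝ)) h1
    simp only [coeff_mono] at h2
    rw [if_pos trivial] at h2
    have h3 : (fun _ => (∑ j, (part l j : ℝ)) / n) = fun j : Fin n => (part l j : ℝ) := by
      by_contra h
      rw [if_neg h] at h2
      exact one_ne_zero h2
    have h4 := diffs_part l
    rw [← h3] at h4
    refine hl (funext fun k => ?_)
    have h5 := congrFun h4 k
    simp only [diffs, sub_self] at h5
    exact_mod_cast h5.symm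
  have hp : p.1 = 0 := resSU_injOn hn l (polyRep_le l p.2) (funext fun x => by
    change evalM x.1 p.1 = 0
    rw [hinv, h0])
  rw [show p = 0 from Subtype.ext hp, map_zero]

theorem invariants_irrep (hn : n ≠ 0) {κ : Weight n} (hκ : κ ≠ 0) : (irrep κ).invariants = ⊥ := by
  rw [← dynkin_fullLabels κ 0] at hκ ⊢
  exact invariants_irrep_dynkin hn hκ

theorem trace_rtransOn_conj (hn : n ≠ 0) (l : Fin n → ℕ)
    {U : Matrix (Fin n) (Fin n) ℂ} (hU : U ∈ Matrix.unitaryGroup (Fin n) ℂ)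
    (A : Matrix (Fin n) (Fin n) ℂ) :
    LinearMap.trace ℂ _ (rtransOn hn l (U * A * star U)) =
      LinearMap.trace ℂ _ (rtransOn hn l A) := by
  rw [rtransOn_mul, LinearMap.trace_mul_comm, ← rtransOn_mul, ← mul_assoc,
    mem_unitaryGroup_iff'.mp hU, one_mul]

theorem chi_conj (hn : n ≠ 0) (κ : Weight n) {U : Matrix (Fin n) (Fin n) ℂ}
    (hU : U ∈ Matrix.unitaryGroup (Fin n) ℂ) {g x : SU n} (h : g.1 = U * x.1 * star U) :
    chi κ g = chi κ x := by
  rw [← dynkin_fullLabels κ 0, chi_dynkin hn, chi_dynkin hn, h, trace_rtransOn_conj hn _ hU]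

theorem torus_inv (t : Fin n → ℝ) (ht : ∑ j, t j = 0) :
    (torus t ht)⁻¹ = torus (-t) (by simpa using ht) := by
  refine inv_eq_of_mul_eq_one_left (Subtype.ext ?_)
  rw [Submonoid.coe_mul, coe_torus, coe_torus, Matrix.diagonal_mul_diagonal, OneMemClass.coe_one,
    ← Matrix.diagonal_one]
  congr 1
  funext j
  rw [expi, expi, ← Complex.exp_add]
  simp

/-! ### Multiplicities as coefficients of products of characters. -/

section

variable {ch : Weight n → TrigPoly n}

/-- The values of the characters at the elements with angles `t`. -/
theorem chi_values (hn : n ≠ 0) (hch : ∀ κ (t : Fin n → ℝ) (T : SU n), ∑ j, t j = 0 →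
      (T : Matrix (Fin n) (Fin n) ℂ) = diagonal (expi t) → chi κ T = ev t (ch κ))
    (g : SU n) : ∃ t : Fin n → ℝ, ∑ j, t j = 0 ∧ (∀ κ, chi κ g = ev t (ch κ)) ∧
      ∀ κ, chi κ g⁻¹ = ev t (inv (ch κ)) := by
  obtain ⟨U, hU, t, ht, hg⟩ := exists_conj_torus hn g
  refine ⟨t, ht, fun κ => ?_, fun κ => ?_⟩
  · rw [chi_conj hn κ hU hg, hch κ t _ ht (coe_torus t ht)]
  · have h1 : (g⁻¹).1 = U * ((torus t ht)⁻¹).1 * star U := by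
      have h2 : ∀ x : SU n, (x⁻¹).1 = star x.1 := fun x => rfl
      rw [h2, h2, hg, star_mul, star_mul, star_star, mul_assoc]
    have ht' : ∑ j, (-t) j = 0 := by simpa using ht
    rw [chi_conj hn κ hU h1, torus_inv, hch κ (-t) _ ht' (coe_torus _ ht'), ev_inv]

theorem IsSchurFamily.zero (h : IsSchurFamily ch) : ch 0 = 1 := by
  refine mul_right_cancel₀ (alt_ne_zero strictAnti_rho) ?_
  rw [h, shifted_zero, one_mul]

/-- The Littlewood-Richardson coefficients are the coefficients of the product of two
characters. -/
theorem lrCoeff_eq (hn : n ≠ 0) (h : IsSchurFamily ch)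
    (hs : ∀ κ, SuppIn (weightLattice n : Set (Fin n → ℝ)) (ch κ))
    (hch : ∀ κ (t : Fin n → ℝ) (T : SU n), ∑ j, t j = 0 →
      (T : Matrix (Fin n) (Fin n) ℂ) = diagonal (expi t) → chi κ T = ev t (ch κ))
    (κ μ ν : Weight n) :
    (lrCoeff κ μ ν : ℂ) = (ch κ * ch μ * alt rho).coeff (shifted ν) := by
  have hfd := fun σ : Weight n => finiteDimensional_irrepSpace hn σ
  obtain ⟨I, hI1, hI⟩ := exists_mean (SU n)
  -- The only orthogonality needed is that with the trivial representation, since `χ_κ χ_μ` times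
  -- the conjugate of `χ_ν` is first expanded into characters.
  have hσ : ∀ σ, I ⟨(irrep σ).character, (contRep_irrep hn σ).continuous_character⟩ =
      if σ = 0 then 1 else 0 := by
    intro σ
    split_ifs with h0
    · have : (⟨(irrep σ).character, (contRep_irrep hn σ).continuous_character⟩ : C(SU n, ℂ)) =
          1 := by
        ext g
        obtain ⟨t, -, h1, -⟩ := chi_values hn hch g
        change chi σ g = 1
        rw [h1, h0, h.zero, map_one]
      rw [this, hI1]
    · rw [← (contRep_irrep hn σ).finrank_invariants hI1 hI, invariants_irrep hn h0, finrank_bot,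
        Nat.cast_zero]
  have hsymm : IsSymm (ch κ * ch μ * inv (ch ν)) :=
    ((h.isSymm κ).mul (h.isSymm μ)).mul (h.isSymm ν).inv
  have hsupp : SuppIn (weightLattice n : Set (Fin n → ℝ)) (ch κ * ch μ * inv (ch ν)) :=
    ((hs κ).mul (hs μ) fun a ha b hb => add_mem ha hb).mul
      ((hs ν).inv fun a ha => neg_mem ha) fun a ha b hb => add_mem ha hb
  have hexp := h.eq_sum hsymm hsupp
  have hlr : (lrCoeff κ μ ν : ℂ) = _ := finrank_intertwiningMap (contRep_irrep hn ν)
    (contRep_irrep hn κ) (contRep_irrep hn μ) hI1 hI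
  set c := altCoeffs (ch κ * ch μ * inv (ch ν) * alt rho) with hc
  have hc0 : (ch κ * ch μ * inv (ch ν) * alt rho).coeff rho = c 0 := by
    rw [hc, altCoeffs_apply, shifted_zero]
  rw [hlr, ← h.coeff_inv_mul ((h.isSymm κ).mul (h.isSymm μ)), hc0]
  have hfun : (⟨fun g => (irrep ν).character g⁻¹ * ((irrep κ).character g * (irrep μ).character g),
      ((contRep_irrep hn ν).continuous_character.comp continuous_inv).mul
        ((contRep_irrep hn κ).continuous_character.mul
          (contRep_irrep hn μ).continuous_character)⟩ : C(SU n, ℂ)) = ∑ σ ∈ c.support, c σ •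
        ⟨(irrep σ).character, (contRep_irrep hn σ).continuous_character⟩ := by
    ext g
    obtain ⟨t, -, h1, h2⟩ := chi_values hn hch g
    simp only [ContinuousMap.coe_mk, ContinuousMap.coe_sum, Finset.sum_apply,
      ContinuousMap.coe_smul, Pi.smul_apply]
    change chi ν g⁻¹ * (chi κ g * chi μ g) = ∑ σ ∈ c.support, c σ • chi σ g
    have h3 := congrArg (ev t) hexp
    rw [Finsupp.sum, map_sum, map_mul, map_mul] at h3
    simp only [h1, h2]
    rw [mul_comm, h3]
    exact sum_congr rfl fun σ _ => map_smul _ _ _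
  rw [hfun, map_sum]
  simp only [map_smul, hσ, smul_eq_mul, mul_ite, mul_one, mul_zero, Finset.sum_ite_eq']
  split_ifs with h0
  · rfl
  · exact (Finsupp.notMem_support_iff.mp h0).symm

theorem dimV_eq (hn : n ≠ 0) (hch : ∀ κ (t : Fin n → ℝ) (T : SU n), ∑ j, t j = 0 →
      (T : Matrix (Fin n) (Fin n) ℂ) = diagonal (expi t) → chi κ T = ev t (ch κ))
    (κ : Weight n) : (dimV κ : ℂ) = ev 0 (ch κ) := by
  have := finiteDimensional_irrepSpace hn κ
  rw [← hch κ 0 1 (by simp) (by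
    rw [OneMemClass.coe_one, ← Matrix.diagonal_one]
    congr 1
    funext j
    simp [expi]), chi, Representation.char_one]
  rfl

end

/-! ### Character expansions -/

/-- The irreducible characters as trigonometric polynomials. -/
def schur (hn : n ≠ 0) : Weight n → TrigPoly n := (exists_schurFamily hn).choose

theorem isSchurFamily_schur (hn : n ≠ 0) : IsSchurFamily (schur hn) := (exists_schurFamily hn).choose_spec.1

theorem suppIn_schur (hn : n ≠ 0) (κ : Weight n) : SuppIn (weightLattice n : Set (Fin n → ℝ)) (schur hn κ) :=
  (exists_schurFamily hn).choose_spec.2.1 κ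

theorem chi_eq_ev (hn : n ≠ 0) (κ : Weight n) (t : Fin n → ℝ) (T : SU n) (ht : ∑ j, t j = 0)
    (hT : (T : Matrix (Fin n) (Fin n) ℂ) = diagonal (expi t)) :
    chi κ T = ev t (schur hn κ) := (exists_schurFamily hn).choose_spec.2.2 κ t T ht hT

theorem lrCoeff_eq_coeff (hn : n ≠ 0) (κ μ ν : Weight n) : (lrCoeff κ μ ν : ℂ) =
    (schur hn κ * schur hn μ * alt rho).coeff (shifted ν) :=
  lrCoeff_eq hn (isSchurFamily_schur hn) (suppIn_schur hn) (chi_eq_ev hn) κ μ ν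

theorem dimV_eq_ev (hn : n ≠ 0) (κ : Weight n) : (dimV κ : ℂ) = ev 0 (schur hn κ) :=
  dimV_eq hn (chi_eq_ev hn) κ

theorem dimV_eq_vander (hn : n ≠ 0) (κ : Weight n) :
    (dimV κ : ℝ) = vander (shifted κ) / vander (rho : Fin n → ℝ) := by
  have h := dimV_eq_ev hn κ
  rw [ev_zero_of_mul_alt (isSchurFamily_schur hn κ)] at h
  exact_mod_cast h

/-- The combination `∑ r_κ ch_κ`. -/
def combo (hn : n ≠ 0) (r : Weight n →₀ ℝ) : TrigPoly n := r.sum fun κ a => (a : ℂ) • schur hn κ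

theorem combo_eq (hn : n ≠ 0) (r : Weight n →₀ ℝ) :
    combo hn r = ∑ κ ∈ r.support, (r κ : ℂ) • schur hn κ := rfl

theorem isSymm_combo (hn : n ≠ 0) (r : Weight n →₀ ℝ) : IsSymm (combo hn r) := by
  intro w
  rw [combo_eq, map_sum]
  refine sum_congr rfl fun κ _ => ?_
  rw [map_smul, (isSchurFamily_schur hn).isSymm κ w]

theorem suppIn_combo (hn : n ≠ 0) (r : Weight n →₀ ℝ) :
    SuppIn (weightLattice n : Set (Fin n → ℝ)) (combo hn r) :=
  SuppIn.sum _ _ fun κ _ => (suppIn_schur hn κ).smul _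

theorem coeff_combo_mul (hn : n ≠ 0) (r : Weight n →₀ ℝ) (κ : Weight n) :
    (combo hn r * alt rho).coeff (shifted κ) = (r κ : ℂ) := by
  have h1 : combo hn r * alt rho =
      (r.mapRange Complex.ofReal Complex.ofReal_zero).sum fun κ a => a • alt (shifted κ) := by
    rw [Finsupp.sum_mapRange_index (by simp), combo, Finsupp.sum, Finsupp.sum, sum_mul]
    refine sum_congr rfl fun κ _ => ?_
    rw [smul_mul_assoc, isSchurFamily_schur hn κ]
  rw [h1, coeff_sum_alt]
  rfl

theorem combo_injective (hn : n ≠ 0) : Injective (combo hn) := by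
  intro r s h
  ext κ
  have h1 := coeff_combo_mul hn r κ
  rw [h, coeff_combo_mul] at h1
  exact_mod_cast h1.symm

theorem isCharacterExpansion_iff (hn : n ≠ 0) (F : (Fin (n - 1) → ℝ) → ℝ) (r : Weight n →₀ ℝ) :
    IsCharacterExpansion F r ↔ ∀ t ∈ traceless n, Injective (expi t) →
      (F (diffs t) : ℂ) = ev t (combo hn r) := by
  have key : ∀ (t : Fin n → ℝ) (T : SU n), ∑ j, t j = 0 →
      (T : Matrix (Fin n) (Fin n) ℂ) = diagonal (expi t) →
      (r.sum fun κ a => (a : ℂ) * chi κ T) = ev t (combo hn r) := by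
    intro t T ht hT
    rw [combo_eq, map_sum, Finsupp.sum]
    refine sum_congr rfl fun κ _ => ?_
    rw [map_smul, smul_eq_mul, chi_eq_ev hn κ t T ht hT]
  constructor
  · intro h t ht hreg
    rw [h t (torus t ht) ht rfl hreg, key t _ ht rfl]
  · intro h t T ht hT hreg
    rw [h t ht hreg, key t T ht hT]

/-- The combination is determined by the values of the expansion. -/
theorem combo_eq_of_expansion (hn : n ≠ 0) {F : (Fin (n - 1) → ℝ) → ℝ} {f : TrigPoly n}
    (hs : SuppIn (weightLattice n : Set (Fin n → ℝ)) f)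
    (hF : ∀ t ∈ traceless n, Injective (expi t) → (F (diffs t) : ℂ) = ev t f)
    {r : Weight n →₀ ℝ} (hr : IsCharacterExpansion F r) : combo hn r = f := by
  rw [isCharacterExpansion_iff hn] at hr
  rw [← sub_eq_zero]
  refine eq_zero_of_ev_regular (A := (weightLattice n : Set (Fin n → ℝ))) ?_
    (fun x hx y hy => weightLattice_le_traceless n (sub_mem hx hy)) fun t ht hreg => ?_
  · rw [sub_eq_add_neg, ← neg_one_smul ℂ]
    exact (suppIn_combo hn r).add (hs.smul _)
  · rw [map_sub, ← hr t ht hreg, ← hF t ht hreg, sub_self]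

/-- The coefficient of `χ_κ` is that of `f a_ρ` at `κ + ρ`, an integral combination of coefficients
of `f`; this is where reality comes from. -/
theorem existsUnique_expansion (hn : n ≠ 0) {F : (Fin (n - 1) → ℝ) → ℝ} {f : TrigPoly n} (hf : IsSymm f)
    (hs : SuppIn (weightLattice n : Set (Fin n → ℝ)) f) (hre : ∀ x, (f.coeff x).im = 0)
    (hF : ∀ t ∈ traceless n, Injective (expi t) → (F (diffs t) : ℂ) = ev t f) :
    ∃! r : Weight n →₀ ℝ, IsCharacterExpansion F r := by
  have hre' : ∀ x, ((f * alt rho).coeff x).im = 0 := by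
    intro x
    rw [alt, mul_sum, coeff_sum, Finsupp.finsetSum_apply, Complex.im_sum]
    refine Finset.sum_eq_zero fun w _ => ?_
    rw [mul_smul_comm, coeff_smul, Finsupp.smul_apply, coeff_mul_mono, smul_eq_mul,
      Complex.mul_im, hre, Complex.intCast_im, mul_zero, zero_mul, add_zero]
  let r : Weight n →₀ ℝ := (altCoeffs (f * alt rho)).mapRange Complex.re Complex.zero_re
  have hr : combo hn r = f := by
    conv_rhs => rw [(isSchurFamily_schur hn).eq_sum hf hs]
    rw [combo, Finsupp.sum_mapRange_index (by simp)]
    refine sum_congr rfl fun κ _ => ?_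
    beta_reduce
    congr 1
    rw [altCoeffs_apply]
    refine Complex.ext (by simp) ?_
    rw [Complex.ofReal_im, hre']
  refine ⟨r, ?_, fun s hs' => ?_⟩
  · beta_reduce
    rw [isCharacterExpansion_iff hn, hr]
    exact hF
  · exact combo_injective hn (by rw [combo_eq_of_expansion hn hs hF hs', hr])

/-! ### Sum rules for the dimensions. -/

theorem ev_zero_combo (hn : n ≠ 0) (r : Weight n →₀ ℝ) :
    ev 0 (combo hn r) = ((r.sum fun κ a => a * (dimV κ : ℝ) : ℝ) : ℂ) := by
  rw [combo_eq, map_sum, Finsupp.sum]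
  push_cast
  refine sum_congr rfl fun κ _ => ?_
  rw [map_smul, smul_eq_mul, dimV_eq_ev hn]

theorem cCoeff_eq (hn : n ≠ 0) (r : Weight n →₀ ℝ) (ν ν' : Weight n) :
    (cCoeff r ν ν' : ℂ) = (combo hn r * schur hn ν * alt rho).coeff (shifted ν') := by
  rw [cCoeff, combo_eq, Finsupp.sum]
  simp only [sum_mul, coeff_sum, Finsupp.finsetSum_apply, smul_mul_assoc,
    coeff_smul, Finsupp.smul_apply, ← lrCoeff_eq_coeff hn, smul_eq_mul]
  push_cast
  exact sum_congr rfl fun κ _ => mul_comm _ _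

theorem sum_altCoeffs_dimV (hn : n ≠ 0) {f : TrigPoly n} (hf : IsSymm f)
    (hs : SuppIn (weightLattice n : Set (Fin n → ℝ)) f) :
    ∑ᶠ ν : Weight n, (f * alt rho).coeff (shifted ν) * (dimV ν : ℂ) = ev 0 f := by
  conv_rhs => rw [(isSchurFamily_schur hn).eq_sum hf hs, Finsupp.sum, map_sum]
  rw [finsum_eq_sum_of_support_subset (s := (altCoeffs (f * alt rho)).support)]
  · refine sum_congr rfl fun κ _ => ?_
    rw [map_smul, smul_eq_mul, dimV_eq_ev hn, altCoeffs_apply]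
  · intro ν hν
    rw [Finset.mem_coe, Finsupp.mem_support_iff, altCoeffs_apply]
    exact left_ne_zero_of_mul hν

theorem finite_support_altCoeffs (f : TrigPoly n) :
    {ν : Weight n | f.coeff (shifted ν) ≠ 0}.Finite := by
  refine (altCoeffs f).support.finite_toSet.subset fun ν hν => ?_
  rw [Finset.mem_coe, Finsupp.mem_support_iff, altCoeffs_apply]
  exact hν

/-- For fixed `ν'` the numbers `c` are, by `coeff_swap`, the coefficients in `ν` of the conjugate of
`R` times `χ_{ν'}`. Evaluation at the identity, where `R` is 1, gives `∑_ν c dim V_ν = dim V_{ν'}`.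
The remaining sum over `ν'` is the dimension of the tensor product. -/
theorem sum_lrCoeff_mul_cCoeff (hn : n ≠ 0) {r : Weight n →₀ ℝ} (hr : (r.sum fun κ a => a * (dimV κ : ℝ)) = 1)
    (lam μ : Weight n) :
    ∑ᶠ q : Weight n × Weight n, (lrCoeff lam μ q.2 : ℝ) * cCoeff r q.1 q.2 * (dimV q.1 : ℝ) =
      (dimV lam : ℝ) * (dimV μ : ℝ) := by
  classical
  have hch := isSchurFamily_schur hn
  set S := (finite_support_altCoeffs (schur hn lam * schur hn μ * alt rho)).toFinset with hS
  have hsw : ∀ ν ν', (cCoeff r ν ν' : ℂ) =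
      (inv (combo hn r) * schur hn ν' * alt rho).coeff (shifted ν) := fun ν ν' => by
    rw [cCoeff_eq hn, hch.coeff_swap (isSymm_combo hn r)]
  set T : Finset (Weight n) := S.biUnion fun ν' =>
    (finite_support_altCoeffs (inv (combo hn r) * schur hn ν' * alt rho)).toFinset with hT
  have hsupp : (Function.support fun q : Weight n × Weight n =>
      (lrCoeff lam μ q.2 : ℝ) * cCoeff r q.1 q.2 * (dimV q.1 : ℝ)) ⊆ (T ×ˢ S : Finset _) := by
    rintro ⟨ν, ν'⟩ h
    have h1 : (lrCoeff lam μ ν' : ℝ) ≠ 0 := left_ne_zero_of_mul (left_ne_zero_of_mul h)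
    have h2 : cCoeff r ν ν' ≠ 0 := right_ne_zero_of_mul (left_ne_zero_of_mul h)
    have h1' : ν' ∈ S := by
      rw [hS, Set.Finite.mem_toFinset, Set.mem_ofPred_eq, ← lrCoeff_eq_coeff hn]
      exact_mod_cast h1
    rw [Finset.mem_coe, Finset.mem_product]
    refine ⟨Finset.mem_biUnion.mpr ⟨ν', h1', ?_⟩, h1'⟩
    rw [Set.Finite.mem_toFinset, Set.mem_ofPred_eq, ← hsw]
    exact_mod_cast h2
  rw [finsum_eq_sum_of_support_subset _ hsupp, Finset.sum_product_right]
  have h0 : ev 0 (inv (combo hn r)) = 1 := by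
    rw [ev_inv, neg_zero, ev_zero_combo, hr, Complex.ofReal_one]
  have h3 : ∀ ν' ∈ S, ∑ ν ∈ T, (cCoeff r ν ν' : ℂ) * (dimV ν : ℂ) = dimV ν' := by
    intro ν' hν'
    have h4 := sum_altCoeffs_dimV hn (f := inv (combo hn r) * schur hn ν')
      ((isSymm_combo hn r).inv.mul (hch.isSymm ν'))
      (((suppIn_combo hn r).inv fun a ha => neg_mem ha).mul (suppIn_schur hn ν')
        fun a ha b hb => add_mem ha hb)
    rw [map_mul, h0, one_mul, ← dimV_eq_ev] at h4
    rw [← h4, finsum_eq_sum_of_support_subset (s := T)]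
    · exact sum_congr rfl fun ν _ => by rw [hsw]
    · intro ν hν
      refine Finset.mem_biUnion.mpr ⟨ν', hν', ?_⟩
      rw [Set.Finite.mem_toFinset]
      exact left_ne_zero_of_mul hν
  have h5 := sum_altCoeffs_dimV hn (f := schur hn lam * schur hn μ)
    ((hch.isSymm lam).mul (hch.isSymm μ))
    ((suppIn_schur hn lam).mul (suppIn_schur hn μ) fun a ha b hb => add_mem ha hb)
  rw [map_mul, ← dimV_eq_ev, ← dimV_eq_ev, finsum_eq_sum_of_support_subset (s := S)] at h5
  · have h6 : ((∑ ν' ∈ S, ∑ ν ∈ T, (lrCoeff lam μ ν' : ℝ) * cCoeff r ν ν' * (dimV ν : ℝ) : ℝ) : ℂ) =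
        ((dimV lam : ℝ) * (dimV μ : ℝ) : ℝ) := by
      push_cast
      rw [← h5]
      refine sum_congr rfl fun ν' hν' => ?_
      rw [← h3 ν' hν', ← lrCoeff_eq_coeff hn, mul_sum]
      exact sum_congr rfl fun ν _ => by ring
    exact_mod_cast h6
  · intro ν hν
    rw [Finset.mem_coe, hS, Set.Finite.mem_toFinset]
    exact left_ne_zero_of_mul hν

/-- The shift by `ρ` is a bijection from all dominant weights onto those off the walls; it reduces
the hatted sum rule to the plain one. -/
theorem finsum_offWalls {M : Type*} [AddCommMonoid M] (g : Weight n × Weight n → M) :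
    ∑ᶠ (q : Weight n × Weight n) (_ : OffWalls q.1), g (subRho q.1, q.2) = ∑ᶠ q, g q := by
  let e : Weight n × Weight n → Weight n × Weight n := fun q => (fun k => q.1 k + 1, q.2)
  have he : Injective e := by
    rintro ⟨a, b⟩ ⟨c, d⟩ h
    simp only [e, Prod.mk.injEq] at h
    refine Prod.ext (funext fun k => ?_) h.2
    simpa using congrFun h.1 k
  have h1 : ∀ q : Weight n × Weight n, OffWalls q.1 ↔ q ∈ Set.range e := by
    rintro ⟨a, b⟩
    constructor
    · intro h
      refine ⟨(subRho a, b), Prod.ext (funext fun k => ?_) rfl⟩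
      have := h k
      simp only [e, subRho]
      simp only at this
      omega
    · rintro ⟨⟨c, d⟩, h⟩ k
      rw [← h]
      simp [e]
  simp only [h1]
  rw [finsum_mem_range he]
  refine finsum_congr fun q => ?_
  congr 1

/-! ### Products of cardinal sines -/

/-- `∏_{i < i'} sinc ((u_i + ⋯ + u_{i'-1}) / 2)`. -/
def sincProd (u : Fin (n - 1) → ℝ) : ℝ :=
  ∏ q : Fin n × Fin n with q.1 < q.2, sinc (blockSum u q.1 q.2 / 2)

theorem continuous_blockSum (i j : Fin n) :
    Continuous fun u : Fin (n - 1) → ℝ => blockSum u i j := by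
  unfold blockSum
  fun_prop

theorem continuous_sincProd : Continuous (sincProd (n := n)) :=
  continuous_finsetProd _ fun q _ =>
    Real.continuous_sinc.comp ((continuous_blockSum q.1 q.2).div_const 2)

theorem abs_sinc_le (x : ℝ) : |sinc x| ≤ 2 * (1 + |x|)⁻¹ := by
  rw [← div_eq_mul_inv, le_div_iff₀ (by positivity)]
  rcases le_or_gt |x| 1 with h | h
  · nlinarith [Real.abs_sinc_le_one x, abs_nonneg x, abs_nonneg (sinc x)]
  · have hx : x ≠ 0 := by
      rintro rfl
      simp at h
      linarith
    have h1 := Real.sinc_le_inv_abs hx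
    have h2 : |sinc x| ≤ |x|⁻¹ := by
      rw [Real.sinc_of_ne_zero hx, abs_div, div_eq_mul_inv]
      exact mul_le_of_le_one_left (by positivity) (Real.abs_sin_le_one x)
    have h3 : |x|⁻¹ * |x| = 1 := inv_mul_cancel₀ (by positivity)
    nlinarith [inv_nonneg.mpr (abs_nonneg x), inv_le_one_of_one_le₀ h.le]

theorem abs_blockSum_le {K : ℝ} {u : Fin (n - 1) → ℝ} (hu : ∀ j, |u j| ≤ K)
    (hK : 0 ≤ K) (i j : Fin n) : |blockSum u i j| ≤ n * K := by
  refine (Finset.abs_sum_le_sum_abs _ _).trans ((Finset.sum_le_sum fun k _ => hu k).trans ?_)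
  rw [sum_const, nsmul_eq_mul]
  gcongr
  refine (Finset.card_filter_le _ _).trans ?_
  simp

theorem blockSum_add {M : Type} [AddCommMonoid M] (u v : Fin (n - 1) → M) (i j : Fin n) :
    blockSum (u + v) i j = blockSum u i j + blockSum v i j := sum_add_distrib

theorem blockSum_smul (c : ℝ) (u : Fin (n - 1) → ℝ) (i j : Fin n) :
    blockSum (c • u) i j = c * blockSum u i j := by
  simp only [blockSum, mul_sum, Pi.smul_apply, smul_eq_mul]

theorem blockSum_castVec (p : Fin (n - 1) → ℤ) (i j : Fin n) :
    blockSum (castVec p) i j = (blockSum p i j : ℤ) := by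
  simp only [blockSum, castVec, Int.cast_sum]

/-- The point is a bound uniform in `v` on boxes, so that translates are dominated by a function on
the lattice. It comes from `1 + |b| ≤ (1 + |a|)(1 + π|a + b|)` for each block sum. -/
theorem abs_sincProd_add_le {K : ℝ} (hK : 0 ≤ K) {v : Fin (n - 1) → ℝ}
    (hv : ∀ j, |v j| ≤ K) (p : Fin (n - 1) → ℝ) :
    |sincProd ((2 * π) • (v + p))| ≤
      ∏ q : Fin n × Fin n with q.1 < q.2, 2 * (1 + n * K) * (1 + |blockSum p q.1 q.2|)⁻¹ := by
  rw [sincProd, Finset.abs_prod]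
  refine Finset.prod_le_prod (fun _ _ => abs_nonneg _) fun q _ => (abs_sinc_le _).trans ?_
  rw [blockSum_smul, blockSum_add, mul_assoc 2 (1 + n * K)]
  refine mul_le_mul_of_nonneg_left ?_ zero_le_two
  rw [inv_le_comm₀ (by positivity) (by positivity), mul_inv, _root_.inv_inv]
  have h1 := abs_blockSum_le hv hK q.1 q.2
  set a := blockSum v q.1 q.2
  set b := blockSum p q.1 q.2
  have h2 : |2 * π * (a + b) / 2| = π * |a + b| := by
    rw [show 2 * π * (a + b) / 2 = π * (a + b) by ring, abs_mul, abs_of_pos Real.pi_pos]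
  have h3 : |b| ≤ |a + b| + |a| := by simpa using abs_add_le (a + b) (-a)
  have h4 : |a + b| ≤ π * |a + b| :=
    le_mul_of_one_le_left (abs_nonneg _) (by linarith [Real.pi_gt_three])
  rw [h2, inv_mul_le_iff₀ (by positivity)]
  nlinarith [abs_nonneg (a + b), abs_nonneg a, abs_nonneg b]

theorem lift_castVec_sub (p : Fin (n - 1) → ℤ) (i j : Fin n) :
    lift (castVec p) i - lift (castVec p) j = ((blockSum p i j - blockSum p j i : ℤ) : ℝ) := by
  have h0 : ∀ a b : Fin n, a ≤ b → blockSum p b a = 0 := fun a b hab =>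
    Finset.sum_eq_zero fun k hk => by
      have h1 := (mem_filter.mp hk).2
      have h2 : a.val ≤ b.val := hab
      omega
  rcases le_total i j with h | h
  · rw [lift_sub_lift _ h, h0 i j h, sub_zero, blockSum_castVec]
  · rw [← neg_sub, lift_sub_lift _ h, h0 j i h, zero_sub, blockSum_castVec, Int.cast_neg]

/-! ### Absolute convergence over the lattice for `n ≥ 3`. -/

theorem summable_prod_int {ι : Type*} [Fintype ι] {f : ℤ → ℝ} (hf : ∀ k, 0 ≤ f k)
    (hs : Summable f) : Summable fun k : ι → ℤ => ∏ j, f (k j) := by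
  classical
  refine summable_of_sum_le (c := ∏ _j : ι, ∑' k, f k)
    (fun k => Finset.prod_nonneg fun j _ => hf _) fun s => ?_
  have h1 : s ⊆ Fintype.piFinset fun j => s.image fun k => k j := fun k hk =>
    Fintype.mem_piFinset.mpr fun j => Finset.mem_image_of_mem (fun k => k j) hk
  refine (Finset.sum_le_sum_of_subset_of_nonneg h1
    fun k _ _ => Finset.prod_nonneg fun j _ => hf _).trans ?_
  rw [← Finset.prod_univ_sum]
  exact Finset.prod_le_prod (fun j _ => Finset.sum_nonneg fun k _ => hf k)
    fun j _ => hs.sum_le_tsum _ fun k _ => hf k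

theorem prod_pairs_sq (a : Fin n → Fin n → ℝ) (ha : ∀ i j, a i j = a j i) (hd : ∀ i, a i i = 1) :
    (∏ q : Fin n × Fin n with q.1 < q.2, a q.1 q.2) ^ 2 = ∏ i, ∏ j, a i j := by
  rw [← Fintype.prod_prod_type',
    ← Finset.prod_filter_mul_prod_filter_not Finset.univ fun q : Fin n × Fin n => q.1 < q.2, sq]
  congr 1
  have h1 : ∏ q : Fin n × Fin n with ¬ q.1 < q.2, a q.1 q.2 =
      ∏ q : Fin n × Fin n with q.2 < q.1, a q.1 q.2 := by
    rw [Finset.prod_filter, Finset.prod_filter]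
    refine prod_congr rfl fun q _ => ?_
    rcases lt_trichotomy q.1 q.2 with h | h | h
    · simp [h, h.le]
    · simp [h, hd]
    · simp [h, h.le]
  rw [h1]
  refine Finset.prod_bij' (fun q _ => q.swap) (fun q _ => q.swap) ?_ ?_ ?_ ?_ ?_ <;>
    simp +contextual [ha]

/-- A product over pairs is bounded by the sum over stars. -/
theorem prod_pairs_le_sum_stars (hn : 3 ≤ n) (a : Fin n → Fin n → ℝ)
    (ha : ∀ i j, a i j = a j i) (hd : ∀ i, a i i = 1) (h0 : ∀ i j, 0 ≤ a i j)
    (h1 : ∀ i j, a i j ≤ 1) :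
    ∏ q : Fin n × Fin n with q.1 < q.2, a q.1 q.2 ≤ ∑ i, ∏ j, a i j ^ (3 / 2 : ℝ) := by
  have hne : Nonempty (Fin n) := ⟨⟨0, by omega⟩⟩
  set x : Fin n → ℝ := fun i => ∏ j, a i j
  have hx0 : ∀ i, 0 ≤ x i := fun i => Finset.prod_nonneg fun j _ => h0 i j
  have hx1 : ∀ i, x i ≤ 1 := fun i => Finset.prod_le_one (fun j _ => h0 i j) fun j _ => h1 i j
  -- The square of the product over pairs is the product of all rows, at most the cube of the
  -- largest row because `n ≥ 3` and rows are at most 1. The resulting exponent `3/2` exceeds 1,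
  -- which makes the lattice sums converge.
  obtain ⟨i, hi⟩ := Finite.exists_max x
  have h2 : (∏ q : Fin n × Fin n with q.1 < q.2, a q.1 q.2) ^ 2 ≤ (x i ^ (3 / 2 : ℝ)) ^ 2 := by
    rw [prod_pairs_sq a ha hd]
    calc ∏ k, x k ≤ ∏ _k : Fin n, x i := Finset.prod_le_prod (fun k _ => hx0 k) fun k _ => hi k
      _ = x i ^ n := by simp
      _ ≤ x i ^ 3 := pow_le_pow_of_le_one (hx0 i) (hx1 i) hn
      _ = (x i ^ (3 / 2 : ℝ)) ^ 2 := by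
        rw [← Real.rpow_natCast, ← Real.rpow_natCast, ← Real.rpow_mul (hx0 i)]
        norm_num
  refine (le_of_sq_le_sq h2 (Real.rpow_nonneg (hx0 i) _)).trans ?_
  rw [← Real.finsetProd_rpow _ _ fun j _ => h0 i j]
  exact Finset.single_le_sum (f := fun i => ∏ j, a i j ^ (3 / 2 : ℝ))
    (fun k _ => Finset.prod_nonneg fun j _ => Real.rpow_nonneg (h0 k j) _) (mem_univ i)

theorem summable_star_int : Summable fun k : ℤ => ((1 + |(k : ℝ)|)⁻¹) ^ (3 / 2 : ℝ) := by
  have h1 : Summable fun k : ℕ => ((1 + |((k : ℤ) : ℝ)|)⁻¹) ^ (3 / 2 : ℝ) := by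
    refine ((Real.summable_one_div_nat_add_rpow 1 (3 / 2)).mpr (by norm_num)).congr fun k => ?_
    rw [Real.inv_rpow (by positivity), one_div, Int.cast_natCast, add_comm,
      abs_of_nonneg (by positivity), abs_of_nonneg (by positivity)]
  refine Summable.of_nat_of_neg h1 ?_
  simpa using h1

/-- In the star at the vertex `i` the variables are the differences from coordinate `i`. They
determine `p`, so each star is dominated by a product of convergent one-dimensional series. -/
theorem summable_prod_pairs (hn : 3 ≤ n) (C : ℝ) : Summable fun p : Fin (n - 1) → ℤ =>
      ∏ q : Fin n × Fin n with q.1 < q.2, C * (1 + |blockSum (castVec p) q.1 q.2|)⁻¹ := by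
  simp only [prod_mul_distrib]
  refine Summable.mul_left _ ?_
  have h1 : ∀ p : Fin (n - 1) → ℤ,
      ∏ q : Fin n × Fin n with q.1 < q.2, (1 + |blockSum (castVec p) q.1 q.2|)⁻¹ ≤
        ∑ i, ∏ j, ((1 + |((blockSum p i j - blockSum p j i : ℤ) : ℝ)|)⁻¹) ^ (3 / 2 : ℝ) := by
    intro p
    refine le_trans (le_of_eq ?_) (prod_pairs_le_sum_stars hn
      (fun i j => (1 + |((blockSum p i j - blockSum p j i : ℤ) : ℝ)|)⁻¹) ?_ ?_ ?_ ?_)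
    · refine prod_congr rfl fun q hq => ?_
      rw [← lift_castVec_sub, lift_sub_lift _ (mem_filter.mp hq).2.le]
    · intro i j
      rw [← lift_castVec_sub, ← lift_castVec_sub, abs_sub_comm]
    · intro i; simp
    · intro i j; positivity
    · intro i j
      exact inv_le_one_of_one_le₀ (le_add_of_nonneg_right (abs_nonneg _))
  refine Summable.of_nonneg_of_le (fun p => Finset.prod_nonneg fun q _ => by positivity) h1 ?_
  refine summable_sum fun i _ => ?_
  refine (summable_prod_int (ι := Fin n) (f := fun k : ℤ => ((1 + |(k : ℝ)|)⁻¹) ^ (3 / 2 : ℝ))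
    (fun k => by positivity) summable_star_int).comp_injective
    (i := fun p : Fin (n - 1) → ℤ => fun j => blockSum p i j - blockSum p j i) fun p p' h => ?_
  beta_reduce at h
  have h2 : ∀ j k, lift (castVec p) j - lift (castVec p) k =
      lift (castVec p') j - lift (castVec p') k := by
    intro j k
    have hj := lift_castVec_sub p i j
    have hk := lift_castVec_sub p i k
    have hj' := lift_castVec_sub p' i j
    have hk' := lift_castVec_sub p' i k
    rw [congrFun h j, ← hj'] at hj
    rw [congrFun h k, ← hk'] at hk
    linarith
  have h3 : diffs (lift (castVec p)) = diffs (lift (castVec p')) := funext fun j => h2 _ _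
  rw [diffs_lift, diffs_lift] at h3
  funext j
  exact Int.cast_injective (congrFun h3 j)

theorem integrable_sincProd (hn : 3 ≤ n) :
    Integrable fun v : Fin (n - 1) → ℝ => sincProd ((2 * π) • v) := by
  let f : C(Fin (n - 1) → ℝ, ℝ) := ⟨fun v => sincProd ((2 * π) • v),
    continuous_sincProd.comp (continuous_const_smul _)⟩
  let s : (Fin (n - 1) → ℤ) → TopologicalSpace.Compacts (Fin (n - 1) → ℝ) := fun p =>
    ⟨Set.Icc (castVec p) (castVec p + 1), isCompact_Icc⟩
  have hs : ⋃ p, (s p : Set (Fin (n - 1) → ℝ)) = Set.univ := by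
    refine Set.eq_univ_of_forall fun v => Set.mem_iUnion.mpr ⟨fun j => ⌊v j⌋, ?_⟩
    exact ⟨fun j => Int.floor_le _, fun j => (Int.lt_floor_add_one _).le⟩
  refine integrable_of_summable_norm_restrict (f := f) (s := s) ?_ hs
  refine Summable.of_nonneg_of_le (fun p => by positivity) (fun p => ?_)
    (summable_prod_pairs hn (2 * (1 + n * 1)))
  have hv : volume.real (s p : Set (Fin (n - 1) → ℝ)) = 1 := by
    simp only [s, TopologicalSpace.Compacts.coe_mk, measureReal_def, Real.volume_Icc_pi]
    simp
  rw [hv, mul_one, ContinuousMap.norm_le _ (Finset.prod_nonneg fun q _ => by positivity)]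
  rintro ⟨v, hv1, hv2⟩
  have := abs_sincProd_add_le (n := n) (v := v - castVec p) zero_le_one (fun j => by
    have h1 := hv1 j
    have h2 := hv2 j
    simp only [Pi.add_apply, Pi.one_apply, Pi.sub_apply] at h1 h2 ⊢
    exact abs_le.mpr ⟨by linarith, by linarith⟩) (castVec p)
  rw [sub_add_cancel] at this
  exact this

/-! ### Poisson summation -/

/-- The projection to the torus. -/
def toTorus (ι : Type) : C(ι → ℝ, UnitAddTorus ι) where
  toFun v i := (v i : UnitAddCircle)
  continuous_toFun := continuous_pi fun i =>
    (AddCircle.continuous_mk' (1 : ℝ)).comp (continuous_apply i)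

theorem isQuotientMap_toTorus (ι : Type) : Topology.IsQuotientMap (toTorus ι) :=
  (IsOpenQuotientMap.piMap (fun _ : ι => QuotientAddGroup.isOpenQuotientMap_mk
    (G := ℝ) (N := AddSubgroup.zmultiples (1 : ℝ)))).isQuotientMap

theorem exists_of_toTorus_eq {ι : Type} {v w : ι → ℝ} (h : toTorus ι v = toTorus ι w) :
    ∃ p : ι → ℤ, v = w + castVec p := by
  have h1 : ∀ i, ∃ p : ℤ, v i = w i + p := fun i => by
    obtain ⟨p, hp⟩ := QuotientAddGroup.eq.mp (congrFun h i)
    refine ⟨-p, ?_⟩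
    simp at hp
    push_cast
    linarith
  choose p hp using h1
  exact ⟨p, funext hp⟩

section

variable {ι : Type} [Fintype ι]

/-- The character `v ↦ exp (2 π i y · v)`. -/
def echar (y v : ι → ℝ) : ℂ := exp (2 * π * I * ((∑ j, y j * v j : ℝ) : ℂ))

theorem norm_echar (y v : ι → ℝ) : ‖echar y v‖ = 1 := by
  rw [echar, show 2 * (π : ℂ) * I * ((∑ j, y j * v j : ℝ) : ℂ) =
    ((2 * π * ∑ j, y j * v j : ℝ) : ℂ) * I by push_cast; ring]
  exact Complex.norm_exp_ofReal_mul_I _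

theorem echar_add (y v w : ι → ℝ) : echar y (v + w) = echar y v * echar y w := by
  rw [echar, echar, echar, ← Complex.exp_add, ← mul_add, ← Complex.ofReal_add, ← sum_add_distrib]
  simp only [Pi.add_apply, mul_add]

theorem echar_add_left (y z v : ι → ℝ) : echar (y + z) v = echar y v * echar z v := by
  rw [echar, echar, echar, ← Complex.exp_add, ← mul_add, ← Complex.ofReal_add, ← sum_add_distrib]
  simp only [Pi.add_apply, add_mul]

theorem echar_zero (y : ι → ℝ) : echar y 0 = 1 := by simp [echar]

theorem echar_int (k p : ι → ℤ) : echar (castVec k) (castVec p) = 1 := by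
  rw [echar, Complex.exp_eq_one_iff]
  refine ⟨∑ j, k j * p j, ?_⟩
  simp only [castVec]
  push_cast
  ring

theorem continuous_echar (y : ι → ℝ) : Continuous (echar y) := by
  unfold echar
  fun_prop

theorem mFourier_toTorus (k : ι → ℤ) (v : ι → ℝ) :
    UnitAddTorus.mFourier k (toTorus ι v) = echar (castVec k) v := by
  rw [UnitAddTorus.mFourier, ContinuousMap.coe_mk, echar]
  have h : ∀ i, fourier (k i) (toTorus ι v i) = _ := fun i =>
    fourier_coe_apply (T := 1) (n := k i) (x := v i)
  rw [prod_congr rfl fun i _ => h i, ← Complex.exp_sum]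
  push_cast
  rw [mul_sum]
  simp only [castVec]
  congr 1
  refine sum_congr rfl fun j _ => ?_
  push_cast
  ring

variable {f : (ι → ℝ) → ℂ}

theorem summable_translates (hb : ∀ K, 0 ≤ K → ∃ b : (ι → ℤ) → ℝ, Summable b ∧
      ∀ v : ι → ℝ, (∀ j, |v j| ≤ K) → ∀ p, ‖f (v + castVec p)‖ ≤ b p) (v : ι → ℝ) :
    Summable fun p : ι → ℤ => f (v + castVec p) := by
  obtain ⟨b, hs, h⟩ := hb (∑ j, |v j|) (Finset.sum_nonneg fun _ _ => abs_nonneg _)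
  exact .of_norm_bounded hs (h v fun j =>
    Finset.single_le_sum (f := fun j => |v j|) (fun _ _ => abs_nonneg _) (mem_univ j))

theorem continuous_tsum_translates (hf : Continuous f)
    (hb : ∀ K, 0 ≤ K → ∃ b : (ι → ℤ) → ℝ, Summable b ∧
      ∀ v : ι → ℝ, (∀ j, |v j| ≤ K) → ∀ p, ‖f (v + castVec p)‖ ≤ b p) :
    Continuous fun v => ∑' p : ι → ℤ, f (v + castVec p) := by
  refine continuous_iff_continuousAt.mpr fun v => ?_
  obtain ⟨b, hs, h⟩ := hb (‖v‖ + 1) (by positivity)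
  refine (continuousOn_tsum (s := Metric.ball 0 (‖v‖ + 1)) (u := b) (fun p => ?_) hs
    fun p w hw => h w (fun j => ?_) p).continuousAt (Metric.isOpen_ball.mem_nhds ?_)
  · exact (hf.comp (continuous_id.add continuous_const)).continuousOn
  · rw [mem_ball_zero_iff] at hw
    exact (norm_le_pi_norm w j).trans hw.le
  · rw [mem_ball_zero_iff]
    exact lt_add_one _

/-- Summing integrals over the unit cubes. -/
theorem hasSum_integral_cubes {h : (ι → ℝ) → ℂ} (hh : Integrable h) :
    HasSum (fun p : ι → ℤ => ∫ v in {v : ι → ℝ | ∀ i, v i ∈ Set.Ioc (0 : ℝ) (0 + 1)},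
      h (v + castVec p)) (∫ v, h v) := by
  set S : (ι → ℤ) → Set (ι → ℝ) := fun p => {v | ∀ i, v i ∈ Set.Ioc (p i : ℝ) (p i + 1)}
  have hm : ∀ p, MeasurableSet (S p) := fun p => by
    have : S p = Set.univ.pi fun i => Set.Ioc (p i : ℝ) (p i + 1) := by ext v; simp [S]
    rw [this]
    exact MeasurableSet.univ_pi fun i => measurableSet_Ioc
  have hd : Pairwise (Function.onFun Disjoint S) := by
    intro p q hpq
    refine Set.disjoint_left.mpr fun v hp hq => hpq (funext fun i => ?_)
    obtain ⟨h1, h2⟩ := hp i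
    obtain ⟨h3, h4⟩ := hq i
    have h5 : (p i : ℝ) < q i + 1 := by linarith
    have h6 : (q i : ℝ) < p i + 1 := by linarith
    norm_cast at h5 h6
    omega
  have hu : ⋃ p, S p = Set.univ := by
    refine Set.eq_univ_of_forall fun v => Set.mem_iUnion.mpr ⟨fun i => ⌈v i⌉ - 1, fun i => ?_⟩
    push_cast
    exact ⟨by linarith [Int.ceil_lt_add_one (v i)], by linarith [Int.le_ceil (v i)]⟩
  have := hasSum_integral_iUnion hm hd (hh.integrableOn (s := ⋃ p, S p))
  rw [hu, setIntegral_univ] at this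
  refine this.congr_fun fun p => ?_
  have h1 : {v : ι → ℝ | ∀ i, v i ∈ Set.Ioc (0 : ℝ) (0 + 1)} =
      (fun v => v + castVec p) ⁻¹' S p := by
    ext v
    simp only [S, Set.mem_ofPred_eq, Set.mem_preimage, Set.mem_Ioc, Pi.add_apply, castVec]
    refine forall_congr' fun i => ?_
    constructor <;> rintro ⟨a, b⟩ <;> constructor <;> linarith
  rw [h1, (measurePreserving_add_right volume
    (castVec p)).setIntegral_preimage_emb (MeasurableEquiv.addRight _).measurableEmbedding]

/-- The periodization descends to the torus. Its Fourier coefficients are the integrals over the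
whole space, cut into unit cubes, and their summability lets the Fourier series recover the values
pointwise. -/
theorem poisson (hf : Continuous f) (hi : Integrable f)
    (hb : ∀ K, 0 ≤ K → ∃ b : (ι → ℤ) → ℝ, Summable b ∧
      ∀ v : ι → ℝ, (∀ j, |v j| ≤ K) → ∀ p, ‖f (v + castVec p)‖ ≤ b p)
    (hs : Summable fun k : ι → ℤ => ∫ v, echar (castVec (-k)) v * f v) (v : ι → ℝ) :
    HasSum (fun k : ι → ℤ => (∫ w, echar (castVec (-k)) w * f w) * echar (castVec k) v)
      (∑' p : ι → ℤ, f (v + castVec p)) := by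
  set g : C(ι → ℝ, ℂ) := ⟨_, continuous_tsum_translates hf hb⟩ with hg
  have hper : ∀ v w : ι → ℝ, toTorus ι v = toTorus ι w → g v = g w := by
    intro v w h
    obtain ⟨q, rfl⟩ := exists_of_toTorus_eq h
    simp only [hg, ContinuousMap.coe_mk]
    rw [← (Equiv.addLeft q).tsum_eq fun p : ι → ℤ => f (w + castVec p)]
    refine tsum_congr fun p => ?_
    rw [add_assoc]
    congr 2
    funext i
    simp [castVec]
  set G : C(UnitAddTorus ι, ℂ) := (isQuotientMap_toTorus ι).lift g fun v w => hper v w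
  have hG : ∀ v, G (toTorus ι v) = g v := fun v =>
    congrArg (fun h : C(ι → ℝ, ℂ) => h v)
      ((isQuotientMap_toTorus ι).lift_comp g fun v w => hper v w)
  have hcoeff : ∀ k, UnitAddTorus.mFourierCoeff G k = ∫ w, echar (castVec (-k)) w * f w := by
    intro k
    have hint : Integrable fun w => echar (castVec (-k)) w * f w :=
      hi.bdd_mul (continuous_echar _).aestronglyMeasurable (c := 1)
        (.of_forall fun w => (norm_echar _ w).le)
    rw [UnitAddTorus.mFourierCoeff_eq_integral G k 0, ← (hasSum_integral_cubes hint).tsum_eq]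
    obtain ⟨b, hbs, hbb⟩ := hb 1 zero_le_one
    set S : Set (ι → ℝ) := {v | ∀ i, v i ∈ Set.Ioc (0 : ℝ) (0 + 1)}
    have hSm : MeasurableSet S := by
      have : S = Set.univ.pi fun i => Set.Ioc (0 : ℝ) (0 + 1) := by ext v; simp [S]
      rw [this]
      exact MeasurableSet.univ_pi fun i => measurableSet_Ioc
    have hSf : volume S < ⊤ := by
      refine lt_of_le_of_lt (measure_mono (t := Set.Icc 0 1) ?_) isCompact_Icc.measure_lt_top
      intro v hv
      exact ⟨fun i => (hv i).1.le, fun i => by simpa using (hv i).2⟩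
    have hSfin : IsFiniteMeasure (volume.restrict S) := ⟨by simpa using hSf⟩
    have hsum := hasSum_integral_of_dominated_convergence (μ := volume.restrict S)
      (F := fun (p : ι → ℤ) w => echar (castVec (-k)) (w + castVec p) * f (w + castVec p))
      (f := fun w => UnitAddTorus.mFourier (-k) (toTorus ι w) • G (toTorus ι w))
      (fun p _ => b p) (fun p => ?_) (fun p => ?_) (.of_forall fun _ => hbs)
      (integrable_const _) (.of_forall fun w => ?_)
    · exact hsum.tsum_eq.symm
    · exact (((continuous_echar _).comp (continuous_id.add continuous_const)).mul
        (hf.comp (continuous_id.add continuous_const))).aestronglyMeasurable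
    · refine (ae_restrict_iff' hSm).mpr (.of_forall fun w hw => ?_)
      rw [norm_mul, norm_echar, one_mul]
      refine hbb w (fun j => abs_le.mpr ⟨?_, ?_⟩) p
      · linarith [(hw j).1]
      · simpa using (hw j).2
    · simp only [echar_add, echar_int, mul_one]
      rw [mFourier_toTorus, hG, smul_eq_mul]
      exact (summable_translates hb w).hasSum.mul_left _
  have := UnitAddTorus.hasSum_mFourier_series_apply_of_summable (f := G)
    ((funext hcoeff : UnitAddTorus.mFourierCoeff G = _) ▸ hs) (toTorus ι v)
  simp only [hcoeff, mFourier_toTorus, hG, smul_eq_mul] at this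
  exact this

end

/-! ### The box spline -/

section

variable {ι : Type} [Fintype ι]

theorem echar_comm (y v : ι → ℝ) : echar y v = echar v y := by simp only [echar, mul_comm]

theorem continuous_echar_left (v : ι → ℝ) : Continuous fun y => echar y v := by
  simp only [echar_comm _ v]
  exact continuous_echar v

theorem continuous_echar_uncurry : Continuous fun q : (ι → ℝ) × (ι → ℝ) => echar q.1 q.2 := by
  unfold echar
  fun_prop

/-- Fourier inversion for test functions, in coordinates. -/
theorem echar_inversion {φ : (ι → ℝ) → ℝ} (h1 : ContDiff ℝ (⊤ : ℕ∞) φ) (h2 : HasCompactSupport φ) :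
    Integrable (fun v => ∫ y, echar (-y) v * (φ y : ℂ)) ∧
      ∀ x, ∫ v, echar x v * ∫ y, echar (-y) v * (φ y : ℂ) = φ x := by
  let Φ : EuclideanSpace ℝ ι → ℂ := fun x => (φ (WithLp.ofLp x) : ℂ)
  have hΦ1 : ContDiff ℝ (⊤ : ℕ∞) Φ := Complex.ofRealCLM.contDiff.comp (h1.comp (PiLp.contDiff_ofLp))
  have hΦ2 : HasCompactSupport Φ := by
    have := h2.comp_homeomorph (PiLp.homeomorph 2 (fun _ : ι => ℝ))
    exact this.comp_left (g := fun r : ℝ => (r : ℂ)) Complex.ofReal_zero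
  let ψ : SchwartzMap (EuclideanSpace ℝ ι) ℂ := hΦ2.toSchwartzMap hΦ1
  have hF : ∀ v : ι → ℝ, FourierTransform.fourier Φ (WithLp.toLp 2 v) =
      ∫ y, echar (-y) v * (φ y : ℂ) := by
    intro v
    rw [Real.fourier_eq', ← (PiLp.volume_preserving_toLp ι).integral_comp
      (MeasurableEquiv.toLp 2 (ι → ℝ)).measurableEmbedding]
    congr 1
    funext y
    rw [smul_eq_mul, echar]
    congr 2
    simp [PiLp.inner_apply, mul_sum, mul_comm, mul_left_comm]
  have hint : Integrable (FourierTransform.fourier Φ) := (FourierTransform.fourier ψ).integrable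
  constructor
  · have := (PiLp.volume_preserving_toLp ι).integrable_comp_of_integrable hint
    refine this.congr (.of_forall fun v => hF v)
  · intro x
    have h3 : FourierTransformInv.fourierInv (FourierTransform.fourier Φ) (WithLp.toLp 2 x) =
        Φ (WithLp.toLp 2 x) :=
      congrFun (hΦ1.continuous.fourierInv_fourier_eq ψ.integrable hint) _
    rw [Real.fourierInv_eq', ← (PiLp.volume_preserving_toLp ι).integral_comp
      (MeasurableEquiv.toLp 2 (ι → ℝ)).measurableEmbedding] at h3
    rw [← show Φ (WithLp.toLp 2 x) = φ x from rfl, ← h3]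
    congr 1
    funext v
    rw [hF, smul_eq_mul, echar]
    congr 2
    simp [PiLp.inner_apply, mul_sum, mul_comm, mul_left_comm]

end

section

/-- The weight with given coordinates in the simple roots, for a vector of edge lengths. -/
def edgeSum (s : Fin n × Fin n → ℝ) (j : Fin (n - 1)) : ℝ :=
  ∑ q : Fin n × Fin n with q.1.val ≤ j.val ∧ j.val < q.2.val, s q

theorem continuous_edgeSum : Continuous (edgeSum (n := n)) := by
  unfold edgeSum
  fun_prop

/-- The uniform distribution on the edge lengths. -/
def edgeMeasure (n : ℕ) : Measure (Fin n × Fin n → ℝ) :=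
  Measure.pi fun _ => volume.restrict (Set.Ioc (-(1 / 2)) (1 / 2))

instance (n : ℕ) : IsFiniteMeasure (edgeMeasure n) := by
  have : IsFiniteMeasure ((volume : Measure ℝ).restrict (Set.Ioc (-(1 / 2)) (1 / 2))) := ⟨by simp⟩
  unfold edgeMeasure
  infer_instance

theorem abs_edgeSum_le : ∀ᵐ s ∂edgeMeasure n, ∀ j, |edgeSum s j| ≤ n * n := by
  have h1 : ∀ᵐ s ∂edgeMeasure n, ∀ q, s q ∈ Set.Ioc (-(1 / 2) : ℝ) (1 / 2) := by
    rw [edgeMeasure, ae_all_iff]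
    intro q
    exact Measure.tendsto_eval_ae_ae.eventually (ae_restrict_mem measurableSet_Ioc)
  filter_upwards [h1] with s hs j
  refine (Finset.abs_sum_le_sum_abs _ _).trans
    ((Finset.sum_le_card_nsmul _ _ 1 fun q _ => abs_le.mpr ⟨?_, ?_⟩).trans ?_)
  · linarith [(hs q).1]
  · linarith [(hs q).2]
  · rw [nsmul_eq_mul, mul_one]
    have := Finset.card_filter_le (Finset.univ : Finset (Fin n × Fin n))
      fun q => q.1.val ≤ j.val ∧ j.val < q.2.val
    rw [card_univ, Fintype.card_prod, Fintype.card_fin] at this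
    exact_mod_cast this

theorem blockSum_of_le {M : Type} [AddCommMonoid M] (u : Fin (n - 1) → M) {i j : Fin n}
    (h : j ≤ i) : blockSum u i j = 0 :=
  Finset.sum_eq_zero fun k hk => by
    have h1 := (mem_filter.mp hk).2
    have h2 : j.val ≤ i.val := h
    omega

theorem sum_edgeSum_mul (s : Fin n × Fin n → ℝ) (v : Fin (n - 1) → ℝ) :
    ∑ j, edgeSum s j * v j = ∑ q, s q * blockSum v q.1 q.2 := by
  simp only [edgeSum, blockSum, sum_filter, sum_mul, mul_sum]
  rw [sum_comm]
  simp only [ite_mul, mul_ite, zero_mul, mul_zero]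

theorem integral_exp_eq_sinc (c : ℝ) :
    ∫ s in Set.Ioc (-(1 / 2) : ℝ) (1 / 2), exp (2 * π * I * ((s * c : ℝ) : ℂ)) =
      (sinc (π * c) : ℂ) := by
  rw [← intervalIntegral.integral_of_le (by norm_num)]
  rcases eq_or_ne c 0 with rfl | hc
  · norm_num
  have h := intervalIntegral.integral_comp_mul_right
    (fun t : ℝ => exp (t * I)) (a := -(1 / 2)) (b := 1 / 2)
    (c := 2 * π * c) (by have := Real.pi_ne_zero; positivity)
  have h2 := integral_exp_mul_I_eq_sinc (π * c)
  rw [show -(1 / 2) * (2 * π * c) = -(π * c) by ring,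
    show 1 / 2 * (2 * π * c) = π * c by ring, h2] at h
  rw [show (fun s : ℝ => exp (2 * π * I * ((s * c : ℝ) : ℂ))) =
    fun s : ℝ => exp (((s * (2 * π * c) : ℝ) : ℂ) * I) by funext s; congr 1; push_cast; ring, h]
  have hpi : (π : ℂ) ≠ 0 := by exact_mod_cast Real.pi_ne_zero
  have hc' : (c : ℂ) ≠ 0 := by exact_mod_cast hc
  rw [Complex.real_smul]
  push_cast
  field_simp

/-- A cardinal sine is the characteristic function of the uniform law on `(-1/2, 1/2]`. The product
is therefore that of a sum of roots with independent uniform coefficients. Index pairs that are not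
increasing have zero block sum and contribute 1. -/
theorem sincProd_eq_integral (v : Fin (n - 1) → ℝ) :
    (sincProd ((2 * π) • v) : ℂ) = ∫ s, echar (edgeSum s) v ∂edgeMeasure n := by
  have h1 : ∀ s : Fin n × Fin n → ℝ, echar (edgeSum s) v =
      ∏ q, exp (2 * π * I * ((s q * blockSum v q.1 q.2 : ℝ) : ℂ)) := by
    intro s
    rw [echar, sum_edgeSum_mul, ← Complex.exp_sum, ← mul_sum, Complex.ofReal_sum]
  simp only [h1, edgeMeasure]
  rw [integral_fintype_prod_eq_prod (𝕜 := ℂ) (fun (q : Fin n × Fin n) (s : ℝ) => exp (2 * π * I *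
      ((s * blockSum v q.1 q.2 : ℝ) : ℂ)))]
  simp only [integral_exp_eq_sinc]
  rw [sincProd, Finset.prod_filter, Complex.ofReal_prod]
  refine prod_congr rfl fun q _ => ?_
  rw [blockSum_smul]
  split_ifs with h
  · congr 2; ring
  · rw [blockSum_of_le v (not_lt.mp h)]; simp

/-- The Fourier transform of the product of cardinal sines, a box spline. -/
def spline (y : Fin (n - 1) → ℝ) : ℂ := ∫ v, echar (-y) v * (sincProd ((2 * π) • v) : ℂ)

theorem integrable_echar_sincProd (hn : 3 ≤ n) (y : Fin (n - 1) → ℝ) :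
    Integrable fun v : Fin (n - 1) → ℝ => echar y v * (sincProd ((2 * π) • v) : ℂ) :=
  (integrable_sincProd hn).ofReal.bdd_mul (continuous_echar _).aestronglyMeasurable (c := 1)
    (.of_forall fun w => (norm_echar _ w).le)

theorem continuous_spline (hn : 3 ≤ n) : Continuous (spline (n := n)) := by
  refine continuous_of_dominated (bound := fun v => ‖(sincProd ((2 * π) • v) : ℂ)‖)
    (fun y => (integrable_echar_sincProd hn _).aestronglyMeasurable)
    (fun y => .of_forall fun v => ?_) (integrable_sincProd hn).ofReal.norm
    (.of_forall fun v => ((continuous_echar_left v).comp continuous_neg).mul continuous_const)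
  rw [norm_mul, norm_echar, one_mul]

/-- By Fourier inversion and Fubini, the spline is the density of the law of `edgeSum`, tested
against smooth functions. -/
theorem integral_mul_spline (hn : 3 ≤ n) {φ : (Fin (n - 1) → ℝ) → ℝ}
    (h1 : ContDiff ℝ (⊤ : ℕ∞) φ) (h2 : HasCompactSupport φ) :
    ∫ y, (φ y : ℂ) * spline y = ∫ s, (φ (edgeSum s) : ℂ) ∂edgeMeasure n := by
  obtain ⟨h3, h4⟩ := echar_inversion h1 h2
  have hφ : Integrable fun y => (φ y : ℂ) :=
    (h1.continuous.integrable_of_hasCompactSupport h2).ofReal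
  have hS : Integrable fun v : Fin (n - 1) → ℝ =>
      (sincProd ((2 * π) • v) : ℂ) := (integrable_sincProd hn).ofReal
  calc ∫ y, (φ y : ℂ) * spline y
      = ∫ y, ∫ v, echar (-y) v * ((φ y : ℂ) * (sincProd ((2 * π) • v) : ℂ)) := by
        congr 1
        funext y
        rw [spline, ← integral_const_mul]
        congr 1
        funext v
        ring
    _ = ∫ v, ∫ y, echar (-y) v * ((φ y : ℂ) * (sincProd ((2 * π) • v) : ℂ)) := by
        refine integral_integral_swap ?_
        refine (hφ.mul_prod hS).bdd_mul (c := 1)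
          (f := fun q : (Fin (n - 1) → ℝ) × (Fin (n - 1) → ℝ) => echar (-q.1) q.2) ?_ ?_
        · exact (continuous_echar_uncurry.comp
            (continuous_fst.neg.prodMk continuous_snd)).aestronglyMeasurable
        · exact .of_forall fun q => (norm_echar _ _).le
    _ = ∫ v, ∫ s, echar (edgeSum s) v * (∫ y, echar (-y) v * (φ y : ℂ)) ∂edgeMeasure n := by
        congr 1
        funext v
        rw [integral_mul_const, ← sincProd_eq_integral, ← integral_const_mul]
        congr 1
        funext y
        ring
    _ = ∫ s, (∫ v, echar (edgeSum s) v * (∫ y, echar (-y) v * (φ y : ℂ))) ∂edgeMeasure n := by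
        refine integral_integral_swap ?_
        have h5 := (h3.mul_prod (integrable_const (μ := edgeMeasure n) (1 : ℂ)))
        refine (h5.bdd_mul (c := 1) (f := fun q : (Fin (n - 1) → ℝ) × (Fin n × Fin n → ℝ) =>
          echar (edgeSum q.2) q.1) ?_ (.of_forall fun q => (norm_echar _ _).le)).congr
          (.of_forall fun q => by simp [Function.uncurry])
        exact (continuous_echar_uncurry.comp
          ((continuous_edgeSum.comp continuous_snd).prodMk continuous_fst)).aestronglyMeasurable
    _ = _ := by simp only [h4]

/-- The law of `edgeSum` lives on a bounded set, so the spline vanishes almost everywhere outside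
it, and everywhere there by continuity. -/
theorem spline_eq_zero (hn : 3 ≤ n) {y : Fin (n - 1) → ℝ} {j : Fin (n - 1)}
    (hy : (n * n : ℝ) < |y j|) : spline y = 0 := by
  set U : Set (Fin (n - 1) → ℝ) := {y | (n * n : ℝ) < |y j|}
  have hU : IsOpen U := isOpen_lt continuous_const (continuous_apply j).abs
  have h := hU.ae_eq_zero_of_integral_contDiff_smul_eq_zero (μ := volume)
    (f := spline) ((continuous_spline hn).locallyIntegrable.locallyIntegrableOn _) fun g h1 h2 h3 => by
      simp only [Complex.real_smul]
      rw [integral_mul_spline hn h1 h2]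
      refine integral_eq_zero_of_ae ?_
      filter_upwards [abs_edgeSum_le (n := n)] with s hs
      have : edgeSum s ∉ tsupport g := fun hs' => absurd (h3 hs') (not_lt.mpr (hs j))
      simp [image_eq_zero_of_notMem_tsupport this]
  have h0 : ∀ᵐ x, x ∈ U → spline x = (fun _ => (0 : ℂ)) x := h
  rw [← ae_restrict_iff' hU.measurableSet] at h0
  exact Measure.eqOn_open_of_ae_eq h0 hU (continuous_spline hn).continuousOn continuousOn_const hy

end

/-! ### Permutation invariance -/

/-- The coordinates of (the traceless part of) a vector in the simple roots. -/
def coords : (Fin n → ℝ) →ₗ[ℝ] (Fin (n - 1) → ℝ) where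
  toFun x j := (∑ k : Fin n with k.val ≤ j.val, x k) - ((j : ℝ) + 1) / n * ∑ k, x k
  map_add' x y := by
    ext j
    simp only [Pi.add_apply, sum_add_distrib]
    ring
  map_smul' c x := by
    ext j
    simp only [Pi.smul_apply, smul_eq_mul, RingHom.id_apply, ← mul_sum]
    ring

theorem coords_apply (x : Fin n → ℝ) (j : Fin (n - 1)) :
    coords x j = (∑ k : Fin n with k.val ≤ j.val, x k) - ((j : ℝ) + 1) / n * ∑ k, x k := rfl

theorem sum_coords_mul (x : Fin n → ℝ) (u : Fin (n - 1) → ℝ) :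
    ∑ j, coords x j * u j = ∑ i, lift u i * x i := by
  simp only [coords_apply, lift_apply, sub_mul, sum_sub_distrib, sum_filter, sum_mul]
  congr 1
  · rw [sum_comm]
    simp only [ite_mul, zero_mul, mul_comm (u _)]
  · simp only [div_mul_eq_mul_div, ← Finset.sum_div, ← mul_sum]
    rw [sum_mul]
    congr 1
    exact sum_congr rfl fun j _ => by ring

theorem coords_const (c : ℝ) : coords (fun _ : Fin n => c) = 0 := by
  have h : ∀ u : Fin (n - 1) → ℝ, ∑ j, coords (fun _ : Fin n => c) j * u j = 0 := fun u => by
    rw [sum_coords_mul, ← sum_mul, sum_lift, zero_mul]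
  funext j
  simpa [Pi.single_apply] using h (Pi.single j 1)

/-- The action of permutations on successive differences. -/
def permDiffs (w : Perm (Fin n)) : (Fin (n - 1) → ℝ) →ₗ[ℝ] (Fin (n - 1) → ℝ) where
  toFun u := diffs (lift u ∘ w)
  map_add' u v := by
    ext j
    simp only [diffs, map_add, Function.comp_apply, Pi.add_apply]
    ring
  map_smul' c u := by
    ext j
    simp only [diffs, map_smul, Function.comp_apply, Pi.smul_apply, smul_eq_mul, RingHom.id_apply]
    ring

theorem lift_permDiffs (w : Perm (Fin n)) (u : Fin (n - 1) → ℝ) :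
    lift (permDiffs w u) = lift u ∘ w :=
  lift_diffs (by
    rw [← sum_lift u]
    exact Equiv.sum_comp w _)

theorem permDiffs_pow (w : Perm (Fin n)) (k : ℕ) : permDiffs w ^ k = permDiffs (w ^ k) := by
  refine LinearMap.ext fun u => lift_injective ?_
  rw [lift_permDiffs]
  induction k with
  | zero => rfl
  | succ k ih =>
    rw [pow_succ', Module.End.mul_apply, lift_permDiffs, ih, pow_succ]
    rfl

/-- A permutation has finite order, so the determinant is a root of unity. -/
theorem abs_det_permDiffs (w : Perm (Fin n)) : |LinearMap.det (permDiffs w)| = 1 := by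
  have h : LinearMap.det (permDiffs w) ^ orderOf w = 1 := by
    rw [← map_pow, permDiffs_pow, pow_orderOf_eq_one,
      show permDiffs (1 : Perm (Fin n)) = LinearMap.id from
        LinearMap.ext fun u => diffs_lift u, LinearMap.det_id]
  have h2 : |LinearMap.det (permDiffs w)| ^ orderOf w = 1 := by rw [← abs_pow, h, abs_one]
  exact (pow_eq_one_iff_of_nonneg (abs_nonneg _) (orderOf_pos w).ne').mp h2

theorem integral_comp_permDiffs (w : Perm (Fin n)) {h : (Fin (n - 1) → ℝ) → ℂ}
    (hh : Continuous h) : ∫ v, h (permDiffs w v) = ∫ v, h v := by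
  have h1 := abs_det_permDiffs w
  have h0 : LinearMap.det (permDiffs w) ≠ 0 := fun h => by simp [h] at h1
  have h2 := Measure.map_linearMap_addHaar_eq_smul_addHaar (volume : Measure (Fin (n - 1) → ℝ)) h0
  rw [abs_inv, h1, inv_one, ENNReal.ofReal_one, one_smul] at h2
  rw [← integral_map (f := h) (LinearMap.continuous_of_finiteDimensional _).measurable.aemeasurable
    (by rw [h2]; exact hh.aestronglyMeasurable), h2]

/-- For symmetric `f` the product runs over unordered pairs, which a permutation merely rearranges.
-/
theorem prod_pairs_comp {M : Type*} [CommMonoid M] (f : Fin n → Fin n → M)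
    (hf : ∀ i j, f i j = f j i) (w : Perm (Fin n)) :
    ∏ q : Fin n × Fin n with q.1 < q.2, f (w q.1) (w q.2) =
      ∏ q : Fin n × Fin n with q.1 < q.2, f q.1 q.2 := by
  have key : ∀ w' : Perm (Fin n), ∏ q : Fin n × Fin n with q.1 < q.2, f (w' q.1) (w' q.2) =
      ∏ i ∈ (Finset.univ : Finset (Fin n)).sym2 with ¬ i.IsDiag,
        Sym2.lift ⟨f, hf⟩ (Sym2.map w' i) := by
    intro w'
    rw [show ∏ i ∈ (Finset.univ : Finset (Fin n)).sym2 with ¬ i.IsDiag,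
        Sym2.lift ⟨f, hf⟩ (Sym2.map w' i) =
          ∏ q ∈ (Finset.univ : Finset (Fin n)).offDiag with q.1 < q.2, f (w' q.1) (w' q.2) from
      Finset.sum_sym2_filter_not_isDiag (M := Additive M) Finset.univ
        fun i => Sym2.lift ⟨f, hf⟩ (Sym2.map w' i)]
    refine prod_congr ?_ fun q _ => rfl
    ext q
    simp only [mem_filter, mem_univ, true_and, Finset.mem_offDiag]
    exact ⟨fun h => ⟨h.ne, h⟩, fun h => h.2⟩
  rw [key w]
  have h1 := key 1
  simp only [Equiv.Perm.coe_one, id, Sym2.map_id'] at h1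
  rw [h1]
  refine Finset.prod_bij' (fun i _ => Sym2.map w i) (fun i _ => Sym2.map w.symm i) ?_ ?_ ?_ ?_ ?_
  · intro i hi
    induction i with | _ a b => simpa using hi
  · intro i hi
    induction i with | _ a b => simpa using hi
  · intro i _
    induction i with | _ a b => simp
  · intro i _
    induction i with | _ a b => simp
  · intro i _
    rfl

theorem sincProd_diffs (t : Fin n → ℝ) :
    sincProd (diffs t) = ∏ q : Fin n × Fin n with q.1 < q.2, sinc ((t q.1 - t q.2) / 2) :=
  prod_congr rfl fun q hq => by rw [blockSum_diffs _ (mem_filter.mp hq).2.le]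

theorem sincProd_permDiffs (w : Perm (Fin n)) (u : Fin (n - 1) → ℝ) :
    sincProd (permDiffs w u) = sincProd u := by
  conv_rhs => rw [← diffs_lift u]
  rw [show permDiffs w u = diffs (lift u ∘ w) from rfl, sincProd_diffs, sincProd_diffs]
  refine prod_pairs_comp (fun i j => sinc ((lift u i - lift u j) / 2)) (fun i j => ?_) w
  rw [← Real.sinc_neg]
  congr 1
  ring

theorem spline_comp (x : Fin n → ℝ) (w : Perm (Fin n)) :
    spline (coords (x ∘ w)) = spline (coords x) := by
  have hc : Continuous fun v : Fin (n - 1) → ℝ =>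
      echar (-coords (x ∘ w)) v * (sincProd ((2 * π) • v) : ℂ) :=
    (continuous_echar _).mul (Complex.continuous_ofReal.comp
      (continuous_sincProd.comp (continuous_const_smul _)))
  rw [spline, ← integral_comp_permDiffs w hc, spline]
  congr 1
  funext v
  rw [← map_smul, sincProd_permDiffs, echar, echar]
  congr 4
  simp only [Pi.neg_apply, neg_mul, Finset.sum_neg_distrib, sum_coords_mul, lift_permDiffs]
  rw [neg_inj]
  exact Equiv.sum_comp w fun i => lift v i * x i

theorem spline_im (y : Fin (n - 1) → ℝ) : (spline y).im = 0 := by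
  rw [← Complex.conj_eq_iff_im, spline, ← integral_conj, ← integral_neg_eq_self]
  congr 1
  funext v
  have h1 : sincProd ((2 * π) • -v) = sincProd ((2 * π) • v) := by
    refine prod_congr rfl fun q _ => ?_
    rw [smul_neg, ← neg_smul, blockSum_smul, blockSum_smul, neg_mul, neg_div, Real.sinc_neg]
  rw [map_mul, Complex.conj_ofReal, h1]
  congr 1
  rw [echar, echar, ← Complex.exp_conj]
  congr 1
  simp only [map_mul, Complex.conj_I, Complex.conj_ofReal, map_ofNat, Pi.neg_apply, mul_neg,
    Finset.sum_neg_distrib, neg_mul, neg_neg, Complex.ofReal_neg]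

/-! ### Spline kernels -/

/-- The box `[-N, N]^{n-1}` of integer points. -/
abbrev intBox (n N : ℕ) : Finset (Fin (n - 1) → ℤ) :=
  Fintype.piFinset fun _ : Fin (n - 1) => Finset.Icc (-(N : ℤ)) (N : ℤ)

/-- The properties of the Fourier transform of `sincProd` that are used: support, symmetry, and its
relation to integrals over large cubes and to sums over large boxes of lattice points. -/
structure IsSplineKernel (B : (Fin (n - 1) → ℝ) → ℝ) : Prop where
  eq_zero : ∀ y j, (n * n : ℝ) < |y j| → B y = 0
  comp : ∀ (x : Fin n → ℝ) (w : Perm (Fin n)), B (coords (x ∘ w)) = B (coords x)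
  tendsto_integral : ∀ y, Tendsto (fun L : ℝ =>
    ∫ v in Set.Icc (fun _ : Fin (n - 1) => -L) (fun _ => L),
      echar (-y) v * (sincProd ((2 * π) • v) : ℂ)) atTop (𝓝 (B y))
  tendsto_sum : ∀ w : Fin (n - 1) → ℝ, (w = 0 ∨ w = coords (rho : Fin n → ℝ)) → ∀ v,
    Tendsto (fun N : ℕ => ∑ p ∈ intBox n N,
      echar w (castVec p) * (sincProd ((2 * π) • (v + castVec p)) : ℂ)) atTop
      (𝓝 (∑ᶠ k : Fin (n - 1) → ℤ, (B (castVec k - w) : ℂ) * echar (castVec k - w) v))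

theorem tendsto_intBox : Tendsto (intBox n) atTop atTop := by
  refine tendsto_atTop_finset_of_monotone (fun N M h p hp => ?_) fun p => ?_
  · simp only [Fintype.mem_piFinset, Finset.mem_Icc] at hp ⊢
    intro j
    have h1 := hp j
    have h2 : (N : ℤ) ≤ M := by exact_mod_cast h
    omega
  · refine ⟨∑ j, (p j).natAbs, ?_⟩
    simp only [Fintype.mem_piFinset, Finset.mem_Icc]
    intro j
    have := Finset.single_le_sum (f := fun j => (p j).natAbs) (fun _ _ => Nat.zero_le _)
      (mem_univ j)
    beta_reduce at this
    omega

/-- A kernel vanishing off a bounded set meets a translate of the lattice in finitely many points. -/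
theorem finite_support_of_eq_zero {B : (Fin (n - 1) → ℝ) → ℝ} {C : ℝ}
    (hB : ∀ y j, C < |y j| → B y = 0) (w : Fin (n - 1) → ℝ) :
    {k : Fin (n - 1) → ℤ | B (castVec k - w) ≠ 0}.Finite := by
  refine (Set.Finite.pi (t := fun j : Fin (n - 1) =>
    Set.Icc (⌊w j - C⌋) (⌈w j + C⌉)) fun j => Set.finite_Icc _ _).subset ?_
  intro k hk j _
  have h : |castVec k j - w j| ≤ C := not_lt.mp fun h => hk (hB _ j h)
  rw [abs_le] at h
  simp only [castVec] at h
  constructor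
  · exact Int.floor_le_iff.mpr (by linarith [h.1])
  · exact Int.le_ceil_iff.mpr (by linarith [h.2])

/-- The lattice sums are Poisson summation for `echar w` times the product of cardinal sines, whose
Fourier transform at `k` is the spline at `k - w`. Absolute convergence makes the limits along cubes
and boxes equal to the integral and the sum. -/
theorem isSplineKernel_spline (hn : 3 ≤ n) : IsSplineKernel (n := n) fun y => (spline y).re := by
  have hre : ∀ y : Fin (n - 1) → ℝ, ((spline y).re : ℂ) = spline y := fun y =>
    Complex.ext (by simp) (by simp [spline_im])
  refine ⟨fun y j h => ?_, fun x w => ?_, fun y => ?_, fun w _ v => ?_⟩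
  · rw [spline_eq_zero hn h, Complex.zero_re]
  · rw [spline_comp]
  · rw [hre]
    refine AECover.integral_tendsto_of_countably_generated
      (aecover_Icc ?_ ?_) (integrable_echar_sincProd hn (-y))
    · refine tendsto_atBot.mpr fun b => ?_
      filter_upwards [eventually_ge_atTop (∑ j, |b j|)] with L hL j
      have := Finset.single_le_sum (f := fun j => |b j|) (fun _ _ => abs_nonneg _) (mem_univ j)
      beta_reduce at this
      linarith [neg_abs_le (b j)]
    · refine tendsto_atTop.mpr fun b => ?_
      filter_upwards [eventually_ge_atTop (∑ j, |b j|)] with L hL j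
      have := Finset.single_le_sum (f := fun j => |b j|) (fun _ _ => abs_nonneg _) (mem_univ j)
      beta_reduce at this
      linarith [le_abs_self (b j)]
  · simp only [hre]
    have hB : ∀ (y : Fin (n - 1) → ℝ) j, (n * n : ℝ) < |y j| → (spline y).re = 0 := fun y j h => by
      rw [spline_eq_zero hn h, Complex.zero_re]
    have hfin := finite_support_of_eq_zero hB w
    set f : (Fin (n - 1) → ℝ) → ℂ := fun v => echar w v * (sincProd ((2 * π) • v) : ℂ)
    have hint : ∀ k : Fin (n - 1) → ℤ,
        ∫ v, echar (castVec (-k)) v * f v = spline (castVec k - w) := by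
      intro k
      rw [spline]
      congr 1
      funext v
      rw [← mul_assoc, ← echar_add_left]
      congr 2
      funext j
      simp [castVec, sub_eq_add_neg, add_comm]
    have hf : Continuous f := (continuous_echar _).mul (Complex.continuous_ofReal.comp
      (continuous_sincProd.comp (continuous_const_smul _)))
    have hb : ∀ K : ℝ, 0 ≤ K → ∃ b : (Fin (n - 1) → ℤ) → ℝ, Summable b ∧
        ∀ v : Fin (n - 1) → ℝ, (∀ j, |v j| ≤ K) → ∀ p, ‖f (v + castVec p)‖ ≤ b p := by
      intro K hK
      refine ⟨_, summable_prod_pairs hn (2 * (1 + n * K)), fun v hv p => ?_⟩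
      rw [norm_mul, norm_echar, one_mul, Complex.norm_real, Real.norm_eq_abs]
      exact abs_sincProd_add_le hK hv _
    have hsupp : ∀ k : Fin (n - 1) → ℤ, k ∉ hfin.toFinset → spline (castVec k - w) = 0 := by
      intro k hk
      rw [Set.Finite.mem_toFinset, Set.mem_ofPred_eq, not_not] at hk
      rw [← hre, hk, Complex.ofReal_zero]
    have hpois := poisson hf (integrable_echar_sincProd hn w) hb
      (by simp only [hint]; exact (hasSum_sum_of_ne_finset_zero hsupp).summable) v
    simp only [hint] at hpois
    have h1 : ∑ᶠ k : Fin (n - 1) → ℤ, spline (castVec k - w) * echar (castVec k - w) v =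
        echar (-w) v * ∑' p : Fin (n - 1) → ℤ, f (v + castVec p) := by
      rw [← hpois.tsum_eq, tsum_eq_sum (s := hfin.toFinset)
        (fun k hk => by rw [hsupp k hk, zero_mul]), mul_sum,
        finsum_eq_sum_of_support_subset (s := hfin.toFinset)]
      · refine sum_congr rfl fun k _ => ?_
        rw [sub_eq_add_neg (castVec k) w, echar_add_left]
        ring
      · intro k hk
        by_contra h
        exact hk (by beta_reduce; rw [hsupp k (by simpa using h), zero_mul])
    rw [h1]
    have h2 := ((summable_translates hb v).hasSum.mul_left (echar (-w) v)).comp tendsto_intBox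
    refine h2.congr fun N => sum_congr rfl fun p _ => ?_
    simp only [f]
    rw [← mul_assoc, echar_add, ← mul_assoc, ← echar_add_left, neg_add_cancel]
    simp [echar]

/-! ### Cardinal sine sums and the Dirichlet integral -/

theorem sum_Icc_neg (f : ℤ → ℂ) (N : ℕ) : ∑ p ∈ Finset.Icc (-(N : ℤ)) N, f p =
      f 0 + ∑ j ∈ Finset.range N, (f (-(j + 1)) + f (j + 1)) := by
  induction N with
  | zero => simp
  | succ N ih =>
    have h : Finset.Icc (-((N + 1 : ℕ) : ℤ)) ((N + 1 : ℕ) : ℤ) =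
        insert (-((N : ℤ) + 1)) (insert ((N : ℤ) + 1) (Finset.Icc (-(N : ℤ)) N)) := by
      ext p
      simp only [Finset.mem_insert, Finset.mem_Icc]
      push_cast
      omega
    rw [h, Finset.sum_insert, Finset.sum_insert, ih, Finset.sum_range_succ]
    · ring
    · simp
    · simp only [Finset.mem_insert, Finset.mem_Icc]
      omega

/-- Euler's expansion of the cotangent, in symmetric partial sums. -/
theorem tendsto_sum_inv_add {x : ℂ} (hx : x ∈ Complex.integerComplement) :
    Tendsto (fun N : ℕ => ∑ p ∈ Finset.Icc (-(N : ℤ)) N, (x + p)⁻¹) atTop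
      (𝓝 (π * Complex.cot (π * x))) := by
  have h := (tendsto_logDeriv_euler_cot_sub hx).const_add (1 / x)
  rw [add_sub_cancel] at h
  refine h.congr fun N => ?_
  rw [sum_Icc_neg]
  simp only [cotTerm, one_div, Int.cast_zero, add_zero]
  congr 1
  refine sum_congr rfl fun j _ => ?_
  push_cast
  rw [← sub_eq_add_neg]

/-- An alternating sum is twice its even part minus the full sum. The even part runs only up to `N /
2`, and for `f p = 1/(v + p)` it is again a cotangent series, at `v / 2`. -/
theorem sum_even (f : ℤ → ℂ) (N : ℕ) : ∑ p ∈ Finset.Icc (-(N : ℤ)) N, (-1 : ℂ) ^ p * f p =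
      2 * ∑ q ∈ Finset.Icc (-((N / 2 : ℕ) : ℤ)) ((N / 2 : ℕ) : ℤ), f (2 * q) -
        ∑ p ∈ Finset.Icc (-(N : ℤ)) N, f p := by
  have h1 : ∑ q ∈ Finset.Icc (-((N / 2 : ℕ) : ℤ)) ((N / 2 : ℕ) : ℤ), f (2 * q) =
      ∑ p ∈ Finset.Icc (-(N : ℤ)) N with Even p, f p := by
    refine Finset.sum_bij' (fun q _ => 2 * q) (fun p _ => p / 2) ?_ ?_ ?_ ?_ ?_
    · intro q hq
      simp only [Finset.mem_Icc, mem_filter] at hq ⊢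
      refine ⟨by omega, even_two_mul q⟩
    · intro p hp
      simp only [Finset.mem_Icc, mem_filter, Int.even_iff] at hp ⊢
      omega
    · intro q _
      simp
    · intro p hp
      exact Int.two_mul_ediv_two_of_even (mem_filter.mp hp).2
    · intro q _
      rfl
  rw [h1, mul_sum, sum_filter, ← sum_sub_distrib]
  refine sum_congr rfl fun p _ => ?_
  rcases Int.even_or_odd p with h | h
  · rw [h.neg_one_zpow, if_pos h]; ring
  · rw [h.neg_one_zpow, if_neg (Int.not_even_iff_odd.mpr h)]; ring

theorem sinc_pi_add {v : ℝ} {p : ℤ} (h : v + p ≠ 0) :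
    sinc (π * (v + p)) = Real.sin (π * v) / π * ((-1) ^ p * (v + p)⁻¹) := by
  rw [Real.sinc_of_ne_zero (mul_ne_zero Real.pi_ne_zero h), mul_add, mul_comm π (p : ℝ),
    Real.sin_add_int_mul_pi]
  have := Real.pi_ne_zero
  field_simp

theorem sinc_pi_int {p : ℤ} (h : p ≠ 0) : sinc (π * p) = 0 := by
  rw [Real.sinc_of_ne_zero (mul_ne_zero Real.pi_ne_zero (by exact_mod_cast h)), mul_comm,
    Real.sin_int_mul_pi, zero_div]

theorem sum_sinc_int (a : ℤ → ℂ) (m : ℤ) {N : ℕ} (hN : m.natAbs ≤ N) :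
    ∑ p ∈ Finset.Icc (-(N : ℤ)) N, a p * (sinc (π * ((-m : ℤ) + p)) : ℂ) = a m := by
  rw [Finset.sum_eq_single_of_mem m (by rw [Finset.mem_Icc]; omega)]
  · simp
  · intro p _ hp
    rw [← Int.cast_add, sinc_pi_int (by omega)]
    simp

theorem mem_integerComplement_of_ne {v : ℝ} (h : ∀ m : ℤ, v ≠ m) :
    (v : ℂ) ∈ Complex.integerComplement := by
  rintro ⟨m, hm⟩
  exact h m (by exact_mod_cast hm.symm)

theorem sin_pi_mul_ne_zero' {v : ℝ} (h : ∀ m : ℤ, v ≠ m) : Real.sin (π * v) ≠ 0 := by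
  intro h0
  obtain ⟨m, hm⟩ := Real.sin_eq_zero_iff.mp h0
  exact h m (mul_left_cancel₀ Real.pi_ne_zero (by rw [← hm]; ring))

/-- The two alternating signs cancel and leave `sin(πv)/π` times the cotangent series. At integral
`v` only one term is nonzero. -/
theorem tendsto_sum_neg_one_sinc (v : ℝ) : Tendsto (fun N : ℕ => ∑ p ∈ Finset.Icc (-(N : ℤ)) N,
      (-1 : ℂ) ^ p * (sinc (π * (v + p)) : ℂ)) atTop
      (𝓝 (Real.cos (π * v))) := by
  by_cases h : ∃ m : ℤ, v = m
  · obtain ⟨m, rfl⟩ := h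
    refine tendsto_const_nhds.congr' ?_
    filter_upwards [eventually_ge_atTop m.natAbs] with N hN
    have h1 := sum_sinc_int (fun p => (-1 : ℂ) ^ p) (-m) (N := N) (by simpa using hN)
    rw [neg_neg] at h1
    rw [h1, mul_comm, Real.cos_int_mul_pi]
    push_cast
    rw [zpow_neg, ← inv_zpow]
    norm_num
  · rw [not_exists] at h
    have h1 := (tendsto_sum_inv_add (mem_integerComplement_of_ne h)).const_mul
      ((Real.sin (π * v) / π : ℝ) : ℂ)
    have h2 : ((Real.sin (π * v) / π : ℝ) : ℂ) * (π * Complex.cot (π * v)) = Real.cos (π * v) := by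
      have hs : (Real.sin (π * v) : ℂ) ≠ 0 := by exact_mod_cast sin_pi_mul_ne_zero' h
      have hp : (π : ℂ) ≠ 0 := by exact_mod_cast Real.pi_ne_zero
      rw [Complex.cot]
      push_cast at hs ⊢
      field_simp
    rw [h2] at h1
    refine h1.congr fun N => ?_
    rw [mul_sum]
    refine sum_congr rfl fun p _ => ?_
    rw [sinc_pi_add fun h0 => h (-p) (by push_cast; linarith)]
    push_cast
    have : (-1 : ℂ) ^ p * (-1 : ℂ) ^ p = 1 := by rw [← mul_zpow]; norm_num
    linear_combination (-(Complex.sin (π * v) / π * (v + p : ℂ)⁻¹)) * this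

/-- The alternating series is a difference of cotangent series, and `cot(πv/2) - cot(πv) =
1/sin(πv)`. -/
theorem tendsto_sum_sinc (v : ℝ) : Tendsto (fun N : ℕ => ∑ p ∈ Finset.Icc (-(N : ℤ)) N,
      (sinc (π * (v + p)) : ℂ)) atTop (𝓝 1) := by
  by_cases h : ∃ m : ℤ, v = m
  · obtain ⟨m, rfl⟩ := h
    refine tendsto_const_nhds.congr' ?_
    filter_upwards [eventually_ge_atTop m.natAbs] with N hN
    have h1 := sum_sinc_int (fun p => 1) (-m) (N := N) (by simpa using hN)
    simp only [neg_neg, one_mul] at h1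
    exact h1.symm
  · rw [not_exists] at h
    have hhalf : ∀ m : ℤ, v / 2 ≠ m := fun m hm => h (2 * m) (by push_cast; linarith)
    have h3 := ((tendsto_sum_inv_add (mem_integerComplement_of_ne hhalf)).comp
      (Nat.tendsto_div_const_atTop (n := 2) two_ne_zero)).sub
      (tendsto_sum_inv_add (mem_integerComplement_of_ne h))
    have h1 := h3.const_mul ((Real.sin (π * v) / π : ℝ) : ℂ)
    have h2 : ((Real.sin (π * v) / π : ℝ) : ℂ) *
        (π * Complex.cot (π * (v / 2 : ℝ)) - π * Complex.cot (π * v)) = 1 := by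
      have hs : Real.sin (π * v) ≠ 0 := sin_pi_mul_ne_zero' h
      have hs2 : Real.sin (π * (v / 2)) ≠ 0 := sin_pi_mul_ne_zero' hhalf
      have hp := Real.pi_ne_zero
      have key : Real.sin (π * v) / π * (π * (Real.cos (π * (v / 2)) / Real.sin (π * (v / 2))) -
            π * (Real.cos (π * v) / Real.sin (π * v))) = 1 := by
        have e1 : Real.sin (π * v) = 2 * Real.sin (π * (v / 2)) * Real.cos (π * (v / 2)) := by
          rw [← Real.sin_two_mul]; congr 1; ring
        have e2 : Real.cos (π * v) = 2 * Real.cos (π * (v / 2)) ^ 2 - 1 := by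
          rw [← Real.cos_two_mul]; congr 1; ring
        have hs3 : Real.cos (π * (v / 2)) ≠ 0 := fun h0 => hs (by rw [e1, h0, mul_zero])
        rw [e1, e2]
        clear hs h1 h3 e1 e2
        generalize Real.sin (π * (v / 2)) = a at *
        generalize Real.cos (π * (v / 2)) = b at *
        field_simp
        ring
      rw [Complex.cot, Complex.cot]
      exact_mod_cast key
    rw [h2] at h1
    refine h1.congr fun N => ?_
    have h4 := sum_even (fun p : ℤ => ((v : ℂ) + p)⁻¹) N
    rw [sum_congr rfl fun (p : ℤ) _ => show ((sinc (π * (v + p)) : ℝ) : ℂ) =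
      ((Real.sin (π * v) / π : ℝ) : ℂ) * ((-1) ^ p * ((v : ℂ) + p)⁻¹) by
        rw [sinc_pi_add fun h0 => h (-p) (by push_cast; linarith)]; push_cast; rfl,
      ← mul_sum, h4, mul_sum]
    congr 2
    refine sum_congr rfl fun q _ => ?_
    push_cast
    rw [show (v : ℂ) + 2 * q = 2 * (v / 2 + q) by ring, mul_inv]
    ring

/-- The terms with indices `±(j + 1)` nearly cancel: together they are of order `1/(j + 1)²`. The
bound does not depend on `N`, as dominated convergence requires. -/
theorem norm_sum_sinc_le {v : ℝ} (h0 : |v| ≤ 1 / 2) (N : ℕ) :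
    ‖∑ p ∈ Finset.Icc (-(N : ℤ)) N, (sinc (π * (v + p)) : ℂ)‖ ≤
      1 + ∑' j : ℕ, 2 * (1 / ((j : ℝ) + 1) ^ 2) := by
  have hs : Summable fun j : ℕ => 2 * (1 / ((j : ℝ) + 1) ^ 2) := by
    refine Summable.mul_left _ ?_
    exact_mod_cast (summable_nat_add_iff 1).mpr (Real.summable_one_div_nat_pow.mpr one_lt_two)
  rw [sum_Icc_neg]
  refine (norm_add_le _ _).trans (add_le_add ?_ ((norm_sum_le _ _).trans
    ((Finset.sum_le_sum fun j _ => ?_).trans (hs.sum_le_tsum _ fun j _ => by positivity))))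
  · rw [Complex.norm_real]
    exact Real.abs_sinc_le_one _
  · rw [abs_le] at h0
    have e1 : v + (-(j + 1) : ℤ) ≠ 0 := by push_cast; intro h; nlinarith [(Nat.cast_nonneg j : (0 : ℝ) ≤ j)]
    have e2 : v + (j + 1 : ℤ) ≠ 0 := by push_cast; intro h; nlinarith [(Nat.cast_nonneg j : (0 : ℝ) ≤ j)]
    rw [← Complex.ofReal_add, Complex.norm_real, sinc_pi_add e1, sinc_pi_add e2, ← mul_add,
      Real.norm_eq_abs, zpow_neg, ← inv_zpow, show (-1 : ℝ)⁻¹ = -1 by norm_num, ← mul_add, abs_mul,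
      abs_mul ((-1) ^ _), abs_zpow, abs_neg, abs_one, one_zpow, one_mul]
    push_cast at e1 e2 ⊢
    have hpos : (0 : ℝ) < ((j : ℝ) + 1) ^ 2 - v ^ 2 := by
      nlinarith [(Nat.cast_nonneg j : (0 : ℝ) ≤ j)]
    have e3 : (v + -((j : ℝ) + 1))⁻¹ + (v + ((j : ℝ) + 1))⁻¹ = -(2 * v) / (((j : ℝ) + 1) ^ 2 - v ^ 2) := by
      rw [eq_div_iff hpos.ne']
      field_simp
      ring
    rw [e3, abs_div (-(2 * v)), abs_of_pos hpos, abs_neg, abs_mul 2, abs_two]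
    have h5 : |Real.sin (π * v) / π| ≤ 1 := by
      rw [abs_div, abs_of_pos Real.pi_pos, div_le_one Real.pi_pos]
      linarith [Real.abs_sin_le_one (π * v), Real.pi_gt_three]
    have h6 : 2 * |v| / (((j : ℝ) + 1) ^ 2 - v ^ 2) ≤ 2 * (1 / ((j : ℝ) + 1) ^ 2) := by
      rw [← mul_div_assoc, mul_one, div_le_div_iff₀ hpos (by positivity)]
      have : |v| ≤ 1 / 2 := abs_le.mpr h0
      nlinarith [(Nat.cast_nonneg j : (0 : ℝ) ≤ j), sq_abs v, abs_nonneg v]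
    calc _ ≤ 1 * (2 * |v| / (((j : ℝ) + 1) ^ 2 - v ^ 2)) := by gcongr
      _ ≤ _ := by rw [one_mul]; exact h6

/-- Cut into unit intervals, the integral over `(-N - 1/2, N + 1/2)` is the integral over one
interval of the partial sums of `∑ sinc (π(v + p))`, which tend boundedly to 1. -/
theorem tendsto_integral_sinc_half :
    Tendsto (fun N : ℕ => ∫ v in (-(N : ℝ) - 1 / 2)..(N + 1 / 2), sinc (π * v)) atTop (𝓝 1) := by
  have hc : Continuous fun v : ℝ => sinc (π * v) :=
    Real.continuous_sinc.comp (continuous_const.mul continuous_id)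
  have h1 : ∀ N : ℕ, ∫ v in (-(N : ℝ) - 1 / 2)..(N + 1 / 2), sinc (π * v) =
      ∫ v in (-(1 / 2) : ℝ)..(1 / 2), ∑ p ∈ Finset.Icc (-(N : ℤ)) N, sinc (π * (v + p)) := by
    intro N
    rw [intervalIntegral.integral_finsetSum (f := fun (p : ℤ) v => sinc (π * (v + p))) fun p _ =>
      (hc.comp (continuous_id.add continuous_const)).intervalIntegrable _ _]
    have h2 := intervalIntegral.sum_integral_adjacent_intervals_Ico
      (f := fun v : ℝ => sinc (π * v)) (μ := volume)
      (a := fun k : ℕ => (k : ℝ) - N - 1 / 2) (m := 0) (n := 2 * N + 1) (by omega)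
      (fun k _ => hc.intervalIntegrable _ _)
    push_cast at h2
    rw [show (0 : ℝ) - N - 1 / 2 = -N - 1 / 2 by ring,
      show 2 * (N : ℝ) + 1 - N - 1 / 2 = N + 1 / 2 by ring] at h2
    rw [← h2]
    refine Finset.sum_bij' (fun k _ => (k : ℤ) - N) (fun p _ => (p + N).toNat) ?_ ?_ ?_ ?_ ?_
    · intro k hk
      simp only [Finset.mem_Ico, Finset.mem_Icc] at hk ⊢
      omega
    · intro p hp
      simp only [Finset.mem_Ico, Finset.mem_Icc] at hp ⊢
      omega
    · intro k _
      simp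
    · intro p hp
      simp only [Finset.mem_Icc] at hp
      omega
    · intro k _
      rw [intervalIntegral.integral_comp_add_right fun v : ℝ => sinc (π * v)]
      congr 1 <;> push_cast <;> ring
  simp only [h1]
  have h3 : Tendsto (fun N : ℕ => ∫ v in (-(1 / 2) : ℝ)..(1 / 2),
      ∑ p ∈ Finset.Icc (-(N : ℤ)) N, sinc (π * (v + p))) atTop
      (𝓝 (∫ v in (-(1 / 2) : ℝ)..(1 / 2), (1 : ℝ))) := by
    refine intervalIntegral.tendsto_integral_filter_of_dominated_convergence
      (fun _ => 1 + ∑' j : ℕ, 2 * (1 / ((j : ℝ) + 1) ^ 2)) ?_ ?_ ?_ ?_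
    · exact .of_forall fun N => (continuous_finsetSum _ fun p _ =>
        hc.comp (continuous_id.add continuous_const)).aestronglyMeasurable
    · refine .of_forall fun N => .of_forall fun v hv => ?_
      rw [Set.uIoc_of_le (by norm_num)] at hv
      have := norm_sum_sinc_le (abs_le.mpr ⟨hv.1.le, hv.2⟩) N
      rw [← Complex.ofReal_sum, Complex.norm_real] at this
      exact this
    · exact intervalIntegrable_const
    · refine .of_forall fun v _ => ?_
      have := (Complex.continuous_re.tendsto _).comp (tendsto_sum_sinc v)
      refine this.congr fun N => ?_
      rw [Function.comp_apply, ← Complex.ofReal_sum, Complex.ofReal_re]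
  convert h3 using 2
  norm_num

/-- The Dirichlet integral. -/
theorem tendsto_integral_sinc :
    Tendsto (fun L : ℝ => ∫ v in (-L)..L, sinc (π * v)) atTop (𝓝 1) := by
  have hc : Continuous fun v : ℝ => sinc (π * v) :=
    Real.continuous_sinc.comp (continuous_const.mul continuous_id)
  have hi : ∀ a b, IntervalIntegrable (fun v : ℝ => sinc (π * v))
    volume a b := fun a b => hc.intervalIntegrable a b
  have h1 := tendsto_integral_sinc_half.comp (tendsto_nat_floor_atTop (α := ℝ))
  -- Passing from half-integral to arbitrary endpoints changes the integral over short intervals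
  -- only, where the integrand is at most the inverse of the left endpoint.
  have hbound : ∀ a b : ℝ, 0 < a → |b - a| ≤ 1 → a ≤ b → ‖∫ v in a..b, sinc (π * v)‖ ≤ a⁻¹ := by
    intro a b ha hab hle
    refine (intervalIntegral.norm_integral_le_of_norm_le_const (C := a⁻¹) fun v hv => ?_).trans ?_
    · rw [Set.uIoc_of_le hle] at hv
      have hv0 : 0 < v := ha.trans hv.1
      rw [Real.sinc_of_ne_zero (by have := Real.pi_ne_zero; positivity), Real.norm_eq_abs, abs_div,
        abs_of_pos (show 0 < π * v by have := Real.pi_pos; positivity),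
        div_le_iff₀ (by have := Real.pi_pos; positivity)]
      refine (Real.abs_sin_le_one _).trans ?_
      rw [inv_mul_eq_div, one_le_div ha]
      nlinarith [Real.pi_gt_three, hv.1]
    · exact mul_le_of_le_one_right (by positivity) hab
  have h2 : Tendsto (fun L : ℝ => (∫ v in (-L)..L, sinc (π * v)) -
      ∫ v in (-(⌊L⌋₊ : ℝ) - 1 / 2)..(⌊L⌋₊ + 1 / 2), sinc (π * v)) atTop (𝓝 0) := by
    refine squeeze_zero_norm' (a := fun L : ℝ => 2 * (L - 1)⁻¹) ?_ ?_
    · filter_upwards [eventually_gt_atTop 2] with L hL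
      have hfl := Nat.floor_le (show 0 ≤ L by linarith)
      have hfu := Nat.lt_floor_add_one L
      set F : ℝ := (⌊L⌋₊ : ℝ)
      have heven : ∀ a b : ℝ, ∫ v in a..b, sinc (π * v) = ∫ v in (-b)..(-a), sinc (π * v) := by
        intro a b
        rw [← intervalIntegral.integral_comp_neg]
        simp only [mul_neg, Real.sinc_neg]
      have e1 : (∫ v in (-L)..L, sinc (π * v)) - ∫ v in (-F - 1 / 2)..(F + 1 / 2), sinc (π * v) =
            -2 * ∫ v in L..(F + 1 / 2), sinc (π * v) := by
        have e2 := intervalIntegral.integral_add_adjacent_intervals (hi (-F - 1 / 2) (-L)) (hi (-L) L)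
        have e3 := intervalIntegral.integral_add_adjacent_intervals (hi (-F - 1 / 2) L)
          (hi L (F + 1 / 2))
        have e4 := heven L (F + 1 / 2)
        rw [show -(F + 1 / 2) = -F - 1 / 2 by ring] at e4
        linarith
      rw [e1, norm_mul]
      have e5 : ‖∫ v in L..(F + 1 / 2), sinc (π * v)‖ ≤ (L - 1)⁻¹ := by
        rcases le_total L (F + 1 / 2) with h | h
        · refine (hbound _ _ (by linarith) (abs_le.mpr ⟨by linarith, by linarith⟩) h).trans ?_
          exact inv_anti₀ (by linarith) (by linarith)
        · rw [intervalIntegral.integral_symm, norm_neg]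
          refine (hbound _ _ (by linarith) (abs_le.mpr ⟨by linarith, by linarith⟩) h).trans ?_
          exact inv_anti₀ (by linarith) (by linarith)
      have e6 : ‖(-2 : ℝ)‖ = 2 := by norm_num
      rw [e6]
      linarith
    · rw [← mul_zero (2 : ℝ)]
      refine Tendsto.const_mul _ (tendsto_inv_atTop_zero.comp ?_)
      exact tendsto_atTop_add_const_right _ _ tendsto_id
  have h3 := h2.add h1
  simp only [Function.comp_apply, sub_add_cancel, zero_add] at h3
  exact h3

/-! ### The kernel in rank one -/

theorem pairs_two : (Finset.univ.filter fun q : Fin 2 × Fin 2 => q.1 < q.2) = {(0, 1)} := by decide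

theorem blockSum_two (u : Fin (2 - 1) → ℝ) : blockSum u (0 : Fin 2) 1 = u 0 := by
  rw [← lift_sub_lift u (by decide)]
  exact congrFun (diffs_lift u) 0

theorem sincProd_two (u : Fin (2 - 1) → ℝ) : sincProd (n := 2) u = sinc (u 0 / 2) := by
  rw [sincProd, pairs_two, Finset.prod_singleton, blockSum_two]

theorem eq_const_two {α : Type*} (p : Fin (2 - 1) → α) : p = fun _ => p 0 := by
  funext j
  rw [show j = 0 from Subsingleton.elim (α := Fin 1) j 0]

theorem sum_two {α : Type*} [AddCommMonoid α] (f : Fin (2 - 1) → α) : ∑ j, f j = f 0 :=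
  (Fin.sum_univ_one f :)

theorem coords_two (x : Fin 2 → ℝ) : coords x = fun _ => (x 0 - x 1) / 2 := by
  funext j
  rw [show j = 0 from Subsingleton.elim (α := Fin 1) j 0, coords_apply]
  have : (Finset.univ.filter fun k : Fin 2 => k.val ≤ 0) = {0} := by decide
  simp only [Fin.isValue, Fin.val_zero, this, Finset.sum_singleton, Fin.sum_univ_two]
  push_cast
  ring

theorem echar_two (y v : Fin (2 - 1) → ℝ) :
    echar y v = exp (2 * π * I * ((y 0 * v 0 : ℝ) : ℂ)) := by
  rw [echar, sum_two]

theorem tendsto_integral_mul_sinc (c : ℝ) :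
    Tendsto (fun L : ℝ => ∫ v in (-L)..L, c * sinc (π * (c * v))) atTop (𝓝 (Real.sign c)) := by
  have h1 : ∀ L : ℝ, ∫ v in (-L)..L, c * sinc (π * (c * v)) =
      ∫ v in (-(c * L))..(c * L), sinc (π * v) := by
    intro L
    rw [intervalIntegral.integral_const_mul, ← smul_eq_mul,
      intervalIntegral.smul_integral_comp_mul_left fun v => sinc (π * v), mul_neg]
  simp only [h1]
  rcases lt_trichotomy c 0 with hc | rfl | hc
  · rw [Real.sign_of_neg hc]
    have h2 := (tendsto_integral_sinc.comp (tendsto_id.const_mul_atTop (neg_pos.mpr hc))).neg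
    refine h2.congr fun L => ?_
    simp only [Function.comp_apply, id, neg_mul, neg_neg]
    rw [intervalIntegral.integral_symm, neg_neg]
  · simp
  · rw [Real.sign_of_pos hc]
    exact tendsto_integral_sinc.comp (tendsto_id.const_mul_atTop hc)

theorem cos_mul_sinc (y v : ℝ) : Real.cos (2 * π * y * v) * sinc (π * v) =
    ((1 + 2 * y) * sinc (π * ((1 + 2 * y) * v)) +
      (1 - 2 * y) * sinc (π * ((1 - 2 * y) * v))) / 2 := by
  rcases eq_or_ne v 0 with rfl | hv
  · simp
  have h : ∀ c : ℝ, c * sinc (π * (c * v)) = Real.sin (π * (c * v)) / (π * v) := by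
    intro c
    rcases eq_or_ne c 0 with rfl | hc
    · simp
    have := Real.pi_ne_zero
    rw [Real.sinc_of_ne_zero (by positivity)]
    field_simp
  have h1 := h 1
  rw [one_mul, one_mul] at h1
  rw [h, h, h1, show π * ((1 + 2 * y) * v) = π * v + 2 * π * y * v by ring,
    show π * ((1 - 2 * y) * v) = π * v - 2 * π * y * v by ring, Real.sin_add,
    Real.sin_sub]
  ring

theorem tendsto_integral_exp_mul_sinc (y : ℝ) : Tendsto (fun L : ℝ => ∫ v in (-L)..L,
      exp (2 * π * I * ((-y * v : ℝ) : ℂ)) * (sinc (π * v) : ℂ)) atTop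
      (𝓝 (((Real.sign (1 + 2 * y) + Real.sign (1 - 2 * y)) / 2 : ℝ) : ℂ)) := by
  have hs : Continuous fun v : ℝ => (sinc (π * v) : ℂ) :=
    Complex.continuous_ofReal.comp (Real.continuous_sinc.comp (continuous_const.mul continuous_id))
  have h1 : ∀ L : ℝ, ∫ v in (-L)..L, exp (2 * π * I * ((-y * v : ℝ) : ℂ)) * (sinc (π * v) : ℂ) =
      (((∫ v in (-L)..L, (1 + 2 * y) * sinc (π * ((1 + 2 * y) * v))) +
        ∫ v in (-L)..L, (1 - 2 * y) * sinc (π * ((1 - 2 * y) * v))) / 2 : ℝ) := by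
    intro L
    set f : ℝ → ℂ := fun v => exp (2 * π * I * ((-y * v : ℝ) : ℂ)) * (sinc (π * v) : ℂ)
    have hf : Continuous f := by
      refine Continuous.mul ?_ hs
      fun_prop
    have h2 : ∫ v in (-L)..L, f (-v) = ∫ v in (-L)..L, f v := by
      rw [intervalIntegral.integral_comp_neg, neg_neg]
    have h3 : ∫ v in (-L)..L, f v = ∫ v in (-L)..L, (f v + f (-v)) / 2 := by
      have h4 : Continuous fun v => f (-v) := hf.comp continuous_neg
      have h5 := intervalIntegral.integral_add (hf.intervalIntegrable (μ := volume)
        (-L) L) (h4.intervalIntegrable (-L) L)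
      rw [intervalIntegral.integral_div, h5, h2]
      ring
    have hc : ∀ c : ℝ, Continuous fun v : ℝ => c * sinc (π * (c * v)) := fun c =>
      continuous_const.mul (Real.continuous_sinc.comp (by fun_prop))
    rw [h3, ← intervalIntegral.integral_add ((hc _).intervalIntegrable _ _)
      ((hc _).intervalIntegrable _ _), ← intervalIntegral.integral_div,
      ← intervalIntegral.integral_ofReal]
    congr 1
    funext v
    rw [← cos_mul_sinc]
    simp only [f]
    rw [mul_neg π v, Real.sinc_neg, ← add_mul, mul_div_right_comm,
      Complex.ofReal_mul (Real.cos _), Complex.ofReal_cos, Complex.cos]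
    congr 2
    rw [add_comm]
    congr 1 <;> congr 1 <;> push_cast <;> ring
  simp only [h1]
  exact (Complex.continuous_ofReal.tendsto _).comp
    (((tendsto_integral_mul_sinc _).add (tendsto_integral_mul_sinc _)).div_const 2)

theorem setIntegral_Icc_two (f : ℝ → ℂ) {L : ℝ} (hL : 0 ≤ L) :
    ∫ v in Set.Icc (fun _ : Fin (2 - 1) => -L) (fun _ => L), f (v 0) = ∫ v in (-L)..L, f v := by
  rw [intervalIntegral.integral_of_le (by linarith), ← integral_Icc_eq_integral_Ioc]
  have h := (volume_preserving_funUnique (Fin 1) ℝ).setIntegral_preimage_emb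
    (MeasurableEquiv.measurableEmbedding _) f (Set.Icc (-L) L)
  rw [← h]
  congr 2
  ext v
  change (∀ i, _) ∧ (∀ i, _) ↔ _ ∧ _
  refine and_congr ⟨fun h => h 0, fun h i => ?_⟩ ⟨fun h => h 0, fun h i => ?_⟩ <;>
  · rw [show i = 0 from Subsingleton.elim (α := Fin 1) i 0]
    exact h

theorem sum_intBox_two (f : ℤ → ℂ) (N : ℕ) :
    ∑ p ∈ intBox 2 N, f (p 0) = ∑ p ∈ Finset.Icc (-(N : ℤ)) N, f p := by
  refine Finset.sum_bij' (fun p _ => p 0) (fun p _ _ => p) ?_ ?_ ?_ ?_ ?_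
  · intro p hp
    exact Fintype.mem_piFinset.mp hp 0
  · intro p hp
    exact Fintype.mem_piFinset.mpr fun _ => hp
  · intro p _
    exact (eq_const_two p).symm
  · intro p _
    rfl
  · intro p _
    rfl

/-- The kernel is the indicator of `[-1/2, 1/2]` with the value `1/2` at both ends, as `Real.sign 0
= 0`. The end values matter: for `w = 1/2`, the coordinate of `ρ`, the lattice points `k - w` in the
support are the two ends, and their two halves add up to `cos (πv)`. -/
theorem isSplineKernel_two : IsSplineKernel (n := 2) fun y =>
    (Real.sign (1 + 2 * y 0) + Real.sign (1 - 2 * y 0)) / 2 := by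
  refine ⟨fun y j h => ?_, fun x w => ?_, fun y => ?_, fun w hw v => ?_⟩
  · rw [show j = 0 from Subsingleton.elim (α := Fin 1) j 0] at h
    norm_num at h
    rcases le_or_gt 0 (y 0) with h0 | h0
    · rw [abs_of_nonneg h0] at h
      rw [Real.sign_of_pos (by linarith), Real.sign_of_neg (by linarith)]
      norm_num
    · rw [abs_of_neg h0] at h
      rw [Real.sign_of_neg (by linarith), Real.sign_of_pos (by linarith)]
      norm_num
  · rw [coords_two, coords_two]
    have hw : (x (w 0) = x 0 ∧ x (w 1) = x 1) ∨ (x (w 0) = x 1 ∧ x (w 1) = x 0) := by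
      have h01 : w 0 ≠ w 1 := w.injective.ne (by decide)
      generalize w 0 = a at *
      generalize w 1 = b at *
      fin_cases a <;> fin_cases b <;> simp at h01 ⊢
    simp only [Function.comp_apply]
    rcases hw with ⟨h1, h2⟩ | ⟨h1, h2⟩
    · rw [h1, h2]
    · rw [h1, h2, add_comm]
      congr 3 <;> ring
  · refine (tendsto_integral_exp_mul_sinc (y 0)).congr' ?_
    filter_upwards [eventually_ge_atTop 0] with L hL
    rw [← setIntegral_Icc_two _ hL]
    congr 1
    funext v
    rw [echar_two, sincProd_two]
    simp only [Pi.neg_apply, Pi.smul_apply, smul_eq_mul]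
    congr 3
    ring
  · have hS : ∀ p : Fin (2 - 1) → ℤ, sincProd (n := 2) ((2 * π) • (v + castVec p)) =
        sinc (π * (v 0 + p 0)) := by
      intro p
      rw [sincProd_two]
      simp only [Pi.smul_apply, Pi.add_apply, smul_eq_mul, castVec]
      congr 1
      ring
    have hk : ∀ k : Fin (2 - 1) → ℤ, ∀ m : ℤ, k 0 = m → k = fun _ => m := fun k m h => by
      rw [eq_const_two k, h]
    rcases hw with rfl | rfl
    · rw [finsum_eq_single _ (0 : Fin (2 - 1) → ℤ)]
      · have h1 := tendsto_sum_sinc (v 0)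
        simp only [← sum_intBox_two fun p => (sinc (π * (v 0 + p)) : ℂ)] at h1
        convert h1 using 2
        · refine sum_congr rfl fun p _ => ?_
          rw [hS]
          simp [echar]
        · simp [echar, castVec, Real.sign_one]
      · intro k hk0
        have h0 : k 0 ≠ 0 := fun h => hk0 (hk k 0 h)
        have : Real.sign (1 + 2 * (castVec k - 0 : Fin (2 - 1) → ℝ) 0) +
            Real.sign (1 - 2 * (castVec k - 0 : Fin (2 - 1) → ℝ) 0) = 0 := by
          simp only [castVec, sub_zero]
          rcases lt_or_gt_of_ne h0 with h | h
          · have h' : (k 0 : ℝ) ≤ -1 := by exact_mod_cast Int.le_sub_one_of_lt h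
            rw [Real.sign_of_neg (by linarith), Real.sign_of_pos (by linarith)]
            norm_num
          · have h' : (1 : ℝ) ≤ k 0 := by exact_mod_cast h
            rw [Real.sign_of_pos (by linarith), Real.sign_of_neg (by linarith)]
            norm_num
        rw [this]
        simp
    · have hρ : coords (rho : Fin 2 → ℝ) = fun _ => 1 / 2 := by
        rw [coords_two]
        funext j
        rw [rho_apply, rho_apply]
        norm_num
      rw [hρ]
      have hfin : ∑ᶠ k : Fin (2 - 1) → ℤ, (((Real.sign (1 + 2 * (castVec k - fun _ => 1 / 2 :
          Fin (2 - 1) → ℝ) 0) + Real.sign (1 - 2 * (castVec k - fun _ => 1 / 2 :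
          Fin (2 - 1) → ℝ) 0)) / 2 : ℝ) : ℂ) * echar (castVec k - fun _ => 1 / 2) v =
          (Real.cos (π * v 0) : ℂ) := by
        have hne : (fun _ => 0 : Fin (2 - 1) → ℤ) ≠ fun _ => 1 := fun h =>
          zero_ne_one (congrFun h 0)
        rw [finsum_eq_sum_of_support_subset (s := {fun _ => 0, fun _ => 1}), Finset.sum_pair hne]
        · simp only [echar_two, Pi.sub_apply, castVec]
          have e1 : Real.sign (2 * 1 : ℝ) = 1 := Real.sign_of_pos (by norm_num)
          norm_num [Real.sign_zero, e1]
          rw [Complex.cos]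
          rw [show Real.sign 2 = 1 from Real.sign_of_pos two_pos]
          push_cast
          ring_nf
        · intro k hk'
          by_contra h
          refine hk' ?_
          simp only [Finset.coe_insert, Finset.coe_singleton, Set.mem_insert_iff,
            Set.mem_singleton_iff, not_or] at h
          have h0 : k 0 ≠ 0 := fun h' => h.1 (hk k 0 h')
          have h1 : k 0 ≠ 1 := fun h' => h.2 (hk k 1 h')
          have : Real.sign (1 + 2 * (castVec k - fun _ => 1 / 2 : Fin (2 - 1) → ℝ) 0) +
              Real.sign (1 - 2 * (castVec k - fun _ => 1 / 2 : Fin (2 - 1) → ℝ) 0) = 0 := by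
            simp only [castVec, Pi.sub_apply]
            rcases lt_or_ge (k 0) 0 with h2 | h2
            · have h' : (k 0 : ℝ) ≤ -1 := by exact_mod_cast Int.le_sub_one_of_lt h2
              rw [Real.sign_of_neg (by linarith), Real.sign_of_pos (by linarith)]
              norm_num
            · have h' : (2 : ℝ) ≤ k 0 := by exact_mod_cast (by omega : (2 : ℤ) ≤ k 0)
              rw [Real.sign_of_pos (by linarith), Real.sign_of_neg (by linarith)]
              norm_num
          beta_reduce
          rw [this]
          simp
      rw [hfin]
      have h1 := tendsto_sum_neg_one_sinc (v 0)
      simp only [← sum_intBox_two fun p => (-1 : ℂ) ^ p * (sinc (π * (v 0 + p)) : ℂ)] at h1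
      refine h1.congr fun N => sum_congr rfl fun p _ => ?_
      rw [hS, echar_two]
      congr 1
      rw [← Complex.exp_pi_mul_I, ← Complex.exp_int_mul]
      congr 1
      simp only [castVec]
      push_cast
      ring

theorem exists_splineKernel (hn : 2 ≤ n) :
    ∃ B : (Fin (n - 1) → ℝ) → ℝ, IsSplineKernel B ∧ (3 ≤ n → Continuous B) := by
  rcases Nat.eq_or_lt_of_le hn with rfl | hn
  · exact ⟨_, isSplineKernel_two, fun h => absurd h (by norm_num)⟩
  · exact ⟨_, isSplineKernel_spline hn, fun _ => Complex.continuous_re.comp (continuous_spline hn)⟩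

/-! ### The trigonometric polynomials of a kernel -/

/-- The vector with given coordinates in the simple roots. -/
def ofCoords (y : Fin (n - 1) → ℝ) : Fin n → ℝ :=
  ∑ j : Fin (n - 1), y j • (Pi.single (⟨j, by have := j.2; omega⟩ : Fin n) (1 : ℝ) -
    Pi.single (⟨j + 1, by have := j.2; omega⟩ : Fin n) (1 : ℝ))

theorem sum_mul_ofCoords (t : Fin n → ℝ) (y : Fin (n - 1) → ℝ) :
    ∑ i, t i * ofCoords y i = ∑ j, y j * diffs t j := by
  simp only [ofCoords, Finset.sum_apply, mul_sum]
  rw [sum_comm]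
  refine sum_congr rfl fun j _ => ?_
  simp only [Pi.smul_apply, Pi.sub_apply, smul_eq_mul, diffs, mul_sub, mul_left_comm (t _),
    sum_sub_distrib, ← mul_sum]
  simp [Pi.single_apply]

theorem ofCoords_mem (y : Fin (n - 1) → ℝ) : ofCoords y ∈ traceless n := by
  rw [mem_traceless]
  simpa [diffs] using sum_mul_ofCoords (fun _ => (1 : ℝ)) y

theorem coords_ofCoords (y : Fin (n - 1) → ℝ) : coords (ofCoords y) = y := by
  have h : ∀ u : Fin (n - 1) → ℝ, ∑ j, coords (ofCoords y) j * u j = ∑ j, y j * u j := fun u => by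
    rw [sum_coords_mul, sum_mul_ofCoords, diffs_lift]
  funext j
  simpa [Pi.single_apply] using h (Pi.single j 1)

theorem sum_coords_mul_diffs {x : Fin n → ℝ} (hx : x ∈ traceless n) (t : Fin n → ℝ) :
    ∑ j, coords x j * diffs t j = ∑ i, t i * x i := by
  rw [sum_coords_mul, lift_diffs_apply]
  simp only [sub_mul, sum_sub_distrib, ← mul_sum]
  rw [mem_traceless.mp hx, mul_zero, sub_zero]

theorem ofCoords_coords {x : Fin n → ℝ} (hx : x ∈ traceless n) : ofCoords (coords x) = x := by
  have h : ∀ t : Fin n → ℝ, ∑ i, t i * ofCoords (coords x) i = ∑ i, t i * x i := fun t => by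
    rw [sum_mul_ofCoords, sum_coords_mul_diffs hx]
  funext i
  simpa [Pi.single_apply] using h (Pi.single i 1)

theorem ofCoords_injective : Injective (ofCoords (n := n)) :=
  Function.LeftInverse.injective coords_ofCoords

theorem exists_castVec_eq_coords {z : Fin n → ℝ} (hz : z ∈ traceless n) :
    (∃ k : Fin (n - 1) → ℤ, castVec k = coords z) ↔ ∀ i, ∃ m : ℤ, z i = m := by
  constructor
  · rintro ⟨k, hk⟩ i
    refine ⟨∑ j : Fin (n - 1), k j * ((Pi.single (⟨j, by have := j.2; omega⟩ : Fin n) (1 : ℤ) -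
      Pi.single (⟨j + 1, by have := j.2; omega⟩ : Fin n) (1 : ℤ) : Fin n → ℤ) i), ?_⟩
    conv_lhs => rw [← ofCoords_coords hz, ← hk]
    simp only [ofCoords, Finset.sum_apply, Pi.smul_apply, smul_eq_mul, castVec, Int.cast_sum,
      Int.cast_mul, Pi.sub_apply, Int.cast_sub, Pi.single_apply, Int.cast_ite, Int.cast_one,
      Int.cast_zero]
  · intro h
    choose m hm using h
    refine ⟨fun j => ∑ k : Fin n with k.val ≤ j.val, m k, funext fun j => ?_⟩
    rw [coords_apply, mem_traceless.mp hz, mul_zero, sub_zero, castVec, Int.cast_sum]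
    exact sum_congr rfl fun k _ => (hm k).symm

/-- The traceless vectors that are integral after addition of `τ`. -/
def cosetLattice (τ : Fin n → ℝ) : Set (Fin n → ℝ) :=
  {x | x ∈ traceless n ∧ ∀ i, ∃ m : ℤ, x i + τ i = m}

/-- The trigonometric polynomial with coefficients given by `B` on a coset of the root lattice. -/
def kernelPoly (B : (Fin (n - 1) → ℝ) → ℝ) (τ : Fin n → ℝ) : TrigPoly n :=
  ∑ᶠ k : Fin (n - 1) → ℤ, (B (castVec k - coords τ) : ℂ) • mono (ofCoords (castVec k - coords τ))

theorem IsSplineKernel.finite {B : (Fin (n - 1) → ℝ) → ℝ}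
    (hB : IsSplineKernel B) (w : Fin (n - 1) → ℝ) :
    {k : Fin (n - 1) → ℤ | B (castVec k - w) ≠ 0}.Finite :=
  finite_support_of_eq_zero hB.eq_zero w

theorem IsSplineKernel.kernelPoly_eq {B : (Fin (n - 1) → ℝ) → ℝ}
    (hB : IsSplineKernel B) (τ : Fin n → ℝ) : kernelPoly B τ =
    ∑ k ∈ (hB.finite (coords τ)).toFinset,
      (B (castVec k - coords τ) : ℂ) • mono (ofCoords (castVec k - coords τ)) := by
  refine finsum_eq_sum_of_support_subset _ fun k hk => ?_
  rw [Set.Finite.coe_toFinset]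
  intro h
  exact hk (by beta_reduce; rw [h, Complex.ofReal_zero, zero_smul])

theorem IsSplineKernel.ev_kernelPoly {B : (Fin (n - 1) → ℝ) → ℝ}
    (hB : IsSplineKernel B) (τ t : Fin n → ℝ) : ev t (kernelPoly B τ) =
    ∑ᶠ k : Fin (n - 1) → ℤ, (B (castVec k - coords τ) : ℂ) *
      echar (castVec k - coords τ) ((2 * π)⁻¹ • diffs t) := by
  rw [hB.kernelPoly_eq, map_sum,
    finsum_eq_sum_of_support_subset (s := (hB.finite (coords τ)).toFinset)]
  · refine sum_congr rfl fun k _ => ?_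
    rw [map_smul, ev_mono, sum_mul_ofCoords, smul_eq_mul, echar]
    congr 2
    have hpi : (π : ℂ) ≠ 0 := by exact_mod_cast Real.pi_ne_zero
    simp only [Pi.smul_apply, smul_eq_mul, mul_left_comm _ (2 * π)⁻¹, ← mul_sum]
    push_cast
    field_simp
  · intro k hk
    rw [Set.Finite.coe_toFinset]
    intro h
    exact hk (by beta_reduce; rw [h, Complex.ofReal_zero, zero_mul])

theorem IsSplineKernel.coeff_kernelPoly {B : (Fin (n - 1) → ℝ) → ℝ}
    (hB : IsSplineKernel B) {τ x : Fin n → ℝ} (hτ : τ ∈ traceless n)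
    (hx : x ∈ cosetLattice τ) : (kernelPoly B τ).coeff x = B (coords x) := by
  obtain ⟨k, hk⟩ := (exists_castVec_eq_coords (add_mem hx.1 hτ)).mpr hx.2
  have hkx : castVec k - coords τ = coords x := by rw [hk, map_add, add_sub_cancel_right]
  rw [hB.kernelPoly_eq, coeff_sum, Finsupp.finsetSum_apply]
  have h1 : ∀ l : Fin (n - 1) → ℤ, l ≠ k →
      ((B (castVec l - coords τ) : ℂ) • mono (ofCoords (castVec l - coords τ)) : TrigPoly n).coeff x
        = 0 := by
    intro l hl
    rw [coeff_smul, Finsupp.smul_apply, coeff_mono, if_neg, smul_zero]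
    intro h
    rw [← ofCoords_coords hx.1, ← hkx] at h
    have h2 := ofCoords_injective h
    refine hl (funext fun j => ?_)
    have := congrFun h2 j
    simp only [Pi.sub_apply, castVec, sub_left_inj, Int.cast_inj] at this
    exact this
  have h2 : ((B (castVec k - coords τ) : ℂ) •
      mono (ofCoords (castVec k - coords τ)) : TrigPoly n).coeff x = B (coords x) := by
    rw [coeff_smul, Finsupp.smul_apply, coeff_mono, hkx, ofCoords_coords hx.1,
      if_pos rfl, smul_eq_mul, mul_one]
  by_cases hk' : k ∈ (hB.finite (coords τ)).toFinset
  · rw [Finset.sum_eq_single_of_mem k hk' fun l _ hl => h1 l hl, h2]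
  · rw [Finset.sum_eq_zero fun l hl => h1 l fun h => hk' (h ▸ hl)]
    rw [Set.Finite.mem_toFinset, Set.mem_ofPred_eq, not_not, hkx] at hk'
    rw [hk', Complex.ofReal_zero]

theorem IsSplineKernel.suppIn_kernelPoly {B : (Fin (n - 1) → ℝ) → ℝ}
    (hB : IsSplineKernel B) {τ : Fin n → ℝ} (hτ : τ ∈ traceless n) :
    SuppIn (cosetLattice τ) (kernelPoly B τ) := by
  intro x hx
  rw [hB.kernelPoly_eq, coeff_sum, Finsupp.finsetSum_apply] at hx
  obtain ⟨k, _, hk⟩ := Finset.exists_ne_zero_of_sum_ne_zero hx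
  rw [coeff_smul, Finsupp.smul_apply, coeff_mono] at hk
  split_ifs at hk with h
  · have hx : x = ofCoords (castVec k - coords τ) := h.symm
    have hxt : x ∈ traceless n := hx ▸ ofCoords_mem _
    refine ⟨hxt, (exists_castVec_eq_coords (add_mem hxt hτ)).mp ⟨k, ?_⟩⟩
    rw [map_add, hx, coords_ofCoords, sub_add_cancel]
  · simp at hk

theorem IsSplineKernel.coeff_kernelPoly_im {B : (Fin (n - 1) → ℝ) → ℝ}
    (hB : IsSplineKernel B) {τ : Fin n → ℝ} (hτ : τ ∈ traceless n) (x : Fin n → ℝ) :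
    ((kernelPoly B τ).coeff x).im = 0 := by
  by_cases hx : x ∈ cosetLattice τ
  · rw [hB.coeff_kernelPoly hτ hx, Complex.ofReal_im]
  · rw [not_not.mp fun h => hx (hB.suppIn_kernelPoly hτ x h), Complex.zero_im]

theorem IsSplineKernel.isSymm_kernelPoly {B : (Fin (n - 1) → ℝ) → ℝ}
    (hB : IsSplineKernel B) {τ : Fin n → ℝ} (hτ : τ ∈ traceless n)
    (hint : ∀ i j, ∃ m : ℤ, τ i - τ j = m) : IsSymm (kernelPoly B τ) := by
  have hmem : ∀ (w : Perm (Fin n)) (x : Fin n → ℝ), x ∈ cosetLattice τ →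
      x ∘ w ∈ cosetLattice τ := by
    rintro w x ⟨h1, h2⟩
    refine ⟨comp_mem_traceless h1 w, fun i => ?_⟩
    obtain ⟨a, ha⟩ := h2 (w i)
    obtain ⟨b, hb⟩ := hint i (w i)
    refine ⟨a + b, ?_⟩
    push_cast
    rw [← ha, ← hb, Function.comp_apply]
    ring
  intro w
  ext x
  obtain ⟨y, rfl⟩ : ∃ y, x = y ∘ w := ⟨x ∘ w.symm, by funext i; simp⟩
  rw [coeff_act]
  by_cases hy : y ∈ cosetLattice τ
  · rw [hB.coeff_kernelPoly hτ hy, hB.coeff_kernelPoly hτ (hmem _ y hy), hB.comp]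
  · rw [not_not.mp fun h => hy (hB.suppIn_kernelPoly hτ y h)]
    by_contra h
    refine hy ?_
    have h3 := hmem w⁻¹ _ (hB.suppIn_kernelPoly hτ _ (Ne.symm h))
    convert h3 using 1
    funext i
    simp

/-- At `v = 0` the box sums have one nonzero term: if `p_j ≠ 0`, the factor of the adjacent pair
`(j, j + 1)` is `sinc (π p_j) = 0`. -/
theorem IsSplineKernel.ev_zero_kernelPoly {B : (Fin (n - 1) → ℝ) → ℝ}
    (hB : IsSplineKernel B) {τ : Fin n → ℝ} (hτ : τ = 0 ∨ τ = rho) :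
    ev 0 (kernelPoly B τ) = 1 := by
  have hw : coords τ = 0 ∨ coords τ = coords (rho : Fin n → ℝ) := by
    rcases hτ with rfl | rfl
    · exact Or.inl (map_zero _)
    · exact Or.inr rfl
  have h := hB.tendsto_sum (coords τ) hw 0
  rw [hB.ev_kernelPoly]
  have h0 : ((2 * π)⁻¹ • diffs (0 : Fin n → ℝ)) = 0 := by funext j; simp [diffs]
  rw [h0]
  refine tendsto_nhds_unique h (tendsto_const_nhds.congr fun N => ?_)
  rw [Finset.sum_eq_single_of_mem (0 : Fin (n - 1) → ℤ)]
  · have h1 : castVec (0 : Fin (n - 1) → ℤ) = 0 := funext fun j => Int.cast_zero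
    rw [h1, echar_zero, one_mul, add_zero, smul_zero]
    simp [sincProd, blockSum]
  · simp
  · intro p _ hp
    have h2 : sincProd (n := n) ((2 * π) • (0 + castVec p)) = 0 := by
      obtain ⟨j, hj⟩ := Function.ne_iff.mp hp
      have hlt := j.2
      rw [sincProd]
      refine Finset.prod_eq_zero (i := (⟨j, by omega⟩, ⟨j + 1, by omega⟩))
        (mem_filter.mpr ⟨mem_univ _, Nat.lt_succ_self _⟩) ?_
      rw [← lift_sub_lift _ (by simp [Fin.le_def])]
      have h3 : lift ((2 * π) • (0 + castVec p)) ⟨j, by omega⟩ -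
          lift ((2 * π) • (0 + castVec p)) ⟨j + 1, by omega⟩ =
          diffs (lift ((2 * π) • (0 + castVec p))) j := rfl
      rw [h3, diffs_lift]
      have h4 : ((2 * π) • (0 + castVec p)) j / 2 = π * p j := by simp [castVec]; ring
      rw [h4]
      exact sinc_pi_int hj
    rw [h2, Complex.ofReal_zero, mul_zero]

/-! ### The functions `R_n` and `R̂_n` as trigonometric polynomials -/

theorem coords_rho (j : Fin (n - 1)) :
    coords (rho : Fin n → ℝ) j = ((j : ℝ) + 1) * (n - 1 - j) / 2 := by
  have h1 : ∀ m, m ≤ n → ∑ k : Fin n with k.val < m, (rho k : ℝ) = (m : ℝ) * (n - m) / 2 := by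
    intro m
    induction m with
    | zero => simp
    | succ m ih =>
      intro hm
      have h2 : (Finset.univ.filter fun k : Fin n => k.val < m + 1) =
          insert ⟨m, hm⟩ (Finset.univ.filter fun k : Fin n => k.val < m) := by
        ext k
        simp only [mem_filter, mem_univ, true_and, Finset.mem_insert, Fin.ext_iff]
        omega
      rw [h2, Finset.sum_insert (by simp), ih (by omega), rho_apply]
      push_cast
      ring
  rw [coords_apply, mem_traceless.mp (weightLattice_le_traceless n rho_mem), mul_zero, sub_zero]
  have h3 := h1 (j + 1) (by have := j.2; omega)
  simp only [Nat.lt_succ_iff] at h3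
  rw [h3]
  push_cast
  ring

theorem echar_int_div_two {m : ℤ} {y v : Fin (n - 1) → ℝ} (h : 2 * ∑ j, y j * v j = m) :
    echar y v = (-1) ^ m := by
  rw [echar, ← Complex.exp_pi_mul_I, ← Complex.exp_int_mul]
  congr 1
  have h' : ((2 * ∑ j, y j * v j : ℝ) : ℂ) = m := by rw [h]; norm_cast
  rw [← h']
  push_cast
  ring

theorem echar_rho_eq_pairs (p : Fin (n - 1) → ℤ) : echar (coords (rho : Fin n → ℝ)) (castVec p) =
      (-1) ^ ∑ q : Fin n × Fin n with q.1 < q.2, blockSum p q.1 q.2 := by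
  refine echar_int_div_two ?_
  rw [sum_coords_mul]
  simp only [mul_comm (lift _ _)]
  rw [← sum_pairs_sub, Int.cast_sum]
  refine sum_congr rfl fun q hq => ?_
  rw [lift_sub_lift _ (mem_filter.mp hq).2.le, blockSum_castVec]

/-- Twice the pairing of `ρ` with `p` is `∑ (j + 1)(n - 1 - j) p_j`. As `j (j + 1)` is even, `n - 1
- j` may be replaced by `n - 1`, which gives the sign in `D_n`. -/
theorem echar_rho_eq_sign (p : Fin (n - 1) → ℤ) : echar (coords (rho : Fin n → ℝ)) (castVec p) =
      (-1) ^ ∑ j : Fin (n - 1), ((j : ℤ) + 1) * p j * ((n : ℤ) - 1) := by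
  have h1 : echar (coords (rho : Fin n → ℝ)) (castVec p) =
      (-1) ^ ∑ j : Fin (n - 1), ((j : ℤ) + 1) * p j * ((n : ℤ) - 1 - j) := by
    refine echar_int_div_two ?_
    rw [mul_sum]
    push_cast
    refine sum_congr rfl fun j _ => ?_
    rw [coords_rho, castVec]
    ring
  have h2 : Even (∑ j : Fin (n - 1), (j : ℤ) * ((j : ℤ) + 1) * p j) :=
    Finset.even_sum _ fun j _ => (Int.even_mul_succ_self (j : ℤ)).mul_right _
  have h3 : (-1 : ℂ) ^ (∑ j : Fin (n - 1), (j : ℤ) * ((j : ℤ) + 1) * p j) = 1 := h2.neg_one_zpow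
  have h4 : ∑ j : Fin (n - 1), ((j : ℤ) + 1) * p j * ((n : ℤ) - 1) =
      ∑ j : Fin (n - 1), ((j : ℤ) + 1) * p j * ((n : ℤ) - 1 - j) +
        ∑ j : Fin (n - 1), (j : ℤ) * ((j : ℤ) + 1) * p j := by
    rw [← sum_add_distrib]
    exact sum_congr rfl fun j _ => by ring
  rw [h1, h4, zpow_add₀ (by norm_num), h3, mul_one]

/-- Translation of a block sum by `2π` times an integer changes the sine of its half by the parity
sign of that integer; then `2 sin(b/2) / b` is a cardinal sine. -/
theorem varpi_mul_inv {u : Fin (n - 1) → ℝ} (p : Fin (n - 1) → ℤ)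
    (h : ∀ q : Fin n × Fin n, q.1 < q.2 → blockSum (fun j => u j + p j * (2 * π)) q.1 q.2 ≠ 0) :
    (vanderTilde fun j => u j + p j * (2 * π))⁻¹ * varpi u =
      (-1) ^ (∑ q : Fin n × Fin n with q.1 < q.2, blockSum p q.1 q.2) *
        sincProd ((2 * π) • ((2 * π)⁻¹ • u + castVec p)) := by
  have h2 : (2 * π) • ((2 * π)⁻¹ • u + castVec p) = fun j => u j + p j * (2 * π) := by
    funext j
    have := Real.pi_ne_zero
    simp only [Pi.smul_apply, Pi.add_apply, smul_eq_mul, castVec]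
    field_simp
  have h3 : ((-1 : ℝ) ^ ∑ q : Fin n × Fin n with q.1 < q.2, blockSum p q.1 q.2) =
      ∏ q : Fin n × Fin n with q.1 < q.2, (-1 : ℝ) ^ blockSum p q.1 q.2 := by
    classical
    induction (Finset.univ.filter fun q : Fin n × Fin n => q.1 < q.2) using Finset.induction with
    | empty => simp
    | insert a s ha ih => rw [Finset.sum_insert ha, Finset.prod_insert ha, zpow_add₀ (by norm_num), ih]
  rw [h2, vanderTilde, varpi, sincProd, h3, ← Finset.prod_inv_distrib, ← prod_mul_distrib,
    ← prod_mul_distrib]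
  refine prod_congr rfl fun q hq => ?_
  have h4 := h q (mem_filter.mp hq).2
  have h5 : blockSum (fun j => u j + p j * (2 * π)) q.1 q.2 =
      blockSum u q.1 q.2 + blockSum p q.1 q.2 * (2 * π) := by
    rw [show (fun j => u j + p j * (2 * π)) = u + (2 * π) • castVec p by
      funext j; simp [castVec, mul_comm], blockSum_add, blockSum_smul, blockSum_castVec]
    ring
  have h6 : Real.sin (blockSum (fun j => u j + p j * (2 * π)) q.1 q.2 / 2) =
      (-1) ^ blockSum p q.1 q.2 * Real.sin (blockSum u q.1 q.2 / 2) := by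
    rw [h5, ← Real.sin_add_int_mul_pi]
    congr 1
    ring
  have h7 : ((-1 : ℝ) ^ blockSum p q.1 q.2) * (-1) ^ blockSum p q.1 q.2 = 1 := by
    rw [← mul_zpow]; norm_num
  rw [Real.sinc_of_ne_zero (div_ne_zero h4 two_ne_zero), h6]
  set b := blockSum (fun j => u j + p j * (2 * π)) q.1 q.2
  rw [mul_div_assoc', ← mul_assoc ((-1 : ℝ) ^ _), h7]
  field_simp

theorem sub_ne_int_of_injective {t : Fin n → ℝ} (ht : Injective (expi t)) {i j : Fin n}
    (h : i ≠ j) (m : ℤ) : t i - t j ≠ m * (2 * π) := by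
  intro h0
  refine h (ht ?_)
  simp only [expi]
  rw [Complex.exp_eq_exp_iff_exists_int]
  refine ⟨m, ?_⟩
  have : (t i : ℂ) = t j + m * (2 * π) := by
    rw [← sub_eq_iff_eq_add']
    exact_mod_cast h0
  rw [this]
  ring

theorem varpi_ne_zero {t : Fin n → ℝ} (ht : Injective (expi t)) : varpi (diffs t) ≠ 0 := by
  refine Finset.prod_ne_zero_iff.mpr fun q hq => mul_ne_zero two_ne_zero fun h => ?_
  have hq := (mem_filter.mp hq).2
  obtain ⟨m, hm⟩ := Real.sin_eq_zero_iff.mp h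
  rw [blockSum_diffs _ hq.le] at hm
  exact sub_ne_int_of_injective ht hq.ne m (by linarith)

theorem varpi_mul_inv_diffs {t : Fin n → ℝ} (ht : Injective (expi t)) (p : Fin (n - 1) → ℤ) :
    (vanderTilde fun j => diffs t j + p j * (2 * π))⁻¹ * varpi (diffs t) =
      (-1) ^ (∑ q : Fin n × Fin n with q.1 < q.2, blockSum p q.1 q.2) *
        sincProd ((2 * π) • ((2 * π)⁻¹ • diffs t + castVec p)) := by
  refine varpi_mul_inv p fun q hq h => ?_
  rw [show (fun j => diffs t j + p j * (2 * π)) = diffs t + (2 * π) • castVec p by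
    funext j; simp [castVec, mul_comm], blockSum_add, blockSum_smul, blockSum_castVec,
    blockSum_diffs _ hq.le] at h
  exact sub_ne_int_of_injective ht hq.ne (-blockSum p q.1 q.2) (by push_cast; linarith)

/-- The product of a limit of box sums with `ϖ_n`. -/
theorem limUnder_mul_eq {D : ℕ → ℝ} {a : ℝ} (ha : a ≠ 0) {L : ℂ}
    (h : Tendsto (fun N => ((D N * a : ℝ) : ℂ)) atTop (𝓝 L)) :
    ((limUnder atTop D * a : ℝ) : ℂ) = L := by
  have hre := (Complex.continuous_re.tendsto _).comp h
  have him := (Complex.continuous_im.tendsto _).comp h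
  simp only [Function.comp_def, Complex.ofReal_re, Complex.ofReal_im] at hre him
  have h1 : Tendsto D atTop (𝓝 (L.re / a)) := by
    have := hre.div_const a
    simpa only [mul_div_cancel_right₀ _ ha] using this
  rw [h1.limUnder_eq, div_mul_cancel₀ _ ha]
  refine Complex.ext (by simp) ?_
  rw [Complex.ofReal_im]
  exact tendsto_nhds_unique tendsto_const_nhds him

/-- The sign in `D_n` and the signs of the sines are both the character `e^{2πi ρ·p}`, and their
product is 1. -/
theorem IsSplineKernel.Rfun_eq {B : (Fin (n - 1) → ℝ) → ℝ} (hB : IsSplineKernel B) {t : Fin n → ℝ}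
    (ht : Injective (expi t)) : (Rfun (diffs t) : ℂ) = ev t (kernelPoly B 0) := by
  rw [Rfun, Dser]
  refine limUnder_mul_eq (varpi_ne_zero ht) ?_
  rw [hB.ev_kernelPoly, map_zero]
  refine (hB.tendsto_sum 0 (Or.inl rfl) _).congr fun N => ?_
  rw [sum_mul, Complex.ofReal_sum]
  refine sum_congr rfl fun p _ => ?_
  have h2 : ((-1 : ℂ) ^ ∑ j : Fin (n - 1), ((j : ℤ) + 1) * p j * ((n : ℤ) - 1)) *
      (-1) ^ ∑ q : Fin n × Fin n with q.1 < q.2, blockSum p q.1 q.2 = 1 := by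
    rw [← echar_rho_eq_sign, echar_rho_eq_pairs, ← mul_zpow]
    norm_num
  rw [mul_assoc, varpi_mul_inv_diffs ht, ← mul_assoc]
  push_cast
  rw [h2]
  simp [echar]

/-- Here the signs of the sines stay. They twist the lattice sum by the character of `ρ`, which
moves the dual lattice by `ρ`. -/
theorem IsSplineKernel.RfunHat_eq {B : (Fin (n - 1) → ℝ) → ℝ} (hB : IsSplineKernel B)
    {t : Fin n → ℝ} (ht : Injective (expi t)) :
    (RfunHat (diffs t) : ℂ) = ev t (kernelPoly B rho) := by
  rw [RfunHat, DserHat]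
  refine limUnder_mul_eq (varpi_ne_zero ht) ?_
  rw [hB.ev_kernelPoly]
  refine (hB.tendsto_sum _ (Or.inr rfl) _).congr fun N => ?_
  rw [sum_mul, Complex.ofReal_sum]
  refine sum_congr rfl fun p _ => ?_
  rw [varpi_mul_inv_diffs ht, echar_rho_eq_pairs]
  push_cast
  rfl

/-! ### Expansions of `R_n` and `R̂_n` in characters. -/

theorem rho_sub_int (i j : Fin n) : ∃ m : ℤ, rho i - rho j = m :=
  (mem_weightLattice_iff.mp rho_mem).2 i j

theorem cosetLattice_subset {τ : Fin n → ℝ} (hint : ∀ i j, ∃ m : ℤ, τ i - τ j = m) :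
    cosetLattice τ ⊆ (weightLattice n : Set (Fin n → ℝ)) := by
  rintro x ⟨h1, h2⟩
  refine mem_weightLattice_iff.mpr ⟨h1, fun i j => ?_⟩
  obtain ⟨a, ha⟩ := h2 i
  obtain ⟨b, hb⟩ := h2 j
  obtain ⟨c, hc⟩ := hint i j
  refine ⟨a - b - c, ?_⟩
  push_cast
  linarith

theorem suppIn_weightLattice_kernelPoly {B : (Fin (n - 1) → ℝ) → ℝ} (hB : IsSplineKernel B)
    {τ : Fin n → ℝ} (hτ : τ ∈ traceless n) (hint : ∀ i j, ∃ m : ℤ, τ i - τ j = m) :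
    SuppIn (weightLattice n : Set (Fin n → ℝ)) (kernelPoly B τ) := fun x hx =>
  cosetLattice_subset hint (hB.suppIn_kernelPoly hτ x hx)

theorem sum_dimV_of_expansion (hn : n ≠ 0) {B : (Fin (n - 1) → ℝ) → ℝ} (hB : IsSplineKernel B)
    {τ : Fin n → ℝ} (hτ : τ = 0 ∨ τ = rho) (hτ' : τ ∈ traceless n)
    (hint : ∀ i j, ∃ m : ℤ, τ i - τ j = m) {F : (Fin (n - 1) → ℝ) → ℝ}
    (hF : ∀ t : Fin n → ℝ, Injective (expi t) → (F (diffs t) : ℂ) = ev t (kernelPoly B τ))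
    {r : Weight n →₀ ℝ} (hr : IsCharacterExpansion F r) :
    (r.sum fun κ a => a * (dimV κ : ℝ)) = 1 := by
  have h1 := ev_zero_combo hn r
  rw [combo_eq_of_expansion hn (suppIn_weightLattice_kernelPoly hB hτ' hint)
    (fun t _ ht => hF t ht) hr, hB.ev_zero_kernelPoly hτ] at h1
  exact_mod_cast h1.symm

theorem traceless_rho : (rho : Fin n → ℝ) ∈ traceless n := weightLattice_le_traceless n rho_mem

theorem zero_sub_int (i j : Fin n) : ∃ m : ℤ, (0 : Fin n → ℝ) i - (0 : Fin n → ℝ) j = m :=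
  ⟨0, by simp⟩

theorem existsUnique_Rfun (hn : 2 ≤ n) : ∃! r : Weight n →₀ ℝ, IsCharacterExpansion Rfun r := by
  obtain ⟨B, hB, -⟩ := exists_splineKernel hn
  exact existsUnique_expansion (by omega) (hB.isSymm_kernelPoly (zero_mem _) zero_sub_int)
    (suppIn_weightLattice_kernelPoly hB (zero_mem _) zero_sub_int)
    (hB.coeff_kernelPoly_im (zero_mem _)) fun t _ ht => hB.Rfun_eq ht

theorem existsUnique_RfunHat (hn : 2 ≤ n) :
    ∃! r : Weight n →₀ ℝ, IsCharacterExpansion RfunHat r := by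
  obtain ⟨B, hB, -⟩ := exists_splineKernel hn
  exact existsUnique_expansion (by omega) (hB.isSymm_kernelPoly traceless_rho rho_sub_int)
    (suppIn_weightLattice_kernelPoly hB traceless_rho rho_sub_int)
    (hB.coeff_kernelPoly_im traceless_rho) fun t _ ht => hB.RfunHat_eq ht

theorem sum_Rfun (hn : 2 ≤ n) {r : Weight n →₀ ℝ} (hr : IsCharacterExpansion Rfun r) :
    (r.sum fun κ a => a * (dimV κ : ℝ)) = 1 := by
  obtain ⟨B, hB, -⟩ := exists_splineKernel hn
  exact sum_dimV_of_expansion (by omega) hB (Or.inl rfl) (zero_mem _) zero_sub_int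
    (fun t ht => hB.Rfun_eq ht) hr

theorem sum_RfunHat (hn : 2 ≤ n) {r : Weight n →₀ ℝ} (hr : IsCharacterExpansion RfunHat r) :
    (r.sum fun κ a => a * (dimV κ : ℝ)) = 1 := by
  obtain ⟨B, hB, -⟩ := exists_splineKernel hn
  exact sum_dimV_of_expansion (by omega) hB (Or.inr rfl) traceless_rho rho_sub_int
    (fun t ht => hB.RfunHat_eq ht) hr

section

/-! ### The kernel `J_n` -/

theorem ev_lift_alt (u : Fin (n - 1) → ℝ) (x : Fin n → ℝ) :
    ev (lift u) (alt x) = ev (lift u) (alt (lift (diffs x))) := by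
  simp only [alt, map_sum, map_smul, ev_mono]
  refine sum_congr rfl fun w _ => ?_
  congr 4
  simp only [lift_diffs_apply, Function.comp_apply, mul_sub, sum_sub_distrib,
    ← sum_mul, sum_lift, zero_mul, sub_zero]

theorem card_pairs : (Finset.univ.filter fun q : Fin n × Fin n => q.1 < q.2).card =
    n * (n - 1) / 2 := by
  rw [Finset.card_eq_sum_ones, sum_pairs fun _ _ => 1]
  simp only [← Finset.card_eq_sum_ones, Fin.card_Ioi]
  rw [Fin.sum_univ_eq_sum_range fun i => n - 1 - i, Finset.sum_range_reflect fun i => i,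
    Finset.sum_range_id]

theorem kernelIntegrand_eq (α β γ : Fin n → ℝ) (u : Fin (n - 1) → ℝ) : kernelIntegrand α β γ u =
      ev (lift u) (alt α * alt β * inv (alt γ)) / (vanderTilde u : ℂ) := by
  rw [kernelIntegrand, map_mul, map_mul]
  congr 1
  simp only [alt, map_sum, map_smul, inv_mono, ev_mono]
  rw [Finset.sum_mul_sum, sum_mul]
  refine sum_congr rfl fun P _ => ?_
  rw [Finset.sum_mul_sum]
  refine sum_congr rfl fun P' _ => sum_congr rfl fun P'' _ => ?_
  have h1 : ∀ j, phase α β γ P P' P'' j = coords (α ∘ P + β ∘ P' - γ ∘ P'') j := by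
    intro j
    rw [coords_apply, phase]
    simp only [Pi.sub_apply, Pi.add_apply, Function.comp_apply, sum_sub_distrib,
      sum_add_distrib, Equiv.sum_comp]
  have h2 : ∑ j, u j * phase α β γ P P' P'' j =
      ∑ k, lift u k * (α ∘ P) k + ∑ k, lift u k * (β ∘ P') k + ∑ k, lift u k * (-(γ ∘ P'')) k := by
    simp only [h1, mul_comm (u _), sum_coords_mul, ← sum_add_distrib]
    exact sum_congr rfl fun k _ => by simp only [Pi.sub_apply, Pi.add_apply, Pi.neg_apply]; ring
  rw [← Complex.exp_sum, ← mul_sum, ← Complex.ofReal_sum, h2, Complex.ofReal_add,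
    Complex.ofReal_add, mul_add, mul_add, Complex.exp_add, Complex.exp_add]
  simp only [smul_eq_mul]
  ring

theorem ev_lift_alt_rho (u : Fin (n - 1) → ℝ) : ev (lift u) (alt rho) =
    I ^ (n * (n - 1) / 2) * (vanderTilde u : ℂ) * (sincProd u : ℂ) := by
  rw [ev_alt_rho, ← card_pairs, vanderTilde, sincProd, Complex.ofReal_prod, Complex.ofReal_prod,
    ← Finset.prod_const, ← prod_mul_distrib, ← prod_mul_distrib]
  refine prod_congr rfl fun q hq => ?_
  rw [lift_sub_lift u (mem_filter.mp hq).2.le]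
  set b := blockSum u q.1 q.2
  rcases eq_or_ne b 0 with h | h
  · simp [h]
  rw [Real.sinc_of_ne_zero (div_ne_zero h two_ne_zero)]
  have h' : (b : ℂ) ≠ 0 := by exact_mod_cast h
  push_cast
  field_simp

theorem ae_vanderTilde_ne_zero : ∀ᵐ u : Fin (n - 1) → ℝ, vanderTilde u ≠ 0 := by
  have h : ∀ q : Fin n × Fin n, q.1 < q.2 → ∀ᵐ u : Fin (n - 1) → ℝ, blockSum u q.1 q.2 ≠ 0 := by
    intro q hq
    let S : Submodule ℝ (Fin (n - 1) → ℝ) :=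
      { carrier := {u | blockSum u q.1 q.2 = 0}
        add_mem' := fun {a b} ha hb => by
          simp only [Set.mem_ofPred_eq] at *
          rw [blockSum_add, ha, hb, add_zero]
        zero_mem' := by simp [blockSum]
        smul_mem' := fun c x hx => by
          simp only [Set.mem_ofPred_eq] at *
          rw [blockSum_smul, hx, mul_zero] }
    have hS : S ≠ ⊤ := by
      intro hS
      have h1 : diffs (fun i : Fin n => -(i : ℝ)) ∈ S := hS ▸ Submodule.mem_top
      have h2 : blockSum (diffs (fun i : Fin n => -(i : ℝ))) q.1 q.2 = 0 := h1
      rw [blockSum_diffs _ hq.le] at h2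
      have h3 : (q.1 : ℝ) < q.2 := by exact_mod_cast hq
      linarith
    exact measure_eq_zero_iff_ae_notMem.mp (Measure.addHaar_submodule _ S hS)
  have h' : ∀ᵐ u : Fin (n - 1) → ℝ, ∀ q : Fin n × Fin n, q.1 < q.2 → blockSum u q.1 q.2 ≠ 0 :=
    ae_all_iff.mpr fun q => by
      by_cases hq : q.1 < q.2
      · filter_upwards [h q hq] with u hu _ using hu
      · exact Eventually.of_forall fun u h => absurd h hq
  filter_upwards [h'] with u hu
  exact Finset.prod_ne_zero_iff.mpr fun q hq => hu q (mem_filter.mp hq).2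

/-- The pairing of the Fourier transform of a trigonometric polynomial with a kernel. -/
def kernelPairing (B : (Fin (n - 1) → ℝ) → ℝ) : TrigPoly n →ₗ[ℂ] ℂ :=
  (Finsupp.linearCombination ℂ fun x : Fin n → ℝ => (B (-coords x) : ℂ)) ∘ₗ
    (AddMonoidAlgebra.coeffLinearEquiv ℂ).toLinearMap

theorem kernelPairing_apply (B : (Fin (n - 1) → ℝ) → ℝ) (f : TrigPoly n) :
    kernelPairing B f = f.coeff.sum fun x c => c * (B (-coords x) : ℂ) := rfl

theorem kernelPairing_mono (B : (Fin (n - 1) → ℝ) → ℝ) (x : Fin n → ℝ) :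
    kernelPairing B (mono x) = B (-coords x) := by
  rw [kernelPairing_apply, mono, AddMonoidAlgebra.coeff_single, Finsupp.sum_single_index] <;> simp

theorem kernelPairing_mul_mono (B : (Fin (n - 1) → ℝ) → ℝ) (f : TrigPoly n) (y : Fin n → ℝ) :
    kernelPairing B (f * mono (-y)) = f.coeff.sum fun x c => c * (B (coords (y - x)) : ℂ) := by
  conv_lhs => rw [eq_sum_mono f]
  rw [Finsupp.sum, sum_mul, map_sum, Finsupp.sum]
  refine sum_congr rfl fun x _ => ?_
  rw [smul_mul_assoc, map_smul, AddMonoidAlgebra.single_mul_single, one_mul, kernelPairing_mono,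
    ← map_neg, neg_add, neg_neg, neg_add_eq_sub, smul_eq_mul]

theorem integrableOn_cube {F : (Fin (n - 1) → ℝ) → ℂ} (hF : Continuous F) (L : ℝ) :
    IntegrableOn F (Set.Icc (fun _ => -L) (fun _ => L)) :=
  hF.continuousOn.integrableOn_compact isCompact_Icc

open scoped Pointwise in
theorem setIntegral_cube_smul {c : ℝ} (hc : 0 < c) (F : (Fin (n - 1) → ℝ) → ℂ) (L : ℝ) :
    ∫ u in Set.Icc (fun _ : Fin (n - 1) => -(c * L)) (fun _ => c * L), F u =
      (c : ℂ) ^ (n - 1) * ∫ v in Set.Icc (fun _ : Fin (n - 1) => -L) (fun _ => L), F (c • v) := by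
  have h1 : c • Set.Icc (fun _ : Fin (n - 1) => -L) (fun _ => L) =
      Set.Icc (fun _ : Fin (n - 1) => -(c * L)) (fun _ => c * L) := by
    ext u
    rw [Set.mem_smul_set_iff_inv_smul_mem₀ hc.ne']
    simp only [Set.mem_Icc, Pi.le_def, Pi.smul_apply, smul_eq_mul, inv_mul_eq_div, le_div_iff₀ hc,
      div_le_iff₀ hc, neg_mul, mul_comm L]
  rw [Measure.setIntegral_comp_smul_of_pos _ _ _ hc, h1, Module.finrank_fin_fun,
    Complex.real_smul, Complex.ofReal_inv, Complex.ofReal_pow, mul_inv_cancel_left₀]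
  exact pow_ne_zero _ (by exact_mod_cast hc.ne')

namespace IsSplineKernel

variable {B : (Fin (n - 1) → ℝ) → ℝ}

theorem kernelPairing_act (hB : IsSplineKernel B) (w : Perm (Fin n)) (f : TrigPoly n) :
    kernelPairing B (act w f) = kernelPairing B f := by
  induction f using trigPoly_induction with
  | hm x =>
    rw [act_mono, kernelPairing_mono, kernelPairing_mono, ← map_neg, ← map_neg]
    exact congrArg _ (hB.comp (-x) w)
  | ha f g hf hg => simp only [map_add, hf, hg]
  | hs c f hf => simp only [map_smul, hf]

/-- All `n!` terms of the alternant contribute equally; this is the factorial in the normalization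
of `J_n`. -/
theorem kernelPairing_mul_inv_alt (hB : IsSplineKernel B) {g : TrigPoly n} (hg : IsAlt g)
    (y : Fin n → ℝ) : kernelPairing B (g * inv (alt y)) =
      (n.factorial : ℂ) * kernelPairing B (g * mono (-y)) := by
  simp only [alt, map_sum, map_smul, inv_mono, mul_sum, mul_smul_comm]
  rw [sum_congr rfl fun w _ => show _ = kernelPairing B (g * mono (-y)) from ?_,
    sum_const, card_univ, Fintype.card_perm, Fintype.card_fin, nsmul_eq_mul]
  rw [← hB.kernelPairing_act w (g * mono (-y)), map_mul (act w), hg, act_mono, smul_mul_assoc, map_smul]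
  rfl

theorem tendsto_kernelPairing (hB : IsSplineKernel B) (f : TrigPoly n) :
    Tendsto (fun L : ℝ => ∫ v in Set.Icc (fun _ : Fin (n - 1) => -L) (fun _ => L),
      ev (lift ((2 * π) • v)) f * (sincProd ((2 * π) • v) : ℂ)) atTop
      (𝓝 (kernelPairing B f)) := by
  have hc : ∀ f : TrigPoly n, Continuous fun v : Fin (n - 1) → ℝ =>
      ev (lift ((2 * π) • v)) f * (sincProd ((2 * π) • v) : ℂ) := fun f =>
    ((continuous_ev f).comp ((LinearMap.continuous_of_finiteDimensional lift).comp
      (continuous_const_smul _))).mul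
      (Complex.continuous_ofReal.comp (continuous_sincProd.comp (continuous_const_smul _)))
  induction f using trigPoly_induction with
  | hm x =>
    rw [kernelPairing_mono]
    refine (hB.tendsto_integral (-coords x)).congr fun L => ?_
    congr 1
    funext v
    rw [neg_neg, ev_mono, echar, ← sum_coords_mul]
    congr 2
    simp only [Pi.smul_apply, smul_eq_mul, mul_left_comm _ (2 * π), ← mul_sum]
    push_cast
    ring
  | ha f g hf hg =>
    rw [map_add]
    refine (hf.add hg).congr fun L => ?_
    rw [← integral_add (integrableOn_cube (hc f) L) (integrableOn_cube (hc g) L)]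
    simp only [map_add, add_mul]
  | hs c f hf =>
    rw [map_smul, smul_eq_mul]
    refine (hf.const_mul c).congr fun L => ?_
    rw [← integral_const_mul]
    simp only [map_smul, smul_eq_mul, mul_assoc]

/-- The integrals over cubes of the integrand of `J_n`, in terms of the quotient of the alternants
of `α` and `β` by that of `ρ`. -/
theorem tendsto_kernelIntegrand (hB : IsSplineKernel B) {α β : Fin n → ℝ} {g : TrigPoly n}
    (hg : IsAlt g) (h : alt (lift (diffs α)) * alt (lift (diffs β)) = g * alt rho) (γ : Fin n → ℝ) :
    Tendsto (fun L : ℝ => ∫ u in Set.Icc (fun _ : Fin (n - 1) => -L) (fun _ => L),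
      kernelIntegrand α β γ u) atTop (𝓝 (((2 * π : ℝ) : ℂ) ^ (n - 1) *
        (I ^ (n * (n - 1) / 2) * ((n.factorial : ℂ) * kernelPairing B (g * mono (-γ)))))) := by
  have hpi : (0 : ℝ) < 2 * π := by positivity
  -- Off the null set where the Vandermonde product vanishes, it cancels against `a_ρ`, which is a
  -- power of `i` times that product times the cardinal sines.
  have h1 : (fun u => kernelIntegrand α β γ u) =ᵐ[volume] fun u =>
      I ^ (n * (n - 1) / 2) * (ev (lift u) (g * inv (alt γ)) * (sincProd u : ℂ)) := by
    filter_upwards [ae_vanderTilde_ne_zero (n := n)] with u hu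
    have hu' : (vanderTilde u : ℂ) ≠ 0 := by exact_mod_cast hu
    rw [kernelIntegrand_eq, map_mul, map_mul, ev_lift_alt u α, ev_lift_alt u β, ← map_mul, h,
      map_mul, ev_lift_alt_rho, map_mul]
    field_simp
  rw [← hB.kernelPairing_mul_inv_alt hg]
  refine Tendsto.congr (fun L => ?_) ((((hB.tendsto_kernelPairing (g * inv (alt γ))).comp
    (tendsto_id.atTop_mul_const (inv_pos.mpr hpi))).const_mul (I ^ (n * (n - 1) / 2))).const_mul
    (((2 * π : ℝ) : ℂ) ^ (n - 1)))
  rw [integral_congr_ae (ae_restrict_of_ae h1), integral_const_mul]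
  have h3 := setIntegral_cube_smul hpi
    (fun u => ev (lift u) (g * inv (alt γ)) * (sincProd u : ℂ)) (L * (2 * π)⁻¹)
  rw [mul_left_comm (2 * π), mul_inv_cancel₀ hpi.ne', mul_one] at h3
  rw [h3]
  simp only [Function.comp_apply, id]
  ring

/-- The kernel `J_n` in terms of the quotient of the alternants of `α` and `β` by that of `ρ`. -/
theorem J_eq (hB : IsSplineKernel B) {α β : Fin n → ℝ} {g : TrigPoly n} (hg : IsAlt g)
    (h : alt (lift (diffs α)) * alt (lift (diffs β)) = g * alt rho) (γ : Fin n → ℝ) :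
    J α β γ = kernelPairing B (g * mono (-γ)) := by
  rw [J, (hB.tendsto_kernelIntegrand hg h γ).limUnder_eq]
  have hf : (n.factorial : ℂ) ≠ 0 := by exact_mod_cast n.factorial_ne_zero
  have hp : (π : ℂ) ≠ 0 := by exact_mod_cast Real.pi_ne_zero
  have hI := Complex.I_ne_zero
  push_cast
  rw [mul_pow]
  field_simp

end IsSplineKernel

/-! ### Homogeneity of the kernel. -/

theorem vanderTilde_smul (c : ℝ) (u : Fin (n - 1) → ℝ) :
    vanderTilde (c • u) = c ^ (n * (n - 1) / 2) * vanderTilde u := by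
  rw [vanderTilde, vanderTilde, ← card_pairs, ← Finset.prod_const, ← prod_mul_distrib]
  simp only [blockSum_smul]

theorem ev_alt_smul (c : ℝ) (t x : Fin n → ℝ) : ev t (alt (c • x)) = ev (c • t) (alt x) := by
  rw [ev_alt, ev_alt]
  simp only [Pi.smul_apply, smul_eq_mul, mul_left_comm, mul_assoc]

theorem kernelIntegrand_smul {c : ℝ} (hc : c ≠ 0) (α β γ : Fin n → ℝ) (u : Fin (n - 1) → ℝ) :
    kernelIntegrand (c • α) (c • β) (c • γ) u =
      (c : ℂ) ^ (n * (n - 1) / 2) * kernelIntegrand α β γ (c • u) := by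
  have hc' : (c : ℂ) ≠ 0 := by exact_mod_cast hc
  rw [kernelIntegrand_eq, kernelIntegrand_eq, vanderTilde_smul]
  simp only [map_mul, ev_inv, ev_alt_smul, smul_neg, map_smul, Complex.ofReal_mul, Complex.ofReal_pow]
  field_simp

/-- Homogeneity of `J_n`. -/
theorem J_smul {c : ℝ} (hc : 0 < c) {α β γ : Fin n → ℝ} {l : ℂ}
    (h : Tendsto (fun L : ℝ => ∫ u in Set.Icc (fun _ : Fin (n - 1) => -L) (fun _ => L),
      kernelIntegrand α β γ u) atTop (𝓝 l)) :
    J (c • α) (c • β) (c • γ) = (c : ℂ) ^ (n * (n - 1) / 2) / (c : ℂ) ^ (n - 1) * J α β γ := by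
  have hc' : (c : ℂ) ≠ 0 := by exact_mod_cast hc.ne'
  have h1 : Tendsto (fun L : ℝ => ∫ u in Set.Icc (fun _ : Fin (n - 1) => -L) (fun _ => L),
      kernelIntegrand (c • α) (c • β) (c • γ) u) atTop
      (𝓝 ((c : ℂ) ^ (n * (n - 1) / 2) / (c : ℂ) ^ (n - 1) * l)) := by
    refine Tendsto.congr (fun L => ?_) ((h.comp (tendsto_id.const_mul_atTop hc)).const_mul _)
    simp only [Function.comp_apply, id, setIntegral_cube_smul hc, kernelIntegrand_smul hc.ne',
      integral_const_mul]
    field_simp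
  rw [J, J, h1.limUnder_eq, h.limUnder_eq]
  ring

end

/-! ### The kernel `J_n` at integral vectors -/

theorem coeff_mul_eq_sum (f h : TrigPoly n) (y : Fin n → ℝ) :
    (f * h).coeff y = f.coeff.sum fun x c => c * h.coeff (y - x) := by
  conv_lhs => rw [eq_sum_mono f]
  rw [Finsupp.sum, sum_mul, coeff_sum, Finsupp.finsetSum_apply, Finsupp.sum]
  refine sum_congr rfl fun x _ => ?_
  rw [smul_mul_assoc, coeff_smul, Finsupp.smul_apply, mul_comm, coeff_mul_mono, smul_eq_mul]

/-- The exponents of `a_ρ` are congruent to `ρ` modulo integral vectors. Hence the parts of `f`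
inside and outside the coset have products with `a_ρ` of disjoint supports, so the second product is
zero, and with it the second part. -/
theorem suppIn_of_mul_alt_rho {f : TrigPoly n} {τ : Fin n → ℝ}
    (hf : SuppIn (traceless n : Set (Fin n → ℝ)) f) (h : SuppIn (cosetLattice τ) (f * alt rho)) :
    SuppIn (cosetLattice (τ + rho)) f := by
  classical
  set f₁ : TrigPoly n := AddMonoidAlgebra.ofCoeff (f.coeff.filter (· ∈ cosetLattice (τ + rho)))
  set f₂ : TrigPoly n := AddMonoidAlgebra.ofCoeff (f.coeff.filter (· ∉ cosetLattice (τ + rho)))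
  have h0 : f₁ + f₂ = f := by
    refine AddMonoidAlgebra.ext ?_
    rw [AddMonoidAlgebra.coeff_add]
    exact Finsupp.filter_add_filter_not _ _
  have hs1 : SuppIn (cosetLattice (τ + rho)) f₁ := fun x hx => by
    by_contra hx'
    exact hx (Finsupp.filter_apply_neg _ _ hx')
  have hs2 : SuppIn {x | x ∈ traceless n ∧ x ∉ cosetLattice (τ + rho)} f₂ := fun x hx => by
    have hx2 : x ∉ cosetLattice (τ + rho) := by
      by_contra hx'
      exact hx (Finsupp.filter_apply_neg _ _ (not_not.mpr hx'))
    refine ⟨hf x fun h => hx ?_, hx2⟩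
    exact (Finsupp.filter_apply_pos (· ∉ cosetLattice (τ + rho)) f.coeff hx2).trans h
  have hr : SuppIn {y : Fin n → ℝ | y ∈ traceless n ∧ ∀ i, ∃ m : ℤ, y i - rho i = m} (alt rho) :=
    suppIn_alt fun w => ⟨comp_mem_traceless traceless_rho w, fun i => rho_sub_int _ _⟩
  have h1 : SuppIn (cosetLattice τ) (f₁ * alt rho) := hs1.mul hr fun a ha b hb =>
    ⟨add_mem ha.1 hb.1, fun i => by
      obtain ⟨k, hk⟩ := ha.2 i
      obtain ⟨l, hl⟩ := hb.2 i
      refine ⟨k + l, ?_⟩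
      push_cast
      rw [← hk, ← hl]
      simp only [Pi.add_apply]
      ring⟩
  have h2 : SuppIn (cosetLattice τ) (f₂ * alt rho) := by
    have : f₂ * alt rho = f * alt rho + (-1 : ℂ) • (f₁ * alt rho) := by
      rw [← h0, add_mul, neg_one_smul]
      abel
    rw [this]
    exact h.add (h1.smul _)
  have h3 : SuppIn (cosetLattice τ)ᶜ (f₂ * alt rho) := hs2.mul hr fun a ha b hb hab => ha.2
    ⟨ha.1, fun i => by
      obtain ⟨k, hk⟩ := hab.2 i
      obtain ⟨l, hl⟩ := hb.2 i
      refine ⟨k - l, ?_⟩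
      push_cast
      rw [← hk, ← hl]
      simp only [Pi.add_apply]
      ring⟩
  have h4 : f₂ * alt rho = 0 := by
    refine AddMonoidAlgebra.ext (Finsupp.ext fun x => ?_)
    by_contra hx
    exact h3 x hx (h2 x hx)
  have h5 : f₂ = 0 := (mul_eq_zero.mp h4).resolve_right (alt_ne_zero (strictAnti_rho (n := n)))
  rwa [← h0, h5, add_zero]

theorem castVec_strictAnti {α : Fin n → ℤ} (hα : StrictAnti α) : StrictAnti (castVec α) :=
  fun _ _ h => Int.cast_lt.mpr (hα h)

theorem exists_shifted_eq_lift {α : Fin n → ℤ} (hα : StrictAnti α) :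
    ∃ κ : Weight n, lift (diffs (castVec α)) = shifted κ := by
  refine exists_eq_shifted ⟨fun j => α ⟨j, by have := j.2; omega⟩ - α ⟨j + 1, by have := j.2; omega⟩,
    ?_⟩ fun i j hij => ?_
  · congr 1
    funext j
    simp [diffs, castVec]
  · simp only [lift_diffs_apply, castVec]
    have := castVec_strictAnti hα hij
    simp only [castVec] at this
    linarith

theorem vander_lift_diffs (x : Fin n → ℝ) : vander (lift (diffs x)) = vander x := by
  simp only [vander, lift_diffs_apply, sub_sub_sub_cancel_right]

theorem coords_lift_diffs_sub (x y : Fin n → ℝ) : coords (lift (diffs x) - y) = coords (x - y) := by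
  have : lift (diffs x) - y = (x - y) - fun _ => (∑ k, x k) / n := by
    rw [lift_diffs_apply]
    funext i
    simp only [Pi.sub_apply]
    ring
  rw [this, map_sub, coords_const, sub_zero]

theorem two_rho_int (i : Fin n) : ∃ m : ℤ, 2 * rho i = m :=
  ⟨n - 1 - 2 * i, by rw [rho_apply]; push_cast; ring⟩

/-- The tensor product of the representations with shifted highest weights `α` and `β`, as a
trigonometric polynomial times the alternant of `ρ`. -/
theorem exists_quotient (hn : n ≠ 0) {α β : Fin n → ℤ} (hα : StrictAnti α) (hβ : StrictAnti β) :
    ∃ κ μ : Weight n, lift (diffs (castVec α)) = shifted κ ∧ lift (diffs (castVec β)) = shifted μ ∧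
      alt (lift (diffs (castVec α))) * alt (lift (diffs (castVec β))) =
        schur hn κ * schur hn μ * alt rho * alt rho ∧
      SuppIn (cosetLattice ((fun _ => (∑ k, (castVec α k + castVec β k)) / n) + rho))
        (schur hn κ * schur hn μ * alt rho) := by
  obtain ⟨κ, hκ⟩ := exists_shifted_eq_lift hα
  obtain ⟨μ, hμ⟩ := exists_shifted_eq_lift hβ
  have h1 : alt (lift (diffs (castVec α))) * alt (lift (diffs (castVec β))) =
      schur hn κ * schur hn μ * alt rho * alt rho := by
    rw [hκ, hμ, ← isSchurFamily_schur hn, ← isSchurFamily_schur hn]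
    ring
  refine ⟨κ, μ, hκ, hμ, h1, suppIn_of_mul_alt_rho ?_ ?_⟩
  · refine SuppIn.mono (B := traceless n) (((suppIn_schur hn κ).mul (suppIn_schur hn μ)
      fun a ha b hb => add_mem ha hb).mul (suppIn_alt fun w => comp_mem_weightLattice rho_mem w)
      fun a ha b hb => add_mem ha hb) (weightLattice_le_traceless n)
  · rw [← h1]
    have h2 : ∀ γ : Fin n → ℤ, SuppIn {x : Fin n → ℝ | x ∈ traceless n ∧ ∀ i, ∃ m : ℤ,
        x i + (∑ k, castVec γ k) / n = m} (alt (lift (diffs (castVec γ)))) := fun γ =>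
      suppIn_alt fun w => ⟨comp_mem_traceless (lift_mem_traceless _) w, fun i => ⟨γ (w i), by
        simp [lift_diffs_apply, castVec]⟩⟩
    refine (h2 α).mul (h2 β) fun a ha b hb => ⟨add_mem ha.1 hb.1, fun i => ?_⟩
    obtain ⟨k, hk⟩ := ha.2 i
    obtain ⟨l, hl⟩ := hb.2 i
    refine ⟨k + l, ?_⟩
    push_cast
    rw [← hk, ← hl, sum_add_distrib, Pi.add_apply]
    ring

theorem isAlt_schur_mul (hn : n ≠ 0) (κ μ : Weight n) : IsAlt (schur hn κ * schur hn μ * alt rho) :=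
  (((isSchurFamily_schur hn).isSymm κ).mul ((isSchurFamily_schur hn).isSymm μ)).mul_isAlt
    (isAlt_alt rho)

/-- The polynomial is `χ_κ χ_μ R̂_n`, with `R̂_n` in the form `kernelPoly B rho`. For integral `γ`
the differences `γ - x` between `γ` and the exponents of `χ_κ χ_μ a_ρ` have traceless parts in the
coset where `B` gives the coefficients of that kernel polynomial, so the convolution defining `J_n`
is a coefficient of a product. -/
theorem exists_symm_J_eq (hn : n ≠ 0) {B : (Fin (n - 1) → ℝ) → ℝ} (hB : IsSplineKernel B)
    {α β : Fin n → ℤ} (hα : StrictAnti α) (hβ : StrictAnti β) :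
    ∃ f : TrigPoly n, IsSymm f ∧ SuppIn (weightLattice n : Set (Fin n → ℝ)) f ∧
      ev 0 f = ((vander (castVec α) * vander (castVec β) / vander (rho : Fin n → ℝ) ^ 2 : ℝ) : ℂ) ∧
      SuppIn (cosetLattice fun _ => (∑ k, (castVec α k + castVec β k)) / n) (f * alt rho) ∧
      ∀ γ : Fin n → ℤ, ∑ k, castVec γ k = ∑ k, (castVec α k + castVec β k) →
        J (castVec α) (castVec β) (castVec γ) = (f * alt rho).coeff (lift (diffs (castVec γ))) := by
  obtain ⟨κ, μ, hκ, hμ, h1, h2⟩ := exists_quotient hn hα hβ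
  have hS := isSchurFamily_schur hn
  have hcomm : schur hn κ * schur hn μ * kernelPoly B rho * alt rho =
      schur hn κ * schur hn μ * alt rho * kernelPoly B rho := by ring
  refine ⟨schur hn κ * schur hn μ * kernelPoly B rho, ((hS.isSymm κ).mul (hS.isSymm μ)).mul
    (hB.isSymm_kernelPoly traceless_rho rho_sub_int), ((suppIn_schur hn κ).mul (suppIn_schur hn μ)
      fun a ha b hb => add_mem ha hb).mul (suppIn_weightLattice_kernelPoly hB traceless_rho rho_sub_int)
      fun a ha b hb => add_mem ha hb, ?_, ?_, fun γ hγ => ?_⟩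
  · rw [map_mul, map_mul, ← dimV_eq_ev, ← dimV_eq_ev, hB.ev_zero_kernelPoly (Or.inr rfl), mul_one,
      ← vander_lift_diffs (castVec α), ← vander_lift_diffs (castVec β), hκ, hμ]
    have h3 := dimV_eq_vander hn κ
    have h4 := dimV_eq_vander hn μ
    have h5 : (dimV κ : ℝ) * dimV μ = vander (shifted κ) * vander (shifted μ) /
        vander (rho : Fin n → ℝ) ^ 2 := by
      rw [h3, h4, div_mul_div_comm, sq]
    exact_mod_cast congrArg Complex.ofReal h5
  · rw [hcomm]
    refine h2.mul (hB.suppIn_kernelPoly traceless_rho) fun a ha b hb => ⟨add_mem ha.1 hb.1, fun i => ?_⟩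
    obtain ⟨k, hk⟩ := ha.2 i
    obtain ⟨l, hl⟩ := hb.2 i
    obtain ⟨m, hm⟩ := two_rho_int i
    refine ⟨k + l - m, ?_⟩
    push_cast
    rw [← hk, ← hl, ← hm]
    simp only [Pi.add_apply]
    ring
  · rw [hB.J_eq (isAlt_schur_mul hn κ μ) h1, kernelPairing_mul_mono, hcomm, coeff_mul_eq_sum,
      Finsupp.sum, Finsupp.sum]
    refine sum_congr rfl fun x hx => ?_
    have hx' := h2 x (Finsupp.mem_support_iff.mp hx)
    rw [hB.coeff_kernelPoly traceless_rho ⟨sub_mem (lift_mem_traceless _) hx'.1, fun i => ?_⟩,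
      coords_lift_diffs_sub]
    obtain ⟨k, hk⟩ := hx'.2 i
    obtain ⟨m, hm⟩ := two_rho_int i
    refine ⟨γ i - k + m, ?_⟩
    push_cast
    rw [← hk, ← hm, lift_diffs_apply, hγ]
    simp only [Pi.add_apply, Pi.sub_apply, castVec]
    ring

/-! ### The lattice sum over ordered vectors. -/

theorem sum_complete (hn : n ≠ 0) (α β : Fin n → ℝ) (g : Fin (n - 1) → ℝ) :
    ∑ k, complete α β g k = ∑ k, (α k + β k) := by
  obtain ⟨m, rfl⟩ : ∃ m, n = m + 1 := ⟨n - 1, by omega⟩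
  rw [Fin.sum_univ_castSucc]
  simp [complete]

theorem exists_complete_eq (α β : Fin n → ℤ) (m : Fin (n - 1) → ℤ) : ∃ γ : Fin n → ℤ,
    complete (castVec α) (castVec β) (castVec m) = castVec γ := by
  refine ⟨fun i => if h : (i : ℕ) < n - 1 then m ⟨i, h⟩ else ∑ k, (α k + β k) - ∑ j, m j, ?_⟩
  funext i
  simp only [complete, castVec]
  split_ifs <;> push_cast <;> rfl

theorem complete_eq_of_sum (hn : n ≠ 0) {α β γ : Fin n → ℝ} (h : ∑ k, γ k = ∑ k, (α k + β k)) :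
    complete α β (fun j => γ ⟨j, by have := j.2; omega⟩) = γ := by
  obtain ⟨m, rfl⟩ : ∃ m, n = m + 1 := ⟨n - 1, by omega⟩
  rw [Fin.sum_univ_castSucc] at h
  funext i
  rcases Fin.eq_castSucc_or_eq_last i with ⟨j, rfl⟩ | rfl
  · simp only [complete, Fin.val_castSucc, Nat.add_sub_cancel, j.2, dite_true]
    rfl
  · simp only [complete, Fin.val_last, Nat.add_sub_cancel, lt_irrefl, dite_false, ← h]
    exact add_sub_cancel_left _ _

/-- The chamber of ordered vectors, described by the first `n - 1` coordinates. -/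
def chamber (α β : Fin n → ℝ) : Set (Fin (n - 1) → ℝ) := {g | Antitone (complete α β g)}

/-- Antisymmetry kills the `γ` with repeated coordinates, so the nonzero terms correspond to
dominant `ν`, with `ν + ρ` the traceless part of `γ`. A term is a coefficient times `dim V_ν` times
`Δ(ρ) / (Δ(α) Δ(β))`. The sum of coefficients times dimensions is the value at the identity, `Δ(α)
Δ(β) / Δ(ρ)²`, and `1 / Δ(ρ)` remains. -/
theorem finsum_chamber (hn : n ≠ 0) {B : (Fin (n - 1) → ℝ) → ℝ} (hB : IsSplineKernel B)
    {α β : Fin n → ℤ} (hα : StrictAnti α) (hβ : StrictAnti β) :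
    ∑ᶠ (m : Fin (n - 1) → ℤ) (_ : castVec m ∈ chamber (castVec α) (castVec β)),
      density (castVec α) (castVec β) (castVec m) = ((Nat.superFactorial (n - 1) : ℕ) : ℂ)⁻¹ := by
  obtain ⟨f, hf, hs, h0, hsupp, hJ⟩ := exists_symm_J_eq hn hB hα hβ
  set c := (∑ k, (castVec α k + castVec β k)) / n with hc
  have hvr := (vander_pos (strictAnti_rho (n := n))).ne'
  have hva : vander (castVec α) ≠ 0 := (vander_pos (castVec_strictAnti hα)).ne'
  have hvb : vander (castVec β) ≠ 0 := (vander_pos (castVec_strictAnti hβ)).ne'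
  have key := sum_altCoeffs_dimV hn hf hs
  -- For the relevant `ν` these numbers are already integers; rounding only makes the map total.
  set e : Weight n → Fin (n - 1) → ℤ := fun ν j =>
    round (shifted ν ⟨j, by have := j.2; omega⟩ + c) with he
  have hcomp : ∀ ν : Weight n, (f * alt rho).coeff (shifted ν) ≠ 0 →
      complete (castVec α) (castVec β) (castVec (e ν)) = fun i => shifted ν i + c := by
    intro ν hν
    have h1 := hsupp _ hν
    have h2 : castVec (e ν) = fun j : Fin (n - 1) => shifted ν ⟨j, by have := j.2; omega⟩ + c := by
      funext j
      obtain ⟨m, hm⟩ := h1.2 ⟨j, by have := j.2; omega⟩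
      simp only [castVec, he]
      rw [hm, round_intCast]
    rw [h2]
    refine complete_eq_of_sum (γ := fun i => shifted ν i + c) hn ?_
    rw [sum_add_distrib, mem_traceless.mp h1.1, sum_const, card_univ,
      Fintype.card_fin, hc, nsmul_eq_mul, mul_div_cancel₀ _ (by exact_mod_cast hn), zero_add]
  have hld : ∀ ν : Weight n, lift (diffs fun i => shifted ν i + c) = shifted ν := fun ν => by
    conv_rhs => rw [← lift_diffs (weightLattice_le_traceless n (shifted_mem ν))]
    exact congrArg lift (funext fun j => add_sub_add_right_eq_sub ..)
  have hint : ∀ ν : Weight n, (f * alt rho).coeff (shifted ν) ≠ 0 →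
      J (castVec α) (castVec β) (complete (castVec α) (castVec β) (castVec (e ν))) =
        (f * alt rho).coeff (shifted ν) := fun ν hν => by
    obtain ⟨γ, hγ⟩ := exists_complete_eq α β (e ν)
    rw [hγ, hJ γ (by rw [← hγ, sum_complete hn]), ← hγ, hcomp ν hν, hld]
  have hbij : Set.BijOn e {ν | (f * alt rho).coeff (shifted ν) ≠ 0}
      ({m | castVec m ∈ chamber (castVec α) (castVec β)} ∩
        Function.support fun m => density (castVec α) (castVec β) (castVec m)) := by
    refine ⟨fun ν hν => ⟨?_, ?_⟩, fun ν hν ν' hν' h => ?_, fun m hm => ?_⟩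
    · rw [Set.mem_ofPred_eq, chamber, Set.mem_ofPred_eq, hcomp ν hν]
      exact (strictAnti_shifted ν).antitone.add_const c
    · rw [Function.mem_support, density, hint ν hν]
      refine mul_ne_zero hν ?_
      rw [hcomp ν hν, ← vander_lift_diffs, hld]
      exact_mod_cast div_ne_zero (vander_pos (strictAnti_shifted ν)).ne' (mul_ne_zero hva hvb)
    · have h1 := hcomp ν hν
      rw [h, hcomp ν' hν'] at h1
      refine shifted_injective (funext fun i => ?_)
      simpa using (congrFun h1 i).symm
    · obtain ⟨γ, hγ⟩ := exists_complete_eq α β m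
      have hγs : ∑ k, castVec γ k = ∑ k, (castVec α k + castVec β k) := by rw [← hγ, sum_complete hn]
      have h1 : (f * alt rho).coeff (lift (diffs (castVec γ))) ≠ 0 := by
        rw [← hJ γ hγs, ← hγ]
        exact left_ne_zero_of_mul hm.2
      have h2 : Antitone (castVec γ) := hγ ▸ hm.1
      have h3 : Injective (lift (diffs (castVec γ))) := by
        by_contra h
        exact h1 ((hf.mul_isAlt (isAlt_alt rho)).coeff_eq_zero h)
      have h4 : StrictAnti (lift (diffs (castVec γ))) := by
        refine Antitone.strictAnti_of_injective (fun i j hij => ?_) h3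
        simp only [lift_diffs_apply]
        exact sub_le_sub_right (h2 hij) _
      obtain ⟨ν, hν⟩ := exists_eq_shifted (hs.mul (C := (weightLattice n : Set (Fin n → ℝ)))
        (suppIn_alt fun w => comp_mem_weightLattice rho_mem w) (fun a ha b hb => add_mem ha hb) _ h1) h4
      rw [hν] at h1
      refine ⟨ν, h1, ?_⟩
      funext j
      have h5 : castVec m j = castVec γ ⟨j, by have := j.2; omega⟩ := by rw [← hγ]; simp [complete]
      have h6 : (m j : ℝ) = shifted ν ⟨j, by have := j.2; omega⟩ + c := by
        rw [show (m j : ℝ) = castVec m j from rfl, h5, ← hν, lift_diffs_apply, hγs]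
        simp [hc]
      simp only [he]
      rw [← h6, round_intCast]
  set S : Set (Weight n) := {ν | (f * alt rho).coeff (shifted ν) ≠ 0}
  set F : Weight n → ℂ := fun ν => (f * alt rho).coeff (shifted ν) * (dimV ν : ℂ) *
    ((vander (rho : Fin n → ℝ) / (vander (castVec α) * vander (castVec β)) : ℝ) : ℂ)
  have h1 : ∑ᶠ ν ∈ S, F ν = ∑ᶠ (m : Fin (n - 1) → ℤ) (_ : castVec m ∈ chamber (castVec α) (castVec β)),
      density (castVec α) (castVec β) (castVec m) := by
    refine (finsum_mem_eq_of_bijOn e hbij fun ν hν => ?_).trans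
      (finsum_mem_inter_support _ {m | castVec m ∈ chamber (castVec α) (castVec β)})
    rw [density, hint ν hν, hcomp ν hν, ← vander_lift_diffs, hld]
    simp only [F]
    rw [mul_assoc]
    congr 1
    have h2 : (dimV ν : ℝ) * (vander (rho : Fin n → ℝ) / (vander (castVec α) * vander (castVec β))) =
        vander (shifted ν) / (vander (castVec α) * vander (castVec β)) := by
      rw [dimV_eq_vander hn, div_mul_div_cancel₀ hvr]
    exact_mod_cast congrArg Complex.ofReal h2
  have h3 : ∑ᶠ ν ∈ S, F ν = ∑ᶠ ν, F ν := by
    rw [finsum_mem_inter_support_eq' F S Set.univ fun ν h => ?_, finsum_mem_univ]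
    exact ⟨fun _ => trivial, fun _ => left_ne_zero_of_mul (left_ne_zero_of_mul h)⟩
  rw [← h1, h3, ← finsum_mul, key, h0, ← Complex.ofReal_mul,
    div_mul_div_comm, mul_comm (vander _ ^ 2), sq, ← mul_assoc, mul_div_mul_right _ _ hvr,
    div_mul_cancel_left₀ (mul_ne_zero hva hvb),
    vander_rho (Nat.pos_of_ne_zero hn)]
  push_cast
  rfl

/-! ### Covariant functions attached to intertwiners -/

/-- Evaluation at a matrix of the polynomial representing a vector. -/
def evalRep (hn : n ≠ 0) (l : Fin n → ℕ) (A : Matrix (Fin n) (Fin n) ℂ) :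
    irrepSpace (dynkin l) →ₗ[ℂ] ℂ :=
  (evalM A).toLinearMap ∘ₗ (polyRep l).subtype ∘ₗ (polyRepEquiv hn l).symm.toLinearMap

theorem evalRep_equiv (hn : n ≠ 0) (l : Fin n → ℕ) (A : Matrix (Fin n) (Fin n) ℂ) (f : polyRep l) :
    evalRep hn l A (polyRepEquiv hn l f) = evalM A f.1 :=
  congrArg (fun f : polyRep l => evalM A f.1) ((polyRepEquiv hn l).symm_apply_apply f)

theorem evalRep_irrep (hn : n ≠ 0) (l : Fin n → ℕ) (A : Matrix (Fin n) (Fin n) ℂ) (x : SU n)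
    (v : irrepSpace (dynkin l)) : evalRep hn l A (irrep (dynkin l) x v) = evalRep hn l (A * x.1) v := by
  obtain ⟨f, rfl⟩ := (polyRepEquiv hn l).surjective v
  rw [← polyRepEquiv_rtransOn, evalRep_equiv, evalRep_equiv, coe_rtransOn, evalM_rtrans]

theorem evalRep_lower (hn : n ≠ 0) (l : Fin n → ℕ) {b : Matrix (Fin n) (Fin n) ℂ}
    (hb : ∀ i j, i < j → b i j = 0) (A : Matrix (Fin n) (Fin n) ℂ) (v : irrepSpace (dynkin l)) :
    evalRep hn l (b * A) v = (∏ j, b j j ^ part l j) * evalRep hn l A v := by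
  obtain ⟨f, rfl⟩ := (polyRepEquiv hn l).surjective v
  rw [evalRep_equiv, evalRep_equiv]
  obtain ⟨a, ha⟩ := exists_eq_sum (polyRep_le l f.2)
  rw [ha, map_sum, map_sum, mul_sum]
  refine sum_congr rfl fun φ _ => ?_
  rw [map_smul, map_smul, evalM_lower_mul hb, mul_smul_comm]

theorem evalRep_eq_zero (hn : n ≠ 0) (l : Fin n → ℕ) {v : irrepSpace (dynkin l)}
    (h : ∀ x : SU n, evalRep hn l x.1 v = 0) : v = 0 := by
  obtain ⟨f, rfl⟩ := (polyRepEquiv hn l).surjective v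
  simp only [evalRep_equiv] at h
  have h1 : f = 0 :=
    Subtype.ext (eq_zero_of_evalM_SU hn (minorSpace_isHomogeneous (polyRep_le l f.2)) h)
  rw [h1, map_zero]

theorem evalRep_eq_evalM (hn : n ≠ 0) (l : Fin n → ℕ) (A : Matrix (Fin n) (Fin n) ℂ)
    (v : irrepSpace (dynkin l)) : ∃ q : MPoly n, q.IsHomogeneous (labelDeg l) ∧
      ∀ x, evalRep hn l (A * x) v = evalM x q := by
  obtain ⟨f, rfl⟩ := (polyRepEquiv hn l).surjective v
  refine ⟨MvPolynomial.aeval (fun q : Fin n × Fin n => ∑ k, MvPolynomial.C (A q.1 k) *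
    MvPolynomial.X (k, q.2)) f.1, ?_, fun x => ?_⟩
  · rw [← one_mul (labelDeg l)]
    refine (minorSpace_isHomogeneous (polyRep_le l f.2)).aeval _ fun q =>
      MvPolynomial.IsHomogeneous.sum _ _ _ fun k _ => ?_
    simpa using (MvPolynomial.isHomogeneous_C (Fin n × Fin n) (A q.1 k)).mul
      (MvPolynomial.isHomogeneous_X ℂ (k, q.2))
  · rw [evalRep_equiv]
    refine DFunLike.congr_fun (MvPolynomial.algHom_ext (A := ℂ) (f := evalM (A * x))
      (g := (evalM x).comp (MvPolynomial.aeval _)) fun q => ?_) f.1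
    rw [evalM_X, AlgHom.comp_apply, MvPolynomial.aeval_X, map_sum, Matrix.mul_apply]
    refine sum_congr rfl fun k _ => ?_
    rw [map_mul, evalM_X, ← MvPolynomial.algebraMap_eq, AlgHom.commutes]
    rfl

/-- Evaluation of a tensor at a pair of matrices. -/
def evalPair (hn : n ≠ 0) (l m : Fin n → ℕ) (A B : Matrix (Fin n) (Fin n) ℂ) :
    TensorProduct ℂ (irrepSpace (dynkin l)) (irrepSpace (dynkin m)) →ₗ[ℂ] ℂ :=
  TensorProduct.lift ((LinearMap.mul ℂ ℂ).compl₁₂ (evalRep hn l A) (evalRep hn m B))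

theorem evalPair_tmul (hn : n ≠ 0) (l m : Fin n → ℕ) (A B : Matrix (Fin n) (Fin n) ℂ)
    (v : irrepSpace (dynkin l)) (w : irrepSpace (dynkin m)) :
    evalPair hn l m A B (TensorProduct.tmul ℂ v w) = evalRep hn l A v * evalRep hn m B w := by
  rw [evalPair, TensorProduct.lift.tmul]
  rfl

theorem evalPair_lower (hn : n ≠ 0) (l m : Fin n → ℕ) {b c : Matrix (Fin n) (Fin n) ℂ}
    (hb : ∀ i j, i < j → b i j = 0) (hc : ∀ i j, i < j → c i j = 0) (A B : Matrix (Fin n) (Fin n) ℂ)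
    (t : TensorProduct ℂ (irrepSpace (dynkin l)) (irrepSpace (dynkin m))) :
    evalPair hn l m (b * A) (c * B) t =
      (∏ j, b j j ^ part l j) * (∏ j, c j j ^ part m j) * evalPair hn l m A B t := by
  induction t using TensorProduct.induction_on with
  | zero => simp only [map_zero, mul_zero]
  | tmul v w =>
    rw [evalPair_tmul, evalPair_tmul, evalRep_lower hn l hb, evalRep_lower hn m hc]
    ring
  | add s t hs ht => rw [map_add, map_add, hs, ht, mul_add]

theorem evalPair_tprod (hn : n ≠ 0) (l m : Fin n → ℕ) (A B : Matrix (Fin n) (Fin n) ℂ) (x : SU n)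
    (t : TensorProduct ℂ (irrepSpace (dynkin l)) (irrepSpace (dynkin m))) :
    evalPair hn l m A B ((irrep (dynkin l)).tprod (irrep (dynkin m)) x t) =
      evalPair hn l m (A * x.1) (B * x.1) t := by
  induction t using TensorProduct.induction_on with
  | zero => simp only [map_zero]
  | tmul v w =>
    rw [Representation.tprod_apply, TensorProduct.map_tmul, evalPair_tmul, evalPair_tmul,
      evalRep_irrep, evalRep_irrep]
  | add s t hs ht => rw [map_add, map_add, map_add, hs, ht]

theorem evalPair_eq_evalM (hn : n ≠ 0) (l m : Fin n → ℕ) (A B : Matrix (Fin n) (Fin n) ℂ)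
    (t : TensorProduct ℂ (irrepSpace (dynkin l)) (irrepSpace (dynkin m))) :
    ∃ q : MPoly n, q.IsHomogeneous (labelDeg l + labelDeg m) ∧
      ∀ x, evalPair hn l m (A * x) (B * x) t = evalM x q := by
  induction t using TensorProduct.induction_on with
  | zero => exact ⟨0, MvPolynomial.isHomogeneous_zero _ _ _, fun x => by simp only [map_zero]⟩
  | tmul v w =>
    obtain ⟨p, hp, hp'⟩ := evalRep_eq_evalM hn l A v
    obtain ⟨q, hq, hq'⟩ := evalRep_eq_evalM hn m B w
    exact ⟨p * q, hp.mul hq, fun x => by rw [evalPair_tmul, hp', hq', map_mul]⟩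
  | add s t hs ht =>
    obtain ⟨p, hp, hp'⟩ := hs
    obtain ⟨q, hq, hq'⟩ := ht
    exact ⟨p + q, hp.add hq, fun x => by rw [map_add, hp', hq', map_add]⟩

theorem evalPair_eq_zero (hn : n ≠ 0) (l m : Fin n → ℕ)
    {t : TensorProduct ℂ (irrepSpace (dynkin l)) (irrepSpace (dynkin m))}
    (h : ∀ x y : SU n, evalPair hn l m x.1 y.1 t = 0) : t = 0 := by
  have := finiteDimensional_irrepSpace hn (dynkin m)
  obtain ⟨c, rfl⟩ := TensorProduct.eq_repr_basis_right (Module.finBasis ℂ (irrepSpace (dynkin m))) t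
  set b := Module.finBasis ℂ (irrepSpace (dynkin m))
  have h1 : ∀ (x : SU n) i, evalRep hn l x.1 (c i) = 0 := by
    intro x
    have h2 : ∑ i, evalRep hn l x.1 (c i) • b i = 0 := evalRep_eq_zero hn m fun y => by
      have h3 := h x y
      have h5 : (c.sum fun i v => TensorProduct.tmul ℂ v (b i)) = ∑ i, TensorProduct.tmul ℂ (c i) (b i) :=
        Finsupp.sum_fintype _ _ fun i => TensorProduct.zero_tmul _ _
      rw [h5, map_sum] at h3
      simpa only [evalPair_tmul, map_sum, map_smul, smul_eq_mul] using h3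
    exact Fintype.linearIndependent_iff.mp b.linearIndependent _ h2
  have h4 : c = 0 := Finsupp.ext fun i => evalRep_eq_zero hn l fun x => h1 x i
  rw [h4, Finsupp.sum_zero_index]

/-- An intertwiner that kills the highest weight vector kills its translates, which span. -/
theorem exists_intertwiner (hn : n ≠ 0) {l m p : Fin n → ℕ}
    (h : lrCoeff (dynkin l) (dynkin m) (dynkin p) ≠ 0) :
    ∃ (F : polyRep p) (K : polyRep p →ₗ[ℂ] TensorProduct ℂ (irrepSpace (dynkin l)) (irrepSpace (dynkin m))),
      F.1 = hwv p ∧ K F ≠ 0 ∧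
      ∀ (x : SU n) f, K (rtransOn hn p x.1 f) = (irrep (dynkin l)).tprod (irrep (dynkin m)) x (K f) := by
  have hT : ∃ T : Representation.IntertwiningMap (irrep (dynkin p))
      ((irrep (dynkin l)).tprod (irrep (dynkin m))), T ≠ 0 := by
    by_contra! hT
    have : Subsingleton (Representation.IntertwiningMap (irrep (dynkin p))
      ((irrep (dynkin l)).tprod (irrep (dynkin m)))) := ⟨fun a b => by rw [hT a, hT b]⟩
    exact h (Module.finrank_zero_of_subsingleton)
  obtain ⟨T, hT⟩ := hT
  set F : polyRep p := ⟨hwv p, Submodule.subset_span ⟨1, rtrans_one _⟩⟩ with hF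
  set K : polyRep p →ₗ[ℂ] TensorProduct ℂ (irrepSpace (dynkin l)) (irrepSpace (dynkin m)) :=
    T.toLinearMap ∘ₗ (polyRepEquiv hn p).toLinearMap with hK
  have hKx : ∀ (x : SU n) f, K (rtransOn hn p x.1 f) =
      (irrep (dynkin l)).tprod (irrep (dynkin m)) x (K f) := fun x f => by
    change T (polyRepEquiv hn p (rtransOn hn p x.1 f)) = _
    rw [polyRepEquiv_rtransOn, T.isIntertwining]
    rfl
  refine ⟨F, K, rfl, fun h0 => hT ?_, hKx⟩
  have h1 : polyRep p ≤ K.ker.map (polyRep p).subtype := by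
    refine Submodule.span_le.mpr ?_
    rintro _ ⟨x, rfl⟩
    exact ⟨rtransOn hn p x.1 F, LinearMap.mem_ker.mpr (by rw [hKx, h0, map_zero]), rfl⟩
  refine Representation.IntertwiningMap.ext (LinearMap.ext fun v => ?_)
  obtain ⟨f, rfl⟩ := (polyRepEquiv hn p).surjective v
  obtain ⟨g, hg, hgf⟩ := h1 f.2
  rw [← Subtype.ext hgf]
  exact hg

/-- A nonzero intertwiner gives a function of two matrices with prescribed covariance. -/
theorem exists_covariant (hn : n ≠ 0) {l m p : Fin n → ℕ} (hdeg : labelDeg p = labelDeg l + labelDeg m)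
    (h : lrCoeff (dynkin l) (dynkin m) (dynkin p) ≠ 0) :
    ∃ t : TensorProduct ℂ (irrepSpace (dynkin l)) (irrepSpace (dynkin m)), t ≠ 0 ∧
      ∀ x : Matrix (Fin n) (Fin n) ℂ, (∀ i j, j < i → x i j = 0) → ∀ A B,
        evalPair hn l m (A * x) (B * x) t = (∏ j, x j j ^ part p j) * evalPair hn l m A B t := by
  obtain ⟨F, K, hF, h0, hK⟩ := exists_intertwiner hn h
  refine ⟨K F, h0, fun x hx A B => ?_⟩
  set L : polyRep p →ₗ[ℂ] ℂ := evalPair hn l m A B ∘ₗ K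
  obtain ⟨L', hL'⟩ := LinearMap.exists_extend L
  obtain ⟨q₁, hq₁, hx₁⟩ := rtrans_eq_sum (polyRep_le p F.2)
  obtain ⟨q₂, hq₂, hx₂⟩ := evalPair_eq_evalM hn l m A B (K F)
  have h2 : ∀ y, L (rtransOn hn p y F) = evalM y (∑ ψ, L' (prodMinor ψ) • q₁ ψ) := fun y => by
    refine (LinearMap.congr_fun hL' (rtransOn hn p y F)).symm.trans ?_
    change L' (rtrans y F.1) = _
    rw [hx₁, map_sum, map_sum]
    refine sum_congr rfl fun ψ _ => ?_
    rw [map_smul, map_smul, smul_eq_mul, smul_eq_mul, mul_comm]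
  -- Both sides are polynomials of the same degree, by `hdeg`, that agree on `SU(n)`. So the
  -- intertwining relation extends to all matrices, in particular to upper triangular ones, which
  -- act on the highest weight vector by a scalar.
  have h3 : (∑ ψ, L' (prodMinor ψ) • q₁ ψ) - q₂ = 0 := by
    refine eq_zero_of_evalM_SU hn ((isHomogeneous_sum_smul _ hq₁).sub (hdeg ▸ hq₂)) fun y => ?_
    rw [map_sub, ← h2, ← hx₂, sub_eq_zero, ← evalPair_tprod, ← hK]
    rfl
  have h4 : rtransOn hn p x F = (∏ j, x j j ^ part p j) • F := Subtype.ext (by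
    rw [coe_rtransOn, hF, rtrans_upper_hwv hx, ← hF]
    rfl)
  rw [hx₂, ← sub_eq_zero.mp h3, ← h2, h4, map_smul, smul_eq_mul]
  rfl

/-- The degrees of the factors and of a constituent of a tensor product agree modulo `n`. -/
theorem labelDeg_dvd (hn : n ≠ 0) {l m p : Fin n → ℕ}
    (h : lrCoeff (dynkin l) (dynkin m) (dynkin p) ≠ 0) :
    (n : ℤ) ∣ labelDeg p - (labelDeg l + labelDeg m : ℕ) := by
  obtain ⟨F, K, hF, h0, hK⟩ := exists_intertwiner hn h
  have hζ := Complex.isPrimitiveRoot_exp n hn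
  -- The central element `ζ` of `SU(n)` acts by `ζ` to the power of the degree on either side of the
  -- intertwiner.
  set ζ := exp (2 * π * I / n)
  have hz : star ζ * ζ = 1 := by
    rw [mul_comm, Complex.star_def, Complex.mul_conj, Complex.normSq_eq_norm_sq, hζ.norm'_eq_one hn]
    simp
  have hu : (ζ • 1 : Matrix (Fin n) (Fin n) ℂ) ∈ Matrix.specialUnitaryGroup (Fin n) ℂ := by
    rw [mem_specialUnitaryGroup_iff, mem_unitaryGroup_iff']
    constructor
    · rw [star_smul, star_one, smul_mul_smul_comm, hz, one_mul, one_smul]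
    · rw [Matrix.det_smul, Matrix.det_one, mul_one, Fintype.card_fin, hζ.pow_eq_one]
  have h1 : ∃ x y : SU n, evalPair hn l m x.1 y.1 (K F) ≠ 0 := by
    by_contra! h1
    exact h0 (evalPair_eq_zero hn l m h1)
  obtain ⟨A, B, hAB⟩ := h1
  obtain ⟨q, hq, hq'⟩ := evalPair_eq_evalM hn l m A.1 B.1 (K F)
  have h2 : rtransOn hn p (ζ • 1) F = ζ ^ labelDeg p • F := Subtype.ext (mpoly_ext fun g => by
    rw [coe_rtransOn, evalM_rtrans, mul_smul_comm, mul_one,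
      evalM_smul (minorSpace_isHomogeneous (polyRep_le p F.2))]
    exact (map_smul (evalM g) _ _).symm)
  have h3 := congrArg (evalPair hn l m A.1 B.1) (hK ⟨_, hu⟩ F)
  rw [evalPair_tprod, hq', evalM_smul hq, ← hq', mul_one, mul_one, h2, map_smul, map_smul,
    smul_eq_mul] at h3
  have h4 := mul_right_cancel₀ hAB h3
  rw [← hζ.zpow_eq_one_iff_dvd, zpow_sub₀ (hζ.ne_zero hn), zpow_natCast, zpow_natCast, h4,
    div_self (pow_ne_zero _ (hζ.ne_zero hn))]

section

/-! ### Spectra of sums from tensor products -/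

/-- Gram–Schmidt: the LDL decomposition of `g gᴴ`, with square roots of its positive diagonal, makes
`g` unitary, and a scalar of modulus one corrects the determinant. -/
theorem exists_lower_mul_mem_SU (hn : n ≠ 0) {g : Matrix (Fin n) (Fin n) ℂ} (hg : g.det ≠ 0) :
    ∃ a : Matrix (Fin n) (Fin n) ℂ, (∀ i j, i < j → a i j = 0) ∧
      a * g ∈ Matrix.specialUnitaryGroup (Fin n) ℂ := by
  have hS : (g * gᴴ).PosDef := Matrix.PosDef.mul_conjTranspose_self g
    (Matrix.vecMul_injective_iff_isUnit.mpr ((Matrix.isUnit_iff_isUnit_det g).mpr hg.isUnit))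
  set L := LDL.lowerInv hS
  have hD : LDL.diag hS = L * (g * gᴴ) * Lᴴ := LDL.diag_eq_lowerInv_conj hS
  have hL : IsUnit L := isUnit_of_invertible L
  have hP : (LDL.diag hS).PosDef := by
    rw [hD]
    exact hS.mul_mul_conjTranspose_same (Matrix.vecMul_injective_iff_isUnit.mpr hL)
  have hd : ∀ i, ∃ r : ℝ, 0 < r ∧ LDL.diagEntries hS i = (r : ℂ) ^ 2 := fun i => by
    have h1 := hP.diag_pos (i := i)
    rw [LDL.diag, Matrix.diagonal_apply_eq, Complex.lt_def] at h1
    refine ⟨√(LDL.diagEntries hS i).re, Real.sqrt_pos.mpr h1.1, ?_⟩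
    rw [← Complex.ofReal_pow, Real.sq_sqrt h1.1.le]
    exact Complex.ext rfl h1.2.symm
  choose r hr0 hr using hd
  have hr' : ∀ i, (r i : ℂ) ≠ 0 := fun i => by exact_mod_cast (hr0 i).ne'
  set a := diagonal (fun i => ((r i : ℂ))⁻¹) * L with ha
  have ha' : a * g * (a * g)ᴴ = 1 := by
    have h1 : a * g * (a * g)ᴴ = diagonal (fun i => ((r i : ℂ))⁻¹) * (L * (g * gᴴ) * Lᴴ) *
        (diagonal (fun i => ((r i : ℂ))⁻¹))ᴴ := by
      simp only [ha, Matrix.conjTranspose_mul, Matrix.mul_assoc]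
    rw [h1, ← hD, LDL.diag, Matrix.diagonal_conjTranspose, Matrix.diagonal_mul_diagonal,
      Matrix.diagonal_mul_diagonal, ← Matrix.diagonal_one]
    congr 1
    funext i
    have := hr' i
    simp only [hr, Pi.star_apply, star_inv₀, Complex.star_def, Complex.conj_ofReal]
    field_simp
  have hdet : (a * g).det * star (a * g).det = 1 := by
    rw [← Matrix.det_conjTranspose, ← Matrix.det_mul, ha', Matrix.det_one]
  obtain ⟨c, hc⟩ := IsAlgClosed.exists_pow_nat_eq (star (a * g).det) (Nat.pos_of_ne_zero hn)
  have hc1 : c * star c = 1 := by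
    have h1 : ‖c‖ ^ n = 1 := by
      have h2 := congrArg norm hdet
      rw [norm_mul, norm_star, norm_one, ← sq] at h2
      rw [← norm_pow, hc, norm_star]
      exact (pow_eq_one_iff_of_nonneg (norm_nonneg _) two_ne_zero).mp h2
    rw [Complex.star_def, Complex.mul_conj, Complex.normSq_eq_norm_sq,
      (pow_eq_one_iff_of_nonneg (norm_nonneg c) hn).mp h1]
    simp
  refine ⟨c • a, fun i j hij => ?_, mem_specialUnitaryGroup_iff.mpr
    ⟨mem_unitaryGroup_iff.mpr ?_, ?_⟩⟩
  · have h1 : L i j = 0 := LDL.lowerInv_triangular hS hij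
    rw [Matrix.smul_apply, ha, Matrix.diagonal_mul, h1, mul_zero, smul_zero]
  · rw [Matrix.smul_mul, star_smul, smul_mul_smul_comm, hc1, one_smul]
    exact ha'
  · rw [Matrix.smul_mul, Matrix.det_smul, Fintype.card_fin, hc, mul_comm, hdet]

theorem evalM_one_hwv (l : Fin n → ℕ) : evalM (1 : Matrix (Fin n) (Fin n) ℂ) (hwv l) = 1 := by
  simp only [hwv, prodMinor, map_prod, evalM_minorAt, leadCols]
  refine Finset.prod_eq_one fun k _ => Finset.prod_eq_one fun r _ => ?_
  rw [Matrix.submatrix_one _ (Fin.castLE_injective _), Matrix.det_one]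

theorem evalM_conj_lower {a : Matrix (Fin n) (Fin n) ℂ} (ha : ∀ i j, i < j → a i j = 0)
    (l : Fin n → ℕ) (P : Matrix (Fin n) (Fin n) ℂ) : evalM (a * P * aᴴ) (hwv l) =
      (normSq (∏ j, a j j ^ part l j) : ℂ) * evalM P (hwv l) := by
  rw [evalM_mul_upper (fun i j h => by rw [Matrix.conjTranspose_apply, ha _ _ h, star_zero]),
    hwv, evalM_lower_mul ha, ← mul_assoc, Complex.normSq_eq_conj_mul_self, map_prod]
  simp only [Matrix.conjTranspose_apply, map_pow]
  rfl

theorem hasDerivAt_evalM {C : ℝ → Matrix (Fin n) (Fin n) ℂ} {Y : Matrix (Fin n) (Fin n) ℂ}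
    (h0 : C 0 = 1) (hC : ∀ i j, HasDerivAt (fun s => C s i j) (Y i j) 0) (f : MPoly n) :
    HasDerivAt (fun s => evalM (C s) f) (∑ i, ∑ j, Y i j * evalM 1 (der i j f)) 0 := by
  induction f using MvPolynomial.induction_on with
  | C c =>
    simp only [← MvPolynomial.algebraMap_eq, AlgHom.commutes, Derivation.map_algebraMap, map_zero,
      mul_zero, Finset.sum_const_zero]
    exact hasDerivAt_const _ _
  | add f g hf hg =>
    simp only [map_add, mul_add, sum_add_distrib]
    exact hf.add hg
  | mul_X f q hf =>
    simp only [map_mul, evalM_X]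
    refine (hf.mul (hC q.1 q.2)).congr_deriv ?_
    have h1 : ∀ i j, Y i j * evalM 1 (der i j (f * MvPolynomial.X q)) =
        Y i j * evalM 1 (der i j f) * (1 : Matrix (Fin n) (Fin n) ℂ) q.1 q.2 +
          if q.2 = j then (if q.1 = i then evalM 1 f * Y i j else 0) else 0 := fun i j => by
      rw [Derivation.leibniz, map_add, smul_eq_mul, smul_eq_mul, map_mul, map_mul, evalM_X, der_X]
      split_ifs with h2 h3
      · rw [evalM_X, ← h3, Matrix.one_apply_eq]; ring
      · rw [evalM_X, Matrix.one_apply_ne h3]; ring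
      · rw [map_zero]; ring
    simp only [h1, h0, sum_add_distrib, Finset.sum_ite_eq, mem_univ, if_true, ← sum_mul]

/-- Only the diagonal of `Y` matters. For `i < j` the operator kills the highest weight vector; for
`i > j` its value at 1 vanishes because the highest weight vector is constant along the lower
unipotent curve `1 + s E_{ij}`. -/
theorem hasDerivAt_evalM_hwv {C : ℝ → Matrix (Fin n) (Fin n) ℂ} {Y : Matrix (Fin n) (Fin n) ℂ}
    (h0 : C 0 = 1) (hC : ∀ i j, HasDerivAt (fun s => C s i j) (Y i j) 0) (l : Fin n → ℕ) :
    HasDerivAt (fun s => evalM (C s) (hwv l)) (∑ i, part l i * Y i i) 0 := by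
  refine (hasDerivAt_evalM h0 hC (hwv l)).congr_deriv (sum_congr rfl fun i _ => ?_)
  rw [sum_eq_single i _ (by simp)]
  · rw [(isWeightVector_hwv l).der, map_smul, evalM_one_hwv, smul_eq_mul, mul_one, mul_comm]
  · intro j _ hji
    rcases hji.lt_or_gt with h | h
    · have hE : ∀ (s : ℝ) a b, (1 + (s : ℂ) • Matrix.single i j 1 : Matrix (Fin n) (Fin n) ℂ) a b =
          (if a = b then 1 else 0) + if i = a ∧ j = b then (s : ℂ) else 0 := fun s a b => by
        simp [Matrix.add_apply, Matrix.one_apply, Matrix.single]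
      have h1 := hasDerivAt_evalM (C := fun s : ℝ => 1 + (s : ℂ) • Matrix.single i j 1)
        (Y := Matrix.single i j 1) (by simp) (fun a b => by
          rw [show (fun s : ℝ => (1 + (s : ℂ) • Matrix.single i j 1 : Matrix (Fin n) (Fin n) ℂ) a b) =
            _ from funext fun s => hE s a b, Matrix.single, Matrix.of_apply]
          split_ifs
          all_goals first
            | exact (hasDerivAt_id (0 : ℝ)).ofReal_comp.const_add _
            | exact hasDerivAt_const _ _) (hwv l)
      have h2 : (fun s : ℝ => evalM (1 + (s : ℂ) • Matrix.single i j 1) (hwv l)) = fun _ => 1 := by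
        funext s
        have h3 := evalM_lower_mul (b := 1 + (s : ℂ) • Matrix.single i j 1) (fun a b hab => by
          rw [hE, if_neg hab.ne, if_neg (by omega), add_zero]) 1 (leadCols l)
        rw [mul_one] at h3
        rw [hwv, h3, ← hwv, evalM_one_hwv, mul_one]
        refine Finset.prod_eq_one fun k _ => ?_
        rw [hE, if_pos rfl, if_neg (by omega), add_zero, one_pow]
      rw [h2] at h1
      have h4 := h1.unique (hasDerivAt_const _ _)
      rw [sum_eq_single i _ (by simp), sum_eq_single j _ (by simp),
        Matrix.single_apply_same, one_mul] at h4
      · rw [h4, mul_zero]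
      · intro b _ hb; rw [Matrix.single_apply_of_col_ne _ _ hb.symm, zero_mul]
      · intro b _ hb
        refine Finset.sum_eq_zero fun c _ => ?_
        rw [Matrix.single_apply_of_row_ne hb.symm, zero_mul]
    · rw [der_hwv_of_lt h, map_zero, mul_zero]

/-- The function attached to an intertwiner is bounded in terms of its maximum on `SU(n)`. -/
theorem normSq_evalPair_le (hn : n ≠ 0) (l m : Fin n → ℕ)
    {t : TensorProduct ℂ (irrepSpace (dynkin l)) (irrepSpace (dynkin m))} {M : ℝ}
    (hM : ∀ x y : SU n, normSq (evalPair hn l m x.1 y.1 t) ≤ M)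
    {g h : Matrix (Fin n) (Fin n) ℂ} (hg : g.det ≠ 0) (hh : h.det ≠ 0) :
    normSq (evalPair hn l m g h t) ≤
      M * ((evalM (g * gᴴ) (hwv l)).re * (evalM (h * hᴴ) (hwv m)).re) := by
  -- The covariance factor of the triangular matrix that brings `g` into `SU(n)` is the inverse of
  -- the value of the leading minors at `g gᴴ`.
  have key : ∀ (l : Fin n → ℕ) {g a : Matrix (Fin n) (Fin n) ℂ}, (∀ i j, i < j → a i j = 0) →
      a * g ∈ Matrix.specialUnitaryGroup (Fin n) ℂ →
      normSq (∏ j, a j j ^ part l j) * (evalM (g * gᴴ) (hwv l)).re = 1 := by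
    intro l g a ha hag
    have h1 := evalM_conj_lower ha l (g * gᴴ)
    have h2 : a * (g * gᴴ) * aᴴ = 1 := by
      have := mem_unitaryGroup_iff.mp (mem_specialUnitaryGroup_iff.mp hag).1
      rw [Matrix.star_eq_conjTranspose, Matrix.conjTranspose_mul] at this
      rw [← this]
      simp only [Matrix.mul_assoc]
    rw [h2, evalM_one_hwv] at h1
    have h3 := congrArg Complex.re h1
    rw [Complex.re_ofReal_mul, Complex.one_re] at h3
    exact h3.symm
  obtain ⟨a, ha, hag⟩ := exists_lower_mul_mem_SU hn hg
  obtain ⟨b, hb, hbh⟩ := exists_lower_mul_mem_SU hn hh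
  have h1 := hM ⟨_, hag⟩ ⟨_, hbh⟩
  rw [evalPair_lower hn l m ha hb, map_mul, map_mul] at h1
  have h2 := key l ha hag
  have h3 := key m hb hbh
  set p := normSq (∏ j, a j j ^ part l j)
  set q := normSq (∏ j, b j j ^ part m j)
  set u := (evalM (g * gᴴ) (hwv l)).re
  set v := (evalM (h * hᴴ) (hwv m)).re
  have hp : 0 ≤ p := Complex.normSq_nonneg _
  have hq : 0 ≤ q := Complex.normSq_nonneg _
  have hu : 0 ≤ u := by
    by_contra hu
    linarith [mul_nonpos_of_nonneg_of_nonpos hp (not_le.mp hu).le]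
  have hv : 0 ≤ v := by
    by_contra hv
    linarith [mul_nonpos_of_nonneg_of_nonpos hq (not_le.mp hv).le]
  calc _ = (p * u) * (q * v) * normSq (evalPair hn l m g h t) := by rw [h2, h3]; ring
    _ = p * q * normSq (evalPair hn l m g h t) * (u * v) := by ring
    _ ≤ _ := mul_le_mul_of_nonneg_right h1 (mul_nonneg hu hv)

theorem continuous_evalPair (hn : n ≠ 0) (l m : Fin n → ℕ)
    (t : TensorProduct ℂ (irrepSpace (dynkin l)) (irrepSpace (dynkin m))) :
    Continuous fun z : SU n × SU n => evalPair hn l m z.1.1 z.2.1 t := by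
  have h1 : ∀ (l : Fin n → ℕ) (v : irrepSpace (dynkin l)),
      Continuous fun x : SU n => evalRep hn l x.1 v := fun l v => by
    obtain ⟨f, rfl⟩ := (polyRepEquiv hn l).surjective v
    simp only [evalRep_equiv]
    exact continuous_evalM _
  induction t using TensorProduct.induction_on with
  | zero => simp only [map_zero]; exact continuous_const
  | tmul v w =>
    simp only [evalPair_tmul]
    exact ((h1 l v).comp continuous_fst).mul ((h1 m w).comp continuous_snd)
  | add s t hs ht => simp only [map_add]; exact hs.add ht

theorem trace_conj_diagonal (c : Fin n → ℕ) (k Y : Matrix (Fin n) (Fin n) ℂ) :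
    ∑ i, (c i : ℂ) * (k * Y * kᴴ) i i = (kᴴ * diagonal (fun i => (c i : ℂ)) * k * Y).trace := by
  rw [Matrix.mul_assoc, Matrix.mul_assoc, Matrix.trace_mul_comm, Matrix.mul_assoc, Matrix.trace]
  simp only [Matrix.diag_apply, ← Matrix.mul_assoc, Matrix.mul_diagonal, mul_comm]

theorem hasDerivAt_matrix_mul {A B : ℝ → Matrix (Fin n) (Fin n) ℂ} {A' B' : Matrix (Fin n) (Fin n) ℂ}
    (hA : ∀ i j, HasDerivAt (fun s => A s i j) (A' i j) 0)
    (hB : ∀ i j, HasDerivAt (fun s => B s i j) (B' i j) 0) (i j : Fin n) :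
    HasDerivAt (fun s => (A s * B s) i j) ((A' * B 0 + A 0 * B') i j) 0 := by
  simp only [Matrix.mul_apply, Matrix.add_apply, ← sum_add_distrib]
  exact HasDerivAt.fun_sum fun r _ => (hA i r).mul (hB r j)

section

variable (X : Matrix (Fin n) (Fin n) ℂ)

theorem hasDerivAt_line (i j : Fin n) :
    HasDerivAt (fun s : ℝ => (1 + (s : ℂ) • X : Matrix (Fin n) (Fin n) ℂ) i j) (X i j) 0 := by
  simpa using ((hasDerivAt_id (0 : ℝ)).ofReal_comp.mul_const (X i j)).const_add
    ((1 : Matrix (Fin n) (Fin n) ℂ) i j)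

theorem hasDerivAt_line_conj (i j : Fin n) :
    HasDerivAt (fun s : ℝ => (1 + (s : ℂ) • X : Matrix (Fin n) (Fin n) ℂ)ᴴ i j) (Xᴴ i j) 0 :=
  (hasDerivAt_line X j i).star

theorem hasDerivAt_conj_line {k : Matrix (Fin n) (Fin n) ℂ} (hk : k * kᴴ = 1) (l : Fin n → ℕ) :
    HasDerivAt (fun s : ℝ => (evalM (k * (1 + (s : ℂ) • X) * (k * (1 + (s : ℂ) • X))ᴴ) (hwv l)).re)
      ((kᴴ * diagonal (fun i => (part l i : ℂ)) * k * (X + Xᴴ)).trace).re 0 := by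
  have h1 := hasDerivAt_evalM_hwv
    (C := fun s : ℝ => k * ((1 + (s : ℂ) • X) * (1 + (s : ℂ) • X)ᴴ) * kᴴ)
    (Y := k * (X + Xᴴ) * kᴴ) (by simp [hk]) (fun i j =>
      (hasDerivAt_matrix_mul (hasDerivAt_matrix_mul (A := fun _ => k) (A' := 0)
        (fun _ _ => hasDerivAt_const _ _)
        (hasDerivAt_matrix_mul (hasDerivAt_line X) (hasDerivAt_line_conj X))) (B := fun _ => kᴴ) (B' := 0)
        (fun _ _ => hasDerivAt_const _ _) i j).congr_deriv (by simp)) l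
  rw [trace_conj_diagonal] at h1
  refine (Complex.reCLM.hasFDerivAt.comp_hasDerivAt (0 : ℝ) h1).congr_of_eventuallyEq
    (Eventually.of_forall fun s => ?_)
  change (evalM _ (hwv l)).re = (evalM _ (hwv l)).re
  rw [Matrix.conjTranspose_mul, ← Matrix.mul_assoc, Matrix.mul_assoc k]

theorem hasDerivAt_conjTranspose_line (l : Fin n → ℕ) :
    HasDerivAt (fun s : ℝ => (evalM ((1 + (s : ℂ) • X)ᴴ * (1 + (s : ℂ) • X)) (hwv l)).re)
      ((diagonal (fun i => (part l i : ℂ)) * (X + Xᴴ)).trace).re 0 := by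
  have h1 := hasDerivAt_evalM_hwv (C := fun s : ℝ => (1 + (s : ℂ) • X)ᴴ * (1 + (s : ℂ) • X))
    (Y := X + Xᴴ) (by simp) (fun i j => (hasDerivAt_matrix_mul (hasDerivAt_line_conj X)
      (hasDerivAt_line X) i j).congr_deriv (by simp [add_comm])) l
  refine (Complex.reCLM.hasFDerivAt.comp_hasDerivAt (0 : ℝ) h1).congr_deriv ?_
  simp only [Matrix.trace, Matrix.diag_apply, Matrix.diagonal_mul]
  rfl

end

theorem exists_upper_add_conjTranspose {N : Matrix (Fin n) (Fin n) ℂ} (hN : Nᴴ = N) :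
    ∃ X : Matrix (Fin n) (Fin n) ℂ, X + Xᴴ = N ∧ ∀ i j, j < i → X i j = 0 := by
  refine ⟨Matrix.of fun i j => if i < j then N i j else if i = j then N i j / 2 else 0, ?_,
    fun i j h => by simp [h.not_gt, h.ne']⟩
  ext i j
  have h1 : star (N j i) = N i j := congrFun (congrFun hN i) j
  rw [Matrix.add_apply, Matrix.conjTranspose_apply, Matrix.of_apply, Matrix.of_apply]
  rcases lt_trichotomy i j with hij | rfl | hij
  · rw [if_pos hij, if_neg hij.not_gt, if_neg hij.ne', star_zero, add_zero]
  · rw [if_neg (lt_irrefl _), if_pos rfl, star_div₀, h1]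
    simp
  · rw [if_neg hij.not_gt, if_neg hij.ne', if_pos hij, h1, zero_add]

theorem exists_max_prod {G : Type*} [TopologicalSpace G] [CompactSpace G] [Nonempty G] {φ : G × G → ℝ}
    (h : Continuous φ) : ∃ a b, ∀ x y, φ (x, y) ≤ φ (a, b) := by
  obtain ⟨⟨a, b⟩, -, hk⟩ := isCompact_univ.exists_isMaxOn Set.univ_nonempty h.continuousOn
  exact ⟨a, b, fun x y => hk (Set.mem_univ (x, y))⟩

theorem exists_max_evalPair (hn : n ≠ 0) (l m : Fin n → ℕ)
    {t : TensorProduct ℂ (irrepSpace (dynkin l)) (irrepSpace (dynkin m))} (ht : t ≠ 0) :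
    ∃ k₁ k₂ : SU n, 0 < normSq (evalPair hn l m k₁.1 k₂.1 t) ∧ ∀ x y : SU n,
      normSq (evalPair hn l m x.1 y.1 t) ≤ normSq (evalPair hn l m k₁.1 k₂.1 t) := by
  have h1 : Continuous fun z : SU n × SU n => normSq (evalPair hn l m z.1.1 z.2.1 t) :=
    Complex.continuous_normSq.comp (continuous_evalPair hn l m t)
  obtain ⟨k₁, k₂, hM⟩ := exists_max_prod h1
  refine ⟨k₁, k₂, ?_, hM⟩
  by_contra hM0
  exact ht (evalPair_eq_zero hn l m fun x y => Complex.normSq_eq_zero.mp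
    (le_antisymm ((hM x y).trans (not_lt.mp hM0)) (Complex.normSq_nonneg _)))

/-- The moment map vanishes at a maximum. -/
theorem exists_diagonal_eq (hn : n ≠ 0) {l m p : Fin n → ℕ} (hdeg : labelDeg p = labelDeg l + labelDeg m)
    (h : lrCoeff (dynkin l) (dynkin m) (dynkin p) ≠ 0) : ∃ k₁ k₂ : SU n,
      diagonal (fun i => (part p i : ℂ)) = k₁.1ᴴ * diagonal (fun i => (part l i : ℂ)) * k₁.1 +
          k₂.1ᴴ * diagonal (fun i => (part m i : ℂ)) * k₂.1 := by
  obtain ⟨t, ht, hx⟩ := exists_covariant hn hdeg h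
  obtain ⟨k₁, k₂, hM0, hM⟩ := exists_max_evalPair hn l m ht
  refine ⟨k₁, k₂, ?_⟩
  set N := diagonal (fun i => (part p i : ℂ)) - (k₁.1ᴴ * diagonal (fun i => (part l i : ℂ)) * k₁.1 +
      k₂.1ᴴ * diagonal (fun i => (part m i : ℂ)) * k₂.1) with hN
  have hd : ∀ c : Fin n → ℕ, (diagonal fun i => (c i : ℂ))ᴴ = diagonal fun i => (c i : ℂ) :=
    fun c => by
      rw [Matrix.diagonal_conjTranspose]
      congr 1
      funext i
      simp
  have hNH : Nᴴ = N := by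
    simp only [hN, Matrix.conjTranspose_sub, Matrix.conjTranspose_add, Matrix.conjTranspose_mul,
      Matrix.conjTranspose_conjTranspose, hd, Matrix.mul_assoc]
  have hkk : ∀ k : SU n, k.1 * k.1ᴴ = 1 := fun k =>
    mem_unitaryGroup_iff.mp (mem_specialUnitaryGroup_iff.mp k.2).1
  suffices h0 : (N * Nᴴ).trace = 0 by
    exact sub_eq_zero.mp (Matrix.trace_mul_conjTranspose_self_eq_zero_iff.mp h0)
  -- `N` is the defect of the claimed equation. Along `1 + s X`, with `X` upper triangular and `X +
  -- Xᴴ = N`, covariance gives the modulus of the function exactly, while `normSq_evalPair_le`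
  -- bounds it. The difference of the two has a local maximum at `s = 0`, and its derivative there
  -- is the trace of `N²`.
  obtain ⟨X, hXN, hX⟩ := exists_upper_add_conjTranspose hNH
  set C : ℝ → Matrix (Fin n) (Fin n) ℂ := fun s => 1 + (s : ℂ) • X with hC
  have hCup : ∀ s i j, j < i → C s i j = 0 := fun s i j hij => by
    simp [hC, hX i j hij, Matrix.one_apply_ne hij.ne']
  have hC0 : C 0 = 1 := by simp [hC]
  have hle : ∀ᶠ s in 𝓝 (0 : ℝ), (evalM ((C s)ᴴ * C s) (hwv p)).re -
      (evalM (k₁.1 * C s * (k₁.1 * C s)ᴴ) (hwv l)).re *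
        (evalM (k₂.1 * C s * (k₂.1 * C s)ᴴ) (hwv m)).re ≤ 0 := by
    have hc : Continuous fun s => (C s).det := Continuous.matrix_det (by fun_prop)
    filter_upwards [hc.continuousAt.eventually_ne (y := 0) (by simp [hC0])] with s hs
    have h1 := normSq_evalPair_le hn l m hM (g := k₁.1 * C s) (h := k₂.1 * C s)
      (by rwa [Matrix.det_mul, (mem_specialUnitaryGroup_iff.mp k₁.2).2, one_mul])
      (by rwa [Matrix.det_mul, (mem_specialUnitaryGroup_iff.mp k₂.2).2, one_mul])
    have h2 := evalM_conj_lower (a := (C s)ᴴ) (fun i j hij => by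
      rw [Matrix.conjTranspose_apply, hCup s j i hij, star_zero]) p 1
    rw [hx _ (hCup s), map_mul, mul_comm] at h1
    have h3 := le_of_mul_le_mul_left h1 hM0
    rw [mul_one, Matrix.conjTranspose_conjTranspose, evalM_one_hwv, mul_one] at h2
    have h4 : normSq (∏ j, (C s)ᴴ j j ^ part p j) = normSq (∏ j, C s j j ^ part p j) := by
      simp only [map_prod, map_pow, Matrix.conjTranspose_apply, Complex.star_def, Complex.normSq_conj]
    rw [h2, Complex.ofReal_re, h4]
    linarith
  have hval : ∀ k : SU n, k.1 * C 0 * (k.1 * C 0)ᴴ = 1 := fun k => by rw [hC0, mul_one, hkk]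
  have hmax : IsLocalMax (fun s => (evalM ((C s)ᴴ * C s) (hwv p)).re -
      (evalM (k₁.1 * C s * (k₁.1 * C s)ᴴ) (hwv l)).re *
        (evalM (k₂.1 * C s * (k₂.1 * C s)ᴴ) (hwv m)).re) 0 := by
    filter_upwards [hle] with s hs
    refine hs.trans (le_of_eq ?_)
    rw [hval, hval, hC0, Matrix.conjTranspose_one, one_mul, evalM_one_hwv, evalM_one_hwv, evalM_one_hwv]
    simp
  have h5 := hmax.hasDerivAt_eq_zero ((hasDerivAt_conjTranspose_line X p).sub
    ((hasDerivAt_conj_line X (hkk k₁) l).mul (hasDerivAt_conj_line X (hkk k₂) m)))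
  have hval' : ∀ k : SU n, k.1 * (1 + ((0 : ℝ) : ℂ) • X) * (k.1 * (1 + ((0 : ℝ) : ℂ) • X))ᴴ = 1 := hval
  rw [hval', hval', evalM_one_hwv, evalM_one_hwv, Complex.one_re, mul_one, one_mul, hXN] at h5
  have h6 := (Matrix.posSemidef_self_mul_conjTranspose N).trace_nonneg
  refine Complex.ext ?_ (Complex.le_def.mp h6).2.symm
  rw [hNH]
  conv_lhs => rw [hN, sub_mul, add_mul, Matrix.trace_sub, Matrix.trace_add, Complex.sub_re, Complex.add_re]
  exact h5

end

/-! ### Spectra of sums and their limits. -/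

/-- A real diagonal matrix. -/
def realDiag (x : Fin n → ℝ) : Matrix (Fin n) (Fin n) ℂ := diagonal fun i => (x i : ℂ)

/-- `diag γ` is a sum of matrices in the orbits of `α` and `β`. -/
def IsSumSpectrum (α β γ : Fin n → ℝ) : Prop :=
  ∃ u v : SU n, realDiag γ = star u.1 * realDiag α * u.1 + star v.1 * realDiag β * v.1

theorem IsSumSpectrum.smul {α β γ : Fin n → ℝ} (h : IsSumSpectrum α β γ) (c : ℝ) :
    IsSumSpectrum (c • α) (c • β) (c • γ) := by
  obtain ⟨u, v, huv⟩ := h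
  have h1 : ∀ x : Fin n → ℝ, realDiag (c • x) = (c : ℂ) • realDiag x := fun x => by
    rw [realDiag, realDiag, ← Matrix.diagonal_smul]
    congr 1
    funext i
    simp
  refine ⟨u, v, ?_⟩
  simp only [h1, huv, smul_add, Matrix.mul_smul, Matrix.smul_mul]

theorem star_mul_self_SU (u : SU n) : star u.1 * u.1 = 1 :=
  mem_unitaryGroup_iff'.mp (mem_specialUnitaryGroup_iff.mp u.2).1

theorem realDiag_add_const (x : Fin n → ℝ) (c : ℝ) :
    realDiag (x + fun _ => c) = realDiag x + (c : ℂ) • 1 := by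
  rw [realDiag, realDiag, ← Matrix.diagonal_one, ← Matrix.diagonal_smul, Matrix.diagonal_add]
  congr 1
  funext i
  simp

theorem IsSumSpectrum.add_const {α β γ : Fin n → ℝ} (h : IsSumSpectrum α β γ) (a b : ℝ) :
    IsSumSpectrum (α + fun _ => a) (β + fun _ => b) (γ + fun _ => a + b) := by
  obtain ⟨u, v, huv⟩ := h
  refine ⟨u, v, ?_⟩
  simp only [realDiag_add_const, huv, mul_add, add_mul, Matrix.mul_smul, Matrix.smul_mul, mul_one,
    star_mul_self_SU, Complex.ofReal_add, add_smul]
  abel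

theorem continuous_realDiag : Continuous (realDiag (n := n)) :=
  Continuous.matrix_diagonal (by fun_prop)

instance : FirstCountableTopology (SU n) :=
  inferInstanceAs (FirstCountableTopology
    {x : Fin n → Fin n → ℂ // x ∈ Matrix.specialUnitaryGroup (Fin n) ℂ})

theorem isSumSpectrum_of_tendsto {a b c : ℕ → Fin n → ℝ} {α β γ : Fin n → ℝ}
    (h : ∀ k, IsSumSpectrum (a k) (b k) (c k)) (ha : Tendsto a atTop (𝓝 α))
    (hb : Tendsto b atTop (𝓝 β)) (hc : Tendsto c atTop (𝓝 γ)) : IsSumSpectrum α β γ := by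
  choose u v huv using h
  obtain ⟨⟨u₀, v₀⟩, φ, hφ, hlim⟩ := CompactSpace.tendsto_subseq fun k => (u k, v k)
  have hu : Tendsto (fun k => (u (φ k)).1) atTop (𝓝 u₀.1) :=
    ((continuous_subtype_val.comp continuous_fst).tendsto (u₀, v₀)).comp hlim
  have hv : Tendsto (fun k => (v (φ k)).1) atTop (𝓝 v₀.1) :=
    ((continuous_subtype_val.comp continuous_snd).tendsto (u₀, v₀)).comp hlim
  have hd : ∀ {x : ℕ → Fin n → ℝ} {y}, Tendsto x atTop (𝓝 y) →
      Tendsto (fun k => realDiag (x (φ k))) atTop (𝓝 (realDiag y)) := fun hx =>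
    (continuous_realDiag.tendsto _).comp (hx.comp hφ.tendsto_atTop)
  have hs : ∀ {x : ℕ → Matrix (Fin n) (Fin n) ℂ} {y}, Tendsto x atTop (𝓝 y) →
      Tendsto (fun k => star (x k)) atTop (𝓝 (star y)) := fun hx =>
    (continuous_star.tendsto _).comp hx
  refine ⟨u₀, v₀, tendsto_nhds_unique (hd hc) ?_⟩
  simp only [huv]
  exact (((hs hu).mul (hd ha)).mul hu).add (((hs hv).mul (hd hb)).mul hv)

theorem part_eq_wt (hn : n ≠ 0) (l : Fin n → ℕ) :
    (fun i => (part l i : ℝ)) = wt (dynkin l) + fun _ => (labelDeg l : ℝ) / n := by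
  have h := partRho_sub hn l
  funext i
  have h1 := congrFun h i
  simp only [partRho, shifted, Pi.add_apply] at h1 ⊢
  linarith

theorem labelDeg_fullLabels (hn : n ≠ 0) (κ : Weight n) (c : ℕ) :
    labelDeg (fullLabels κ c) = labelDeg (fullLabels κ 0) + n * c := by
  obtain ⟨m, rfl⟩ : ∃ m, n = m + 1 := ⟨n - 1, by omega⟩
  simp only [labelDeg, Fin.sum_univ_castSucc]
  simp [fullLabels]
  ring

/-- A constituent of a tensor product gives a spectrum of a sum of matrices. -/
theorem isSumSpectrum_of_lrCoeff (hn : n ≠ 0) {κ μ ν : Weight n} (h : lrCoeff κ μ ν ≠ 0) :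
    IsSumSpectrum (wt κ) (wt μ) (wt ν) := by
  have h0 : lrCoeff (dynkin (fullLabels κ 0)) (dynkin (fullLabels μ 0))
      (dynkin (fullLabels ν 0)) ≠ 0 := by simpa only [dynkin_fullLabels] using h
  obtain ⟨c, hc⟩ := labelDeg_dvd hn h0
  -- Powers of the determinant, `a` for `κ` and `a - c ≥ 0` for `ν`, make the degrees agree without
  -- changing the Dynkin labels.
  set a := c.natAbs
  have h1 : labelDeg (fullLabels ν (a - c).natAbs) =
      labelDeg (fullLabels κ a) + labelDeg (fullLabels μ 0) := by
    rw [labelDeg_fullLabels hn ν, labelDeg_fullLabels hn κ]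
    zify
    rw [abs_of_nonneg (show 0 ≤ (a : ℤ) - c by omega)]
    push_cast at hc
    linarith
  obtain ⟨k₁, k₂, hk⟩ := exists_diagonal_eq hn h1 (by simpa only [dynkin_fullLabels] using h)
  have h2 : ∀ l : Fin n → ℕ, (diagonal fun i => (part l i : ℂ)) =
      realDiag (wt (dynkin l) + fun _ => (labelDeg l : ℝ) / n) := fun l => by
    rw [← part_eq_wt hn, realDiag]
    congr 1
  rw [h2, h2, h2] at hk
  simp only [dynkin_fullLabels] at hk
  have h3 := IsSumSpectrum.add_const ⟨k₁, k₂, hk⟩ (-((labelDeg (fullLabels κ a) : ℝ) / n))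
    (-((labelDeg (fullLabels μ 0) : ℝ) / n))
  have h4 : (labelDeg (fullLabels ν (a - c).natAbs) : ℝ) / n = (labelDeg (fullLabels κ a) : ℝ) / n +
    (labelDeg (fullLabels μ 0) : ℝ) / n := by rw [h1]; push_cast; ring
  rw [h4] at h3
  convert h3 using 1 <;> funext i <;> simp only [Pi.add_apply] <;> ring

theorem realDiag_comp_mem_orbit (x : Fin n → ℝ) (w : Perm (Fin n)) :
    realDiag (x ∘ w) ∈ orbit x := by
  have h1 : star (w⁻¹.permMatrix ℂ) = w.permMatrix ℂ := by
    rw [Matrix.star_eq_conjTranspose, Matrix.conjTranspose_permMatrix, _root_.inv_inv]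
  have h2 : w.permMatrix ℂ * w⁻¹.permMatrix ℂ = 1 := by
    rw [← Matrix.permMatrix_mul, inv_mul_cancel, Matrix.permMatrix_one]
  refine ⟨w⁻¹.permMatrix ℂ, mem_unitaryGroup_iff'.mpr (h1 ▸ h2), ?_⟩
  have h3 : realDiag (x ∘ w) * w.permMatrix ℂ = w.permMatrix ℂ * realDiag x := by
    ext i j
    simp only [realDiag, Matrix.diagonal_mul, Matrix.mul_diagonal, Equiv.Perm.permMatrix,
      PEquiv.toMatrix_apply, Equiv.toPEquiv_apply, Option.mem_some_iff, Function.comp_apply]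
    split_ifs with h <;> simp [h]
  rw [h1]
  change _ = w.permMatrix ℂ * realDiag x * w⁻¹.permMatrix ℂ
  rw [← h3, mul_assoc, h2, mul_one]

theorem star_mul_mem_orbit (x : Fin n → ℝ) (u : SU n) : star u.1 * realDiag x * u.1 ∈ orbit x :=
  ⟨u.1, (mem_specialUnitaryGroup_iff.mp u.2).1, rfl⟩

theorem mem_hornPolytope {α β γ : Fin n → ℝ} {w : Perm (Fin n)} (hγ : Antitone γ)
    (h : IsSumSpectrum α β (γ ∘ w)) : γ ∈ hornPolytope α β := by
  obtain ⟨u, v, huv⟩ := h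
  exact subset_convexHull ℝ _ ⟨hγ, _, star_mul_mem_orbit α u, _, star_mul_mem_orbit β v,
    huv ▸ realDiag_comp_mem_orbit γ w⟩

/-! ### The support of `J_n`. -/

/-- A point where `J_n` does not vanish is close to a constituent of the tensor product. -/
theorem exists_lrCoeff_of_J_ne_zero (hn : n ≠ 0) {B : (Fin (n - 1) → ℝ) → ℝ} (hB : IsSplineKernel B)
    {α β : Fin n → ℤ} (hα : StrictAnti α) (hβ : StrictAnti β) {γ : Fin n → ℝ}
    (h : J (castVec α) (castVec β) γ ≠ 0) : ∃ (y : Fin (n - 1) → ℝ) (w : Perm (Fin n)),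
      (∀ j, |y j| ≤ n * n) ∧ IsSumSpectrum (lift (diffs (castVec α)) - rho)
        (lift (diffs (castVec β)) - rho) ((lift (diffs γ) - ofCoords y) ∘ w - rho) := by
  obtain ⟨κ, μ, hκ, hμ, h1, h2⟩ := exists_quotient hn hα hβ
  have hg := isAlt_schur_mul hn κ μ
  rw [hB.J_eq hg h1, kernelPairing_mul_mono] at h
  obtain ⟨x, hx, hx0⟩ := Finset.exists_ne_zero_of_sum_ne_zero h
  have hxc := left_ne_zero_of_mul hx0
  have hxt := (h2 x hxc).1
  have hxB : B (coords (γ - x)) ≠ 0 := fun h0 => hx0 (by simp only [h0, Complex.ofReal_zero, mul_zero])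
  have hinj : Injective x := by
    by_contra hi
    exact hxc (hg.coeff_eq_zero hi)
  obtain ⟨w, hw⟩ := exists_strictAnti_comp hinj
  have hxw : x ∈ weightLattice n := (((suppIn_schur hn κ).mul (suppIn_schur hn μ)
      fun a ha b hb => add_mem ha hb).mul (suppIn_alt fun w => comp_mem_weightLattice rho_mem w)
      fun a ha b hb => add_mem ha hb : SuppIn (weightLattice n : Set (Fin n → ℝ)) _) x hxc
  obtain ⟨ν, hν⟩ := exists_eq_shifted (comp_mem_weightLattice hxw w) hw
  have h3 : lrCoeff κ μ ν ≠ 0 := by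
    intro h0
    have h4 := lrCoeff_eq_coeff hn κ μ ν
    rw [h0, ← hν, hg.coeff_comp, Nat.cast_zero, zero_eq_mul] at h4
    rcases h4 with h4 | h4
    · exact absurd (sign_sq w) (by rw [h4]; norm_num)
    · exact hxc h4
  refine ⟨coords (γ - x), w, fun j => not_lt.mp fun hj => hxB (hB.eq_zero _ j hj), ?_⟩
  rw [hκ, hμ, ← coords_lift_diffs_sub, ofCoords_coords (sub_mem (lift_mem_traceless _) hxt),
    sub_sub_cancel, hν]
  simpa only [shifted, add_sub_cancel_right] using isSumSpectrum_of_lrCoeff hn h3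

/-- The support of `J_n` is contained in the Horn polytope. -/
theorem mem_hornPolytope_of_J_ne_zero (hn : n ≠ 0) {B : (Fin (n - 1) → ℝ) → ℝ} (hB : IsSplineKernel B)
    {α β : Fin n → ℤ} (hα : StrictAnti α) (hβ : StrictAnti β) {γ : Fin n → ℝ} (hγ : Antitone γ)
    (hs : ∑ k, γ k = ∑ k, (castVec α k + castVec β k)) (h : J (castVec α) (castVec β) γ ≠ 0) :
    γ ∈ hornPolytope (castVec α) (castVec β) := by
  obtain ⟨κ, μ, hκ, hμ, h1, h2⟩ := exists_quotient hn hα hβ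
  have hlim := hB.tendsto_kernelIntegrand (isAlt_schur_mul hn κ μ) h1 γ
  -- `J_n` does not vanish at the multiple by `k + 1` either, which is therefore within bounded
  -- distance of a constituent. Dividing by `k + 1` makes that distance and the shifts by `ρ` tend
  -- to zero.
  have hk : ∀ k : ℕ, ∃ (y : Fin (n - 1) → ℝ) (w : Perm (Fin n)), (∀ j, |y j| ≤ n * n) ∧
      IsSumSpectrum (lift (diffs (castVec α)) - ((k : ℝ) + 1)⁻¹ • rho)
        (lift (diffs (castVec β)) - ((k : ℝ) + 1)⁻¹ • rho)
        ((lift (diffs γ) - ofCoords (((k : ℝ) + 1)⁻¹ • y)) ∘ w - ((k : ℝ) + 1)⁻¹ • rho) := by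
    intro k
    have hk0 : (0 : ℝ) < k + 1 := by positivity
    have hcast : ∀ α : Fin n → ℤ, castVec (fun i => ((k : ℤ) + 1) * α i) = ((k : ℝ) + 1) • castVec α :=
      fun α => by funext i; simp [castVec]
    have hanti : ∀ {α : Fin n → ℤ}, StrictAnti α → StrictAnti fun i => ((k : ℤ) + 1) * α i :=
      fun hα i j hij => mul_lt_mul_of_pos_left (hα hij) (by positivity)
    obtain ⟨y, w, hy, hw⟩ := exists_lrCoeff_of_J_ne_zero hn hB (hanti hα) (hanti hβ)
      (γ := ((k : ℝ) + 1) • γ) (by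
        rw [hcast, hcast, J_smul hk0 hlim]
        have : (((k : ℝ) + 1 : ℝ) : ℂ) ≠ 0 := by exact_mod_cast hk0.ne'
        exact mul_ne_zero (div_ne_zero (pow_ne_zero _ this) (pow_ne_zero _ this)) h)
    refine ⟨y, w, hy, ?_⟩
    have hd : ∀ x : Fin n → ℝ, lift (diffs (((k : ℝ) + 1) • x)) = ((k : ℝ) + 1) • lift (diffs x) :=
      fun x => by
        rw [← map_smul]
        congr 1
        funext j
        simp [diffs, mul_sub]
    have h3 := hw.smul ((k : ℝ) + 1)⁻¹
    rw [hcast, hcast, hd, hd, hd, smul_sub, smul_sub, smul_sub, smul_smul, smul_smul,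
      inv_mul_cancel₀ hk0.ne', one_smul, one_smul] at h3
    convert h3 using 2
    funext i
    have h4 : ofCoords (((k : ℝ) + 1)⁻¹ • y) = ((k : ℝ) + 1)⁻¹ • ofCoords y := by
      simp only [ofCoords, smul_sum, Pi.smul_apply, smul_eq_mul, mul_smul]
    rw [h4]
    simp only [Function.comp_apply, Pi.sub_apply, Pi.smul_apply, smul_eq_mul]
    field_simp
  choose y w hy hw using hk
  -- There are finitely many permutations, so one of them occurs along a subsequence.
  obtain ⟨w₀, hw₀⟩ := Finite.exists_infinite_fiber w
  obtain ⟨φ, hφ, hφw⟩ := extraction_of_frequently_atTop (P := fun k => w k = w₀)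
    (Nat.frequently_atTop_iff_infinite.mpr (Set.infinite_coe_iff.mp hw₀))
  have h0 : Tendsto (fun k : ℕ => ((φ k : ℝ) + 1)⁻¹) atTop (𝓝 0) :=
    (tendsto_inv_atTop_zero.comp (tendsto_atTop_add_const_right _ _ tendsto_natCast_atTop_atTop)).comp
      hφ.tendsto_atTop
  have hrho : ∀ x : Fin n → ℝ, Tendsto (fun k => x - ((φ k : ℝ) + 1)⁻¹ • (rho : Fin n → ℝ)) atTop (𝓝 x) :=
    fun x => by simpa using tendsto_const_nhds.sub (h0.smul_const (rho : Fin n → ℝ))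
  have hy0 : Tendsto (fun k => ((φ k : ℝ) + 1)⁻¹ • y (φ k)) atTop (𝓝 0) := by
    refine tendsto_pi_nhds.mpr fun j => ?_
    refine squeeze_zero_norm (fun k => ?_) (by simpa using h0.mul_const ((n : ℝ) * n))
    rw [Pi.smul_apply, smul_eq_mul, norm_mul, Real.norm_eq_abs, Real.norm_eq_abs,
      abs_of_pos (by positivity)]
    exact mul_le_mul_of_nonneg_left (hy _ j) (by positivity)
  have hoc : Continuous (ofCoords (n := n)) := by unfold ofCoords; fun_prop
  have hc : Tendsto (fun k => (lift (diffs γ) - ofCoords (((φ k : ℝ) + 1)⁻¹ • y (φ k))) ∘ w₀ -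
      ((φ k : ℝ) + 1)⁻¹ • (rho : Fin n → ℝ)) atTop (𝓝 (lift (diffs γ) ∘ w₀)) := by
    have h5 : ofCoords (0 : Fin (n - 1) → ℝ) = 0 := by simp [ofCoords]
    have h6 : Continuous fun p : (Fin (n - 1) → ℝ) × ℝ =>
        (lift (diffs γ) - ofCoords p.1) ∘ w₀ - p.2 • (rho : Fin n → ℝ) := by
      refine continuous_pi fun i => ?_
      simp only [Pi.sub_apply, Function.comp_apply, Pi.smul_apply]
      have := continuous_pi_iff.mp (hoc.comp (continuous_fst (X := Fin (n - 1) → ℝ) (Y := ℝ))) (w₀ i)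
      exact (continuous_const.sub this).sub (continuous_snd.smul continuous_const)
    have h7 := (h6.tendsto (0, 0)).comp (hy0.prodMk_nhds h0)
    rw [h5, sub_zero, zero_smul, sub_zero] at h7
    exact h7
  have h8 := isSumSpectrum_of_tendsto (fun k => hφw k ▸ hw (φ k)) (hrho _) (hrho _) hc
  have h9 := h8.add_const ((∑ k, castVec α k) / n) ((∑ k, castVec β k) / n)
  refine mem_hornPolytope (w := w₀) hγ ?_
  convert h9 using 1 <;> funext i
  · simp [lift_diffs_apply]
  · simp [lift_diffs_apply]
  · simp only [lift_diffs_apply, Pi.add_apply, Function.comp_apply, hs, sum_add_distrib]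
    ring

/-! ### The integral of the density -/

theorem continuous_complete (α β : Fin n → ℝ) : Continuous (complete α β) := by
  refine continuous_pi fun i => ?_
  unfold complete
  split_ifs <;> fun_prop

theorem isClosed_chamber (α β : Fin n → ℝ) : IsClosed (chamber α β) := by
  have : chamber α β = ⋂ (i : Fin n) (j : Fin n) (_ : i ≤ j),
      {g | complete α β g j ≤ complete α β g i} := by
    ext g
    simp only [chamber, Set.mem_ofPred_eq, Set.mem_iInter]
    rfl
  rw [this]
  have h := continuous_pi_iff.mp (continuous_complete α β)
  exact isClosed_iInter fun i => isClosed_iInter fun j => isClosed_iInter fun _ =>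
    isClosed_le (h j) (h i)

theorem complete_combo (α β : Fin n → ℝ) (x y : Fin (n - 1) → ℝ) {a b : ℝ} (hab : a + b = 1) :
    complete α β (a • x + b • y) = a • complete α β x + b • complete α β y := by
  funext i
  simp only [complete, Pi.add_apply, Pi.smul_apply, smul_eq_mul, sum_add_distrib, ← mul_sum]
  split_ifs
  · rfl
  · linear_combination (-∑ k, α k - ∑ k, β k) * hab

theorem convex_chamber (α β : Fin n → ℝ) : Convex ℝ (chamber α β) := by
  intro x hx y hy a b ha hb hab i j hij
  rw [complete_combo α β x y hab]
  exact add_le_add (mul_le_mul_of_nonneg_left (hx hij) ha) (mul_le_mul_of_nonneg_left (hy hij) hb)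

theorem hornRegion_subset_chamber (α β : Fin n → ℝ) : hornRegion α β ⊆ chamber α β := by
  have h : Convex ℝ {γ : Fin n → ℝ | Antitone γ} := fun x hx y hy a b ha hb _ i j hij =>
    add_le_add (mul_le_mul_of_nonneg_left (hx hij) ha) (mul_le_mul_of_nonneg_left (hy hij) hb)
  exact fun g hg => convexHull_min (fun γ hγ => hγ.1) h hg

theorem density_eq_zero (hn : n ≠ 0) {B : (Fin (n - 1) → ℝ) → ℝ} (hB : IsSplineKernel B)
    {α β : Fin n → ℤ} (hα : StrictAnti α) (hβ : StrictAnti β) {g : Fin (n - 1) → ℝ}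
    (hg : g ∈ chamber (castVec α) (castVec β) \ hornRegion (castVec α) (castVec β)) :
    density (castVec α) (castVec β) g = 0 := by
  by_contra h
  exact hg.2 (mem_hornPolytope_of_J_ne_zero hn hB hα hβ hg.1 (sum_complete hn _ _ g)
    (left_ne_zero_of_mul h))

theorem setIntegral_hornRegion (hn : n ≠ 0) {B : (Fin (n - 1) → ℝ) → ℝ} (hB : IsSplineKernel B)
    {α β : Fin n → ℤ} (hα : StrictAnti α) (hβ : StrictAnti β) :
    ∫ g in hornRegion (castVec α) (castVec β), density (castVec α) (castVec β) g =
      ∫ g in chamber (castVec α) (castVec β), density (castVec α) (castVec β) g :=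
  (setIntegral_eq_of_subset_of_forall_sdiff_eq_zero
    (isClosed_chamber _ _).measurableSet (hornRegion_subset_chamber _ _)
    fun _ hg => density_eq_zero hn hB hα hβ hg).symm

/-- The sum over the integral points of the Horn polytope. -/
theorem finsum_hornRegion (hn : n ≠ 0) {B : (Fin (n - 1) → ℝ) → ℝ} (hB : IsSplineKernel B)
    {α β : Fin n → ℤ} (hα : StrictAnti α) (hβ : StrictAnti β) :
    ∑ᶠ (m : Fin (n - 1) → ℤ) (_ : castVec m ∈ hornRegion (castVec α) (castVec β)),
      density (castVec α) (castVec β) (castVec m) = ((Nat.superFactorial (n - 1) : ℕ) : ℂ)⁻¹ := by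
  rw [← finsum_chamber hn hB hα hβ]
  refine finsum_congr fun m => ?_
  by_cases h : castVec m ∈ hornRegion (castVec α) (castVec β)
  · simp only [h, hornRegion_subset_chamber _ _ h, finsum_true]
  · by_cases h' : castVec m ∈ chamber (castVec α) (castVec β)
    · simp only [h, h', finsum_true, finsum_false, density_eq_zero hn hB hα hβ ⟨h', h⟩]
    · simp only [h, h', finsum_false]

theorem exists_J_eq_sum (hn : n ≠ 0) {B : (Fin (n - 1) → ℝ) → ℝ} (hB : IsSplineKernel B)
    {α β : Fin n → ℤ} (hα : StrictAnti α) (hβ : StrictAnti β) :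
    ∃ g : (Fin n → ℝ) →₀ ℂ, (∀ x, g x ≠ 0 → x ∈ traceless n) ∧
      ∀ γ, J (castVec α) (castVec β) γ = g.sum fun x c => c * (B (coords (γ - x)) : ℂ) := by
  obtain ⟨κ, μ, -, -, h1, h2⟩ := exists_quotient hn hα hβ
  exact ⟨(schur hn κ * schur hn μ * alt rho).coeff, fun x hx => (h2 x hx).1, fun γ => by
    rw [hB.J_eq (isAlt_schur_mul hn κ μ) h1, kernelPairing_mul_mono]⟩

theorem continuous_density (hn : n ≠ 0) {B : (Fin (n - 1) → ℝ) → ℝ} (hB : IsSplineKernel B)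
    (hc : Continuous B) {α β : Fin n → ℤ} (hα : StrictAnti α) (hβ : StrictAnti β) :
    Continuous (density (castVec α) (castVec β)) := by
  obtain ⟨g, -, hg⟩ := exists_J_eq_sum hn hB hα hβ
  have h1 : Continuous (coords (n := n)) := LinearMap.continuous_of_finiteDimensional _
  have h2 := continuous_complete (castVec α) (castVec β)
  have h3 := continuous_pi_iff.mp h2
  unfold density vander
  simp only [hg, Finsupp.sum]
  refine Continuous.mul (continuous_finsetSum _ fun x _ => continuous_const.mul
    (Complex.continuous_ofReal.comp (hc.comp (h1.comp (h2.sub continuous_const))))) ?_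
  exact Complex.continuous_ofReal.comp (Continuous.div_const
    (continuous_finsetProd _ fun q _ => (h3 q.1).sub (h3 q.2)) _)

theorem exists_density_bound (hn : n ≠ 0) {B : (Fin (n - 1) → ℝ) → ℝ} (hB : IsSplineKernel B)
    {α β : Fin n → ℤ} (hα : StrictAnti α) (hβ : StrictAnti β) :
    ∃ r, ∀ g, density (castVec α) (castVec β) g ≠ 0 → g ∈ Metric.closedBall 0 r := by
  obtain ⟨c, ht, hc⟩ := exists_J_eq_sum hn hB hα hβ
  have hoc : Continuous (ofCoords (n := n)) := by unfold ofCoords; fun_prop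
  set a := (∑ k, (castVec α k + castVec β k)) / n
  let K : Set (Fin (n - 1) → ℝ) := ⋃ x ∈ c.support,
    (fun y (j : Fin (n - 1)) => x ⟨j, by have := j.2; omega⟩ +
      ofCoords (n := n) y ⟨j, by have := j.2; omega⟩ + a) '' Metric.closedBall 0 (n * n)
  have hK : IsCompact K := c.support.isCompact_biUnion fun x _ =>
    (isCompact_closedBall _ _).image (by fun_prop)
  obtain ⟨r, hr⟩ := hK.isBounded.subset_closedBall 0
  refine ⟨r, fun g hg => hr ?_⟩
  have h1 := left_ne_zero_of_mul hg
  rw [hc] at h1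
  obtain ⟨x, hx, hx0⟩ := Finset.exists_ne_zero_of_sum_ne_zero h1
  refine Set.mem_iUnion₂.mpr ⟨x, hx, coords (n := n) (complete (castVec α) (castVec β) g - x), ?_, ?_⟩
  · rw [mem_closedBall_zero_iff, pi_norm_le_iff_of_nonneg (by positivity)]
    exact fun j => not_lt.mp fun hj => hx0 (by
      simp only
      rw [hB.eq_zero _ j (by rwa [Real.norm_eq_abs] at hj), Complex.ofReal_zero, mul_zero])
  · funext j
    beta_reduce
    rw [← coords_lift_diffs_sub, ofCoords_coords (sub_mem (lift_mem_traceless _)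
      (ht x (Finsupp.mem_support_iff.mp hx))), lift_diffs_apply, sum_complete hn]
    simp [complete, a]

/-! ### Riemann sums by homogeneity. -/

theorem complete_smul (α β : Fin n → ℝ) (c : ℝ) (g : Fin (n - 1) → ℝ) :
    complete (c • α) (c • β) (c • g) = c • complete α β g := by
  funext i
  simp only [complete, Pi.smul_apply, smul_eq_mul, ← mul_add, ← mul_sum]
  split_ifs
  · rfl
  · ring

theorem smul_mem_chamber (α β : Fin n → ℝ) {c : ℝ} (hc : 0 < c) (g : Fin (n - 1) → ℝ) :
    c • g ∈ chamber (c • α) (c • β) ↔ g ∈ chamber α β := by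
  simp only [chamber, Set.mem_ofPred_eq, complete_smul]
  exact ⟨fun h i j hij => le_of_mul_le_mul_left (h hij) hc,
    fun h i j hij => mul_le_mul_of_nonneg_left (h hij) hc.le⟩

/-- The powers `c^{n(n-1)/2}` of `J_n` and of the quotient of Vandermonde products cancel. What
remains is the Jacobian `c^{n-1}` of the scaling of the integration variable. -/
theorem density_smul (hn : n ≠ 0) {B : (Fin (n - 1) → ℝ) → ℝ} (hB : IsSplineKernel B)
    {α β : Fin n → ℤ} (hα : StrictAnti α) (hβ : StrictAnti β) {c : ℝ} (hc : 0 < c)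
    (g : Fin (n - 1) → ℝ) :
    density (castVec α) (castVec β) g =
      (c : ℂ) ^ (n - 1) * density (c • castVec α) (c • castVec β) (c • g) := by
  obtain ⟨κ, μ, -, -, h1, -⟩ := exists_quotient hn hα hβ
  have hv : ∀ x : Fin n → ℝ, vander (c • x) = c ^ (n * (n - 1) / 2) * vander x := fun x => by
    simp only [vander, Pi.smul_apply, smul_eq_mul, ← mul_sub, prod_mul_distrib,
      Finset.prod_const, card_pairs]
  have hc' : (c : ℂ) ≠ 0 := by exact_mod_cast hc.ne'
  have hc2 := pow_ne_zero (n * (n - 1) / 2) hc.ne'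
  rw [density, density, complete_smul, hv, hv, hv, J_smul hc
    (hB.tendsto_kernelIntegrand (isAlt_schur_mul hn κ μ) h1 _)]
  push_cast
  field_simp

open scoped Pointwise

/-- The points of `(1/M) ℤ^{n-1}` correspond to the integral points for `Mα` and `Mβ`. By
homogeneity the Riemann sum is the lattice sum for these, whose value does not involve `M`. The
functional `φ` stands for the real and the imaginary part. -/
theorem tsum_density (hn : n ≠ 0) {B : (Fin (n - 1) → ℝ) → ℝ} (hB : IsSplineKernel B)
    {α β : Fin n → ℤ} (hα : StrictAnti α) (hβ : StrictAnti β) {r : ℝ}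
    (hr : ∀ g, density (castVec α) (castVec β) g ≠ 0 → g ∈ Metric.closedBall 0 r) (φ : ℂ →L[ℝ] ℝ)
    {M : ℕ} (hM : M ≠ 0) :
    (∑' x : ↑((chamber (castVec α) (castVec β) ∩ Metric.closedBall 0 r) ∩ (M : ℝ)⁻¹ •
      (Submodule.span ℤ (Set.range (Pi.basisFun ℝ (Fin (n - 1)))) : Set (Fin (n - 1) → ℝ))),
      φ (density (castVec α) (castVec β) x)) / (M : ℝ) ^ Fintype.card (Fin (n - 1)) =
      φ ((Nat.superFactorial (n - 1) : ℕ) : ℂ)⁻¹ := by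
  have hM0 : (0 : ℝ) < M := by positivity
  have hcast : ∀ α : Fin n → ℤ, castVec (fun i => (M : ℤ) * α i) = (M : ℝ) • castVec α :=
    fun α => by funext i; simp [castVec]
  have hanti : ∀ {α : Fin n → ℤ}, StrictAnti α → StrictAnti fun i => (M : ℤ) * α i :=
    fun hα i j hij => mul_lt_mul_of_pos_left (hα hij) (by positivity)
  have hsum := finsum_chamber hn hB (hanti hα) (hanti hβ)
  rw [hcast, hcast] at hsum
  set D : (Fin (n - 1) → ℤ) → ℂ := fun m =>
    ∑ᶠ (_ : castVec m ∈ chamber ((M : ℝ) • castVec α) ((M : ℝ) • castVec β)),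
      density ((M : ℝ) • castVec α) ((M : ℝ) • castVec β) (castVec m) with hD
  -- A `finsum` with infinite support is zero by convention, while this one is known to be nonzero.
  have hfin : (Function.support D).Finite := by
    by_contra h
    rw [finsum_of_infinite_support h, eq_comm, inv_eq_zero, Nat.cast_eq_zero] at hsum
    have := vander_pos (strictAnti_rho (n := n))
    rw [vander_rho (by omega), hsum] at this
    exact lt_irrefl _ (by exact_mod_cast this)
  have hmem : ∀ x : Fin (n - 1) → ℝ, x ∈ (M : ℝ)⁻¹ •
      (Submodule.span ℤ (Set.range (Pi.basisFun ℝ (Fin (n - 1)))) : Set (Fin (n - 1) → ℝ)) ↔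
      ∃ m : Fin (n - 1) → ℤ, (M : ℝ)⁻¹ • castVec m = x := fun x => by
    rw [← Submodule.coe_pointwise_smul, SetLike.mem_coe]
    have : NeZero M := ⟨hM⟩
    rw [BoxIntegral.unitPartition.mem_smul_span_iff]
    constructor
    · intro h
      choose m hm using h
      refine ⟨m, funext fun i => ?_⟩
      simp only [Pi.smul_apply, castVec, smul_eq_mul]
      rw [← eq_intCast (algebraMap ℤ ℝ), hm]
      field_simp
    · rintro ⟨m, rfl⟩ i
      exact ⟨m i, by simp [castVec, hM]⟩
  have hinj : Injective fun m : Fin (n - 1) → ℤ => (M : ℝ)⁻¹ • (castVec m : _ → ℝ) :=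
    fun m m' h => funext fun i => by
      have := congrFun (smul_right_injective _ (inv_ne_zero hM0.ne') h) i
      exact Int.cast_injective this
  rw [tsum_subtype _ fun x => φ (density (castVec α) (castVec β) x), ← hinj.tsum_eq fun x hx =>
    (hmem x).mp (Set.mem_of_indicator_ne_zero hx).2]
  have hterm : ∀ m : Fin (n - 1) → ℤ, Set.indicator ((chamber (castVec α) (castVec β) ∩
      Metric.closedBall 0 r) ∩ (M : ℝ)⁻¹ •
      (Submodule.span ℤ (Set.range (Pi.basisFun ℝ (Fin (n - 1)))) : Set (Fin (n - 1) → ℝ)))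
      (fun x => φ (density (castVec α) (castVec β) x)) ((M : ℝ)⁻¹ • castVec m) =
      (M : ℝ) ^ (n - 1) * φ (D m) := by
    intro m
    have h1 : castVec m = (M : ℝ) • ((M : ℝ)⁻¹ • castVec m : Fin (n - 1) → ℝ) := by
      rw [smul_smul, mul_inv_cancel₀ hM0.ne', one_smul]
    have h2 : (M : ℝ) ^ (n - 1) * φ (D m) = φ ((M : ℂ) ^ (n - 1) * D m) := by
      rw [← smul_eq_mul, ← map_smul]
      congr 1
      rw [Complex.real_smul]
      push_cast
      rfl
    have h3 := density_smul hn hB hα hβ hM0 ((M : ℝ)⁻¹ • castVec m : Fin (n - 1) → ℝ)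
    rw [← h1] at h3
    have h4 := smul_mem_chamber (castVec α) (castVec β) hM0 ((M : ℝ)⁻¹ • castVec m)
    rw [← h1] at h4
    rw [h2]
    by_cases hm : (M : ℝ)⁻¹ • castVec m ∈ chamber (castVec α) (castVec β)
    · have h5 : D m = density ((M : ℝ) • castVec α) ((M : ℝ) • castVec β) (castVec m) := by
        simp only [hD, h4.mpr hm, finsum_true]
      rw [h5, ← Complex.ofReal_natCast, ← h3]
      by_cases hb : (M : ℝ)⁻¹ • castVec m ∈ Metric.closedBall (0 : Fin (n - 1) → ℝ) r
      · exact Set.indicator_of_mem (Set.mem_inter (Set.mem_inter hm hb) ((hmem _).mpr (Exists.intro m rfl))) _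
      · rw [Set.indicator_of_notMem fun h => hb h.1.2, not_not.mp (mt (hr _) hb), map_zero]
    · have h5 : D m = 0 := by simp only [hD, h4, hm, finsum_false]
      rw [Set.indicator_of_notMem fun h => hm h.1.1, h5, mul_zero, map_zero]
  simp only [hterm]
  rw [tsum_mul_left, ← φ.map_tsum (summable_of_hasFiniteSupport hfin), tsum_eq_finsum hfin, hsum,
    Fintype.card_fin, mul_div_cancel_left₀ _ (pow_ne_zero _ hM0.ne')]

/-- The integral over the Horn polytope, when the spline kernel is continuous. -/
theorem integral_density (hn : n ≠ 0) {B : (Fin (n - 1) → ℝ) → ℝ} (hB : IsSplineKernel B)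
    (hc : Continuous B) {α β : Fin n → ℤ} (hα : StrictAnti α) (hβ : StrictAnti β) :
    ∫ g in chamber (castVec α) (castVec β), density (castVec α) (castVec β) g =
      ((Nat.superFactorial (n - 1) : ℕ) : ℂ)⁻¹ := by
  obtain ⟨r, hr⟩ := exists_density_bound hn hB hα hβ
  have hcd := continuous_density hn hB hc hα hβ
  set s := chamber (castVec α) (castVec β) ∩ Metric.closedBall 0 r
  have hs1 : Bornology.IsBounded s := Metric.isBounded_closedBall.subset Set.inter_subset_right
  have hs2 : IsClosed s := (isClosed_chamber _ _).inter Metric.isClosed_closedBall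
  have hs3 : Convex ℝ s := (convex_chamber _ _).inter (convex_closedBall _ _)
  rw [setIntegral_eq_of_subset_of_forall_sdiff_eq_zero (s := s)
    (isClosed_chamber _ _).measurableSet Set.inter_subset_left
    fun g hg => not_not.mp fun h => hg.2 ⟨hg.1, hr g h⟩]
  have hint : IntegrableOn (density (castVec α) (castVec β)) s :=
    hcd.continuousOn.integrableOn_compact (Metric.isCompact_of_isClosed_isBounded hs2 hs1)
  have key : ∀ φ : ℂ →L[ℝ] ℝ, φ (∫ g in s, density (castVec α) (castVec β) g) =
      φ ((Nat.superFactorial (n - 1) : ℕ) : ℂ)⁻¹ := fun φ => by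
    rw [← φ.integral_comp_comm hint]
    -- The convergence of Riemann sums needs a bounded region with null frontier; here the region is
    -- convex.
    refine tendsto_nhds_unique (tendsto_tsum_div_pow_atTop_integral s _ (φ.continuous.comp hcd) hs1
      hs2.measurableSet (hs3.addHaar_frontier _)) (tendsto_const_nhds.congr' ?_)
    filter_upwards [eventually_ne_atTop 0] with M hM
    exact (tsum_density hn hB hα hβ hr φ hM).symm
  exact Complex.ext (key Complex.reCLM) (key Complex.imCLM)

/-! ### The integral of the density for two by two matrices -/

section

theorem alt_two (x : Fin 2 → ℝ) : alt x = mono x - mono (x ∘ Equiv.swap 0 1) := by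
  have : (Finset.univ : Finset (Perm (Fin 2))) = {1, Equiv.swap 0 1} := by decide
  rw [alt, this, Finset.sum_pair (by decide)]
  simp [sub_eq_add_neg]

theorem kernelPairing_sign_two (x : Fin 2 → ℝ) :
    kernelPairing (n := 2) (fun y => Real.sign (2 * y 0)) (mono x) = (Real.sign (x 1 - x 0) : ℂ) := by
  rw [kernelPairing_mono, coords_two]
  congr 2
  simp only [Pi.neg_apply]
  ring

/-- The indicator kernel is a difference of two sign functions shifted by `ρ`, and these shifts
amount to multiplication by `a_ρ`. So `J_n` is the pairing of a sign function with `a_α a_β`, a sum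
of four monomials. -/
theorem J_two {α β : Fin 2 → ℤ} (hα : StrictAnti α) (hβ : StrictAnti β) {γ : Fin 2 → ℝ} {a b c : ℝ}
    (ha : (α 0 : ℝ) - α 1 = a) (hb : (β 0 : ℝ) - β 1 = b) (hc : γ 0 - γ 1 = c) :
    J (castVec α) (castVec β) γ = ((Real.sign (c - a + b) + Real.sign (c + a - b) -
      Real.sign (c - a - b) - Real.sign (c + a + b)) / 2 : ℝ) := by
  obtain ⟨κ, μ, -, -, h1, -⟩ := exists_quotient two_ne_zero hα hβ
  have hg := isAlt_schur_mul two_ne_zero κ μ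
  set g := schur two_ne_zero κ * schur two_ne_zero μ * alt rho
  have h2 : kernelPairing (n := 2) (fun y => Real.sign (2 * y 0)) (g * alt rho * mono (-γ)) =
      -2 * J (castVec α) (castVec β) γ := by
    rw [isSplineKernel_two.J_eq hg h1]
    have h3 : g * alt rho * mono (-γ) = g * mono (-(γ - rho)) - g * mono (-(γ + rho)) := by
      rw [alt_two, mul_assoc, ← mul_sub, sub_mul]
      congr 2 <;>
      · rw [mono, mono, mono, AddMonoidAlgebra.single_mul_single, one_mul]
        congr 1
        funext i
        fin_cases i <;> simp [rho_apply] <;> ring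
    rw [h3, map_sub]
    simp only [kernelPairing_mul_mono]
    rw [Finsupp.sum, Finsupp.sum, Finsupp.sum, ← sum_sub_distrib, mul_sum]
    refine sum_congr rfl fun x _ => ?_
    set y := γ 0 - x 0 - (γ 1 - x 1) with hy
    have e1 : 2 * coords (γ - rho - x) 0 = y - 1 := by
      rw [coords_two]
      simp [rho_apply, hy]
      ring
    have e2 : 2 * coords (γ + rho - x) 0 = y + 1 := by
      rw [coords_two]
      simp [rho_apply, hy]
      ring
    have e3 : 2 * coords (γ - x) 0 = y := by
      rw [coords_two]
      simp [hy]
      ring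
    rw [e1, e2, e3, add_comm 1 y, ← neg_sub y 1, Real.sign_neg]
    push_cast
    ring
  have h5 : ∀ x y : Fin 2 → ℝ, kernelPairing (n := 2) (fun y => Real.sign (2 * y 0))
      (mono x * mono y * mono (-γ)) = (Real.sign (x 1 - x 0 + (y 1 - y 0) + c) : ℂ) := fun x y => by
    have h6 : mono x * mono y * mono (-γ) = mono (x + y - γ) := by
      rw [mono, mono, mono, AddMonoidAlgebra.single_mul_single, AddMonoidAlgebra.single_mul_single,
        one_mul, one_mul, ← sub_eq_add_neg, mono]
    rw [h6, kernelPairing_sign_two, ← hc]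
    congr 2
    simp only [Pi.sub_apply, Pi.add_apply]
    ring
  have h7 : ∀ (δ : Fin 2 → ℤ) (d : ℝ), (δ 0 : ℝ) - δ 1 = d →
      lift (diffs (castVec δ)) 1 - lift (diffs (castVec δ)) 0 = -d := fun δ d h => by
    rw [lift_diffs_apply, ← h]
    simp only [castVec]
    ring
  have h8 : ∀ (δ : Fin 2 → ℤ) (d : ℝ), (δ 0 : ℝ) - δ 1 = d →
      lift (diffs (castVec δ)) 0 - lift (diffs (castVec δ)) 1 = d := fun δ d h => by
    rw [← neg_sub, h7 δ d h, neg_neg]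
  rw [← h1, alt_two, alt_two, sub_mul, mul_sub, mul_sub, sub_mul, sub_mul, sub_mul, map_sub, map_sub,
    map_sub, h5, h5, h5, h5] at h2
  simp only [Function.comp_apply, Equiv.swap_apply_left, Equiv.swap_apply_right, h7 α a ha, h7 β b hb,
    h8 α a ha, h8 β b hb] at h2
  rw [show -a + -b + c = c - a - b by ring, show -a + b + c = c - a + b by ring,
    show a + -b + c = c + a - b by ring, show a + b + c = c + a + b by ring] at h2
  push_cast
  linear_combination (1 / 2 : ℂ) * h2

/-- On the chamber `J_n` is the indicator of `|a - b| ≤ c ≤ a + b` up to the endpoints, with `c = 2x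
- s` the gap of `γ`. There the density is `c / (ab)`, and `((a + b)² - (a - b)²) / (4ab) = 1`. -/
theorem integral_density_two {α β : Fin 2 → ℤ} (hα : StrictAnti α) (hβ : StrictAnti β) :
    ∫ g in chamber (castVec α) (castVec β), density (castVec α) (castVec β) g = 1 := by
  obtain ⟨a, ha⟩ : ∃ a : ℝ, (α 0 : ℝ) - α 1 = a := ⟨_, rfl⟩
  obtain ⟨b, hb⟩ : ∃ b : ℝ, (β 0 : ℝ) - β 1 = b := ⟨_, rfl⟩
  have ha0 : 0 < a := ha ▸ sub_pos.mpr (Int.cast_lt.mpr (hα (by decide)))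
  have hb0 : 0 < b := hb ▸ sub_pos.mpr (Int.cast_lt.mpr (hβ (by decide)))
  obtain ⟨s, hs⟩ : ∃ s : ℝ, ∑ k, (castVec α k + castVec β k) = s := ⟨_, rfl⟩
  have hc0 : ∀ g, complete (castVec α) (castVec β) g 0 = g 0 := fun g => rfl
  have hc1 : ∀ g, complete (castVec α) (castVec β) g 1 = s - g 0 := fun g => by
    rw [← hs]
    simp only [complete, sum_two]
    rfl
  have hv : ∀ x : Fin 2 → ℝ, vander x = x 0 - x 1 := fun x => by
    rw [vander, pairs_two, Finset.prod_singleton]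
  set e : ℝ := |a - b| with he
  have hea : e < a + b := abs_lt.mpr ⟨by linarith, by linarith⟩
  have hd : ∀ g, density (castVec α) (castVec β) g = (((Real.sign (2 * g 0 - s - a + b) +
      Real.sign (2 * g 0 - s + a - b) - Real.sign (2 * g 0 - s - a - b) -
      Real.sign (2 * g 0 - s + a + b)) / 2 * ((2 * g 0 - s) / (a * b)) : ℝ) : ℂ) := fun g => by
    rw [density, J_two hα hβ ha hb (c := 2 * g 0 - s) (by rw [hc0, hc1]; ring), hv, hv, hv, hc0, hc1]
    simp only [castVec, ha, hb]
    rw [← Complex.ofReal_mul, show g 0 - (s - g 0) = 2 * g 0 - s by ring]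
  have hin : ∀ x ∈ Set.Ioo ((s + e) / 2) ((s + a + b) / 2), (Real.sign (2 * x - s - a + b) +
      Real.sign (2 * x - s + a - b) - Real.sign (2 * x - s - a - b) -
      Real.sign (2 * x - s + a + b)) / 2 * ((2 * x - s) / (a * b)) = (2 * x - s) / (a * b) := by
    intro x hx
    have h1 := le_abs_self (a - b)
    have h2 := neg_le_abs (a - b)
    rw [← he] at h1 h2
    rw [Real.sign_of_pos (by linarith [hx.1]), Real.sign_of_pos (by linarith [hx.1]),
      Real.sign_of_neg (by linarith [hx.2]), Real.sign_of_pos (by linarith [hx.1])]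
    ring
  have hout : ∀ x, s ≤ 2 * x → x ∉ Set.Icc ((s + e) / 2) ((s + a + b) / 2) →
      Real.sign (2 * x - s - a + b) + Real.sign (2 * x - s + a - b) -
      Real.sign (2 * x - s - a - b) - Real.sign (2 * x - s + a + b) = 0 := by
    intro x hx hx'
    rcases lt_or_ge x ((s + e) / 2) with h | h
    · rw [Real.sign_of_neg (r := 2 * x - s - a - b) (by linarith),
        Real.sign_of_pos (r := 2 * x - s + a + b) (by linarith)]
      have h1 : 2 * x - s < e := by linarith
      rcases lt_abs.mp h1 with h2 | h2
      · rw [Real.sign_of_neg (by linarith), Real.sign_of_pos (by linarith)]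
        norm_num
      · rw [Real.sign_of_pos (by linarith), Real.sign_of_neg (by linarith)]
        norm_num
    · have h1 : (s + a + b) / 2 < x := not_le.mp fun h1 => hx' ⟨h, h1⟩
      rw [Real.sign_of_pos (by linarith), Real.sign_of_pos (by linarith),
        Real.sign_of_pos (by linarith), Real.sign_of_pos (by linarith)]
      norm_num
  have hch : ∀ g, g ∈ chamber (castVec α) (castVec β) ↔ s ≤ 2 * g 0 := fun g => by
    have h1 : Antitone (complete (castVec α) (castVec β) g) ↔
        complete (castVec α) (castVec β) g 1 ≤ complete (castVec α) (castVec β) g 0 := by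
      refine ⟨fun h => h (by decide), fun h i j hij => ?_⟩
      fin_cases i <;> fin_cases j
      · exact le_rfl
      · exact h
      · exact absurd hij (by decide)
      · exact le_rfl
    rw [chamber, Set.mem_ofPred_eq, h1, hc0, hc1]
    constructor <;> intro h <;> linarith
  have he0 : 0 ≤ e := abs_nonneg _
  have hsub : (MeasurableEquiv.funUnique (Fin 1) ℝ) ⁻¹' Set.Icc ((s + e) / 2) ((s + a + b) / 2) ⊆
      chamber (castVec α) (castVec β) := fun g hg => (hch g).mpr (by
    have h1 : (s + e) / 2 ≤ g 0 := hg.1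
    linarith)
  rw [setIntegral_eq_of_subset_of_forall_sdiff_eq_zero
    (isClosed_chamber _ _).measurableSet hsub fun g hg => by
      rw [hd, hout (g 0) ((hch g).mp hg.1) hg.2, zero_div, zero_mul, Complex.ofReal_zero]]
  simp only [hd]
  refine ((volume_preserving_funUnique (Fin 1) ℝ).setIntegral_preimage_emb
    (MeasurableEquiv.measurableEmbedding _) (fun x => (((Real.sign (2 * x - s - a + b) +
      Real.sign (2 * x - s + a - b) - Real.sign (2 * x - s - a - b) -
      Real.sign (2 * x - s + a + b)) / 2 * ((2 * x - s) / (a * b)) : ℝ) : ℂ)) _).trans ?_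
  rw [integral_complex_ofReal, integral_Icc_eq_integral_Ioo,
    setIntegral_congr_fun measurableSet_Ioo hin,
    ← integral_Ioc_eq_integral_Ioo,
    ← intervalIntegral.integral_of_le (by linarith)]
  have hfin : ∫ x in (s + e) / 2..(s + a + b) / 2, (2 * x - s) / (a * b) = 1 := by
    rw [intervalIntegral.integral_div, intervalIntegral.integral_sub
      (Continuous.intervalIntegrable (by fun_prop) _ _) intervalIntegrable_const,
      intervalIntegral.integral_const_mul, integral_id, intervalIntegral.integral_const, smul_eq_mul,
      div_eq_one_iff_eq (by positivity)]
    have : e ^ 2 = (a - b) ^ 2 := sq_abs _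
    nlinarith
  rw [hfin, Complex.ofReal_one]

end

/-- The integral over the Horn polytope. -/
theorem setIntegral_density (hn : 2 ≤ n) {α β : Fin n → ℤ} (hα : StrictAnti α) (hβ : StrictAnti β) :
    ∫ g in hornRegion (castVec α) (castVec β), density (castVec α) (castVec β) g =
      ((Nat.superFactorial (n - 1) : ℕ) : ℂ)⁻¹ := by
  obtain ⟨B, hB, hc⟩ := exists_splineKernel hn
  rw [setIntegral_hornRegion (by omega) hB hα hβ]
  rcases hn.eq_or_lt with rfl | hn'
  · rw [integral_density_two hα hβ]
    simp
  · exact integral_density (by omega) hB (hc hn') hα hβ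

end

end HornLR

end

/-! ### Conclusion. -/

theorem mainTheorem10 (n : ℕ) (hn : 2 ≤ n) :
    (∃! r : HornLR.Weight n →₀ ℝ, HornLR.IsCharacterExpansion HornLR.Rfun r) ∧
    (∃! r' : HornLR.Weight n →₀ ℝ, HornLR.IsCharacterExpansion HornLR.RfunHat r') ∧
    (∀ r : HornLR.Weight n →₀ ℝ, HornLR.IsCharacterExpansion HornLR.Rfun r →
      (r.sum fun κ a => a * (HornLR.dimV κ : ℝ)) = 1 ∧
      ∀ lam μ : HornLR.Weight n,
        (∑ᶠ q : HornLR.Weight n × HornLR.Weight n,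
            (HornLR.lrCoeff lam μ q.2 : ℝ) * HornLR.cCoeff r q.1 q.2 * (HornLR.dimV q.1 : ℝ)) =
          (HornLR.dimV lam : ℝ) * (HornLR.dimV μ : ℝ)) ∧
    (∀ r' : HornLR.Weight n →₀ ℝ, HornLR.IsCharacterExpansion HornLR.RfunHat r' →
      (r'.sum fun κ a => a * (HornLR.dimV κ : ℝ)) = 1 ∧
      ∀ lam μ : HornLR.Weight n, HornLR.OffWalls lam → HornLR.OffWalls μ →
        (∑ᶠ (q : HornLR.Weight n × HornLR.Weight n) (_ : HornLR.OffWalls q.1),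
            (HornLR.lrCoeff (HornLR.subRho lam) (HornLR.subRho μ) q.2 : ℝ) *
              HornLR.cCoeffHat r' q.1 q.2 * (HornLR.dimV (HornLR.subRho q.1) : ℝ)) =
          (HornLR.dimV (HornLR.subRho lam) : ℝ) * (HornLR.dimV (HornLR.subRho μ) : ℝ)) ∧
    (∀ α β : Fin n → ℤ, StrictAnti α → StrictAnti β →
      (∫ g in HornLR.hornRegion (HornLR.castVec α) (HornLR.castVec β),
          HornLR.density (HornLR.castVec α) (HornLR.castVec β) g) =
        (∑ᶠ (m : Fin (n - 1) → ℤ)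
            (_ : HornLR.castVec m ∈ HornLR.hornRegion (HornLR.castVec α) (HornLR.castVec β)),
          HornLR.density (HornLR.castVec α) (HornLR.castVec β) (HornLR.castVec m)) ∧
      (∑ᶠ (m : Fin (n - 1) → ℤ)
            (_ : HornLR.castVec m ∈ HornLR.hornRegion (HornLR.castVec α) (HornLR.castVec β)),
          HornLR.density (HornLR.castVec α) (HornLR.castVec β) (HornLR.castVec m)) =
        ((Nat.superFactorial (n - 1) : ℕ) : ℂ)⁻¹) := by
  refine ⟨HornLR.existsUnique_Rfun hn, HornLR.existsUnique_RfunHat hn, fun r hr =>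
    ⟨HornLR.sum_Rfun hn hr,
      HornLR.sum_lrCoeff_mul_cCoeff (by omega) (HornLR.sum_Rfun hn hr)⟩, fun r hr =>
    ⟨HornLR.sum_RfunHat hn hr, fun lam μ _ _ => ?_⟩, fun α β hα hβ => ?_⟩
  -- After the shift by `ρ`, the hatted rule is the plain sum rule for the coefficients of `R̂_n`;
  -- that rule uses only that they pair with the dimensions to 1.
  · rw [← HornLR.sum_lrCoeff_mul_cCoeff (by omega) (HornLR.sum_RfunHat hn hr),
      ← HornLR.finsum_offWalls fun q => (HornLR.lrCoeff (HornLR.subRho lam) (HornLR.subRho μ) q.2 : ℝ) *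
        HornLR.cCoeff r q.1 q.2 * (HornLR.dimV q.1 : ℝ)]
    rfl
  · obtain ⟨B, hB, -⟩ := HornLR.exists_splineKernel hn
    have h := HornLR.finsum_hornRegion (by omega) hB hα hβ
    exact ⟨(HornLR.setIntegral_density hn hα hβ).trans h.symm, h⟩
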